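/- **Setting.** A DL-Lite$_{\mathcal A}$ TBox $T=T_p\uplus T_n\uplus T_f$ consists of finitely many positive inclusions $B_1\sqsubseteq B_2$, $R_1\sqsubseteq R_2$ ($T_p$), negative inclusions $B_1\sqsubseteq\neg B_2$, $R_1\sqsubseteq\neg R_2$ ($T_n$) and functionality assertions $(\mathsf{funct}\,R)$ ($T_f$), where $R$ is $P$ or $P^-$ for a role name $P$, $B$ is a concept name $N$ or $\exists R$, and no functional role (or inverse of one) stands on the right of a positive role inclusion. An ABox is a finite set of facts $N(c)$, $P(c,d)$ over a countably infinite set $\Delta$ of constants; $\mathrm{adom}(A)$ is the set of constants in $A$. Semantics is first-order, distinct constants denoting distinct objects; $A$ is $T$-consistent if $(T,A)$ has a model. UCQs are evaluated under certain answers (truth in all models of $(T,A)$); an ECQ is built from UCQs $[q]$ by $\neg,\wedge,\exists x$, with $\exists x$ ranging over $\mathrm{adom}(A)$; its answers are the assignments of its free variables in $\mathrm{adom}(A)$ that satisfy it. A *KAB* $\mathcal K=(T,A_0,\Gamma,\Pi)$ has such a TBox, a $T$-consistent ABox $A_0$, a finite set $\Gamma$ of actions (parameters together with finitely many effects $[q^+]\wedge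 Q^-\rightsquigarrow E$, with $q^+$ a UCQ, $Q^-$ an ECQ whose free variables are among those of $q^+$, and $E$ a finite set of facts over constants, free variables $x$ of $q^+$ and service calls $f(\vec x)$ on them) and a finite set $\Pi$ of rules $Q\mapsto\alpha$ ($\alpha\in\Gamma$, $Q$ an ECQ whose free variables are exactly the parameters of $\alpha$). The special concept names $\mathsf{State},\mathsf{Viol}$ do not occur in $\mathcal K$; $\Delta$ contains a constant $\mathit{temp}$ and a constant $\mathrm{label}(t)$ for each TBox assertion $t$, different assertions having different labels. A state is a pair $\langle A,m\rangle$ of an ABox and a partial map $m$ from ground service calls to $\Delta$. $\langle A',m'\rangle$ results from executing $\alpha$ with parameters $\sigma$ in $\langle A,m\rangle$ if some rule $Q\mapsto\alpha$ has $\sigma$ among the answers of $Q$ over $(T,A)$, and, with $D$ the union of the sets $E\sigma\rho$ over all effects of $\alpha$ and all answers $\rho$ of $([q^+]\wedge Q^-)\sigma$ over $(T,A)$, there is a map $\theta$ from the service calls in $D$ to $\Delta$, agreeing with $m$ where both are defined, with $A'=D\theta$ and $m'=m\cup\theta$. A *b-repair* of $A$ is a maximal $T$-consistent subset of $A$; the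 *c-repair* of $A$ is the intersection of all its b-repairs. $\mathrm{viol}(A,T)$ is the set of labels of the $(\mathsf{funct}\,R)\in T_f$ for which $A$ contains facts $R(c,c_1),R(c,c_2)$ with $c_1\ne c_2$, and of the $B_1\sqsubseteq\neg B_2$ (resp. $R_1\sqsubseteq\neg R_2$) in $T_n$ for which "some object is in $B_1$ and $B_2$" (resp. "some pair is in $R_1$ and $R_2$") is true in all models of $(T_p,A)$. The *eb-transition system* (resp. *ec-transition system*) of $\mathcal K$ has initial state $\langle A_0,\emptyset\rangle$, the states reachable from it, and these transitions: if $\mathsf{State}(\mathit{temp})\notin A$, then $\langle A,m\rangle\Rightarrow\langle A'\cup\{\mathsf{State}(\mathit{temp})\},m'\rangle$ for every $\langle A',m'\rangle$ resulting from executing an action with parameters in $\langle A,m\rangle$; if $\mathsf{State}(\mathit{temp})\in A$, then, with $A^-=A\setminus\{\mathsf{State}(\mathit{temp})\}$, $\langle A,m\rangle\Rightarrow\langle R\cup\{\mathsf{Viol}(d)\mid d\in\mathrm{viol}(A^-,T)\},m\rangle$ for every b-repair (resp. for the c-repair) $R$ of $A^-$. The transition system is *run-bounded* if there is $b$ such that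 along each run (path from the initial state) fewer than $b$ constants occur in all ABoxes together. $\mu\mathcal L_A^{\mathrm{IT}}$ is the logic $\Phi ::= Q\mid\neg\Phi\mid\Phi_1\wedge\Phi_2\mid\exists x.\Phi\mid\langle-\rangle[-]\Phi\mid[-][-]\Phi\mid Z\mid\mu Z.\Phi$, with $Q$ an ECQ evaluated over $T$ and the ABox of the current state, $\exists x$ ranging over the active domain of the current state, $[-]\Phi=\neg\langle-\rangle\neg\Phi$, and the remaining operators having their standard $\mu$-calculus semantics ($\mu Z.\Phi$ requires that $Z$ occur only positively in $\Phi$). A property is a closed formula; it holds in a transition system if it holds in the initial state. **Theorem.** There is an algorithm that, given a KAB $\mathcal K$ whose eb-transition system is run-bounded and a $\mu\mathcal L_A^{\mathrm{IT}}$ property $\Phi$, halts and decides whether $\Phi$ holds in the eb-transition system of $\mathcal K$. The same is true with "ec" in place of "eb". -/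

import Mathlib

namespace KABs

/-! ## DL-Lite TBoxes -/

/-- Role expressions `P` and `P⁻`; role names are natural numbers. -/
inductive Role where
  | name (P : ℕ)
  | inv (P : ℕ)
deriving DecidableEq

/-- The inverse of a role expression. -/
def Role.inverse : Role → Role
  | .name P => .inv P
  | .inv P => .name P

/-- Basic concepts `N` and `∃R`; the concept names of the TBox are natural numbers. -/
inductive BasicConcept where
  | atomic (N : ℕ)
  | exist (R : Role)
deriving DecidableEq

/-- TBox assertions: positive inclusions, negative inclusions (disjointness), functionality. -/
inductive TAssertion where
  | subConcept (B₁ B₂ : BasicConcept)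
  | subRole (R₁ R₂ : Role)
  | disjConcept (B₁ B₂ : BasicConcept)
  | disjRole (R₁ R₂ : Role)
  | funct (R : Role)
deriving DecidableEq

/-- A TBox is a finite set of assertions, presented as a list. -/
abbrev TBox := List TAssertion

def TAssertion.isPositive : TAssertion → Bool
  | .subConcept _ _ => true
  | .subRole _ _ => true
  | _ => false

/-- The positive inclusions `T_p` of a TBox. -/
def TBox.positive (T : TBox) : TBox := List.filter TAssertion.isPositive T

/-- The syntactic restriction of DL-Lite_A: no functional role (and no inverse of one) is
specialized by a positive role inclusion. -/
def TBox.IsDLLiteA (T : TBox) : Prop :=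
  ∀ R R₁ R₂ : Role, TAssertion.funct R ∈ T → TAssertion.subRole R₁ R₂ ∈ T →
    R₂ ≠ R ∧ R₂ ≠ R.inverse

/-! ## Constants, atoms, ABoxes -/

/-- The countably infinite set of constants. It contains the distinguished constant `temp` and a
distinguished constant labelling each TBox assertion. -/
inductive Const where
  | val (n : ℕ)
  | temp
  | label (t : TAssertion)
deriving DecidableEq

/-- Concept names: the ordinary ones and the two special ones `State` and `Viol`. -/
inductive CName where
  | name (n : ℕ)
  | state
  | viol
deriving DecidableEq

/-- Atoms `N(t)` and `P(t₁,t₂)` over a set `τ` of terms. -/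
inductive Atom (τ : Type) where
  | concept (N : CName) (t : τ)
  | role (P : ℕ) (t₁ t₂ : τ)
deriving DecidableEq

namespace Atom

variable {τ τ' : Type}

def map (g : τ → τ') : Atom τ → Atom τ'
  | concept N t => concept N (g t)
  | role P t₁ t₂ => role P (g t₁) (g t₂)

/-- The terms occurring in an atom. -/
def terms : Atom τ → Set τ
  | concept _ t => {t}
  | role _ t₁ t₂ => {t₁, t₂}

/-- The atom uses neither of the special concepts `State` and `Viol`. -/
def Plain : Atom τ → Prop
  | concept (.name _) _ => True
  | concept _ _ => False
  | role _ _ _ => True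

end Atom

/-- ABox membership assertions. -/
abbrev Fact := Atom Const

abbrev ABox := Finset Fact

/-- The constants that appear in an ABox. -/
def adom (A : ABox) : Set Const := {c | ∃ f ∈ A, c ∈ f.terms}

/-- The special fact `State(temp)`. -/
def stateTemp : Fact := .concept .state .temp

/-- The special fact `Viol(d)`. -/
def violFact (d : Const) : Fact := .concept .viol d

/-! ## First-order semantics -/

/-- Interpretations; distinct constants denote distinct objects (unique names). -/
structure Interp where
  Dom : Type
  const : Const → Dom
  const_injective : Function.Injective const
  concept : CName → Set Dom
  role : ℕ → Dom → Dom → Prop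

namespace Interp

variable (I : Interp)

def roleExt : Role → I.Dom → I.Dom → Prop
  | .name P => fun x y => I.role P x y
  | .inv P => fun x y => I.role P y x

def conceptExt : BasicConcept → Set I.Dom
  | .atomic N => I.concept (.name N)
  | .exist R => {x | ∃ y, I.roleExt R x y}

/-- Satisfaction of an atom whose terms denote elements of the domain. -/
def satAtom : Atom I.Dom → Prop
  | .concept N x => x ∈ I.concept N
  | .role P x y => I.role P x y

def satT : TAssertion → Prop
  | .subConcept B₁ B₂ => I.conceptExt B₁ ⊆ I.conceptExt B₂
  | .subRole R₁ R₂ => ∀ x y, I.roleExt R₁ x y → I.roleExt R₂ x y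
  | .disjConcept B₁ B₂ => Disjoint (I.conceptExt B₁) (I.conceptExt B₂)
  | .disjRole R₁ R₂ => ∀ x y, I.roleExt R₁ x y → ¬ I.roleExt R₂ x y
  | .funct R => ∀ x y z, I.roleExt R x y → I.roleExt R x z → y = z

/-- `I` is a model of the knowledge base `(T, A)`. -/
def IsModel (T : TBox) (A : ABox) : Prop :=
  (∀ t ∈ T, I.satT t) ∧ ∀ f ∈ A, I.satAtom (f.map I.const)

end Interp

/-- `A` is `T`-consistent. -/
def Consistent (T : TBox) (A : ABox) : Prop := ∃ I : Interp, I.IsModel T A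

/-! ## Queries -/

/-- Terms of queries; variables are natural numbers. -/
inductive QTerm where
  | var (x : ℕ)
  | const (c : Const)
deriving DecidableEq

/-- A conjunctive query: a conjunction of atoms, some of whose variables are existentially
quantified. -/
structure CQ where
  exVars : List ℕ
  atoms : List (Atom QTerm)

/-- A union of conjunctive queries. -/
abbrev UCQ := List CQ

/-- The free variables. -/
def CQ.fv (q : CQ) : Set ℕ := {x | (∃ a ∈ q.atoms, QTerm.var x ∈ a.terms) ∧ x ∉ q.exVars}

def UCQ.fv (q : UCQ) : Set ℕ := {x | ∃ d ∈ q, x ∈ CQ.fv d}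

def CQ.Plain (q : CQ) : Prop := ∀ a ∈ q.atoms, a.Plain

def UCQ.Plain (q : UCQ) : Prop := ∀ d ∈ q, CQ.Plain d

def QTerm.eval (I : Interp) (η : ℕ → I.Dom) : QTerm → I.Dom
  | .var x => η x
  | .const c => I.const c

/-- The query, with its free variables replaced by constants according to `v`, is true in `I`. -/
def CQ.TrueIn (I : Interp) (q : CQ) (v : ℕ → Const) : Prop :=
  ∃ η : ℕ → I.Dom, (∀ x, x ∉ q.exVars → η x = I.const (v x)) ∧
    ∀ a ∈ q.atoms, I.satAtom (a.map (QTerm.eval I η))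

def UCQ.TrueIn (I : Interp) (q : UCQ) (v : ℕ → Const) : Prop := ∃ d ∈ q, CQ.TrueIn I d v

/-- Certain truth of a UCQ under the substitution `v` of its free variables. -/
def UCQ.Certain (T : TBox) (A : ABox) (q : UCQ) (v : ℕ → Const) : Prop :=
  ∀ I : Interp, I.IsModel T A → UCQ.TrueIn I q v

/-- EQL-Lite(UCQ) queries. -/
inductive ECQ where
  | ucq (q : UCQ)
  | neg (Q : ECQ)
  | and (Q₁ Q₂ : ECQ)
  | ex (x : ℕ) (Q : ECQ)

namespace ECQ

def fv : ECQ → Set ℕ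
  | ucq q => UCQ.fv q
  | neg Q => Q.fv
  | and Q₁ Q₂ => Q₁.fv ∪ Q₂.fv
  | ex x Q => Q.fv \ {x}

def Plain : ECQ → Prop
  | ucq q => UCQ.Plain q
  | neg Q => Q.Plain
  | and Q₁ Q₂ => Q₁.Plain ∧ Q₂.Plain
  | ex _ Q => Q.Plain

/-- The query, with its free variables replaced according to `v`, holds over `(T, A)`: UCQs are
evaluated under certain answers and quantifiers range over the active domain. -/
def Holds (T : TBox) (A : ABox) : ECQ → (ℕ → Const) → Prop
  | ucq q, v => UCQ.Certain T A q v
  | neg Q, v => ¬ Q.Holds T A v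
  | and Q₁ Q₂, v => Q₁.Holds T A v ∧ Q₂.Holds T A v
  | ex x Q, v => ∃ d ∈ adom A, Q.Holds T A (Function.update v x d)

/-- The answers: the substitutions of the free variables by constants of the active domain that
make the query hold (values outside the free variables are irrelevant). -/
def Ans (T : TBox) (A : ABox) (Q : ECQ) : Set (ℕ → Const) :=
  {v | (∀ x ∈ Q.fv, v x ∈ adom A) ∧ Q.Holds T A v}

end ECQ

/-! ## Knowledge and action bases -/

/-- Terms of effects: constants, variables, and service calls (Skolem terms) on variables. -/
inductive ETerm where
  | const (c : Const)
  | var (x : ℕ)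
  | call (f : ℕ) (args : List ℕ)
deriving DecidableEq

def ETerm.vars : ETerm → Set ℕ
  | .const _ => ∅
  | .var x => {x}
  | .call _ args => {x | x ∈ args}

/-- An effect `[q⁺] ∧ Q⁻ ⇝ E`. -/
structure Effect where
  qpos : UCQ
  qneg : ECQ
  facts : List (Atom ETerm)

/-- The condition `[q⁺] ∧ Q⁻` of an effect. -/
def Effect.cond (e : Effect) : ECQ := .and (.ucq e.qpos) e.qneg

structure Effect.WellFormed (e : Effect) : Prop where
  fv_neg : e.qneg.fv ⊆ UCQ.fv e.qpos
  fv_facts : ∀ a ∈ e.facts, ∀ t ∈ a.terms, t.vars ⊆ UCQ.fv e.qpos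
  plain_pos : UCQ.Plain e.qpos
  plain_neg : e.qneg.Plain
  plain_facts : ∀ a ∈ e.facts, a.Plain

structure Action where
  name : ℕ
  params : List ℕ
  effects : List Effect

/-- A condition/action rule `Q ↦ α`. -/
structure Rule where
  cond : ECQ
  act : Action

/-- Knowledge and action bases (finite sets are presented as lists). -/
structure KAB where
  tbox : TBox
  init : List Fact
  actions : List Action
  rules : List Rule

/-- The conditions in the definition of a KAB. The special concepts `State` and `Viol` are fresh:
they occur nowhere in the KAB. -/
structure KAB.WellFormed (K : KAB) : Prop where
  dlLiteA : K.tbox.IsDLLiteA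
  init_plain : ∀ f ∈ K.init, f.Plain
  init_consistent : Consistent K.tbox K.init.toFinset
  effects_wf : ∀ α ∈ K.actions, ∀ e ∈ α.effects, e.WellFormed
  rules_act : ∀ r ∈ K.rules, r.act ∈ K.actions
  rules_fv : ∀ r ∈ K.rules, r.cond.fv = {x | x ∈ r.act.params}
  rules_plain : ∀ r ∈ K.rules, r.cond.Plain

/-! ## Execution of actions -/

/-- Ground service calls `f(c₁,…,cₙ)`. -/
abbrev ServiceCall := ℕ × List Const

/-- Ground terms: constants and ground service calls. -/
abbrev GTerm := Const ⊕ ServiceCall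

def ETerm.ground (v : ℕ → Const) : ETerm → GTerm
  | .const c => .inl c
  | .var x => .inl (v x)
  | .call f args => .inr (f, args.map v)

/-- `DO(T, A, ασ)`: the facts, possibly with service calls, produced by the effects of `α` with
actual parameters `σ`. A single substitution `v` combines `σ` on the parameters and an answer on
the remaining free variables. -/
def doFacts (T : TBox) (A : ABox) (α : Action) (σ : ℕ → Const) : Set (Atom GTerm) :=
  {g | ∃ e ∈ α.effects, ∃ v : ℕ → Const,
    (∀ p ∈ α.params, v p = σ p) ∧
    (∀ x ∈ e.cond.fv, x ∉ α.params → v x ∈ adom A) ∧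
    e.cond.Holds T A v ∧
    ∃ a ∈ e.facts, g = a.map (ETerm.ground v)}

/-- The service calls contained in a set of facts. -/
def callsOf (E : Set (Atom GTerm)) : Set ServiceCall := {c | ∃ g ∈ E, Sum.inr c ∈ g.terms}

/-- Replacement of service calls by their results. -/
def GTerm.subst (θ : ServiceCall → Const) : GTerm → Const := Sum.elim id θ

/-- A state: an ABox and a service call map (a partial function). -/
structure KState where
  abox : ABox
  scmap : ServiceCall → Option Const

/-- `σ` is a legal parameter assignment for `α` over the ABox `A`. -/
def KAB.Legal (K : KAB) (A : ABox) (α : Action) (σ : ℕ → Const) : Prop :=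
  ∃ r ∈ K.rules, r.act = α ∧ σ ∈ r.cond.Ans K.tbox A

/-- The relation `EXEC`. The function `θ` is used only on the service calls of `DO(T, A, ασ)`. -/
def KAB.Exec (K : KAB) (s : KState) (α : Action) (σ : ℕ → Const) (s' : KState) : Prop :=
  K.Legal s.abox α σ ∧
  ∃ θ : ServiceCall → Const,
    (∀ c ∈ callsOf (doFacts K.tbox s.abox α σ), ∀ d, s.scmap c = some d → θ c = d) ∧
    (s'.abox : Set Fact) = Atom.map (GTerm.subst θ) '' doFacts K.tbox s.abox α σ ∧
    (∀ c ∈ callsOf (doFacts K.tbox s.abox α σ), s'.scmap c = some (θ c)) ∧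
    (∀ c ∉ callsOf (doFacts K.tbox s.abox α σ), s'.scmap c = s.scmap c)

/-! ## Repairs and violated assertions -/

/-- The bold repairs: maximal `T`-consistent subsets. -/
def IsBoldRepair (T : TBox) (A R : ABox) : Prop :=
  Maximal (fun B : ABox => B ⊆ A ∧ Consistent T B) R

/-- The certain repair: the intersection of all bold repairs. -/
def IsCertainRepair (T : TBox) (A R : ABox) : Prop :=
  (R : Set Fact) = ⋂ B ∈ {B : ABox | IsBoldRepair T A B}, (B : Set Fact)

inductive RepairKind where
  | bold
  | certain

def IsRepair : RepairKind → TBox → ABox → ABox → Prop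
  | .bold => IsBoldRepair
  | .certain => IsCertainRepair

/-- The fact `R(c, d)`, i.e. `P(c, d)` or, for `R = P⁻`, `P(d, c)`. -/
def roleAtom {τ : Type} : Role → τ → τ → Atom τ
  | .name P, x, y => .role P x y
  | .inv P, x, y => .role P y x

/-- The atom expressing membership of `x` in `B`, with `y` in the unused place. -/
def conceptAtom {τ : Type} : BasicConcept → τ → τ → Atom τ
  | .atomic N, x, _ => .concept (.name N) x
  | .exist R, x, y => roleAtom R x y

/-- `∃ x y y'. γ(B₁, x) ∧ γ(B₂, x)`. -/
def disjConceptQuery (B₁ B₂ : BasicConcept) : UCQ :=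
  [⟨[0, 1, 2], [conceptAtom B₁ (.var 0) (.var 1), conceptAtom B₂ (.var 0) (.var 2)]⟩]

/-- `∃ x y. R₁(x, y) ∧ R₂(x, y)`. -/
def disjRoleQuery (R₁ R₂ : Role) : UCQ :=
  [⟨[0, 1], [roleAtom R₁ (.var 0) (.var 1), roleAtom R₂ (.var 0) (.var 1)]⟩]

/-- The assertion is violated by `A`. For functionality the ABox is inspected as a database; for
negative inclusions the closed query has to be a certain answer with respect to the positive
inclusions (equivalently, its rewriting with respect to them is true in the database `A`). -/
def Violates (T : TBox) (A : ABox) : TAssertion → Prop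
  | .funct R => ∃ c c₁ c₂ : Const, roleAtom R c c₁ ∈ A ∧ roleAtom R c c₂ ∈ A ∧ c₁ ≠ c₂
  | .disjConcept B₁ B₂ =>
      ∀ v : ℕ → Const, UCQ.Certain T.positive A (disjConceptQuery B₁ B₂) v
  | .disjRole R₁ R₂ =>
      ∀ v : ℕ → Const, UCQ.Certain T.positive A (disjRoleQuery R₁ R₂) v
  | _ => False

/-- The labels of the assertions of `T` violated by `A`. -/
def viol (T : TBox) (A : ABox) : Set Const :=
  {d | ∃ t ∈ T, d = Const.label t ∧ Violates T A t}

/-! ## Transition systems -/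

structure TransitionSystem where
  tbox : TBox
  State : Type
  states : Set State
  start : State
  abox : State → ABox
  trans : State → State → Prop

/-- A run of length `n` (finite or infinite): a path from the initial state. -/
def TransitionSystem.IsRun (Υ : TransitionSystem) (n : ℕ∞) (τ : ℕ → Υ.State) : Prop :=
  τ 0 = Υ.start ∧ ∀ i : ℕ, (i : ℕ∞) < n → Υ.trans (τ i) (τ (i + 1))

/-- One bound `b` works for all runs: fewer than `b` constants occur in the states of a run. -/
def TransitionSystem.RunBounded (Υ : TransitionSystem) : Prop :=
  ∃ b : ℕ, ∀ (n : ℕ∞) (τ : ℕ → Υ.State), Υ.IsRun n τ →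
    {c | ∃ i : ℕ, (i : ℕ∞) ≤ n ∧ c ∈ adom (Υ.abox (τ i))}.encard < b

/-- The action and repair steps under the extended repair semantics. In the repair step `Viol`
records the assertions violated by the ABox `A` that the action step has produced (without the
marker `State(temp)`). -/
inductive KAB.Step (K : KAB) (k : RepairKind) : KState → KState → Prop where
  | action (s : KState) (α : Action) (σ : ℕ → Const) (s' : KState) :
      stateTemp ∉ s.abox → α ∈ K.actions → K.Exec s α σ s' →
      KAB.Step K k s ⟨s'.abox ∪ {stateTemp}, s'.scmap⟩
  | repair (s : KState) (A R Rv : ABox) :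
      stateTemp ∈ s.abox → A = s.abox \ {stateTemp} → IsRepair k K.tbox A R →
      (Rv : Set Fact) = ↑R ∪ {f | ∃ d ∈ viol K.tbox A, f = violFact d} →
      KAB.Step K k s ⟨Rv, s.scmap⟩

def KAB.startState (K : KAB) : KState := ⟨K.init.toFinset, fun _ => none⟩

/-- The extended transition system of `K`: states are those reachable from `⟨A₀, ∅⟩`. -/
def KAB.extendedTS (K : KAB) (k : RepairKind) : TransitionSystem where
  tbox := K.tbox
  State := KState
  states := {s | Relation.ReflTransGen (K.Step k) K.startState s}
  start := K.startState
  abox := KState.abox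
  trans := fun s s' =>
    Relation.ReflTransGen (K.Step k) K.startState s ∧ K.Step k s s'

/-! ## The first-order mu-calculus -/

/-- Formulae of the mu-calculus over EQL queries; predicate variables are natural numbers. -/
inductive MuEQL where
  | query (Q : ECQ)
  | neg (Φ : MuEQL)
  | and (Φ Ψ : MuEQL)
  | ex (x : ℕ) (Φ : MuEQL)
  | dia (Φ : MuEQL)
  | pvar (Z : ℕ)
  | mu (Z : ℕ) (Φ : MuEQL)

namespace MuEQL

def box (Φ : MuEQL) : MuEQL := neg (dia (neg Φ))

/-- Free individual variables. -/
def fv : MuEQL → Set ℕ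
  | query Q => Q.fv
  | neg Φ => Φ.fv
  | and Φ Ψ => Φ.fv ∪ Ψ.fv
  | ex x Φ => Φ.fv \ {x}
  | dia Φ => Φ.fv
  | pvar _ => ∅
  | mu _ Φ => Φ.fv

/-- Free predicate variables. -/
def fpv : MuEQL → Set ℕ
  | query _ => ∅
  | neg Φ => Φ.fpv
  | and Φ Ψ => Φ.fpv ∪ Ψ.fpv
  | ex _ Φ => Φ.fpv
  | dia Φ => Φ.fpv
  | pvar Z => {Z}
  | mu Z Φ => Φ.fpv \ {Z}

def Closed (Φ : MuEQL) : Prop := Φ.fv = ∅ ∧ Φ.fpv = ∅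

/-- Every free occurrence of `Z` is in the scope of an even (for `pol = true`) or odd (for
`pol = false`) number of negations. -/
def OccursWith (Z : ℕ) : Bool → MuEQL → Prop
  | _, query _ => True
  | pol, neg Φ => OccursWith Z (!pol) Φ
  | pol, and Φ Ψ => OccursWith Z pol Φ ∧ OccursWith Z pol Ψ
  | pol, ex _ Φ => OccursWith Z pol Φ
  | pol, dia Φ => OccursWith Z pol Φ
  | pol, pvar Y => Y = Z → pol = true
  | pol, mu Y Φ => Y = Z ∨ OccursWith Z pol Φ

/-- Syntactic monotonicity: in each `μZ.Φ`, the variable `Z` occurs only positively in `Φ`. -/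
def Monotone : MuEQL → Prop
  | query _ => True
  | neg Φ => Φ.Monotone
  | and Φ Ψ => Φ.Monotone ∧ Ψ.Monotone
  | ex _ Φ => Φ.Monotone
  | dia Φ => Φ.Monotone
  | pvar _ => True
  | mu Z Φ => OccursWith Z true Φ ∧ Φ.Monotone

/-- The extension of a formula under valuations of individual and predicate variables. -/
def ext (Υ : TransitionSystem) :
    MuEQL → (ℕ → Const) → (ℕ → Set Υ.State) → Set Υ.State
  | query Q, v, _ => {s ∈ Υ.states | Q.Holds Υ.tbox (Υ.abox s) v}
  | neg Φ, v, V => Υ.states \ Φ.ext Υ v V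
  | and Φ Ψ, v, V => Φ.ext Υ v V ∩ Ψ.ext Υ v V
  | ex x Φ, v, V =>
      {s ∈ Υ.states | ∃ d ∈ adom (Υ.abox s), s ∈ Φ.ext Υ (Function.update v x d) V}
  | dia Φ, v, V => {s ∈ Υ.states | ∃ s', Υ.trans s s' ∧ s' ∈ Φ.ext Υ v V}
  | pvar Z, _, V => V Z
  | mu Z Φ, v, V =>
      {s ∈ Υ.states | ∀ E : Set Υ.State, E ⊆ Υ.states →
        Φ.ext Υ v (Function.update V Z E) ⊆ E → s ∈ E}

end MuEQL

/-- `Υ ⊨ Φ` (for closed `Φ` the valuations do not matter). -/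
def TransitionSystem.Models (Υ : TransitionSystem) (Φ : MuEQL) : Prop :=
  ∀ (v : ℕ → Const) (V : ℕ → Set Υ.State), (∀ Z, V Z ⊆ Υ.states) → Υ.start ∈ Φ.ext Υ v V

/-- The inconsistency-tolerant fragment, in which next-state operators come in the pairs
`⟨-⟩[-]` and `[-][-]`. -/
inductive MuIT where
  | query (Q : ECQ)
  | neg (Φ : MuIT)
  | and (Φ Ψ : MuIT)
  | ex (x : ℕ) (Φ : MuIT)
  | diaBox (Φ : MuIT)
  | boxBox (Φ : MuIT)
  | pvar (Z : ℕ)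
  | mu (Z : ℕ) (Φ : MuIT)

/-- The formula of the full logic denoted by a formula of the fragment. -/
def MuIT.toEQL : MuIT → MuEQL
  | .query Q => .query Q
  | .neg Φ => .neg Φ.toEQL
  | .and Φ Ψ => .and Φ.toEQL Ψ.toEQL
  | .ex x Φ => .ex x Φ.toEQL
  | .diaBox Φ => .dia (.box Φ.toEQL)
  | .boxBox Φ => .box (.box Φ.toEQL)
  | .pvar Z => .pvar Z
  | .mu Z Φ => .mu Z Φ.toEQL

/-- Closed and syntactically monotone formulae: the properties to be verified. -/
def MuIT.IsProperty (Φ : MuIT) : Prop := Φ.toEQL.Closed ∧ Φ.toEQL.Monotone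

/-! ## Codes of the syntax, for use as inputs of algorithms -/

/-- The code of a list of objects, from the codes of its entries. -/
def codeList {τ : Type} (c : τ → ℕ) (l : List τ) : ℕ := Encodable.encode (l.map c)

def Role.code : Role → ℕ
  | .name P => Nat.pair 0 P
  | .inv P => Nat.pair 1 P

def BasicConcept.code : BasicConcept → ℕ
  | .atomic N => Nat.pair 0 N
  | .exist R => Nat.pair 1 R.code

def TAssertion.code : TAssertion → ℕ
  | .subConcept B₁ B₂ => Nat.pair 0 (Nat.pair B₁.code B₂.code)
  | .subRole R₁ R₂ => Nat.pair 1 (Nat.pair R₁.code R₂.code)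
  | .disjConcept B₁ B₂ => Nat.pair 2 (Nat.pair B₁.code B₂.code)
  | .disjRole R₁ R₂ => Nat.pair 3 (Nat.pair R₁.code R₂.code)
  | .funct R => Nat.pair 4 R.code

def Const.code : Const → ℕ
  | .val n => Nat.pair 0 n
  | .temp => Nat.pair 1 0
  | .label t => Nat.pair 2 t.code

def CName.code : CName → ℕ
  | .name n => Nat.pair 0 n
  | .state => Nat.pair 1 0
  | .viol => Nat.pair 2 0

def Atom.code {τ : Type} (c : τ → ℕ) : Atom τ → ℕ
  | .concept N t => Nat.pair 0 (Nat.pair N.code (c t))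
  | .role P t₁ t₂ => Nat.pair 1 (Nat.pair P (Nat.pair (c t₁) (c t₂)))

def QTerm.code : QTerm → ℕ
  | .var x => Nat.pair 0 x
  | .const d => Nat.pair 1 d.code

def ETerm.code : ETerm → ℕ
  | .const d => Nat.pair 0 d.code
  | .var x => Nat.pair 1 x
  | .call f args => Nat.pair 2 (Nat.pair f (Encodable.encode args))

def CQ.code (q : CQ) : ℕ :=
  Nat.pair (Encodable.encode q.exVars) (codeList (Atom.code QTerm.code) q.atoms)

def ECQ.code : ECQ → ℕ
  | .ucq q => Nat.pair 0 (codeList CQ.code q)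
  | .neg Q => Nat.pair 1 Q.code
  | .and Q₁ Q₂ => Nat.pair 2 (Nat.pair Q₁.code Q₂.code)
  | .ex x Q => Nat.pair 3 (Nat.pair x Q.code)

def Effect.code (e : Effect) : ℕ :=
  Nat.pair (codeList CQ.code e.qpos)
    (Nat.pair e.qneg.code (codeList (Atom.code ETerm.code) e.facts))

def Action.code (α : Action) : ℕ :=
  Nat.pair α.name (Nat.pair (Encodable.encode α.params) (codeList Effect.code α.effects))

def Rule.code (r : Rule) : ℕ := Nat.pair r.cond.code r.act.code

def KAB.code (K : KAB) : ℕ :=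
  Nat.pair (codeList TAssertion.code K.tbox)
    (Nat.pair (codeList (Atom.code Const.code) K.init)
      (Nat.pair (codeList Action.code K.actions) (codeList Rule.code K.rules)))

def MuIT.code : MuIT → ℕ
  | .query Q => Nat.pair 0 Q.code
  | .neg Φ => Nat.pair 1 Φ.code
  | .and Φ Ψ => Nat.pair 2 (Nat.pair Φ.code Ψ.code)
  | .ex x Φ => Nat.pair 3 (Nat.pair x Φ.code)
  | .diaBox Φ => Nat.pair 4 Φ.code
  | .boxBox Φ => Nat.pair 5 Φ.code
  | .pvar Z => Nat.pair 6 Z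
  | .mu Z Φ => Nat.pair 7 (Nat.pair Z Φ.code)

/-! The coding of the inputs is injective. -/

theorem codeList_injective {τ : Type} {c : τ → ℕ} (hc : Function.Injective c) :
    Function.Injective (codeList c) :=
  fun _ _ h => List.map_injective_iff.2 hc (Encodable.encode_injective h)

theorem Role.code_injective : Function.Injective Role.code := by
  intro a b h; cases a <;> cases b <;> simp_all [Role.code, Nat.pair_eq_pair]

theorem BasicConcept.code_injective : Function.Injective BasicConcept.code := by
  intro a b h
  cases a <;> cases b <;>
    simp_all [BasicConcept.code, Nat.pair_eq_pair, Role.code_injective.eq_iff]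

theorem TAssertion.code_injective : Function.Injective TAssertion.code := by
  intro a b h
  cases a <;> cases b <;>
    simp_all [TAssertion.code, Nat.pair_eq_pair, Role.code_injective.eq_iff,
      BasicConcept.code_injective.eq_iff]

theorem Const.code_injective : Function.Injective Const.code := by
  intro a b h
  cases a <;> cases b <;>
    simp_all [Const.code, Nat.pair_eq_pair, TAssertion.code_injective.eq_iff]

theorem CName.code_injective : Function.Injective CName.code := by
  intro a b h; cases a <;> cases b <;> simp_all [CName.code, Nat.pair_eq_pair]

theorem Atom.code_injective {τ : Type} {c : τ → ℕ} (hc : Function.Injective c) :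
    Function.Injective (Atom.code c) := by
  intro a b h
  cases a <;> cases b <;>
    simp_all [Atom.code, Nat.pair_eq_pair, CName.code_injective.eq_iff, hc.eq_iff]

theorem QTerm.code_injective : Function.Injective QTerm.code := by
  intro a b h
  cases a <;> cases b <;>
    simp_all [QTerm.code, Nat.pair_eq_pair, Const.code_injective.eq_iff]

theorem ETerm.code_injective : Function.Injective ETerm.code := by
  intro a b h
  cases a <;> cases b <;>
    simp_all [ETerm.code, Nat.pair_eq_pair, Const.code_injective.eq_iff]

theorem CQ.code_injective : Function.Injective CQ.code := by
  rintro ⟨xs, as⟩ ⟨ys, bs⟩ h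
  simp_all [CQ.code, Nat.pair_eq_pair,
    (codeList_injective (Atom.code_injective QTerm.code_injective)).eq_iff]

theorem ECQ.code_injective : Function.Injective ECQ.code := by
  intro a
  induction a with
  | ucq q => intro b h; cases b <;>
      simp_all [ECQ.code, Nat.pair_eq_pair, (codeList_injective CQ.code_injective).eq_iff]
  | neg Q ih => intro b h; cases b <;> simp_all [ECQ.code, Nat.pair_eq_pair]; exact ih rfl
  | and Q₁ Q₂ ih₁ ih₂ =>
    intro b h; cases b <;> simp_all [ECQ.code, Nat.pair_eq_pair]; exact ⟨ih₁ rfl, ih₂ rfl⟩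
  | ex x Q ih => intro b h; cases b <;> simp_all [ECQ.code, Nat.pair_eq_pair]; exact ih rfl

theorem Effect.code_injective : Function.Injective Effect.code := by
  rintro ⟨p, n, a⟩ ⟨p', n', a'⟩ h
  simp_all [Effect.code, Nat.pair_eq_pair, (codeList_injective CQ.code_injective).eq_iff,
    ECQ.code_injective.eq_iff,
    (codeList_injective (Atom.code_injective ETerm.code_injective)).eq_iff]

theorem Action.code_injective : Function.Injective Action.code := by
  rintro ⟨p, n, a⟩ ⟨p', n', a'⟩ h
  simp_all [Action.code, Nat.pair_eq_pair, (codeList_injective Effect.code_injective).eq_iff]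

theorem Rule.code_injective : Function.Injective Rule.code := by
  rintro ⟨Q, α⟩ ⟨Q', α'⟩ h
  simp_all [Rule.code, Nat.pair_eq_pair, ECQ.code_injective.eq_iff, Action.code_injective.eq_iff]

theorem KAB.code_injective : Function.Injective KAB.code := by
  rintro ⟨t, i, a, r⟩ ⟨t', i', a', r'⟩ h
  simp_all [KAB.code, Nat.pair_eq_pair, (codeList_injective TAssertion.code_injective).eq_iff,
    (codeList_injective (Atom.code_injective Const.code_injective)).eq_iff,
    (codeList_injective Action.code_injective).eq_iff,
    (codeList_injective Rule.code_injective).eq_iff]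

theorem MuIT.code_injective : Function.Injective MuIT.code := by
  intro a
  induction a with
  | query Q => intro b h; cases b <;>
      simp_all [MuIT.code, Nat.pair_eq_pair, ECQ.code_injective.eq_iff]
  | neg Φ ih => intro b h; cases b <;> simp_all [MuIT.code, Nat.pair_eq_pair]; exact ih rfl
  | and Φ Ψ ih₁ ih₂ =>
    intro b h; cases b <;> simp_all [MuIT.code, Nat.pair_eq_pair]; exact ⟨ih₁ rfl, ih₂ rfl⟩
  | ex x Φ ih => intro b h; cases b <;> simp_all [MuIT.code, Nat.pair_eq_pair]; exact ih rfl
  | diaBox Φ ih => intro b h; cases b <;> simp_all [MuIT.code, Nat.pair_eq_pair]; exact ih rfl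
  | boxBox Φ ih => intro b h; cases b <;> simp_all [MuIT.code, Nat.pair_eq_pair]; exact ih rfl
  | pvar Z => intro b h; cases b <;> simp_all [MuIT.code, Nat.pair_eq_pair]
  | mu Z Φ ih => intro b h; cases b <;> simp_all [MuIT.code, Nat.pair_eq_pair]; exact ih rfl

end KABs

namespace KABs

/-! ## Computability over coded types -/

/-! A true property has a finite certificate, and so has the negation of a false one. The algorithm
searches for a certificate of `Φ` and one of its negation at the same time. The bound on the runs is
not an input: it only guarantees that one of the searches succeeds.

Reduction to finitely many states. Service calls may return infinitely many constants, but nothing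
distinguishes constants outside a finite list `C` that contains `temp`, the labels and the constants
of `K` and `Φ`: queries, repairs, violations and steps commute with the renamings that fix `C`
(`holds_perm`, `IsRepair.perm`, `viol_perm`, `KAB.Step.perm`). For a finite `F` containing `C`, let
new results of calls be restricted to `F`, and call `F` adequate if each state reachable in this way
leaves some element of `F` that is neither in `C` nor a recorded result. Results occur in the ABox
of the state in which they are first recorded, so a run bound `b` makes the union of `C` with
`C.length + b` constants adequate (`exists_adequate`). If `F` is adequate, every step can be renamed
into `F`: send the new constants injectively to unused elements of `F`. Were there too many of them,
a surjection onto the unused elements would again give a step, because results may be chosen freely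
and may coincide (`KAB.Step.post`), and its target would exhaust `F`. This is
`KAB.Adequate.exists_stepIn`. So equality up to renaming is a bisimulation between the full system
and the restricted one. It keeps track of the values of individual variables, which remain known for
ever in the service call map (`bisim_boundedTS`); formulae are invariant under it (`Bisim.ext`), and
the restricted system is finite (`finite_reachIn`).

Local decidability. A DL-Lite ontology has a canonical model whose elements are words of roles
attached to constants. It maps homomorphically into every model and is itself a model if the
ontology is consistent, so consistency and certain answers are read off it (`consistent_iff`,
`certain_iff`). A match of a conjunctive query can be made shallow by shortening paths at a level
that no variable uses (`CQ.Match.exists_bounded`), so a finite search answers queries. Repairs,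
violated assertions and the successors of a state are then computable (`stepIn_decode_iff`).

Assembly. Formulae are evaluated over the finite system by inference rules in which least fixpoints
are reached through increasing approximants (`der_evalRule_sound`, `der_evalRule_complete`).
Derivability from recursively enumerable rules is recursively enumerable (`RE.der`), and a
certificate consists of `C`, `F`, the states, a check of adequacy and the evaluation
(`certified_iff`). Computability itself is organised in the classes `RE` and `RFun` over coded
types, so that most computability proofs are found by instance search. -/

theorem rfind_dom_iff (r : ℕ → Bool) :
    (Nat.rfind fun m => Part.some (r m)).Dom ↔ ∃ m, r m = true := by
  refine Nat.rfind_dom.trans ?_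
  simp

/-- The witness `m` is the fuel of a bounded evaluation of a program that semi-decides `p`. In this
form, closure under conjunction and projection amounts to pairing witnesses. -/
theorem rePred_iff_exists {p : ℕ → Prop} :
    REPred p ↔ ∃ r : ℕ → ℕ → Bool, Computable₂ r ∧ ∀ n, p n ↔ ∃ m, r n m = true := by
  constructor
  · intro h
    have h' := Partrec.nat_iff.1 (Partrec.map h (Computable.const 0).to₂)
    obtain ⟨c, hc⟩ := Nat.Partrec.Code.exists_code.1 h'
    refine ⟨fun n m => (Nat.Partrec.Code.evaln m c n).isSome, ?_, fun n => ?_⟩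
    · refine Primrec₂.to_comp ?_
      exact Primrec.option_isSome.comp (Nat.Partrec.Code.primrec_evaln.comp
        (((Primrec.snd).pair (Primrec.const c)).pair Primrec.fst))
    · have : p n ↔ ∃ x, x ∈ Nat.Partrec.Code.eval c n := by
        rw [hc]; simp
      rw [this]
      simp only [Nat.Partrec.Code.evaln_complete, Option.isSome_iff_exists]
      exact ⟨fun ⟨x, k, h⟩ => ⟨k, x, h⟩, fun ⟨k, x, h⟩ => ⟨x, k, h⟩⟩
  · rintro ⟨r, hr, h⟩
    have h1 : Partrec fun n => Nat.rfind fun m => Part.some (r n m) :=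
      Partrec.rfind (Computable₂.partrec₂ hr)
    refine h1.dom_re.of_eq fun n => ?_
    exact (rfind_dom_iff (r n)).trans (h n).symm

theorem rePred_and {p q : ℕ → Prop} (hp : REPred p) (hq : REPred q) :
    REPred fun n => p n ∧ q n := by
  obtain ⟨r, hr, hp⟩ := rePred_iff_exists.1 hp
  obtain ⟨r', hr', hq⟩ := rePred_iff_exists.1 hq
  refine rePred_iff_exists.2 ⟨fun n m => r n m.unpair.1 && r' n m.unpair.2, ?_, fun n => ?_⟩
  · have hu : Computable fun x : ℕ × ℕ => x.2.unpair := Computable.unpair.comp Computable.snd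
    exact Primrec.and.to_comp.comp (hr.comp Computable.fst (Computable.fst.comp hu))
      (hr'.comp Computable.fst (Computable.snd.comp hu))
  · rw [hp, hq]
    constructor
    · rintro ⟨⟨a, ha⟩, b, hb⟩
      exact ⟨Nat.pair a b, by simp [ha, hb]⟩
    · rintro ⟨m, hm⟩
      rw [Bool.and_eq_true] at hm
      exact ⟨⟨_, hm.1⟩, _, hm.2⟩

theorem rePred_or {p q : ℕ → Prop} (hp : REPred p) (hq : REPred q) :
    REPred fun n => p n ∨ q n := by
  obtain ⟨r, hr, hp⟩ := rePred_iff_exists.1 hp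
  obtain ⟨r', hr', hq⟩ := rePred_iff_exists.1 hq
  refine rePred_iff_exists.2 ⟨fun n m => r n m || r' n m, ?_, fun n => ?_⟩
  · exact Primrec.or.to_comp.comp hr hr'
  · rw [hp, hq, ← exists_or]
    simp

theorem rePred_exists {p : ℕ → Prop} (hp : REPred p) :
    REPred fun n => ∃ k, p (Nat.pair n k) := by
  obtain ⟨r, hr, hp⟩ := rePred_iff_exists.1 hp
  refine rePred_iff_exists.2 ⟨fun n m => r (Nat.pair n m.unpair.1) m.unpair.2, ?_, fun n => ?_⟩
  · have hu : Computable fun x : ℕ × ℕ => x.2.unpair := Computable.unpair.comp Computable.snd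
    exact hr.comp (Primrec₂.natPair.to_comp.comp Computable.fst (Computable.fst.comp hu))
      (Computable.snd.comp hu)
  · simp only [hp]
    constructor
    · rintro ⟨k, m, h⟩
      exact ⟨Nat.pair k m, by simpa using h⟩
    · rintro ⟨m, hm⟩
      exact ⟨_, _, hm⟩

theorem rePred_of_mem {g : ℕ →. ℕ} (hg : Partrec g) {p : ℕ → Prop} (hp : REPred p) :
    REPred fun n => ∃ y ∈ g n, p y := by
  have h : Partrec fun n => (g n).bind fun y => Part.assert (p y) fun _ => Part.some () :=
    hg.bind (hp.comp Computable.snd).to₂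
  refine h.dom_re.of_eq fun n => ?_
  constructor
  · rintro ⟨h1, h2⟩
    exact ⟨_, Part.get_mem h1, h2.1⟩
  · rintro ⟨y, hy, hp⟩
    obtain ⟨h1, rfl⟩ := hy
    exact ⟨h1, hp, trivial⟩

/-- The right fold of a partial function over a list. -/
def partFold (s : ℕ →. ℕ) (a : ℕ) : List ℕ → ℕ → Part ℕ
  | [], i => Part.some i
  | x :: l, i => (partFold s a l i).bind fun acc => s (Nat.pair a (Nat.pair x acc))

/-- A right fold is a recursion on the length whose step `k` reads entry `k` of the reversed list,
the form required by `Partrec.nat_rec`. Asking `L` to agree with the reversal only on the first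
`l.length` entries lets `L` stay fixed while `l` shrinks in the induction. -/
theorem partFold_eq_rec (s : ℕ →. ℕ) (a i : ℕ) (l : List ℕ) : ∀ L : List ℕ,
    (∀ j < l.length, L.getD j 0 = l.reverse.getD j 0) →
    partFold s a l i = Nat.rec (motive := fun _ => Part ℕ) (Part.some i)
      (fun k IH => IH.bind fun acc => s (Nat.pair a (Nat.pair (L.getD k 0) acc))) l.length := by
  induction l with
  | nil => intro L _; rfl
  | cons x l ih =>
    intro L hL
    simp only [partFold, List.length_cons]
    rw [ih L fun j hj => ?_]
    · have := hL l.length (by simp)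
      simp only [List.reverse_cons, List.getD_eq_getElem?_getD] at this ⊢
      rw [this]
      simp
    · rw [hL j (by simp; omega)]
      simp only [List.reverse_cons, List.getD_eq_getElem?_getD]
      rw [List.getElem?_append_left (by simpa using hj)]

theorem partrec_partFold {s : ℕ →. ℕ} (hs : Partrec s) :
    Partrec fun x : ℕ × List ℕ × ℕ => partFold s x.1 x.2.1 x.2.2 := by
  have h : Partrec fun x : ℕ × List ℕ × ℕ => Nat.rec (motive := fun _ => Part ℕ) (Part.some x.2.2)
      (fun k IH => IH.bind fun acc => s (Nat.pair x.1 (Nat.pair (x.2.1.reverse.getD k 0) acc)))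
      x.2.1.length := by
    refine Partrec.nat_rec (f := fun x : ℕ × List ℕ × ℕ => x.2.1.length)
      (g := fun x => Part.some x.2.2)
      (h := fun x y => s (Nat.pair x.1 (Nat.pair (x.2.1.reverse.getD y.1 0) y.2))) ?_ ?_ ?_
    · exact (Primrec.list_length.comp (Primrec.fst.comp Primrec.snd)).to_comp
    · exact (Computable.snd.comp Computable.snd).partrec
    · refine hs.comp ?_
      refine Primrec.to_comp ?_
      refine Primrec₂.natPair.comp (Primrec.fst.comp Primrec.fst) (Primrec₂.natPair.comp ?_
        (Primrec.snd.comp Primrec.snd))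
      exact (Primrec.list_getD 0).comp (Primrec.list_reverse.comp
        (Primrec.fst.comp (Primrec.snd.comp Primrec.fst))) (Primrec.fst.comp Primrec.snd)
  refine h.of_eq fun x => ?_
  rw [partFold_eq_rec s _ _ _ x.2.1.reverse (fun _ _ => rfl)]

/-- Semi-decide the conditions one after the other: a fold whose step halts exactly when `p` holds
at the entry has the conjunction as its domain. -/
theorem rePred_ball {p : ℕ → Prop} (hp : REPred p) :
    REPred fun n : ℕ => ∀ x ∈ Denumerable.ofNat (List ℕ) n.unpair.2, p (Nat.pair n.unpair.1 x) := by
  let s : ℕ →. ℕ := fun n => (Part.assert (p (Nat.pair n.unpair.1 n.unpair.2.unpair.1))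
    fun _ => Part.some ()).map fun _ => 0
  have hs : Partrec s := by
    have hc : Computable fun n : ℕ => Nat.pair n.unpair.1 n.unpair.2.unpair.1 :=
      (Primrec₂.natPair.comp (Primrec.fst.comp Primrec.unpair)
      (Primrec.fst.comp (Primrec.unpair.comp (Primrec.snd.comp Primrec.unpair)))).to_comp
    have h0 : Partrec fun n : ℕ => Part.assert (p (Nat.pair n.unpair.1 n.unpair.2.unpair.1))
        fun _ => Part.some () := Partrec.comp hp hc
    exact Partrec.map h0 (Computable.const 0).to₂
  have hs_dom : ∀ n, (s n).Dom ↔ p (Nat.pair n.unpair.1 n.unpair.2.unpair.1) := fun n =>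
    ⟨fun h => h.1, fun h => ⟨h, trivial⟩⟩
  have h : Partrec fun n : ℕ =>
      partFold s n.unpair.1 (Denumerable.ofNat (List ℕ) n.unpair.2) 0 := by
    have hc : Computable fun n : ℕ =>
        (n.unpair.1, Denumerable.ofNat (List ℕ) n.unpair.2, 0) := Primrec.to_comp ((Primrec.fst.comp Primrec.unpair).pair
      (((Primrec.ofNat (List ℕ)).comp (Primrec.snd.comp Primrec.unpair)).pair (Primrec.const 0)))
    exact Partrec.comp (partrec_partFold hs) hc
  refine h.dom_re.of_eq fun n => ?_
  generalize Denumerable.ofNat (List ℕ) n.unpair.2 = l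
  induction l with
  | nil => simp [partFold]
  | cons x l ih =>
    simp only [partFold, List.mem_cons, forall_eq_or_imp, ← ih, Part.bind_dom, hs_dom]
    simp [and_comm]

/-- Types with an injective coding by natural numbers whose range is recursively enumerable. -/
class Coded (α : Type) where
  code : α → ℕ
  inj : Function.Injective code
  re : REPred fun n => ∃ a, code a = n

open Coded (code)

/-- Recursively enumerable predicates on a coded type. -/
class RE {α : Type} [Coded α] (p : α → Prop) : Prop where
  out : ∃ P : ℕ → Prop, REPred P ∧ ∀ a, p a ↔ P (code a)

/-- Computable functions between coded types. -/
class RFun {α β : Type} [Coded α] [Coded β] (f : α → β) : Prop where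
  out : ∃ g : ℕ →. ℕ, Partrec g ∧ ∀ a, code (f a) ∈ g (code a)

/-! ### Closure properties of enumerable predicates and computable functions on coded types -/

section Basic

variable {α β γ δ : Type} [Coded α] [Coded β] [Coded γ] [Coded δ]

theorem RE.congr {p q : α → Prop} (h : ∀ a, p a ↔ q a) [hq : RE q] : RE p := by
  obtain ⟨P, hP, h'⟩ := hq.out
  exact ⟨P, hP, fun a => (h a).trans (h' a)⟩

theorem RFun.congr {f g : α → β} (h : ∀ a, f a = g a) [hg : RFun g] : RFun f := by
  rwa [funext h]

theorem RFun.comp {f : β → γ} {g : α → β} (hf : RFun f) (hg : RFun g) :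
    RFun fun a => f (g a) := by
  obtain ⟨F, hF, hf⟩ := hf.out
  obtain ⟨G, hG, hg⟩ := hg.out
  refine ⟨fun n => (G n).bind F, hG.bind (hF.comp Computable.snd).to₂, fun a => ?_⟩
  exact Part.mem_bind (hg a) (hf (g a))

theorem RFun.of_computable {f : α → β} (g : ℕ → ℕ) (hg : Computable g)
    (h : ∀ a, code (f a) = g (code a)) : RFun f :=
  ⟨g, hg.partrec, fun a => by simp [h]⟩

theorem RE.comp {p : β → Prop} {f : α → β} (hp : RE p) (hf : RFun f) : RE fun a => p (f a) := by
  obtain ⟨P, hP, hp⟩ := hp.out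
  obtain ⟨F, hF, hf⟩ := hf.out
  refine ⟨_, rePred_of_mem hF hP, fun a => ?_⟩
  rw [hp]
  exact ⟨fun h => ⟨_, hf a, h⟩, fun ⟨y, hy, h⟩ => by rwa [Part.mem_unique (hf a) hy]⟩

instance RE.and {p q : α → Prop} [hp : RE p] [hq : RE q] : RE fun a => p a ∧ q a := by
  obtain ⟨P, hP, hp⟩ := hp.out
  obtain ⟨Q, hQ, hq⟩ := hq.out
  exact ⟨_, rePred_and hP hQ, fun a => and_congr (hp a) (hq a)⟩

instance RE.or {p q : α → Prop} [hp : RE p] [hq : RE q] : RE fun a => p a ∨ q a := by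
  obtain ⟨P, hP, hp⟩ := hp.out
  obtain ⟨Q, hQ, hq⟩ := hq.out
  exact ⟨_, rePred_or hP hQ, fun a => or_congr (hp a) (hq a)⟩

instance : Coded ℕ where
  code := id
  inj := Function.injective_id
  re := (rePred_iff_exists.2 ⟨fun _ _ => true, Computable.const true, fun n => by simp⟩)

theorem REPred.comp_computable {p : ℕ → Prop} (hp : REPred p) {f : ℕ → ℕ} (hf : Computable f) :
    REPred fun n => p (f n) := Partrec.comp hp hf

instance : Coded (α × β) where
  code x := Nat.pair (code x.1) (code x.2)
  inj := by
    rintro ⟨a, b⟩ ⟨a', b'⟩ h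
    simpa [Nat.pair_eq_pair, Coded.inj.eq_iff] using h
  re := by
    refine (rePred_and (REPred.comp_computable (Coded.re (α := α))
      (Computable.fst.comp Computable.unpair)) (REPred.comp_computable (Coded.re (α := β))
      (Computable.snd.comp Computable.unpair))).of_eq fun n => ?_
    constructor
    · rintro ⟨⟨a, ha⟩, b, hb⟩
      exact ⟨(a, b), by simp [ha, hb]⟩
    · rintro ⟨⟨a, b⟩, rfl⟩
      simp [Coded.inj.eq_iff]

open Classical in
noncomputable instance : Coded Prop where
  code p := if p then 1 else 0
  inj := by
    intro p q h
    by_cases hp : p <;> by_cases hq : q <;> simp_all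
  re := by
    refine (rePred_iff_exists.2 ⟨fun n _ => decide (n < 2), ?_, fun n => ?_⟩)
    · exact (Primrec.nat_lt.comp Primrec.fst (Primrec.const 2)).decide.to_comp
    · constructor
      · rintro ⟨p, rfl⟩
        split_ifs <;> simp
      · rintro ⟨_, h⟩
        have : n = 0 ∨ n = 1 := by simp at h; omega
        rcases this with rfl | rfl
        · exact ⟨False, by simp⟩
        · exact ⟨True, by simp⟩

theorem code_prop (p : Prop) [Decidable p] : code p = if p then 1 else 0 := by
  simp only [code]
  congr

theorem RFun.congr_prop {p q : α → Prop} (h : ∀ a, p a ↔ q a) [hg : RFun q] : RFun p :=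
  RFun.congr fun a => propext (h a)

theorem code_prod (x : α × β) : code x = Nat.pair (code x.1) (code x.2) := rfl

instance : Coded (List α) where
  code := codeList code
  inj := codeList_injective Coded.inj
  re := by
    refine (REPred.comp_computable (f := fun n => Nat.pair 0 n) (rePred_ball (p := fun n : ℕ => ∃ a : α, code a = n.unpair.2)
      (REPred.comp_computable (Coded.re (α := α)) (Computable.snd.comp Computable.unpair)))
      (Primrec₂.natPair.to_comp.comp (Computable.const 0) Computable.id)).of_eq fun n => ?_
    simp only [Nat.unpair_pair]
    constructor
    · intro h
      obtain ⟨l, hl⟩ : ∃ l : List α, l.map code = Denumerable.ofNat (List ℕ) n := by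
        revert h
        generalize Denumerable.ofNat (List ℕ) n = L
        intro h
        induction L with
        | nil => exact ⟨[], rfl⟩
        | cons x L ih =>
          obtain ⟨l, hl⟩ := ih fun y hy => h y (List.mem_cons_of_mem _ hy)
          obtain ⟨a, ha⟩ := h x (by simp)
          exact ⟨a :: l, by simp [ha, hl]⟩
      exact ⟨l, by simp [codeList, hl]⟩
    · rintro ⟨l, rfl⟩ x hx
      simp only [codeList, Denumerable.ofNat_encode, List.mem_map] at hx
      obtain ⟨a, _, rfl⟩ := hx
      exact ⟨a, rfl⟩

theorem code_list (l : List α) : code l = Encodable.encode (l.map code) := rfl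

theorem RE.ball_pair {p : α → β → Prop} (hp : RE fun x : α × β => p x.1 x.2) :
    RE fun x : α × List β => ∀ b ∈ x.2, p x.1 b := by
  obtain ⟨P, hP, hp⟩ := hp.out
  refine ⟨_, rePred_ball hP, fun x => ?_⟩
  simp only [code_prod x, code_list, Nat.unpair_pair, Denumerable.ofNat_encode, List.mem_map,
    forall_exists_index, and_imp, forall_apply_eq_imp_iff₂]
  exact forall₂_congr fun b _ => hp (x.1, b)

/-- The search runs over all numbers and has to confirm that the number found is a code. This is why
`Coded` demands an enumerable range. -/
instance RE.exists {p : α → β → Prop} [hp : RE fun x : α × β => p x.1 x.2] :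
    RE fun a => ∃ b, p a b := by
  obtain ⟨P, hP, hp⟩ := hp.out
  refine ⟨_, rePred_exists (rePred_and hP (REPred.comp_computable (Coded.re (α := β))
    (Computable.snd.comp Computable.unpair))), fun a => ?_⟩
  constructor
  · rintro ⟨b, hb⟩
    exact ⟨code b, (hp (a, b)).1 hb, b, by simp⟩
  · rintro ⟨k, h, b, hb⟩
    refine ⟨b, (hp (a, b)).2 ?_⟩
    simp only [Nat.unpair_pair] at hb
    rwa [code_prod, hb]

/-- Decidable predicates are treated as computable functions into `Prop`, whose two elements are
coded by 0 and 1; enumerability is the fallback for everything else. -/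
instance (priority := low) RE.of_rFun {p : α → Prop} [hp : RFun p] : RE p := by
  classical
  obtain ⟨G, hG, hp⟩ := hp.out
  refine ⟨_, rePred_of_mem hG (p := fun y => y = 1) (ComputablePred.to_re
    ⟨inferInstance, (Primrec.eq.comp Primrec.id (Primrec.const 1)).decide.to_comp⟩), fun a => ?_⟩
  have h := hp a
  rw [code_prop] at h
  constructor
  · intro ha
    rw [if_pos ha] at h
    exact ⟨_, h, rfl⟩
  · rintro ⟨y, hy, rfl⟩
    by_contra ha
    rw [if_neg ha] at h
    exact absurd (Part.mem_unique h hy) (by simp)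

/-- Post's theorem: run both semi-decisions until one succeeds. Halting is guaranteed only at codes
of elements of `α`, which is all that `RFun` asks for. -/
theorem RFun.of_re {p : α → Prop} (hp : RE p) (hn : RE fun a => ¬ p a) : RFun p := by
  classical
  obtain ⟨P, hP, hp⟩ := hp.out
  obtain ⟨N, hN, hn⟩ := hn.out
  obtain ⟨r, hr, hP⟩ := rePred_iff_exists.1 hP
  obtain ⟨s, hs, hN⟩ := rePred_iff_exists.1 hN
  refine ⟨fun n => (Nat.rfind fun m => Part.some (r n m || s n m)).map
    fun m => bif r n m then 1 else 0, ?_, fun a => ?_⟩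
  · refine Partrec.map (Partrec.rfind (Computable₂.partrec₂ (Primrec.or.to_comp.comp hr hs))) ?_
    exact Computable.cond hr (Computable.const 1) (Computable.const 0)
  · have hd : (Nat.rfind fun m => Part.some (r (code a) m || s (code a) m)).Dom := by
      refine (rfind_dom_iff _).2 ?_
      by_cases ha : p a
      · obtain ⟨m, hm⟩ := (hP _).1 ((hp a).1 ha)
        exact ⟨m, by simp [hm]⟩
      · obtain ⟨m, hm⟩ := (hN _).1 ((hn a).1 ha)
        exact ⟨m, by simp [hm]⟩
    obtain ⟨m, hm⟩ := Part.dom_iff_mem.1 hd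
    refine (Part.mem_map_iff _).2 ⟨m, hm, ?_⟩
    have h1 := Nat.rfind_spec hm
    rw [code_prop]
    by_cases ha : p a
    · have : s (code a) m = false := by
        by_contra h
        exact ((hn a).2 ((hN _).2 ⟨m, by simpa using h⟩)) ha
      simp_all
    · have : r (code a) m = false := by
        by_contra h
        exact ha ((hp a).2 ((hP _).2 ⟨m, by simpa using h⟩))
      simp_all

instance (priority := high) RFun.id : RFun fun a : α => a := .of_computable _ Computable.id fun _ => rfl

instance (priority := high) RFun.const (b : β) : RFun fun _ : α => b :=
  .of_computable _ (Computable.const (code b)) fun _ => rfl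

instance (priority := low) RFun.pair {f : α → β} {g : α → γ} [hf : RFun f] [hg : RFun g] :
    RFun fun a => (f a, g a) := by
  obtain ⟨F, hF, hf⟩ := hf.out
  obtain ⟨G, hG, hg⟩ := hg.out
  refine ⟨fun n => (F n).bind fun x => (G n).map fun y => Nat.pair x y, ?_, fun a => ?_⟩
  · refine hF.bind (Partrec.map (hG.comp Computable.fst) ?_)
    exact Primrec₂.natPair.to_comp.comp (Computable.snd.comp Computable.fst) Computable.snd
  · exact Part.mem_bind (hf a) ((Part.mem_map_iff _).2 ⟨_, hg a, rfl⟩)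

instance (priority := high) RFun.fst {f : α → β × γ} [hf : RFun f] : RFun fun a => (f a).1 :=
  .comp (g := f) (f := Prod.fst) (.of_computable (fun n => n.unpair.1)
    (Computable.fst.comp Computable.unpair) fun x => by simp [code_prod]) hf

instance (priority := high) RFun.snd {f : α → β × γ} [hf : RFun f] : RFun fun a => (f a).2 :=
  .comp (g := f) (f := Prod.snd) (.of_computable (fun n => n.unpair.2)
    (Computable.snd.comp Computable.unpair) fun x => by simp [code_prod]) hf

theorem RFun.comp₂ {f : β → γ → δ} (hf : RFun fun x : β × γ => f x.1 x.2) {g : α → β} {h : α → γ}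
    (hg : RFun g) (hh : RFun h) : RFun fun a => f (g a) (h a) :=
  .comp (f := fun x : β × γ => f x.1 x.2) (g := fun a => (g a, h a)) hf inferInstance

instance RE.ball {p : α → β → Prop} {l : α → List β} [hp : RE fun x : α × β => p x.1 x.2]
    [hl : RFun l] : RE fun a => ∀ b ∈ l a, p a b :=
  RE.comp (f := fun a => (a, l a)) (RE.ball_pair hp) inferInstance

instance RFun.cons {f : α → β} {g : α → List β} [hf : RFun f] [hg : RFun g] :
    RFun fun a => f a :: g a := by
  refine .comp₂ (f := fun x l => x :: l) ?_ hf hg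
  refine .of_computable (fun n => (Nat.pair n.unpair.1 n.unpair.2).succ) ?_ fun x => ?_
  · exact (Primrec.succ.comp (Primrec₂.natPair.comp (Primrec.fst.comp Primrec.unpair)
      (Primrec.snd.comp Primrec.unpair))).to_comp
  · simp [code_prod x, code_list]

instance RFun.eq {f g : α → β} [hf : RFun f] [hg : RFun g] : RFun fun a => f a = g a := by
  classical
  refine .comp₂ (f := fun x y => x = y) ?_ hf hg
  refine .of_computable (fun n => bif decide (n.unpair.1 = n.unpair.2) then 1 else 0) ?_
    fun x => ?_
  · refine Computable.cond ?_ (Computable.const 1) (Computable.const 0)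
    exact (Primrec.eq.comp (Primrec.fst.comp Primrec.unpair)
      (Primrec.snd.comp Primrec.unpair)).decide.to_comp
  · rw [code_prop, code_prod x]
    simp only [Nat.unpair_pair, Coded.inj.eq_iff]
    split_ifs with h <;> simp [h]

instance RFun.ite {p : α → Prop} {hd : ∀ a, Decidable (p a)} {f g : α → β} [hp : RFun p]
    [hf : RFun f] [hg : RFun g] : RFun fun a => if p a then f a else g a := by
  classical
  obtain ⟨P, hP, hp⟩ := hp.out
  obtain ⟨F, hF, hf⟩ := hf.out
  obtain ⟨G, hG, hg⟩ := hg.out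
  refine ⟨fun n => (P n).bind fun y => bif decide (y = 1) then F n else G n, ?_, fun a => ?_⟩
  · refine hP.bind ?_
    exact Partrec.cond (Primrec.eq.comp Primrec.snd (Primrec.const 1)).decide.to_comp
      (hF.comp Computable.fst) (hG.comp Computable.fst)
  · refine Part.mem_bind (hp a) ?_
    rw [code_prop]
    split_ifs with h
    · simpa using hf a
    · simpa using hg a

/-- The one form of recursion on lists that is needed: bounded quantifiers, concatenations, maps,
filters, tails and sublists all reduce to it. -/
instance RFun.foldr {s : α → β → γ → γ} {i : α → γ} {l : α → List β}
    [hs : RFun fun x : α × β × γ => s x.1 x.2.1 x.2.2] [hi : RFun i] [hl : RFun l] :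
    RFun fun a => (l a).foldr (s a) (i a) := by
  suffices h : RFun fun x : α × List β × γ => x.2.1.foldr (s x.1) x.2.2 from
    .comp (f := fun x : α × List β × γ => x.2.1.foldr (s x.1) x.2.2)
      (g := fun a => (a, l a, i a)) h inferInstance
  obtain ⟨S, hS, hs⟩ := hs.out
  refine ⟨fun n => partFold S n.unpair.1 (Denumerable.ofNat (List ℕ) n.unpair.2.unpair.1)
    n.unpair.2.unpair.2, ?_, ?_⟩
  · have hc : Computable fun n : ℕ => (n.unpair.1, Denumerable.ofNat (List ℕ) n.unpair.2.unpair.1,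
      n.unpair.2.unpair.2) := ?_
    · exact Partrec.comp (partrec_partFold hS) hc
    refine Primrec.to_comp ?_
    refine Primrec.pair (Primrec.fst.comp Primrec.unpair) (Primrec.pair ?_ ?_)
    · exact (Primrec.ofNat (List ℕ)).comp (Primrec.fst.comp (Primrec.unpair.comp
        (Primrec.snd.comp Primrec.unpair)))
    · exact Primrec.snd.comp (Primrec.unpair.comp (Primrec.snd.comp Primrec.unpair))
  · rintro ⟨a, l, c⟩
    simp only [code_prod (a, l, c), code_prod (l, c), Nat.unpair_pair, code_list,
      Denumerable.ofNat_encode]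
    induction l with
    | nil => simp [partFold]
    | cons b l ih => exact Part.mem_bind ih (hs (a, b, _))

end Basic

end KABs

namespace KABs
open Coded (code)

open Relation (ReflTransGen)

set_option synthInstance.maxSize 100000
set_option synthInstance.maxHeartbeats 400000

/-! ### Decidable connectives, bounded quantifiers and list operations -/

section Logic

variable {α β γ δ : Type} [Coded α] [Coded β] [Coded γ] [Coded δ]

open Classical in
instance RFun.and {p q : α → Prop} [RFun p] [RFun q] : RFun fun a => p a ∧ q a :=
  RFun.congr_prop (q := fun a => if p a then q a else False) fun a => by
    by_cases h : p a <;> simp [h]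

open Classical in
instance RFun.or {p q : α → Prop} [RFun p] [RFun q] : RFun fun a => p a ∨ q a :=
  RFun.congr_prop (q := fun a => if p a then True else q a) fun a => by
    by_cases h : p a <;> simp [h]

open Classical in
instance RFun.imp {p q : α → Prop} [RFun p] [RFun q] : RFun fun a => p a → q a :=
  RFun.congr_prop (q := fun a => if p a then q a else True) fun a => by
    by_cases h : p a <;> simp [h]

instance RFun.iff {p q : α → Prop} [RFun p] [RFun q] : RFun fun a => (p a ↔ q a) :=
  RFun.congr_prop (q := fun a => p a = q a) fun a => by simp

instance RFun.forall_mem {p : α → β → Prop} {l : α → List β}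
    [RFun fun x : α × β => p x.1 x.2] [RFun l] : RFun fun a => ∀ b, b ∈ l a → p a b := by
  have : RFun fun x : α × β × Prop => p x.1 x.2.1 :=
    .comp (f := fun x : α × β => p x.1 x.2) (g := fun x : α × β × Prop => (x.1, x.2.1))
      inferInstance inferInstance
  refine RFun.congr_prop (q := fun a => (l a).foldr (fun b acc => p a b ∧ acc) True) fun a => ?_
  induction l a with
  | nil => simp
  | cons b l ih => simp [← ih]

instance RFun.exists_mem {p : α → β → Prop} {l : α → List β}
    [RFun fun x : α × β => p x.1 x.2] [RFun l] : RFun fun a => ∃ b, b ∈ l a ∧ p a b :=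
  RFun.congr_prop (q := fun a => ¬ ∀ b, b ∈ l a → ¬ p a b) fun a => by push Not; rfl

instance RFun.mem {f : α → β} {l : α → List β} [hf : RFun f] [hl : RFun l] :
    RFun fun a => f a ∈ l a :=
  .comp₂ (f := fun x l => x ∈ l)
    (RFun.congr_prop (q := fun a => ∃ b, b ∈ a.2 ∧ b = a.1) fun a => by simp) hf hl

instance RFun.append {f g : α → List β} [RFun f] [RFun g] : RFun fun a => f a ++ g a :=
  RFun.congr (g := fun a => (f a).foldr (fun b acc => b :: acc) (g a)) fun a => by simp

instance RFun.flatMap {l : α → List β} {f : α → β → List γ}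
    [RFun fun x : α × β => f x.1 x.2] [RFun l] : RFun fun a => (l a).flatMap (f a) := by
  have : RFun fun x : α × β × List γ => f x.1 x.2.1 :=
    .comp (f := fun x : α × β => f x.1 x.2) (g := fun x : α × β × List γ => (x.1, x.2.1))
      inferInstance inferInstance
  refine RFun.congr (g := fun a => (l a).foldr (fun b acc => f a b ++ acc) []) fun a => ?_
  induction l a with
  | nil => simp
  | cons b l ih => simp [← ih]

instance RFun.map {l : α → List β} {f : α → β → γ}
    [RFun fun x : α × β => f x.1 x.2] [RFun l] : RFun fun a => (l a).map (f a) :=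
  RFun.congr (g := fun a => (l a).flatMap fun b => [f a b]) fun a => by
    rw [← List.flatMap_singleton' (l a), List.map_flatMap]
    simp

/-- The sublist of the elements with a property. -/
noncomputable def sift {α : Type} (p : α → Prop) (l : List α) : List α :=
  open Classical in l.filter fun a => decide (p a)

omit [Coded α] in
@[simp] theorem mem_sift {p : α → Prop} {l : List α} {a : α} : a ∈ sift p l ↔ a ∈ l ∧ p a := by
  simp [sift]

open Classical in
instance RFun.sift {l : α → List β} {p : α → β → Prop}
    [RFun fun x : α × β => p x.1 x.2] [RFun l] : RFun fun a => sift (p a) (l a) := by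
  refine RFun.congr (g := fun a => (l a).flatMap fun b => if p a b then [b] else []) fun a => ?_
  induction l a with
  | nil => simp [KABs.sift]
  | cons b l ih =>
    rw [List.flatMap_cons, ← ih]
    by_cases h : p a b <;> simp [KABs.sift, h]

instance RFun.tails {l : α → List β} [RFun l] : RFun fun a => (l a).tails := by
  refine RFun.congr (g := fun a => ((l a).foldr (fun b (acc : List β × List (List β)) =>
    (b :: acc.1, (b :: acc.1) :: acc.2)) ([], [[]])).2) fun a => ?_
  suffices h : ∀ l : List β, l.foldr (fun b (acc : List β × List (List β)) =>
    (b :: acc.1, (b :: acc.1) :: acc.2)) ([], [[]]) = (l, l.tails) by rw [h]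
  intro l
  induction l with
  | nil => rfl
  | cons b l ih => simp [ih]

instance RFun.sublists' {l : α → List β} [RFun l] : RFun fun a => (l a).sublists' := by
  refine RFun.congr (g := fun a => (l a).foldr (fun b acc => acc ++ acc.map fun t => b :: t) [[]])
    fun a => ?_
  induction l a with
  | nil => rfl
  | cons b l ih => simp [ih]

instance RFun.natPair {f : α → ℕ} {g : α → ℕ} [hf : RFun f] [hg : RFun g] :
    RFun fun a => Nat.pair (f a) (g a) :=
  .comp₂ (f := fun x y => Nat.pair x y)
    (.of_computable (fun n => n) Computable.id fun _ => rfl) hf hg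

instance RFun.coded {f : α → β} [hf : RFun f] : RFun fun a => code (f a) :=
  .comp (f := fun x => Coded.code x) (.of_computable (fun n => n) Computable.id fun _ => rfl) hf

/-! ### Inductive definitions -/

/-- Derivability from the rules `R`, each consisting of a conclusion and a list of premises. -/
inductive Der {α : Type} (R : α → List α → Prop) : α → Prop
  | intro (a : α) (l : List α) : R a l → (∀ b ∈ l, Der R b) → Der R a

/-- Every entry of the list is derived by a rule from later entries. -/
def IsProof {α : Type} (R : α → List α → Prop) (L : List α) : Prop :=
  ∀ t ∈ L.tails, t = [] ∨ ∃ x l ps, t = x :: l ∧ R x ps ∧ ∀ p ∈ ps, p ∈ l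

theorem isProof_cons {α : Type} {R : α → List α → Prop} {x : α} {l : List α} :
    IsProof R (x :: l) ↔ (∃ ps, R x ps ∧ ∀ p ∈ ps, p ∈ l) ∧ IsProof R l := by
  simp only [IsProof, List.tails_cons, List.mem_cons, forall_eq_or_imp]
  refine and_congr_left fun _ => ?_
  constructor
  · rintro (h | ⟨y, m, ps, h, h1, h2⟩)
    · simp at h
    · obtain ⟨rfl, rfl⟩ := List.cons.inj h
      exact ⟨ps, h1, h2⟩
  · rintro ⟨ps, h1, h2⟩
    exact .inr ⟨x, l, ps, rfl, h1, h2⟩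

theorem IsProof.append {α : Type} {R : α → List α → Prop} {l m : List α} (hl : IsProof R l)
    (hm : IsProof R m) : IsProof R (l ++ m) := by
  induction l with
  | nil => exact hm
  | cons x l ih =>
    obtain ⟨⟨ps, h1, h2⟩, h3⟩ := isProof_cons.1 hl
    exact isProof_cons.2 ⟨⟨ps, h1, fun p hp => List.mem_append_left _ (h2 p hp)⟩, ih h3⟩

theorem IsProof.exists_cover {α : Type} {R : α → List α → Prop} (l : List α)
    (h : ∀ a ∈ l, ∃ L, IsProof R L ∧ a ∈ L) : ∃ L, IsProof R L ∧ ∀ a ∈ l, a ∈ L := by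
  induction l with
  | nil => exact ⟨[], by simp [IsProof], by simp⟩
  | cons x l ih =>
    obtain ⟨L, hL, hx⟩ := h x (by simp)
    obtain ⟨M, hM, hl⟩ := ih fun a ha => h a (List.mem_cons_of_mem _ ha)
    refine ⟨L ++ M, hL.append hM, fun a ha => ?_⟩
    rcases List.mem_cons.1 ha with rfl | ha
    · exact List.mem_append_left _ hx
    · exact List.mem_append_right _ (hl a ha)

theorem IsProof.der {α : Type} {R : α → List α → Prop} {L : List α} (h : IsProof R L) :
    ∀ a ∈ L, Der R a := by
  induction L with
  | nil => simp
  | cons x l ih =>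
    obtain ⟨⟨ps, h1, h2⟩, h3⟩ := isProof_cons.1 h
    intro a ha
    rcases List.mem_cons.1 ha with rfl | ha
    · exact .intro _ ps h1 fun b hb => ih h3 b (h2 b hb)
    · exact ih h3 a ha

theorem Der.exists_isProof {α : Type} {R : α → List α → Prop} {a : α} (h : Der R a) :
    ∃ L, IsProof R L ∧ a ∈ L := by
  induction h with
  | intro a l hR _ ih =>
    obtain ⟨L, hL, hl⟩ := IsProof.exists_cover l ih
    exact ⟨a :: L, isProof_cons.2 ⟨⟨l, hR, hl⟩, hL⟩, by simp⟩

/-- Derivability means occurrence in a finite list that is a proof, and being a proof is a bounded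
quantification over the tails of the list. The rules themselves need only be recursively enumerable.
Recursion over syntax, reachability and the evaluation of formulae are all brought into this form.
-/
theorem RE.der {R : α → List α → Prop} (hR : RE fun x : α × List α => R x.1 x.2) :
    RE (Der R) := by
  have : ∀ a, Der R a ↔ ∃ L : List α, a ∈ L ∧ IsProof R L := fun a =>
    ⟨fun h => by obtain ⟨L, h1, h2⟩ := h.exists_isProof; exact ⟨L, h2, h1⟩,
      fun ⟨L, h1, h2⟩ => h2.der a h1⟩
  -- The context below the quantifiers of `IsProof`: the element, the list, a tail, its head, its
  -- rest and the premises. `hR` applies to the head and the premises.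
  have h1 : RE fun x : ((((α × List α) × List α) × α) × List α) × List α =>
      R x.1.1.2 x.2 :=
    .comp (p := fun x : α × List α => R x.1 x.2) (f := fun x : ((((α × List α) × List α) × α) ×
      List α) × List α => (x.1.1.2, x.2)) hR inferInstance
  refine RE.congr this (hq := ?_)
  unfold IsProof
  infer_instance

/-- Dovetailing: the answer tells which of the two predicates was confirmed at the first successful
stage. Nothing is promised where neither holds, as befits a problem whose inputs are subject to
conditions. -/
theorem exists_partrec_decide {p q : α → Prop} [hp : RE p] [hq : RE q] :
    ∃ f : ℕ →. Bool, Partrec f ∧ ∀ a, (p a ∨ q a) → ∃ b ∈ f (code a),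
      (b = true → p a) ∧ (b = false → q a) := by
  obtain ⟨P, hP, hp⟩ := hp.out
  obtain ⟨Q, hQ, hq⟩ := hq.out
  obtain ⟨r, hr, hP⟩ := rePred_iff_exists.1 hP
  obtain ⟨s, hs, hQ⟩ := rePred_iff_exists.1 hQ
  refine ⟨fun n => (Nat.rfind fun m => Part.some (r n m || s n m)).map fun m => r n m, ?_,
    fun a ha => ?_⟩
  · exact Partrec.map (Partrec.rfind (Computable₂.partrec₂ (Primrec.or.to_comp.comp hr hs))) hr
  · have hd : (Nat.rfind fun m => Part.some (r (code a) m || s (code a) m)).Dom := by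
      refine (rfind_dom_iff _).2 ?_
      rcases ha with ha | ha
      · obtain ⟨m, hm⟩ := (hP _).1 ((hp a).1 ha)
        exact ⟨m, by simp [hm]⟩
      · obtain ⟨m, hm⟩ := (hQ _).1 ((hq a).1 ha)
        exact ⟨m, by simp [hm]⟩
    obtain ⟨m, hm⟩ := Part.dom_iff_mem.1 hd
    refine ⟨_, (Part.mem_map_iff _).2 ⟨m, hm, rfl⟩, fun h => ?_, fun h => ?_⟩
    · exact (hp a).2 ((hP _).2 ⟨m, h⟩)
    · have h1 := Nat.rfind_spec hm
      simp only [h, Bool.false_or, Part.mem_some_iff] at h1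
      exact (hq a).2 ((hQ _).2 ⟨m, h1.symm⟩)

/-! ### Case distinctions -/

theorem RFun.constructor {c : δ → γ} (i : ℕ) (hc : ∀ s, code (c s) = Nat.pair i (code s))
    {f : α → δ} (hf : RFun f) : RFun fun a => c (f a) :=
  .comp (f := c) (.of_computable (fun n => Nat.pair i n)
    (Primrec₂.natPair.comp (Primrec.const i) Primrec.id).to_comp hc) hf

theorem rePred_of_re {p : ℕ → Prop} (h : RE p) : REPred p := by
  obtain ⟨P, hP, h⟩ := h.out
  exact hP.of_eq fun n => (h n).symm

end Logic

instance : Coded Unit where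
  code _ := 0
  inj _ _ _ := rfl
  re := rePred_of_re (RE.congr (q := fun n : ℕ => n = 0) fun n => by simp [eq_comm])

instance (priority := 10000) rFun_unit {α : Type} [Coded α] (f : α → Unit) : RFun f :=
  .of_computable (fun _ => 0) (Computable.const 0) fun _ => rfl

section Option

variable {α β γ : Type} [Coded α] [Coded β] [Coded γ]

instance : Coded (Option α) where
  code
    | none => Nat.pair 0 0
    | some a => Nat.pair 1 (code a)
  inj := by
    intro a b h
    cases a <;> cases b <;> simp_all [Nat.pair_eq_pair, Coded.inj.eq_iff]
  re := rePred_of_re (RE.congr (q := fun n : ℕ => n = Nat.pair 0 0 ∨ ∃ a : α, Nat.pair 1 (code a) = n)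
    fun n => by
      constructor
      · rintro ⟨_ | a, rfl⟩
        · exact .inl rfl
        · exact .inr ⟨a, rfl⟩
      · rintro (rfl | ⟨a, rfl⟩)
        · exact ⟨none, rfl⟩
        · exact ⟨some a, rfl⟩)

instance RFun.some {f : α → β} [hf : RFun f] : RFun fun a => some (f a) :=
  RFun.constructor (c := Option.some) 1 (fun _ => rfl) hf

end Option

/-! ## Coding of the syntax -/

/-- A constructor of `τ` with its coded type of arguments. -/
structure Ctor (τ : Type) where
  Arg : Type
  [coded : Coded Arg]
  build : Arg → τ

/-- The constructors are coded by pairs of a tag, counted from `i`, and the code of the argument. -/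
def CodesFrom {τ : Type} (c : τ → ℕ) : ℕ → List (Ctor τ) → Prop
  | _, [] => True
  | i, k :: L => (∀ s, c (k.build s) = Nat.pair i (k.coded.code s)) ∧ CodesFrom c (i + 1) L

/-- `t` is built by one of the constructors. -/
def Covers {τ : Type} (t : τ) : List (Ctor τ) → Prop
  | [] => False
  | k :: L => (∃ s, k.build s = t) ∨ Covers t L

theorem rePred_covers {τ : Type} {c : τ → ℕ} : ∀ (L : List (Ctor τ)) (i : ℕ), CodesFrom c i L →
    REPred fun n => ∃ t, Covers t L ∧ c t = n
  | [], _, _ => rePred_of_re (RE.congr (q := fun _ => False) fun n => by simp [Covers])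
  | k :: L, i, h => by
    let _ := k.coded
    have h1 : REPred fun n => ∃ s : k.Arg, Nat.pair i (code s) = n := rePred_of_re inferInstance
    refine (rePred_or h1 (rePred_covers L (i + 1) h.2)).of_eq fun n => ?_
    constructor
    · rintro (⟨s, hs⟩ | ⟨t, ht, hn⟩)
      · exact ⟨k.build s, .inl ⟨s, rfl⟩, (h.1 s).trans hs⟩
      · exact ⟨t, .inr ht, hn⟩
    · rintro ⟨t, ⟨s, rfl⟩ | ht, hn⟩
      · exact .inl ⟨s, (h.1 s).symm.trans hn⟩
      · exact .inr ⟨t, ht, hn⟩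

/-- The coded type with the given coding and constructors. -/
@[reducible] def Coded.ofCtors {τ : Type} (c : τ → ℕ) (hc : Function.Injective c)
    (L : List (Ctor τ)) (h : CodesFrom c 0 L) (hL : ∀ t, Covers t L) : Coded τ where
  code := c
  inj := hc
  re := (rePred_covers L 0 h).of_eq fun n => by simp [hL]

/-- The function is computable on the values of each constructor. -/
def AllRFun {α β τ : Type} [Coded α] [Coded β] (h : α → τ → β) : List (Ctor τ) → Prop
  | [] => True
  | k :: L => (let _ := k.coded; RFun fun x : α × k.Arg => h x.1 (k.build x.2)) ∧ AllRFun h L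

/-- The program compares the tag with `i` and otherwise passes on to the remaining constructors.
Their tags exceed `i`; the lower bound in the conclusion records this, so that the branches do not
interfere. -/
theorem AllRFun.exists_partrec {α β τ : Type} [Coded α] [Coded β] {c : τ → ℕ} {h : α → τ → β} :
    ∀ (L : List (Ctor τ)) (i : ℕ), CodesFrom c i L → AllRFun h L →
    ∃ g : ℕ →. ℕ, Partrec g ∧ ∀ a t, Covers t L → i ≤ (c t).unpair.1 ∧
      code (h a t) ∈ g (Nat.pair (code a) (c t))
  | [], _, _, _ => ⟨fun _ => Part.none, Partrec.none, fun a t h => h.elim⟩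
  | k :: L, i, hc, hh => by
    let _ := k.coded
    obtain ⟨g, hg, hg'⟩ := exists_partrec L (i + 1) hc.2 hh.2
    obtain ⟨f, hf, hf'⟩ := hh.1.out
    refine ⟨fun x => bif decide (x.unpair.2.unpair.1 = i) then
      f (Nat.pair x.unpair.1 x.unpair.2.unpair.2) else g x, ?_, fun a t ht => ?_⟩
    · have h2 : Primrec fun x : ℕ => x.unpair.2.unpair :=
        Primrec.unpair.comp (Primrec.snd.comp Primrec.unpair)
      exact Partrec.cond (Primrec.eq.comp (Primrec.fst.comp h2) (Primrec.const i)).decide.to_comp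
        (hf.comp (Primrec₂.natPair.comp (Primrec.fst.comp Primrec.unpair)
          (Primrec.snd.comp h2)).to_comp) hg
    · simp only [Nat.unpair_pair]
      rcases ht with ⟨s, rfl⟩ | ht
      · rw [hc.1 s]
        simpa [code_prod (a, s)] using hf' (a, s)
      · obtain ⟨h1, h2⟩ := hg' a t ht
        have h3 : (c t).unpair.1 ≠ i := by omega
        exact ⟨by omega, by simpa [h3] using h2⟩

theorem RFun.cases {α β τ : Type} [Coded α] [Coded β] [Coded τ] (L : List (Ctor τ))
    (h : CodesFrom (code : τ → ℕ) 0 L) (hL : ∀ t, Covers t L) {f : α → τ → β}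
    (H : AllRFun f L) : RFun fun x : α × τ => f x.1 x.2 := by
  obtain ⟨g, hg, H⟩ := AllRFun.exists_partrec L 0 h H
  exact ⟨g, hg, fun x => by rw [code_prod]; exact (H x.1 x.2 (hL _)).2⟩

/-- The constructors of the type. -/
def roleCtors : List (Ctor Role) :=
  [⟨ℕ, fun s : ℕ => Role.name s⟩,
    ⟨ℕ, fun s : ℕ => Role.inv s⟩]

theorem role_covers (t : Role) : Covers t roleCtors := by
  cases t <;> simp [Covers, roleCtors]

instance : Coded Role := .ofCtors Role.code Role.code_injective roleCtors
  ⟨fun _ => rfl, fun _ => rfl, trivial⟩ role_covers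

theorem RFun.role_cases {α β : Type} [Coded α] [Coded β] {h : α → Role → β}
    (h0 : RFun fun x : α × ℕ => h x.1 (Role.name x.2))
    (h1 : RFun fun x : α × ℕ => h x.1 (Role.inv x.2)) :
    RFun fun x : α × Role => h x.1 x.2 :=
  RFun.cases roleCtors ⟨fun _ => rfl, fun _ => rfl, trivial⟩ role_covers
    ⟨h0, h1, trivial⟩

instance RFun.roleName {α : Type} [Coded α] {f0 : α → ℕ} [RFun f0] :
    RFun fun a => Role.name (f0 a) :=
  RFun.constructor (c := fun s : ℕ => Role.name s) 0 (fun _ => rfl)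
    (f := fun a => (f0 a)) inferInstance

instance RFun.roleInv {α : Type} [Coded α] {f0 : α → ℕ} [RFun f0] :
    RFun fun a => Role.inv (f0 a) :=
  RFun.constructor (c := fun s : ℕ => Role.inv s) 1 (fun _ => rfl)
    (f := fun a => (f0 a)) inferInstance

/-- The constructors of the type. -/
def basicConceptCtors : List (Ctor BasicConcept) :=
  [⟨ℕ, fun s : ℕ => BasicConcept.atomic s⟩,
    ⟨Role, fun s : Role => BasicConcept.exist s⟩]

theorem basicConcept_covers (t : BasicConcept) : Covers t basicConceptCtors := by
  cases t <;> simp [Covers, basicConceptCtors]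

instance : Coded BasicConcept := .ofCtors BasicConcept.code BasicConcept.code_injective basicConceptCtors
  ⟨fun _ => rfl, fun _ => rfl, trivial⟩ basicConcept_covers

theorem RFun.basicConcept_cases {α β : Type} [Coded α] [Coded β] {h : α → BasicConcept → β}
    (h0 : RFun fun x : α × ℕ => h x.1 (BasicConcept.atomic x.2))
    (h1 : RFun fun x : α × Role => h x.1 (BasicConcept.exist x.2)) :
    RFun fun x : α × BasicConcept => h x.1 x.2 :=
  RFun.cases basicConceptCtors ⟨fun _ => rfl, fun _ => rfl, trivial⟩ basicConcept_covers
    ⟨h0, h1, trivial⟩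

instance RFun.atomic {α : Type} [Coded α] {f0 : α → ℕ} [RFun f0] :
    RFun fun a => BasicConcept.atomic (f0 a) :=
  RFun.constructor (c := fun s : ℕ => BasicConcept.atomic s) 0 (fun _ => rfl)
    (f := fun a => (f0 a)) inferInstance

instance RFun.exist {α : Type} [Coded α] {f0 : α → Role} [RFun f0] :
    RFun fun a => BasicConcept.exist (f0 a) :=
  RFun.constructor (c := fun s : Role => BasicConcept.exist s) 1 (fun _ => rfl)
    (f := fun a => (f0 a)) inferInstance

/-- The constructors of the type. -/
def tAssertionCtors : List (Ctor TAssertion) :=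
  [⟨BasicConcept × BasicConcept, fun s : BasicConcept × BasicConcept => TAssertion.subConcept s.1 s.2⟩,
    ⟨Role × Role, fun s : Role × Role => TAssertion.subRole s.1 s.2⟩,
    ⟨BasicConcept × BasicConcept, fun s : BasicConcept × BasicConcept => TAssertion.disjConcept s.1 s.2⟩,
    ⟨Role × Role, fun s : Role × Role => TAssertion.disjRole s.1 s.2⟩,
    ⟨Role, fun s : Role => TAssertion.funct s⟩]

theorem tAssertion_covers (t : TAssertion) : Covers t tAssertionCtors := by
  cases t <;> simp [Covers, tAssertionCtors]

instance : Coded TAssertion := .ofCtors TAssertion.code TAssertion.code_injective tAssertionCtors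
  ⟨fun _ => rfl, fun _ => rfl, fun _ => rfl, fun _ => rfl, fun _ => rfl, trivial⟩ tAssertion_covers

theorem RFun.tAssertion_cases {α β : Type} [Coded α] [Coded β] {h : α → TAssertion → β}
    (h0 : RFun fun x : α × (BasicConcept × BasicConcept) => h x.1 (TAssertion.subConcept x.2.1 x.2.2))
    (h1 : RFun fun x : α × (Role × Role) => h x.1 (TAssertion.subRole x.2.1 x.2.2))
    (h2 : RFun fun x : α × (BasicConcept × BasicConcept) => h x.1 (TAssertion.disjConcept x.2.1 x.2.2))
    (h3 : RFun fun x : α × (Role × Role) => h x.1 (TAssertion.disjRole x.2.1 x.2.2))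
    (h4 : RFun fun x : α × Role => h x.1 (TAssertion.funct x.2)) :
    RFun fun x : α × TAssertion => h x.1 x.2 :=
  RFun.cases tAssertionCtors ⟨fun _ => rfl, fun _ => rfl, fun _ => rfl, fun _ => rfl, fun _ => rfl, trivial⟩ tAssertion_covers
    ⟨h0, h1, h2, h3, h4, trivial⟩

/-- The constructors of the type. -/
def constCtors : List (Ctor Const) :=
  [⟨ℕ, fun s : ℕ => Const.val s⟩,
    ⟨Unit, fun _ : Unit => Const.temp⟩,
    ⟨TAssertion, fun s : TAssertion => Const.label s⟩]

theorem const_covers (t : Const) : Covers t constCtors := by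
  cases t <;> simp [Covers, constCtors]

instance : Coded Const := .ofCtors Const.code Const.code_injective constCtors
  ⟨fun _ => rfl, fun _ => rfl, fun _ => rfl, trivial⟩ const_covers

instance RFun.label {α : Type} [Coded α] {f0 : α → TAssertion} [RFun f0] :
    RFun fun a => Const.label (f0 a) :=
  RFun.constructor (c := fun s : TAssertion => Const.label s) 2 (fun _ => rfl)
    (f := fun a => (f0 a)) inferInstance

/-- The constructors of the type. -/
def cNameCtors : List (Ctor CName) :=
  [⟨ℕ, fun s : ℕ => CName.name s⟩,
    ⟨Unit, fun _ : Unit => CName.state⟩,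
    ⟨Unit, fun _ : Unit => CName.viol⟩]

theorem cName_covers (t : CName) : Covers t cNameCtors := by
  cases t <;> simp [Covers, cNameCtors]

instance : Coded CName := .ofCtors CName.code CName.code_injective cNameCtors
  ⟨fun _ => rfl, fun _ => rfl, fun _ => rfl, trivial⟩ cName_covers

theorem RFun.cName_cases {α β : Type} [Coded α] [Coded β] {h : α → CName → β}
    (h0 : RFun fun x : α × ℕ => h x.1 (CName.name x.2))
    (h1 : RFun fun x : α × Unit => h x.1 (CName.state ))
    (h2 : RFun fun x : α × Unit => h x.1 (CName.viol )) :
    RFun fun x : α × CName => h x.1 x.2 :=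
  RFun.cases cNameCtors ⟨fun _ => rfl, fun _ => rfl, fun _ => rfl, trivial⟩ cName_covers
    ⟨h0, h1, h2, trivial⟩

instance RFun.cName {α : Type} [Coded α] {f0 : α → ℕ} [RFun f0] :
    RFun fun a => CName.name (f0 a) :=
  RFun.constructor (c := fun s : ℕ => CName.name s) 0 (fun _ => rfl)
    (f := fun a => (f0 a)) inferInstance

/-- The constructors of the type. -/
def atomCtors {τ : Type} [Coded τ] : List (Ctor (Atom τ)) :=
  [⟨CName × τ, fun s : CName × τ => Atom.concept s.1 s.2⟩,
    ⟨ℕ × τ × τ, fun s : ℕ × τ × τ => Atom.role s.1 s.2.1 s.2.2⟩]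

theorem atom_covers {τ : Type} [Coded τ] (t : (Atom τ)) : Covers t atomCtors := by
  cases t <;> simp [Covers, atomCtors]

instance {τ : Type} [Coded τ] : Coded (Atom τ) := .ofCtors (Atom.code code) (Atom.code_injective Coded.inj) atomCtors
  ⟨fun _ => rfl, fun _ => rfl, trivial⟩ atom_covers

theorem RFun.atom_cases {α β : Type} {τ : Type} [Coded τ] [Coded α] [Coded β] {h : α → (Atom τ) → β}
    (h0 : RFun fun x : α × (CName × τ) => h x.1 (Atom.concept x.2.1 x.2.2))
    (h1 : RFun fun x : α × (ℕ × τ × τ) => h x.1 (Atom.role x.2.1 x.2.2.1 x.2.2.2)) :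
    RFun fun x : α × (Atom τ) => h x.1 x.2 :=
  RFun.cases atomCtors ⟨fun _ => rfl, fun _ => rfl, trivial⟩ atom_covers
    ⟨h0, h1, trivial⟩

instance RFun.atomConcept {α : Type} {τ : Type} [Coded τ] [Coded α] {f0 : α → CName} [RFun f0] {f1 : α → τ} [RFun f1] :
    RFun fun a => Atom.concept (f0 a) (f1 a) :=
  RFun.constructor (c := fun s : CName × τ => Atom.concept s.1 s.2) 0 (fun _ => rfl)
    (f := fun a => (f0 a, f1 a)) inferInstance

instance RFun.atomRole {α : Type} {τ : Type} [Coded τ] [Coded α] {f0 : α → ℕ} [RFun f0] {f1 : α → τ} [RFun f1] {f2 : α → τ} [RFun f2] :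
    RFun fun a => Atom.role (f0 a) (f1 a) (f2 a) :=
  RFun.constructor (c := fun s : ℕ × τ × τ => Atom.role s.1 s.2.1 s.2.2) 1 (fun _ => rfl)
    (f := fun a => (f0 a, f1 a, f2 a)) inferInstance

/-- The constructors of the type. -/
def qTermCtors : List (Ctor QTerm) :=
  [⟨ℕ, fun s : ℕ => QTerm.var s⟩,
    ⟨Const, fun s : Const => QTerm.const s⟩]

theorem qTerm_covers (t : QTerm) : Covers t qTermCtors := by
  cases t <;> simp [Covers, qTermCtors]

instance : Coded QTerm := .ofCtors QTerm.code QTerm.code_injective qTermCtors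
  ⟨fun _ => rfl, fun _ => rfl, trivial⟩ qTerm_covers

theorem RFun.qTerm_cases {α β : Type} [Coded α] [Coded β] {h : α → QTerm → β}
    (h0 : RFun fun x : α × ℕ => h x.1 (QTerm.var x.2))
    (h1 : RFun fun x : α × Const => h x.1 (QTerm.const x.2)) :
    RFun fun x : α × QTerm => h x.1 x.2 :=
  RFun.cases qTermCtors ⟨fun _ => rfl, fun _ => rfl, trivial⟩ qTerm_covers
    ⟨h0, h1, trivial⟩

/-- Reconciles the two codings of lists of numbers, the direct one used in the prescribed codes and
the generic one that first applies `code` to the entries. -/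
theorem code_list_nat (l : List ℕ) : code l = Encodable.encode l :=
  congrArg Encodable.encode (List.map_id l)

/-- The constructors of the type. -/
def eTermCtors : List (Ctor ETerm) :=
  [⟨Const, fun s : Const => ETerm.const s⟩,
    ⟨ℕ, fun s : ℕ => ETerm.var s⟩,
    ⟨ℕ × List ℕ, fun s : ℕ × List ℕ => ETerm.call s.1 s.2⟩]

theorem eTerm_covers (t : ETerm) : Covers t eTermCtors := by
  cases t <;> simp [Covers, eTermCtors]

instance : Coded ETerm := .ofCtors ETerm.code ETerm.code_injective eTermCtors
  ⟨fun _ => rfl, fun _ => rfl, fun s => congrArg (fun n => Nat.pair 2 (Nat.pair s.1 n))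
    (code_list_nat s.2).symm, trivial⟩ eTerm_covers

theorem RFun.eTerm_cases {α β : Type} [Coded α] [Coded β] {h : α → ETerm → β}
    (h0 : RFun fun x : α × Const => h x.1 (ETerm.const x.2))
    (h1 : RFun fun x : α × ℕ => h x.1 (ETerm.var x.2))
    (h2 : RFun fun x : α × (ℕ × List ℕ) => h x.1 (ETerm.call x.2.1 x.2.2)) :
    RFun fun x : α × ETerm => h x.1 x.2 :=
  RFun.cases eTermCtors ⟨fun _ => rfl, fun _ => rfl, fun s => congrArg (fun n => Nat.pair 2 (Nat.pair s.1 n))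
    (code_list_nat s.2).symm, trivial⟩ eTerm_covers
    ⟨h0, h1, h2, trivial⟩

/-- The code of a sum. -/
def sumCode {σ τ : Type} [Coded σ] [Coded τ] : σ ⊕ τ → ℕ
  | .inl a => Nat.pair 0 (code a)
  | .inr b => Nat.pair 1 (code b)

theorem sumCode_injective {σ τ : Type} [Coded σ] [Coded τ] :
    Function.Injective (sumCode : σ ⊕ τ → ℕ) := by
  intro a b h
  cases a <;> cases b <;> simp_all [sumCode, Nat.pair_eq_pair, Coded.inj.eq_iff]

/-- The constructors of the type. -/
def sumCtors {σ τ : Type} [Coded σ] [Coded τ] : List (Ctor (σ ⊕ τ)) :=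
  [⟨σ, fun s : σ => Sum.inl s⟩,
    ⟨τ, fun s : τ => Sum.inr s⟩]

theorem sum_covers {σ τ : Type} [Coded σ] [Coded τ] (t : (σ ⊕ τ)) : Covers t sumCtors := by
  cases t <;> simp [Covers, sumCtors]

instance {σ τ : Type} [Coded σ] [Coded τ] : Coded (σ ⊕ τ) := .ofCtors sumCode sumCode_injective sumCtors
  ⟨fun _ => rfl, fun _ => rfl, trivial⟩ sum_covers

theorem RFun.sum_cases {α β : Type} {σ τ : Type} [Coded σ] [Coded τ] [Coded α] [Coded β] {h : α → (σ ⊕ τ) → β}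
    (h0 : RFun fun x : α × σ => h x.1 (Sum.inl x.2))
    (h1 : RFun fun x : α × τ => h x.1 (Sum.inr x.2)) :
    RFun fun x : α × (σ ⊕ τ) => h x.1 x.2 :=
  RFun.cases sumCtors ⟨fun _ => rfl, fun _ => rfl, trivial⟩ sum_covers
    ⟨h0, h1, trivial⟩

instance RFun.inl {α σ τ : Type} [Coded α] [Coded σ] [Coded τ] {f : α → σ} [hf : RFun f] :
    RFun fun a => (Sum.inl (f a) : σ ⊕ τ) :=
  RFun.constructor (c := fun s : σ => (Sum.inl s : σ ⊕ τ)) 0 (fun _ => rfl) hf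

instance RFun.inr {α σ τ : Type} [Coded α] [Coded σ] [Coded τ] {f : α → τ} [hf : RFun f] :
    RFun fun a => (Sum.inr (f a) : σ ⊕ τ) :=
  RFun.constructor (c := fun s : τ => (Sum.inr s : σ ⊕ τ)) 1 (fun _ => rfl) hf

/-- The coding of a structure through that of an equivalent type. -/
@[reducible] def Coded.ofEquiv {τ σ : Type} [Coded σ] (c : τ → ℕ) (e : τ ≃ σ)
    (h : ∀ t, c t = code (e t)) : Coded τ where
  code := c
  inj a b hab := by
    rw [h, h] at hab
    exact e.injective (Coded.inj hab)
  re := (Coded.re (α := σ)).of_eq fun n => by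
    constructor
    · rintro ⟨s, rfl⟩
      exact ⟨e.symm s, by simp [h]⟩
    · rintro ⟨t, rfl⟩
      exact ⟨e t, (h t).symm⟩

instance : Coded CQ := .ofEquiv (σ := List ℕ × List (Atom QTerm)) CQ.code
  ⟨fun q => (q.exVars, q.atoms), fun x => ⟨x.1, x.2⟩, fun _ => rfl, fun _ => rfl⟩
  fun q => congrArg (fun n => Nat.pair n (codeList (Atom.code QTerm.code) q.atoms))
    (code_list_nat q.exVars).symm

section CQ

variable {α : Type} [Coded α]

theorem RFun.toTuple {τ σ : Type} [Coded τ] [Coded σ] {e : τ → σ}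
    (h : ∀ t, code t = code (e t)) {f : α → τ} (hf : RFun f) : RFun fun a => e (f a) :=
  .comp (f := e) (.of_computable (fun n => n) Computable.id fun t => (h t).symm) hf

theorem CQ.code_eq (q : CQ) : Coded.code q = Coded.code (q.exVars, q.atoms) :=
  congrArg (fun n => Nat.pair n (codeList (Atom.code QTerm.code) q.atoms))
    (code_list_nat q.exVars).symm

instance RFun.cqExVars {f : α → CQ} [hf : RFun f] : RFun fun a => (f a).exVars :=
  have : RFun fun a => ((f a).exVars, (f a).atoms) := RFun.toTuple CQ.code_eq hf
  RFun.fst (f := fun a => ((f a).exVars, (f a).atoms))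

instance RFun.cqAtoms {f : α → CQ} [hf : RFun f] : RFun fun a => (f a).atoms :=
  have : RFun fun a => ((f a).exVars, (f a).atoms) := RFun.toTuple CQ.code_eq hf
  RFun.snd (f := fun a => ((f a).exVars, (f a).atoms))

instance RFun.cqMk {f : α → List ℕ} {g : α → List (Atom QTerm)} [RFun f] [RFun g] :
    RFun fun a => CQ.mk (f a) (g a) :=
  .comp (f := fun x : List ℕ × List (Atom QTerm) => CQ.mk x.1 x.2) (g := fun a => (f a, g a))
    (.of_computable (fun n => n) Computable.id fun _ => CQ.code_eq _) inferInstance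

end CQ

instance RFun.pairMk {α β : Type} [Coded α] [Coded β] {c : α} :
    RFun (Prod.mk c : β → α × β) :=
  RFun.pair (f := fun _ => c) (g := fun b => b)

/-- The rules generating the codes of queries. -/
def ecqRule (n : ℕ) (l : List ℕ) : Prop :=
  (∃ q : UCQ, n = Nat.pair 0 (code q) ∧ l = []) ∨ (∃ m, n = Nat.pair 1 m ∧ l = [m]) ∨
    (∃ m k, n = Nat.pair 2 (Nat.pair m k) ∧ l = [m, k]) ∨
    ∃ x m, n = Nat.pair 3 (Nat.pair x m) ∧ l = [m]

/-- For recursive syntax the set of codes is the least one closed under the constructors, hence an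
instance of `Der`. This yields the enumerability of the range. -/
theorem der_ecqRule_iff {n : ℕ} : Der ecqRule n ↔ ∃ Q : ECQ, Q.code = n := by
  constructor
  · intro h
    induction h with
    | intro n l hR _ ih =>
      rcases hR with ⟨q, rfl, rfl⟩ | ⟨m, rfl, rfl⟩ | ⟨m, k, rfl, rfl⟩ | ⟨x, m, rfl, rfl⟩
      · exact ⟨.ucq q, rfl⟩
      · obtain ⟨Q, rfl⟩ := ih m (by simp)
        exact ⟨.neg Q, rfl⟩
      · obtain ⟨Q, rfl⟩ := ih m (by simp)
        obtain ⟨Q', rfl⟩ := ih k (by simp)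
        exact ⟨.and Q Q', rfl⟩
      · obtain ⟨Q, rfl⟩ := ih m (by simp)
        exact ⟨.ex x Q, rfl⟩
  · rintro ⟨Q, rfl⟩
    induction Q with
    | ucq q => exact .intro _ [] (.inl ⟨q, rfl, rfl⟩) (by simp)
    | neg Q ih => exact .intro _ [Q.code] (.inr (.inl ⟨_, rfl, rfl⟩)) (by simpa using ih)
    | and Q Q' ih ih' =>
      exact .intro _ [Q.code, Q'.code] (.inr (.inr (.inl ⟨_, _, rfl, rfl⟩)))
        (by simpa using ⟨ih, ih'⟩)
    | ex x Q ih => exact .intro _ [Q.code] (.inr (.inr (.inr ⟨_, _, rfl, rfl⟩))) (by simpa using ih)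

instance : Coded ECQ where
  code := ECQ.code
  inj := ECQ.code_injective
  re := (rePred_of_re (RE.der (R := ecqRule) (by unfold ecqRule; infer_instance))).of_eq
    fun _ => der_ecqRule_iff

instance RFun.ecqUcq {α : Type} [Coded α] {f0 : α → UCQ} [RFun f0] :
    RFun fun a => ECQ.ucq (f0 a) :=
  RFun.constructor (c := fun s : UCQ => ECQ.ucq s) 0 (fun _ => rfl)
    (f := fun a => (f0 a)) inferInstance

instance RFun.ecqNeg {α : Type} [Coded α] {f0 : α → ECQ} [RFun f0] :
    RFun fun a => ECQ.neg (f0 a) :=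
  RFun.constructor (c := fun s : ECQ => ECQ.neg s) 1 (fun _ => rfl)
    (f := fun a => (f0 a)) inferInstance

instance RFun.ecqAnd {α : Type} [Coded α] {f0 : α → ECQ} [RFun f0] {f1 : α → ECQ} [RFun f1] :
    RFun fun a => ECQ.and (f0 a) (f1 a) :=
  RFun.constructor (c := fun s : ECQ × ECQ => ECQ.and s.1 s.2) 2 (fun _ => rfl)
    (f := fun a => (f0 a, f1 a)) inferInstance

instance RFun.ecqEx {α : Type} [Coded α] {f0 : α → ℕ} [RFun f0] {f1 : α → ECQ} [RFun f1] :
    RFun fun a => ECQ.ex (f0 a) (f1 a) :=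
  RFun.constructor (c := fun s : ℕ × ECQ => ECQ.ex s.1 s.2) 3 (fun _ => rfl)
    (f := fun a => (f0 a, f1 a)) inferInstance

theorem Effect.code_eq (q : Effect) : Effect.code q = Coded.code (q.qpos, q.qneg, q.facts) :=
  rfl

instance : Coded Effect := .ofEquiv (σ := UCQ × ECQ × List (Atom ETerm)) Effect.code
  ⟨fun q => (q.qpos, q.qneg, q.facts), fun x => ⟨x.1, x.2.1, x.2.2⟩, fun _ => rfl, fun _ => rfl⟩ Effect.code_eq

instance RFun.effectQpos {α : Type} [Coded α] {f : α → Effect} [hf : RFun f] :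
    RFun fun a => (f a).qpos :=
  .comp (f := fun x : UCQ × ECQ × List (Atom ETerm) => x.1)
    (g := fun a => ((f a).qpos, (f a).qneg, (f a).facts)) inferInstance (RFun.toTuple (e := fun q : Effect => (q.qpos, q.qneg, q.facts)) Effect.code_eq hf)

instance RFun.effectQneg {α : Type} [Coded α] {f : α → Effect} [hf : RFun f] :
    RFun fun a => (f a).qneg :=
  .comp (f := fun x : UCQ × ECQ × List (Atom ETerm) => x.2.1)
    (g := fun a => ((f a).qpos, (f a).qneg, (f a).facts)) inferInstance (RFun.toTuple (e := fun q : Effect => (q.qpos, q.qneg, q.facts)) Effect.code_eq hf)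

instance RFun.effectFacts {α : Type} [Coded α] {f : α → Effect} [hf : RFun f] :
    RFun fun a => (f a).facts :=
  .comp (f := fun x : UCQ × ECQ × List (Atom ETerm) => x.2.2)
    (g := fun a => ((f a).qpos, (f a).qneg, (f a).facts)) inferInstance (RFun.toTuple (e := fun q : Effect => (q.qpos, q.qneg, q.facts)) Effect.code_eq hf)

theorem Action.code_eq (q : Action) : Action.code q = Coded.code (q.name, q.params, q.effects) :=
  congrArg (fun n => Nat.pair q.name (Nat.pair n (codeList Effect.code q.effects)))
    (code_list_nat q.params).symm

instance : Coded Action := .ofEquiv (σ := ℕ × List ℕ × List Effect) Action.code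
  ⟨fun q => (q.name, q.params, q.effects), fun x => ⟨x.1, x.2.1, x.2.2⟩, fun _ => rfl, fun _ => rfl⟩ Action.code_eq

instance RFun.actionParams {α : Type} [Coded α] {f : α → Action} [hf : RFun f] :
    RFun fun a => (f a).params :=
  .comp (f := fun x : ℕ × List ℕ × List Effect => x.2.1)
    (g := fun a => ((f a).name, (f a).params, (f a).effects)) inferInstance (RFun.toTuple (e := fun q : Action => (q.name, q.params, q.effects)) Action.code_eq hf)

instance RFun.actionEffects {α : Type} [Coded α] {f : α → Action} [hf : RFun f] :
    RFun fun a => (f a).effects :=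
  .comp (f := fun x : ℕ × List ℕ × List Effect => x.2.2)
    (g := fun a => ((f a).name, (f a).params, (f a).effects)) inferInstance (RFun.toTuple (e := fun q : Action => (q.name, q.params, q.effects)) Action.code_eq hf)

theorem Rule.code_eq (q : Rule) : Rule.code q = Coded.code (q.cond, q.act) :=
  rfl

instance : Coded Rule := .ofEquiv (σ := ECQ × Action) Rule.code
  ⟨fun q => (q.cond, q.act), fun x => ⟨x.1, x.2⟩, fun _ => rfl, fun _ => rfl⟩ Rule.code_eq

instance RFun.ruleCond {α : Type} [Coded α] {f : α → Rule} [hf : RFun f] :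
    RFun fun a => (f a).cond :=
  .comp (f := fun x : ECQ × Action => x.1)
    (g := fun a => ((f a).cond, (f a).act)) inferInstance (RFun.toTuple (e := fun q : Rule => (q.cond, q.act)) Rule.code_eq hf)

instance RFun.ruleAct {α : Type} [Coded α] {f : α → Rule} [hf : RFun f] :
    RFun fun a => (f a).act :=
  .comp (f := fun x : ECQ × Action => x.2)
    (g := fun a => ((f a).cond, (f a).act)) inferInstance (RFun.toTuple (e := fun q : Rule => (q.cond, q.act)) Rule.code_eq hf)

theorem KAB.code_eq (q : KAB) : KAB.code q = Coded.code (q.tbox, q.init, q.actions, q.rules) :=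
  rfl

instance : Coded KAB := .ofEquiv (σ := TBox × List Fact × List Action × List Rule) KAB.code
  ⟨fun q => (q.tbox, q.init, q.actions, q.rules), fun x => ⟨x.1, x.2.1, x.2.2.1, x.2.2.2⟩, fun _ => rfl, fun _ => rfl⟩ KAB.code_eq

instance RFun.kABTbox {α : Type} [Coded α] {f : α → KAB} [hf : RFun f] :
    RFun fun a => (f a).tbox :=
  .comp (f := fun x : TBox × List Fact × List Action × List Rule => x.1)
    (g := fun a => ((f a).tbox, (f a).init, (f a).actions, (f a).rules)) inferInstance (RFun.toTuple (e := fun q : KAB => (q.tbox, q.init, q.actions, q.rules)) KAB.code_eq hf)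

instance RFun.kABInit {α : Type} [Coded α] {f : α → KAB} [hf : RFun f] :
    RFun fun a => (f a).init :=
  .comp (f := fun x : TBox × List Fact × List Action × List Rule => x.2.1)
    (g := fun a => ((f a).tbox, (f a).init, (f a).actions, (f a).rules)) inferInstance (RFun.toTuple (e := fun q : KAB => (q.tbox, q.init, q.actions, q.rules)) KAB.code_eq hf)

instance RFun.kABActions {α : Type} [Coded α] {f : α → KAB} [hf : RFun f] :
    RFun fun a => (f a).actions :=
  .comp (f := fun x : TBox × List Fact × List Action × List Rule => x.2.2.1)
    (g := fun a => ((f a).tbox, (f a).init, (f a).actions, (f a).rules)) inferInstance (RFun.toTuple (e := fun q : KAB => (q.tbox, q.init, q.actions, q.rules)) KAB.code_eq hf)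

instance RFun.kABRules {α : Type} [Coded α] {f : α → KAB} [hf : RFun f] :
    RFun fun a => (f a).rules :=
  .comp (f := fun x : TBox × List Fact × List Action × List Rule => x.2.2.2)
    (g := fun a => ((f a).tbox, (f a).init, (f a).actions, (f a).rules)) inferInstance (RFun.toTuple (e := fun q : KAB => (q.tbox, q.init, q.actions, q.rules)) KAB.code_eq hf)

/-- The rules generating the codes of formulae. -/
def muRule (n : ℕ) (l : List ℕ) : Prop :=
  (∃ Q : ECQ, n = Nat.pair 0 (code Q) ∧ l = []) ∨ (∃ m, n = Nat.pair 1 m ∧ l = [m]) ∨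
    (∃ m k, n = Nat.pair 2 (Nat.pair m k) ∧ l = [m, k]) ∨
    (∃ x m, n = Nat.pair 3 (Nat.pair x m) ∧ l = [m]) ∨ (∃ m, n = Nat.pair 4 m ∧ l = [m]) ∨
    (∃ m, n = Nat.pair 5 m ∧ l = [m]) ∨ (∃ Z, n = Nat.pair 6 Z ∧ l = []) ∨
    ∃ Z m, n = Nat.pair 7 (Nat.pair Z m) ∧ l = [m]

theorem der_muRule_iff {n : ℕ} : Der muRule n ↔ ∃ Φ : MuIT, Φ.code = n := by
  constructor
  · intro h
    induction h with
    | intro n l hR _ ih =>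
      rcases hR with ⟨q, rfl, rfl⟩ | ⟨m, rfl, rfl⟩ | ⟨m, k, rfl, rfl⟩ | ⟨x, m, rfl, rfl⟩ |
        ⟨m, rfl, rfl⟩ | ⟨m, rfl, rfl⟩ | ⟨Z, rfl, rfl⟩ | ⟨Z, m, rfl, rfl⟩
      · exact ⟨.query q, rfl⟩
      · obtain ⟨Q, rfl⟩ := ih m (by simp)
        exact ⟨.neg Q, rfl⟩
      · obtain ⟨Q, rfl⟩ := ih m (by simp)
        obtain ⟨Q', rfl⟩ := ih k (by simp)
        exact ⟨.and Q Q', rfl⟩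
      · obtain ⟨Q, rfl⟩ := ih m (by simp)
        exact ⟨.ex x Q, rfl⟩
      · obtain ⟨Q, rfl⟩ := ih m (by simp)
        exact ⟨.diaBox Q, rfl⟩
      · obtain ⟨Q, rfl⟩ := ih m (by simp)
        exact ⟨.boxBox Q, rfl⟩
      · exact ⟨.pvar Z, rfl⟩
      · obtain ⟨Q, rfl⟩ := ih m (by simp)
        exact ⟨.mu Z Q, rfl⟩
  · rintro ⟨Φ, rfl⟩
    induction Φ with
    | query Q => exact .intro _ [] (.inl ⟨Q, rfl, rfl⟩) (by simp)
    | neg Q ih => exact .intro _ [Q.code] (.inr (.inl ⟨_, rfl, rfl⟩)) (by simpa using ih)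
    | and Q Q' ih ih' =>
      exact .intro _ [Q.code, Q'.code] (.inr (.inr (.inl ⟨_, _, rfl, rfl⟩)))
        (by simpa using ⟨ih, ih'⟩)
    | ex x Q ih =>
      exact .intro _ [Q.code] (.inr (.inr (.inr (.inl ⟨_, _, rfl, rfl⟩)))) (by simpa using ih)
    | diaBox Q ih =>
      exact .intro _ [Q.code] (.inr (.inr (.inr (.inr (.inl ⟨_, rfl, rfl⟩))))) (by simpa using ih)
    | boxBox Q ih =>
      exact .intro _ [Q.code] (.inr (.inr (.inr (.inr (.inr (.inl ⟨_, rfl, rfl⟩))))))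
        (by simpa using ih)
    | pvar Z =>
      exact .intro _ [] (by unfold muRule; iterate 6 right
                            exact .inl ⟨Z, rfl, rfl⟩) (by simp)
    | mu Z Q ih =>
      exact .intro _ [Q.code] (by unfold muRule; iterate 7 right
                                  exact ⟨Z, Q.code, rfl, rfl⟩) (by simpa using ih)

instance : Coded MuIT where
  code := MuIT.code
  inj := MuIT.code_injective
  re := (rePred_of_re (RE.der (R := muRule) (by unfold muRule; infer_instance))).of_eq
    fun _ => der_muRule_iff

instance RFun.muQuery {α : Type} [Coded α] {f0 : α → ECQ} [RFun f0] :
    RFun fun a => MuIT.query (f0 a) :=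
  RFun.constructor (c := fun s : ECQ => MuIT.query s) 0 (fun _ => rfl)
    (f := fun a => (f0 a)) inferInstance

instance RFun.muNeg {α : Type} [Coded α] {f0 : α → MuIT} [RFun f0] :
    RFun fun a => MuIT.neg (f0 a) :=
  RFun.constructor (c := fun s : MuIT => MuIT.neg s) 1 (fun _ => rfl)
    (f := fun a => (f0 a)) inferInstance

instance RFun.muAnd {α : Type} [Coded α] {f0 : α → MuIT} [RFun f0] {f1 : α → MuIT} [RFun f1] :
    RFun fun a => MuIT.and (f0 a) (f1 a) :=
  RFun.constructor (c := fun s : MuIT × MuIT => MuIT.and s.1 s.2) 2 (fun _ => rfl)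
    (f := fun a => (f0 a, f1 a)) inferInstance

instance RFun.muEx {α : Type} [Coded α] {f0 : α → ℕ} [RFun f0] {f1 : α → MuIT} [RFun f1] :
    RFun fun a => MuIT.ex (f0 a) (f1 a) :=
  RFun.constructor (c := fun s : ℕ × MuIT => MuIT.ex s.1 s.2) 3 (fun _ => rfl)
    (f := fun a => (f0 a, f1 a)) inferInstance

instance RFun.muDiaBox {α : Type} [Coded α] {f0 : α → MuIT} [RFun f0] :
    RFun fun a => MuIT.diaBox (f0 a) :=
  RFun.constructor (c := fun s : MuIT => MuIT.diaBox s) 4 (fun _ => rfl)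
    (f := fun a => (f0 a)) inferInstance

instance RFun.muBoxBox {α : Type} [Coded α] {f0 : α → MuIT} [RFun f0] :
    RFun fun a => MuIT.boxBox (f0 a) :=
  RFun.constructor (c := fun s : MuIT => MuIT.boxBox s) 5 (fun _ => rfl)
    (f := fun a => (f0 a)) inferInstance

instance RFun.muPvar {α : Type} [Coded α] {f0 : α → ℕ} [RFun f0] :
    RFun fun a => MuIT.pvar (f0 a) :=
  RFun.constructor (c := fun s : ℕ => MuIT.pvar s) 6 (fun _ => rfl)
    (f := fun a => (f0 a)) inferInstance

instance RFun.muMu {α : Type} [Coded α] {f0 : α → ℕ} [RFun f0] {f1 : α → MuIT} [RFun f1] :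
    RFun fun a => MuIT.mu (f0 a) (f1 a) :=
  RFun.constructor (c := fun s : ℕ × MuIT => MuIT.mu s.1 s.2) 7 (fun _ => rfl)
    (f := fun a => (f0 a, f1 a)) inferInstance

/-! ### Subtypes -/

section Subtype

variable {α β : Type} [Coded α] [Coded β]

/-- A subtype keeps the codes of the ambient type, so a program for it has to be right only there.
This matters below: the tests for consistency are correct only for TBoxes with the DL-Lite_A
restriction. -/
instance {p : α → Prop} [hp : RE p] : Coded {a // p a} where
  code a := code a.1
  inj _ _ h := Subtype.ext (Coded.inj h)
  re := (rePred_of_re (RE.congr (p := fun n => ∃ a : {a // p a}, code a.1 = n)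
    (q := fun n => ∃ a, p a ∧ code a = n) (fun n => by simp) (hq := by
      have : RE fun x : ℕ × α => p x.2 :=
        .comp (p := p) (f := fun x : ℕ × α => x.2) hp inferInstance
      infer_instance)))

instance RFun.subtypeVal {p : α → Prop} [RE p] {f : β → {a // p a}} [hf : RFun f] :
    RFun fun b => (f b).1 :=
  .comp (f := fun a : {a // p a} => a.1)
    (.of_computable (fun n => n) Computable.id fun _ => rfl) hf

theorem RFun.subtypeMk {p : α → Prop} [RE p] {f : β → α} (hf : RFun f) (h : ∀ b, p (f b)) :
    RFun fun b => (⟨f b, h b⟩ : {a // p a}) := by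
  obtain ⟨g, hg, hf⟩ := hf.out
  exact ⟨g, hg, hf⟩

end Subtype

/-- The condition imposed on an assertion by the functionality of `R`. -/
def FunctOk (R : Role) : TAssertion → Prop
  | .subRole _ R₂ => R₂ ≠ R ∧ R₂ ≠ R.inverse
  | _ => True

/-- The condition imposed on a TBox by an assertion. -/
def DLLiteOk (T : TBox) : TAssertion → Prop
  | .funct R => ∀ u, u ∈ T → FunctOk R u
  | _ => True

theorem isDLLiteA_iff (T : TBox) : T.IsDLLiteA ↔ ∀ t, t ∈ T → DLLiteOk T t := by
  constructor
  · intro h t ht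
    cases t <;> simp only [DLLiteOk]
    intro u hu
    cases u <;> simp only [FunctOk]
    exact h _ _ _ ht hu
  · intro h R R₁ R₂ h1 h2
    exact h _ h1 _ h2

instance RFun.inverse {α : Type} [Coded α] {f : α → Role} [hf : RFun f] :
    RFun fun a => (f a).inverse :=
  .comp (f := Role.inverse) (.comp (f := fun x : Unit × Role => x.2.inverse)
    (g := fun r => ((), r)) (RFun.role_cases (h := fun _ r => Role.inverse r)
      (inferInstanceAs (RFun fun x : Unit × ℕ => Role.inv x.2))
      (inferInstanceAs (RFun fun x : Unit × ℕ => Role.name x.2))) inferInstance) hf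

instance RFun.functOk : RFun fun x : Role × TAssertion => FunctOk x.1 x.2 := by
  apply RFun.tAssertion_cases <;> unfold FunctOk <;> infer_instance

instance RFun.dlLiteOk : RFun fun x : TBox × TAssertion => DLLiteOk x.1 x.2 := by
  have : RFun fun x : (TBox × Role) × TAssertion => FunctOk x.1.2 x.2 :=
    .comp (f := fun x : Role × TAssertion => FunctOk x.1 x.2)
      (g := fun x : (TBox × Role) × TAssertion => (x.1.2, x.2)) inferInstance inferInstance
  apply RFun.tAssertion_cases <;> unfold DLLiteOk <;> infer_instance

instance RFun.isDLLiteA : RFun TBox.IsDLLiteA :=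
  RFun.congr_prop (q := fun T => ∀ t, t ∈ T → DLLiteOk T t) isDLLiteA_iff

/-! ## The canonical model of a DL-Lite ontology -/

@[simp] theorem Role.inverse_inverse (R : Role) : R.inverse.inverse = R := by cases R <;> rfl

theorem roleAtom_inverse {τ : Type} (R : Role) (x y : τ) :
    roleAtom R.inverse x y = roleAtom R y x := by cases R <;> rfl

theorem Interp.roleExt_inverse (I : Interp) (R : Role) (x y : I.Dom) :
    I.roleExt R.inverse x y ↔ I.roleExt R y x := by cases R <;> rfl

theorem Interp.satAtom_roleAtom (I : Interp) (R : Role) (x y : I.Dom) :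
    I.satAtom (roleAtom R x y) ↔ I.roleExt R x y := by cases R <;> rfl

theorem roleAtom_map {τ τ' : Type} (g : τ → τ') (R : Role) (x y : τ) :
    (roleAtom R x y).map g = roleAtom R (g x) (g y) := by cases R <;> rfl

/-- A direct inclusion between roles. -/
def RoleEdge (T : TBox) (R S : Role) : Prop :=
  .subRole R S ∈ T ∨ .subRole R.inverse S.inverse ∈ T

/-- A direct inclusion between basic concepts. -/
def ConceptEdge (T : TBox) (B C : BasicConcept) : Prop :=
  .subConcept B C ∈ T ∨ ∃ R S, B = .exist R ∧ C = .exist S ∧ RoleEdge T R S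

/-- Derived inclusions between roles. -/
def RSub (T : TBox) : Role → Role → Prop := ReflTransGen (RoleEdge T)

/-- Derived inclusions between basic concepts. -/
def BSub (T : TBox) : BasicConcept → BasicConcept → Prop := ReflTransGen (ConceptEdge T)

theorem RSub.inverse {T : TBox} {R S : Role} (h : RSub T R S) : RSub T R.inverse S.inverse := by
  induction h with
  | refl => exact .refl
  | tail _ h ih =>
    refine ih.tail ?_
    rcases h with h | h
    · exact .inr (by simpa using h)
    · exact .inl h

theorem RSub.exist {T : TBox} {R S : Role} (h : RSub T R S) : BSub T (.exist R) (.exist S) := by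
  induction h with
  | refl => exact .refl
  | tail _ h ih => exact ih.tail (.inr ⟨_, _, rfl, rfl, h⟩)

/-- The role fact `R(c, d)` follows from the ABox. -/
def BaseR (T : TBox) (A : ABox) (R : Role) (c d : Const) : Prop :=
  ∃ S, RSub T S R ∧ roleAtom S c d ∈ A

/-- The concept fact `B(c)` follows from the ABox. -/
def BaseC (T : TBox) (A : ABox) (B : BasicConcept) (c : Const) : Prop :=
  ∃ C, BSub T C B ∧ ∃ d, conceptAtom C c d ∈ A

/-- The word `w` of roles, last letter first, leads from `c` to an element of `B`. -/
def El (T : TBox) (A : ABox) (c : Const) : List Role → BasicConcept → Prop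
  | [], B => BaseC T A B c
  | S :: _, B => BSub T (.exist S.inverse) B

/-- The word `w` can be prolonged by `R`. -/
def Gen (T : TBox) (A : ABox) (c : Const) : List Role → Role → Prop
  | [], R => BaseC T A (.exist R) c ∧ ¬ ∃ d, roleAtom R c d ∈ A
  | S :: _, R => BSub T (.exist S.inverse) (.exist R) ∧ R ≠ S.inverse

/-- The words leading from `c` to an element of the canonical model. -/
def Valid (T : TBox) (A : ABox) (c : Const) : List Role → Prop
  | [] => True
  | R :: w => Gen T A c w R ∧ Valid T A c w

/-- The role extensions of the canonical model. -/
def Edge (T : TBox) (A : ABox) (R : Role) (x y : Const × List Role) : Prop :=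
  (x.2 = [] ∧ y.2 = [] ∧ BaseR T A R x.1 y.1) ∨
    (x.1 = y.1 ∧ ∃ S, y.2 = S :: x.2 ∧ Valid T A y.1 y.2 ∧ RSub T S R) ∨
    (x.1 = y.1 ∧ ∃ S, x.2 = S :: y.2 ∧ Valid T A x.1 x.2 ∧ RSub T S R.inverse)

/-- The concept extensions of the canonical model. -/
def CanonC (T : TBox) (A : ABox) : CName → Const × List Role → Prop
  | .name N, x => Valid T A x.1 x.2 ∧ El T A x.1 x.2 (.atomic N)
  | N, x => x.2 = [] ∧ .concept N x.1 ∈ A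

/-- The canonical model of the positive inclusions. -/
def canon (T : TBox) (A : ABox) : Interp where
  Dom := Const × List Role
  const c := (c, [])
  const_injective _ _ h := congrArg Prod.fst h
  concept N := {x | CanonC T A N x}
  role P := Edge T A (.name P)

/-- Satisfaction of atoms in the canonical model. -/
def CanonSat (T : TBox) (A : ABox) : Atom (Const × List Role) → Prop
  | .concept N x => CanonC T A N x
  | .role P x y => Edge T A (.name P) x y

/-- The value of a term in the canonical model. -/
def QTerm.val (η : ℕ → Const × List Role) : QTerm → Const × List Role
  | .var x => η x
  | .const c => (c, [])

/-- `η` is a match of the query in the canonical model. -/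
def CQ.Match (T : TBox) (A : ABox) (q : CQ) (v : ℕ → Const) (η : ℕ → Const × List Role) : Prop :=
  (∀ x, x ∉ q.exVars → η x = (v x, [])) ∧ ∀ a ∈ q.atoms, CanonSat T A (a.map (QTerm.val η))

theorem Atom.map_map {τ τ' τ'' : Type} (g : τ' → τ'') (f : τ → τ') (a : Atom τ) :
    (a.map f).map g = a.map (g ∘ f) := by cases a <;> rfl

section Canon

variable {T : TBox} {A : ABox}

theorem El.mono {c : Const} {w : List Role} {B C : BasicConcept} (h : El T A c w B)
    (hs : BSub T B C) : El T A c w C := by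
  cases w with
  | nil =>
    obtain ⟨D, h1, h2⟩ := h
    exact ⟨D, h1.trans hs, h2⟩
  | cons S w => exact ReflTransGen.trans h hs

theorem Gen.el {c : Const} {w : List Role} {R : Role} (h : Gen T A c w R) :
    El T A c w (.exist R) := by
  cases w with
  | nil => exact h.1
  | cons S w => exact h.1

theorem edge_inverse {R : Role} {x y : Const × List Role} :
    Edge T A R.inverse x y ↔ Edge T A R y x := by
  have key : ∀ {R x y}, Edge T A R x y → Edge T A R.inverse y x := by
    rintro R x y (⟨h1, h2, S, h3, h4⟩ | ⟨h1, S, h2, h3, h4⟩ | ⟨h1, S, h2, h3, h4⟩)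
    · exact .inl ⟨h2, h1, S.inverse, h3.inverse, by rwa [roleAtom_inverse]⟩
    · exact .inr (.inr ⟨h1.symm, S, h2, h3, by simpa using h4⟩)
    · exact .inr (.inl ⟨h1.symm, S, h2, h3, h4⟩)
  exact ⟨fun h => by simpa using key h, key⟩

theorem canon_roleExt {R : Role} {x y : Const × List Role} :
    (canon T A).roleExt R x y ↔ Edge T A R x y := by
  cases R with
  | name P => rfl
  | inv P => exact (edge_inverse (R := .name P)).symm

theorem Edge.mono {R S : Role} {x y : Const × List Role} (h : Edge T A R x y)
    (hs : RSub T R S) : Edge T A S x y := by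
  rcases h with ⟨h1, h2, U, h3, h4⟩ | ⟨h1, U, h2, h3, h4⟩ | ⟨h1, U, h2, h3, h4⟩
  · exact .inl ⟨h1, h2, U, h3.trans hs, h4⟩
  · exact .inr (.inl ⟨h1, U, h2, h3, h4.trans hs⟩)
  · exact .inr (.inr ⟨h1, U, h2, h3, h4.trans hs.inverse⟩)

/-- Whatever must have an `R`-successor has one. At a constant it is given by an `R`-fact if there
is one; at a nonempty word it is the parent if `R` is the inverse of the last letter. In the
remaining cases `Gen` permits a child. Membership in a basic concept therefore depends only on the
last letter or, at a constant, on the facts. -/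
theorem canon_conceptExt {B : BasicConcept} {x : Const × List Role} :
    x ∈ (canon T A).conceptExt B ↔ Valid T A x.1 x.2 ∧ El T A x.1 x.2 B := by
  obtain ⟨c, w⟩ := x
  cases B with
  | atomic N => rfl
  | exist R =>
    change (∃ y, (canon T A).roleExt R (c, w) y) ↔ _
    constructor
    · rintro ⟨⟨d, u⟩, h⟩
      rcases canon_roleExt.1 h with ⟨rfl, h2, U, h3, h4⟩ | ⟨rfl, U, h2, h3, h4⟩ | ⟨rfl, U, h2, h3, h4⟩
      · exact ⟨trivial, .exist U, h3.exist, d, h4⟩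
      · simp only at h2; subst h2
        exact ⟨h3.2, h3.1.el.mono h4.exist⟩
      · simp only at h2; subst h2
        refine ⟨h3, RSub.exist ?_⟩
        simpa using h4.inverse
    · rintro ⟨h1, h2⟩
      have child : Gen T A c w R → ∃ y, (canon T A).roleExt R (c, w) y := fun h =>
        ⟨(c, R :: w), canon_roleExt.2 (.inr (.inl ⟨rfl, R, rfl, ⟨h, h1⟩, .refl⟩))⟩
      cases w with
      | nil =>
        by_cases h : ∃ d, roleAtom R c d ∈ A
        · obtain ⟨d, h⟩ := h
          exact ⟨(d, []), canon_roleExt.2 (.inl ⟨rfl, rfl, R, .refl, h⟩)⟩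
        · exact child ⟨h2, h⟩
      | cons S w =>
        by_cases h : R = S.inverse
        · refine ⟨(c, w), canon_roleExt.2 (.inr (.inr ⟨rfl, S, rfl, h1, ?_⟩))⟩
          rw [h, Role.inverse_inverse]
          exact .refl
        · exact child ⟨h2, h⟩

theorem trueIn_canon_iff {q : UCQ} {v : ℕ → Const} :
    q.TrueIn (canon T A) v ↔ ∃ d ∈ q, ∃ η, CQ.Match T A d v η := by
  have h : ∀ (η : ℕ → Const × List Role) (a : Atom QTerm),
      (canon T A).satAtom (a.map (QTerm.eval (canon T A) η)) ↔
        CanonSat T A (a.map (QTerm.val η)) := by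
    intro η a
    have h1 : QTerm.eval (canon T A) η = QTerm.val η := by
      funext t
      cases t <;> rfl
    rw [h1]
    cases a <;> rfl
  exact exists_congr fun d => and_congr_right fun _ => exists_congr fun η =>
    and_congr Iff.rfl (forall₂_congr fun a _ => h η a)

theorem canon_satT_positive {t : TAssertion} (ht : t ∈ T) (hp : t.isPositive = true) :
    (canon T A).satT t := by
  cases t with
  | subConcept B C =>
    intro x hx
    have := canon_conceptExt.1 hx
    exact canon_conceptExt.2 ⟨this.1, this.2.mono (.single (.inl ht))⟩
  | subRole R S =>
    intro x y h
    exact canon_roleExt.2 ((canon_roleExt.1 h).mono (.single (.inl ht)))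
  | _ => simp [TAssertion.isPositive] at hp

theorem canon_satAtom {f : Fact} (hf : f ∈ A) : (canon T A).satAtom (f.map (canon T A).const) := by
  cases f with
  | concept N c =>
    cases N with
    | name N => exact ⟨trivial, .atomic N, .refl, c, hf⟩
    | state => exact ⟨rfl, hf⟩
    | viol => exact ⟨rfl, hf⟩
  | role P c d => exact .inl ⟨rfl, rfl, .name P, .refl, hf⟩

/-- The last inclusion of a nontrivial chain would specialize a functional role or the inverse of
one, which DL-Lite_A forbids. -/
theorem TBox.IsDLLiteA.rsub (hT : T.IsDLLiteA) {R S U : Role} (hf : TAssertion.funct R ∈ T)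
    (h : RSub T S U) (hU : U = R ∨ U = R.inverse) : S = U := by
  rcases ReflTransGen.cases_tail h with h | ⟨V, -, h | h⟩
  · exact h.symm
  · have := hT _ _ _ hf h
    tauto
  · have := hT _ _ _ hf h
    rcases hU with rfl | rfl
    · exact absurd rfl this.2
    · exact absurd (by simp) this.1

/-- A functional role has no proper subroles, so its edges are `R`-facts, edges to a child with
letter `R`, and edges to the parent along a letter `R.inverse`. Two distinct ends of facts would
violate the assertion in the ABox, and a child is generated only when neither a fact nor the parent
supplies the successor. The proof compares the three kinds of edges pairwise. -/
theorem canon_funct (hT : T.IsDLLiteA) {R : Role} (hf : TAssertion.funct R ∈ T)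
    (hv : ¬ Violates T A (.funct R)) : (canon T A).satT (.funct R) := by
  have h1 : ∀ S, RSub T S R → S = R := fun S h => hT.rsub hf h (.inl rfl)
  have h2 : ∀ S, RSub T S R.inverse → S = R.inverse := fun S h => hT.rsub hf h (.inr rfl)
  rintro ⟨c, w⟩ ⟨d, u⟩ ⟨e, z⟩ hxy hxz
  rcases canon_roleExt.1 hxy with ⟨rfl, rfl, U, h3, h4⟩ | ⟨rfl, U, ha, h3, h4⟩ | ⟨rfl, U, ha, h3, h4⟩
    <;> rcases canon_roleExt.1 hxz with ⟨hw, hu, V, h5, h6⟩ | ⟨rfl, V, hb, h5, h6⟩ |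
      ⟨rfl, V, hb, h5, h6⟩ <;> simp only at *
  · subst hu
    obtain rfl := h1 _ h3
    obtain rfl := h1 _ h5
    by_contra hne
    exact hv ⟨c, d, e, h4, h6, fun h => hne (by rw [h])⟩
  · subst hb
    obtain rfl := h1 _ h3
    obtain rfl := h1 _ h6
    exact absurd ⟨_, h4⟩ h5.1.2
  · cases hb
  · subst ha hw
    obtain rfl := h1 _ h4
    obtain rfl := h1 _ h5
    exact absurd ⟨_, h6⟩ h3.1.2
  · rw [ha, hb, h1 _ h4, h1 _ h6]
  · subst ha hb
    obtain rfl := h1 _ h4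
    obtain rfl := h2 _ h6
    exact absurd (by simp) h3.1.2
  · cases ha.symm.trans hw
  · subst hb ha
    obtain rfl := h1 _ h6
    obtain rfl := h2 _ h4
    exact absurd (by simp) h5.1.2
  · rw [ha] at hb
    rw [(List.cons.inj hb).2]

end Canon

/-! ### Homomorphisms into models -/

section Hom

variable (I : Interp)

open Classical in
/-- The image of an element of the canonical model. -/
noncomputable def homWord (c : Const) : List Role → I.Dom
  | [] => I.const c
  | R :: w => if h : ∃ y, I.roleExt R (homWord c w) y then h.choose else I.const c

variable {I} {T : TBox} {A : ABox} (hT : ∀ t ∈ T, t.isPositive = true → I.satT t)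
  (hA : ∀ f ∈ A, I.satAtom (f.map I.const))

include hT in
theorem RSub.roleExt {R S : Role} (h : RSub T R S) {x y : I.Dom} (hx : I.roleExt R x y) :
    I.roleExt S x y := by
  induction h with
  | refl => exact hx
  | tail _ h ih =>
    rcases h with h | h
    · exact hT _ h rfl _ _ ih
    · have := hT _ h rfl y x ((I.roleExt_inverse _ _ _).2 ih)
      exact (I.roleExt_inverse _ _ _).1 this

include hT in
theorem BSub.conceptExt {B C : BasicConcept} (h : BSub T B C) {x : I.Dom}
    (hx : x ∈ I.conceptExt B) : x ∈ I.conceptExt C := by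
  induction h with
  | refl => exact hx
  | tail _ h ih =>
    rcases h with h | ⟨R, S, rfl, rfl, h⟩
    · exact hT _ h rfl ih
    · obtain ⟨y, hy⟩ := ih
      exact ⟨y, RSub.roleExt hT (.single h) hy⟩

include hA in
theorem roleExt_of_mem {R : Role} {c d : Const} (h : roleAtom R c d ∈ A) :
    I.roleExt R (I.const c) (I.const d) := by
  have := hA _ h
  rwa [roleAtom_map, I.satAtom_roleAtom] at this

include hT hA in
theorem BaseC.conceptExt {B : BasicConcept} {c : Const} (h : BaseC T A B c) :
    I.const c ∈ I.conceptExt B := by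
  obtain ⟨C, h1, d, h2⟩ := h
  refine BSub.conceptExt hT h1 ?_
  cases C with
  | atomic N => exact hA _ h2
  | exist R => exact ⟨_, roleExt_of_mem hA h2⟩

theorem homWord_roleExt {c : Const} {w : List Role} {R : Role}
    (h : homWord I c w ∈ I.conceptExt (.exist R)) :
    I.roleExt R (homWord I c w) (homWord I c (R :: w)) := by
  have h' : ∃ y, I.roleExt R (homWord I c w) y := h
  rw [homWord, dif_pos h']
  exact h'.choose_spec

include hT hA in
-- By induction the image of the shorter word has a successor along the next letter, so `homWord`
-- takes a genuine choice; its default value is never reached on valid words. The chosen point then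
-- has that successor's source as a neighbour along the inverse letter.
theorem homWord_conceptExt {c : Const} : ∀ {w : List Role}, Valid T A c w → ∀ {B : BasicConcept},
    El T A c w B → homWord I c w ∈ I.conceptExt B
  | [], _, _, h => BaseC.conceptExt hT hA h
  | _ :: _, hv, _, h =>
    BSub.conceptExt hT h ⟨_, (I.roleExt_inverse _ _ _).2
      (homWord_roleExt (homWord_conceptExt hv.2 hv.1.el))⟩

include hT hA in
theorem Edge.roleExt {R : Role} {x y : Const × List Role} (h : Edge T A R x y) :
    I.roleExt R (homWord I x.1 x.2) (homWord I y.1 y.2) := by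
  obtain ⟨c, w⟩ := x
  obtain ⟨d, u⟩ := y
  have child : ∀ {c : Const} {w : List Role} {R : Role}, Valid T A c (R :: w) →
      I.roleExt R (homWord I c w) (homWord I c (R :: w)) := fun hv =>
    homWord_roleExt (homWord_conceptExt hT hA hv.2 hv.1.el)
  rcases h with ⟨h1, h2, S, h3, h4⟩ | ⟨h1, S, h2, h3, h4⟩ | ⟨h1, S, h2, h3, h4⟩ <;>
    simp only at * <;> subst h1 h2
  · exact RSub.roleExt hT h3 (roleExt_of_mem hA h4)
  · exact RSub.roleExt hT h4 (child h3)
  · exact (I.roleExt_inverse _ _ _).1 (RSub.roleExt hT h4 (child h3))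

include hT hA in
theorem CanonSat.hom {a : Atom (Const × List Role)} (h : CanonSat T A a) :
    I.satAtom (a.map fun x => homWord I x.1 x.2) := by
  cases a with
  | concept N x =>
    obtain ⟨c, w⟩ := x
    cases N with
    | name N => exact homWord_conceptExt hT hA (B := .atomic N) h.1 h.2
    | state =>
      obtain ⟨h1, h2⟩ := h
      simp only at h1 h2
      subst h1
      exact hA _ h2
    | viol =>
      obtain ⟨h1, h2⟩ := h
      simp only at h1 h2
      subst h1
      exact hA _ h2
  | role P x y => exact Edge.roleExt hT hA (R := .name P) h

include hT hA in
theorem UCQ.TrueIn.of_canon {q : UCQ} {v : ℕ → Const}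
    (h : ∃ d ∈ q, ∃ η, CQ.Match T A d v η) : q.TrueIn I v := by
  obtain ⟨d, hd, η, h1, h2⟩ := h
  refine ⟨d, hd, fun x => homWord I (η x).1 (η x).2, fun x hx => ?_, fun a ha => ?_⟩
  · simp only [h1 x hx, homWord]
  · have h3 : (fun x : Const × List Role => homWord I x.1 x.2) ∘ QTerm.val η =
        QTerm.eval I fun x => homWord I (η x).1 (η x).2 := by
      funext t
      cases t <;> rfl
    have := CanonSat.hom hT hA (h2 a ha)
    rwa [Atom.map_map, h3] at this

end Hom

/-- No functionality assertion is violated in the ABox and the canonical model satisfies the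
negative inclusions. -/
def TOk (T : TBox) (A : ABox) : TAssertion → Prop
  | .funct R => ¬ Violates T A (.funct R)
  | .disjConcept B C => ¬ ∃ x, x ∈ (canon T A).conceptExt B ∧ x ∈ (canon T A).conceptExt C
  | .disjRole R S => ¬ ∃ x y, (canon T A).roleExt R x y ∧ (canon T A).roleExt S x y
  | _ => True

/-- The canonical model maps into every model, so a disjointness that fails in it fails in every
model; a functionality that fails in the ABox fails in every model by unique names. If nothing
fails, the canonical model is itself a model. -/
theorem consistent_iff {T : TBox} (hT : T.IsDLLiteA) {A : ABox} :
    Consistent T A ↔ ∀ t, t ∈ T → TOk T A t := by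
  constructor
  · rintro ⟨I, hI, hA⟩ t ht
    have hp : ∀ t ∈ T, t.isPositive = true → I.satT t := fun t ht _ => hI t ht
    have hc : ∀ {B x}, x ∈ (canon T A).conceptExt B → homWord I x.1 x.2 ∈ I.conceptExt B := by
      intro B x hx
      have := canon_conceptExt.1 hx
      exact homWord_conceptExt hp hA this.1 this.2
    have := hI t ht
    cases t with
    | funct R =>
      rintro ⟨c, d, e, h1, h2, h3⟩
      exact h3 (I.const_injective (this _ _ _ (roleExt_of_mem hA h1) (roleExt_of_mem hA h2)))
    | disjConcept B C =>
      rintro ⟨x, h1, h2⟩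
      exact Set.disjoint_left.1 this (hc h1) (hc h2)
    | disjRole R S =>
      rintro ⟨x, y, h1, h2⟩
      exact this _ _ (Edge.roleExt hp hA (canon_roleExt.1 h1))
        (Edge.roleExt hp hA (canon_roleExt.1 h2))
    | _ => trivial
  · refine fun h => ⟨canon T A, fun t ht => ?_, fun f hf => canon_satAtom hf⟩
    have := h t ht
    cases t with
    | funct R => exact canon_funct hT ht this
    | disjConcept B C => exact Set.disjoint_left.2 fun x h1 h2 => this ⟨x, h1, h2⟩
    | disjRole R S => exact fun x y h1 h2 => this ⟨x, y, h1, h2⟩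
    | _ => exact canon_satT_positive ht rfl

theorem canon_isModel {T : TBox} (hT : T.IsDLLiteA) {A : ABox} (h : Consistent T A) :
    (canon T A).IsModel T A := by
  refine ⟨fun t ht => ?_, fun f hf => canon_satAtom hf⟩
  have := (consistent_iff hT).1 h t ht
  cases t with
  | funct R => exact canon_funct hT ht this
  | disjConcept B C => exact Set.disjoint_left.2 fun x h1 h2 => this ⟨x, h1, h2⟩
  | disjRole R S => exact fun x y h1 h2 => this ⟨x, y, h1, h2⟩
  | _ => exact canon_satT_positive ht rfl

/-- Over an inconsistent ontology everything is certain. Otherwise the canonical model is one of the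
models, and homomorphisms carry its matches into all others. -/
theorem certain_iff {T : TBox} (hT : T.IsDLLiteA) {A : ABox} {q : UCQ} {v : ℕ → Const} :
    q.Certain T A v ↔ (Consistent T A → ∃ d ∈ q, ∃ η, CQ.Match T A d v η) := by
  constructor
  · exact fun h hc => trueIn_canon_iff.1 (h _ (canon_isModel hT hc))
  · exact fun h I hI => .of_canon (fun t ht _ => hI.1 t ht) hI.2 (h ⟨I, hI⟩)

/-! ## Computability of the canonical model -/

section Reach

variable {α β : Type} [Coded α] [Coded β]

/-- Reachability is derivable. Unreachability is certified by a list that is closed under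
successors, contains the start and omits the target. Since all successors lie in one finite list,
the reachable elements form such a list; only its existence is needed, not its computation. -/
theorem rFun_reach (succ : α → β → List β) [hs : RFun fun x : α × β => succ x.1 x.2]
    (hfin : ∀ a, ∃ L : List β, ∀ x, ∀ y ∈ succ a x, y ∈ L) :
    RFun fun z : α × β × β => ReflTransGen (fun x y => y ∈ succ z.1 x) z.2.1 z.2.2 := by
  let R (z : α × β × β) (l : List (α × β × β)) : Prop :=
    (z.2.1 = z.2.2 ∧ l = []) ∨ ∃ y, z.2.2 ∈ succ z.1 y ∧ l = [(z.1, z.2.1, y)]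
  have hR : ∀ z, Der R z ↔ ReflTransGen (fun x y => y ∈ succ z.1 x) z.2.1 z.2.2 := by
    intro z
    constructor
    · intro h
      induction h with
      | intro z l h _ ih =>
        rcases h with ⟨h, rfl⟩ | ⟨y, h, rfl⟩
        · rw [h]
        · exact (ih (z.1, z.2.1, y) (by simp)).tail h
    · obtain ⟨a, x, y⟩ := z
      intro h
      simp only at h
      induction h with
      | refl => exact .intro _ [] (.inl ⟨rfl, rfl⟩) (by simp)
      | tail _ h ih => exact .intro _ _ (.inr ⟨_, h, rfl⟩) (by simpa using ih)
  have h1 : RFun fun x : ((α × β × β) × List (α × β × β)) × β => succ x.1.1.1 x.2 :=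
    .comp (f := fun x : α × β => succ x.1 x.2) (g := fun x : ((α × β × β) × List (α × β × β)) × β =>
      (x.1.1.1, x.2)) hs inferInstance
  refine .of_re (RE.congr (fun z => (hR z).symm) (hq := RE.der (by simp only [R]; infer_instance))) ?_
  have h2 : RFun fun x : ((α × β × β) × List β) × β => succ x.1.1.1 x.2 :=
    .comp (f := fun x : α × β => succ x.1 x.2) (g := fun x : ((α × β × β) × List β) × β =>
      (x.1.1.1, x.2)) hs inferInstance
  refine RE.congr (q := fun z : α × β × β => ∃ L : List β, z.2.1 ∈ L ∧ z.2.2 ∉ L ∧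
    ∀ x, x ∈ L → ∀ y, y ∈ succ z.1 x → y ∈ L) fun ⟨a, x, y⟩ => ?_
  simp only
  constructor
  · intro h
    obtain ⟨L, hL⟩ := hfin a
    refine ⟨sift (fun y => ReflTransGen (fun x y => y ∈ succ a x) x y) (x :: L), ?_, ?_, ?_⟩
    · simpa using ReflTransGen.refl
    · simp [h]
    · intro z hz w hw
      rw [mem_sift] at hz ⊢
      exact ⟨List.mem_cons_of_mem _ (hL _ _ hw), hz.2.tail hw⟩
  · rintro ⟨L, h1, h2, h3⟩ h
    refine h2 ?_
    clear h2
    induction h with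
    | refl => exact h1
    | tail _ h ih => exact h3 _ ih _ h

end Reach

/-- The roles reached by an assertion from `R`. -/
def roleStep (R : Role) : TAssertion → List Role
  | .subRole R₁ R₂ => (if R = R₁ then [R₂] else []) ++ if R = R₁.inverse then [R₂.inverse] else []
  | _ => []

/-- The concepts reached by an assertion from `B`. -/
def conceptStep (B : BasicConcept) : TAssertion → List BasicConcept
  | .subConcept B₁ B₂ => if B = B₁ then [B₂] else []
  | .subRole R₁ R₂ => (if B = .exist R₁ then [.exist R₂] else []) ++
      if B = .exist R₁.inverse then [.exist R₂.inverse] else []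
  | _ => []

instance rFun_roleStep : RFun fun x : Role × TAssertion => roleStep x.1 x.2 := by
  apply RFun.tAssertion_cases <;> unfold roleStep <;> infer_instance

instance rFun_conceptStep : RFun fun x : BasicConcept × TAssertion => conceptStep x.1 x.2 := by
  apply RFun.tAssertion_cases <;> unfold conceptStep <;> infer_instance

theorem mem_roleStep {T : TBox} {R S : Role} :
    S ∈ T.flatMap (roleStep R) ↔ RoleEdge T R S := by
  rw [List.mem_flatMap]
  constructor
  · rintro ⟨t, ht, h⟩
    cases t with
    | subRole R₁ R₂ =>
      simp only [roleStep, List.mem_append] at h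
      rcases h with h | h
      · split_ifs at h with h1
        · simp only [List.mem_singleton] at h
          subst h1 h
          exact .inl ht
        · simp at h
      · split_ifs at h with h1
        · simp only [List.mem_singleton] at h
          subst h1 h
          exact .inr (by simpa using ht)
        · simp at h
    | _ => simp [roleStep] at h
  · rintro (h | h)
    · exact ⟨_, h, by simp [roleStep]⟩
    · exact ⟨_, h, by simp [roleStep]⟩

theorem mem_conceptStep {T : TBox} {B C : BasicConcept} :
    C ∈ T.flatMap (conceptStep B) ↔ ConceptEdge T B C := by
  rw [List.mem_flatMap]
  constructor
  · rintro ⟨t, ht, h⟩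
    cases t with
    | subConcept B₁ B₂ =>
      simp only [conceptStep] at h
      split_ifs at h with h1
      · simp only [List.mem_singleton] at h
        subst h1 h
        exact .inl ht
      · simp at h
    | subRole R₁ R₂ =>
      simp only [conceptStep, List.mem_append] at h
      rcases h with h | h
      · split_ifs at h with h1
        · simp only [List.mem_singleton] at h
          exact .inr ⟨_, _, h1, h, .inl ht⟩
        · simp at h
      · split_ifs at h with h1
        · simp only [List.mem_singleton] at h
          exact .inr ⟨_, _, h1, h, .inr (by simpa using ht)⟩
        · simp at h
    | _ => simp [conceptStep] at h
  · rintro (h | ⟨R, S, rfl, rfl, h | h⟩)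
    · exact ⟨_, h, by simp [conceptStep]⟩
    · exact ⟨_, h, by simp [conceptStep]⟩
    · exact ⟨_, h, by simp [conceptStep]⟩

/-- The roles and existential concepts on the right of the positive inclusions. -/
def genStep : TAssertion → List Role
  | .subConcept _ (.exist R) => [R]
  | .subRole _ R => [R, R.inverse]
  | _ => []

/-- The roles that may label anonymous elements. -/
def genRoles (T : TBox) : List Role := T.flatMap genStep

theorem RoleEdge.mem_genRoles {T : TBox} {R S : Role} (h : RoleEdge T R S) : S ∈ genRoles T := by
  rcases h with h | h
  · exact List.mem_flatMap.2 ⟨_, h, by simp [genStep]⟩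
  · exact List.mem_flatMap.2 ⟨_, h, by simp [genStep]⟩

theorem ConceptEdge.mem_genRoles {T : TBox} {B : BasicConcept} {S : Role}
    (h : ConceptEdge T B (.exist S)) : S ∈ genRoles T := by
  rcases h with h | ⟨R, U, rfl, hU, h⟩
  · exact List.mem_flatMap.2 ⟨_, h, by simp [genStep]⟩
  · cases hU
    exact h.mem_genRoles

theorem BSub.mem_genRoles {T : TBox} {B : BasicConcept} {S : Role}
    (h : BSub T B (.exist S)) (hne : B ≠ .exist S) : S ∈ genRoles T := by
  rcases ReflTransGen.cases_tail h with h | ⟨C, -, h⟩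
  · exact absurd h.symm hne
  · exact h.mem_genRoles

section Instances

variable {α : Type} [Coded α] {T : α → TBox} {A : α → List Fact}

theorem rFun_genStep : RFun genStep := by
  have h2 : RFun fun x : (Unit × BasicConcept) × BasicConcept =>
      genStep (.subConcept x.1.2 x.2) := by
    apply RFun.basicConcept_cases (h := fun (x : Unit × BasicConcept) y =>
      genStep (.subConcept x.2 y)) <;> unfold genStep <;> infer_instance
  have : RFun fun x : Unit × TAssertion => genStep x.2 := by
    apply RFun.tAssertion_cases (h := fun _ t => genStep t)
    · exact .comp (f := fun x : (Unit × BasicConcept) × BasicConcept =>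
        genStep (.subConcept x.1.2 x.2)) (g := fun x : Unit × BasicConcept × BasicConcept =>
          ((x.1, x.2.1), x.2.2)) h2 inferInstance
    all_goals unfold genStep; infer_instance
  exact .comp (f := fun x : Unit × TAssertion => genStep x.2) (g := fun t => ((), t)) this
    inferInstance

instance rFun_genRoles [hT : RFun T] : RFun fun a => genRoles (T a) := by
  have : RFun fun x : α × TAssertion => genStep x.2 :=
    .comp (f := genStep) (g := fun x : α × TAssertion => x.2) rFun_genStep inferInstance
  unfold genRoles
  infer_instance

instance rFun_rSub {R S : α → Role} [hT : RFun T] [hR : RFun R] [hS : RFun S] :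
    RFun fun a => RSub (T a) (R a) (S a) := by
  have h0 : RFun fun x : (TBox × Role) × TAssertion => roleStep x.1.2 x.2 :=
    .comp (f := fun x : Role × TAssertion => roleStep x.1 x.2)
      (g := fun x : (TBox × Role) × TAssertion => (x.1.2, x.2)) inferInstance inferInstance
  have h := rFun_reach (fun (T : TBox) (R : Role) => T.flatMap (roleStep R)) fun T =>
    ⟨genRoles T, fun x y hy => (mem_roleStep.1 hy).mem_genRoles⟩
  have h2 : RFun fun z : TBox × Role × Role => RSub z.1 z.2.1 z.2.2 := by
    refine RFun.congr (fun z => ?_) (hg := h)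
    simp only [mem_roleStep]
    rfl
  -- Computability is proved for a tuple of arguments and then composed with arbitrary computable
  -- arguments. Many instances below follow this pattern.
  exact .comp (f := fun z : TBox × Role × Role => RSub z.1 z.2.1 z.2.2)
    (g := fun a => (T a, R a, S a)) h2 inferInstance

instance rFun_bSub {B C : α → BasicConcept} [hT : RFun T] [hR : RFun B] [hS : RFun C] :
    RFun fun a => BSub (T a) (B a) (C a) := by
  have h0 : RFun fun x : (TBox × BasicConcept) × TAssertion => conceptStep x.1.2 x.2 :=
    .comp (f := fun x : BasicConcept × TAssertion => conceptStep x.1 x.2)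
      (g := fun x : (TBox × BasicConcept) × TAssertion => (x.1.2, x.2)) inferInstance inferInstance
  have h := rFun_reach (fun (T : TBox) (B : BasicConcept) => T.flatMap (conceptStep B)) fun T =>
    ⟨T.flatMap (fun t => match t with
      | .subConcept _ B => [B]
      | .subRole _ R => [.exist R, .exist R.inverse]
      | _ => []), fun x y hy => by
      rw [List.mem_flatMap]
      rcases mem_conceptStep.1 hy with h | ⟨R, S, rfl, rfl, h | h⟩
      · exact ⟨_, h, by simp⟩
      · exact ⟨_, h, by simp⟩
      · exact ⟨_, h, by simp⟩⟩
  have h2 : RFun fun z : TBox × BasicConcept × BasicConcept => BSub z.1 z.2.1 z.2.2 := by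
    refine RFun.congr (fun z => ?_) (hg := h)
    simp only [mem_conceptStep]
    rfl
  exact .comp (f := fun z : TBox × BasicConcept × BasicConcept => BSub z.1 z.2.1 z.2.2)
    (g := fun a => (T a, B a, C a)) h2 inferInstance

end Instances

/-- The roles connecting constants by a fact. -/
def factRoles : Fact → List (Role × Const × Const)
  | .role P c d => [(.name P, c, d), (.inv P, d, c)]
  | .concept _ _ => []

/-- The basic concepts to which constants belong by a fact. -/
def factConcepts : Fact → List (BasicConcept × Const)
  | .role P c d => [(.exist (.name P), c), (.exist (.inv P), d)]
  | .concept (.name N) c => [(.atomic N, c)]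
  | .concept _ _ => []

theorem mem_factRoles {f : Fact} {R : Role} {c d : Const} :
    (R, c, d) ∈ factRoles f ↔ roleAtom R c d = f := by
  cases f <;> cases R <;> simp [factRoles, roleAtom, eq_comm]
  tauto

theorem mem_factConcepts {f : Fact} {B : BasicConcept} {c : Const} :
    (B, c) ∈ factConcepts f ↔ ∃ d, conceptAtom B c d = f := by
  cases f with
  | concept N e =>
    cases N <;> rcases B with _ | (_ | _) <;>
      simp [factConcepts, conceptAtom, roleAtom, eq_comm]
    exact fun _ _ => ⟨c⟩
  | role P e e' => rcases B with _ | (_ | _) <;> simp [factConcepts, conceptAtom, roleAtom, eq_comm]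

theorem baseR_iff {T : TBox} {A : List Fact} {R : Role} {c d : Const} :
    BaseR T A.toFinset R c d ↔ ∃ f, f ∈ A ∧ ∃ p, p ∈ factRoles f ∧ RSub T p.1 R ∧ p.2 = (c, d) := by
  constructor
  · rintro ⟨S, h1, h2⟩
    exact ⟨_, List.mem_toFinset.1 h2, (S, c, d), mem_factRoles.2 rfl, h1, rfl⟩
  · rintro ⟨f, hf, ⟨S, _⟩, hp, h1, rfl⟩
    exact ⟨S, h1, List.mem_toFinset.2 (by rwa [mem_factRoles.1 hp])⟩

theorem baseC_iff {T : TBox} {A : List Fact} {B : BasicConcept} {c : Const} :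
    BaseC T A.toFinset B c ↔ ∃ f, f ∈ A ∧ ∃ p, p ∈ factConcepts f ∧ BSub T p.1 B ∧ p.2 = c := by
  constructor
  · rintro ⟨C, h1, d, h2⟩
    exact ⟨_, List.mem_toFinset.1 h2, (C, c), mem_factConcepts.2 ⟨d, rfl⟩, h1, rfl⟩
  · rintro ⟨f, hf, ⟨S, _⟩, hp, h1, rfl⟩
    obtain ⟨d, hd⟩ := mem_factConcepts.1 hp
    exact ⟨S, h1, d, List.mem_toFinset.2 (by rwa [hd])⟩

theorem exists_roleAtom_iff {A : List Fact} {R : Role} {c : Const} :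
    (∃ d, roleAtom R c d ∈ A.toFinset) ↔
      ∃ f, f ∈ A ∧ ∃ p, p ∈ factRoles f ∧ p.1 = R ∧ p.2.1 = c := by
  constructor
  · rintro ⟨d, h⟩
    exact ⟨_, List.mem_toFinset.1 h, (R, c, d), mem_factRoles.2 rfl, rfl, rfl⟩
  · rintro ⟨f, hf, ⟨S, e, d⟩, hp, rfl, rfl⟩
    exact ⟨d, List.mem_toFinset.2 (by rwa [mem_factRoles.1 hp])⟩

/-- The case distinction on the word is expressed by quantifiers over its entries and tails. All
quantifiers are then bounded and instance search can prove decidability; `el_iff`, `valid_iff` and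
`edge_iff` serve the same purpose. -/
theorem gen_iff {T : TBox} {A : ABox} {c : Const} {w : List Role} {R : Role} :
    Gen T A c w R ↔ (w = [] ∧ BaseC T A (.exist R) c ∧ ¬ ∃ d, roleAtom R c d ∈ A) ∨
      ∃ S, S ∈ w ∧ ∃ u, u ∈ w.tails ∧ w = S :: u ∧ BSub T (.exist S.inverse) (.exist R) ∧
        R ≠ S.inverse := by
  cases w with
  | nil => simp [Gen]
  | cons S w =>
    constructor
    · exact fun h => .inr ⟨S, by simp, w, by simp, rfl, h⟩
    · rintro (⟨h, -⟩ | ⟨_, -, _, -, h, h'⟩)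
      · cases h
      · cases h
        exact h'

theorem el_iff {T : TBox} {A : ABox} {c : Const} {w : List Role} {B : BasicConcept} :
    El T A c w B ↔ (w = [] ∧ BaseC T A B c) ∨
      ∃ S, S ∈ w ∧ ∃ u, u ∈ w.tails ∧ w = S :: u ∧ BSub T (.exist S.inverse) B := by
  cases w with
  | nil => simp [El]
  | cons S w =>
    constructor
    · exact fun h => .inr ⟨S, by simp, w, by simp, rfl, h⟩
    · rintro (⟨h, -⟩ | ⟨_, -, _, -, h, h'⟩)
      · cases h
      · cases h
        exact h'

theorem Valid.of_suffix {T : TBox} {A : ABox} {c : Const} {w u : List Role} (h : Valid T A c w)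
    (hs : u <:+ w) : Valid T A c u := by
  obtain ⟨t, rfl⟩ := hs
  induction t with
  | nil => exact h
  | cons R t ih => exact ih h.2

theorem valid_iff {T : TBox} {A : ABox} {c : Const} {w : List Role} :
    Valid T A c w ↔ ∀ R, R ∈ w → ∀ u, u ∈ w.tails → R :: u ∈ w.tails → Gen T A c u R := by
  constructor
  · intro h R _ u _ hR
    exact (h.of_suffix ((List.mem_tails _ _).1 hR)).1
  · intro h
    induction w with
    | nil => trivial
    | cons S w ih =>
      refine ⟨h S (by simp) w (by simp) (by simp), ih fun R hR u hu hRu => ?_⟩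
      simp only [List.mem_tails] at hu hRu h
      exact h R (by simp [hR]) u (hu.trans (List.suffix_cons _ _))
        (hRu.trans (List.suffix_cons _ _))

section Instances

instance rFun_factRoles {α : Type} [Coded α] {f : α → Fact} [hf : RFun f] :
    RFun fun a => factRoles (f a) := by
  have : RFun fun x : Unit × Fact => factRoles x.2 := by
    apply RFun.atom_cases (h := fun _ f => factRoles f) <;> unfold factRoles <;> infer_instance
  exact .comp (f := fun x : Unit × Fact => factRoles x.2) (g := fun a => ((), f a)) this
    inferInstance

instance rFun_factConcepts {α : Type} [Coded α] {f : α → Fact} [hf : RFun f] :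
    RFun fun a => factConcepts (f a) := by
  have h1 : RFun fun x : Const × CName => factConcepts (.concept x.2 x.1) := by
    apply RFun.cName_cases (h := fun c N => factConcepts (.concept N c)) <;>
      unfold factConcepts <;> infer_instance
  have : RFun fun x : Unit × Fact => factConcepts x.2 := by
    apply RFun.atom_cases (h := fun _ f => factConcepts f)
    · exact .comp (f := fun x : Const × CName => factConcepts (.concept x.2 x.1))
        (g := fun x : Unit × CName × Const => (x.2.2, x.2.1)) h1 inferInstance
    · unfold factConcepts
      infer_instance
  exact .comp (f := fun x : Unit × Fact => factConcepts x.2) (g := fun a => ((), f a)) this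
    inferInstance

variable {α : Type} [Coded α] {T : α → TBox} {A : α → List Fact} {R : α → Role} {c d : α → Const}
  {B : α → BasicConcept} {w : α → List Role} {x y : α → Const × List Role}
  [hT : RFun T] [hA : RFun A] [hR : RFun R] [hc : RFun c] [hd : RFun d] [hB : RFun B] [hw : RFun w]
  [hx : RFun x] [hy : RFun y]

instance rFun_baseR : RFun fun a => BaseR (T a) (A a).toFinset (R a) (c a) (d a) :=
  have h : RFun fun x : TBox × List Fact × Role × Const × Const =>
      BaseR x.1 x.2.1.toFinset x.2.2.1 x.2.2.2.1 x.2.2.2.2 :=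
    RFun.congr_prop fun _ => baseR_iff
  .comp (f := fun x : TBox × List Fact × Role × Const × Const =>
    BaseR x.1 x.2.1.toFinset x.2.2.1 x.2.2.2.1 x.2.2.2.2)
    (g := fun a => (T a, A a, R a, c a, d a)) h inferInstance

instance rFun_baseC : RFun fun a => BaseC (T a) (A a).toFinset (B a) (c a) :=
  have h : RFun fun x : TBox × List Fact × BasicConcept × Const =>
      BaseC x.1 x.2.1.toFinset x.2.2.1 x.2.2.2 :=
    RFun.congr_prop fun _ => baseC_iff
  .comp (f := fun x : TBox × List Fact × BasicConcept × Const =>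
    BaseC x.1 x.2.1.toFinset x.2.2.1 x.2.2.2) (g := fun a => (T a, A a, B a, c a)) h inferInstance

instance rFun_exists_roleAtom : RFun fun a => ∃ d, roleAtom (R a) (c a) d ∈ (A a).toFinset :=
  have h : RFun fun x : List Fact × Role × Const =>
      ∃ d, roleAtom x.2.1 x.2.2 d ∈ x.1.toFinset :=
    RFun.congr_prop fun _ => exists_roleAtom_iff
  .comp (f := fun x : List Fact × Role × Const => ∃ d, roleAtom x.2.1 x.2.2 d ∈ x.1.toFinset)
    (g := fun a => (A a, R a, c a)) h inferInstance

instance rFun_gen : RFun fun a => Gen (T a) (A a).toFinset (c a) (w a) (R a) :=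
  have h : RFun fun x : TBox × List Fact × Const × List Role × Role =>
      Gen x.1 x.2.1.toFinset x.2.2.1 x.2.2.2.1 x.2.2.2.2 :=
    RFun.congr_prop fun _ => gen_iff
  .comp (f := fun x : TBox × List Fact × Const × List Role × Role =>
      Gen x.1 x.2.1.toFinset x.2.2.1 x.2.2.2.1 x.2.2.2.2)
    (g := fun a => (T a, A a, c a, w a, R a)) h inferInstance

instance rFun_el : RFun fun a => El (T a) (A a).toFinset (c a) (w a) (B a) :=
  have h : RFun fun x : TBox × List Fact × Const × List Role × BasicConcept =>
      El x.1 x.2.1.toFinset x.2.2.1 x.2.2.2.1 x.2.2.2.2 :=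
    RFun.congr_prop fun _ => el_iff
  .comp (f := fun x : TBox × List Fact × Const × List Role × BasicConcept =>
      El x.1 x.2.1.toFinset x.2.2.1 x.2.2.2.1 x.2.2.2.2)
    (g := fun a => (T a, A a, c a, w a, B a)) h inferInstance

instance rFun_valid : RFun fun a => Valid (T a) (A a).toFinset (c a) (w a) :=
  have h : RFun fun x : TBox × List Fact × Const × List Role =>
      Valid x.1 x.2.1.toFinset x.2.2.1 x.2.2.2 :=
    RFun.congr_prop fun _ => valid_iff
  .comp (f := fun x : TBox × List Fact × Const × List Role =>
      Valid x.1 x.2.1.toFinset x.2.2.1 x.2.2.2) (g := fun a => (T a, A a, c a, w a)) h inferInstance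

theorem edge_iff {T : TBox} {A : ABox} {R : Role} {x y : Const × List Role} :
    Edge T A R x y ↔ (x.2 = [] ∧ y.2 = [] ∧ BaseR T A R x.1 y.1) ∨
    (x.1 = y.1 ∧ ∃ S, S ∈ y.2 ∧ y.2 = S :: x.2 ∧ Valid T A y.1 y.2 ∧ RSub T S R) ∨
    (x.1 = y.1 ∧ ∃ S, S ∈ x.2 ∧ x.2 = S :: y.2 ∧ Valid T A x.1 x.2 ∧ RSub T S R.inverse) := by
  have h : ∀ {l m : List Role} {S : Role} {p : Prop}, (S ∈ l ∧ l = S :: m ∧ p) ↔ l = S :: m ∧ p :=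
    fun {l m S p} => ⟨fun h => h.2, fun h => ⟨by simp [h.1], h⟩⟩
  simp only [h, Edge]

instance rFun_edge : RFun fun a => Edge (T a) (A a).toFinset (R a) (x a) (y a) :=
  have h : RFun fun x : TBox × List Fact × Role × (Const × List Role) × Const × List Role =>
      Edge x.1 x.2.1.toFinset x.2.2.1 x.2.2.2.1 x.2.2.2.2 :=
    RFun.congr_prop fun _ => edge_iff
  .comp (f := fun x : TBox × List Fact × Role × (Const × List Role) × Const × List Role =>
      Edge x.1 x.2.1.toFinset x.2.2.1 x.2.2.2.1 x.2.2.2.2)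
    (g := fun a => (T a, A a, R a, x a, y a)) h inferInstance

theorem rFun_canonC : RFun fun x : (TBox × List Fact × Const × List Role) × CName =>
    CanonC x.1.1 x.1.2.1.toFinset x.2 x.1.2.2 := by
  apply RFun.cName_cases (h := fun (x : TBox × List Fact × Const × List Role) N =>
    CanonC x.1 x.2.1.toFinset N x.2.2) <;> unfold CanonC <;> simp only [List.mem_toFinset] <;>
    infer_instance

instance rFun_canonSat {f : α → Atom (Const × List Role)} [hf : RFun f] :
    RFun fun a => CanonSat (T a) (A a).toFinset (f a) := by
  have h : RFun fun x : (TBox × List Fact) × Atom (Const × List Role) =>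
      CanonSat x.1.1 x.1.2.toFinset x.2 := by
    apply RFun.atom_cases (h := fun (x : TBox × List Fact) f => CanonSat x.1 x.2.toFinset f) <;>
      unfold CanonSat
    · exact .comp (f := fun x : (TBox × List Fact × Const × List Role) × CName =>
        CanonC x.1.1 x.1.2.1.toFinset x.2 x.1.2.2)
        (g := fun x : (TBox × List Fact) × CName × Const × List Role =>
          ((x.1.1, x.1.2, x.2.2), x.2.1)) rFun_canonC inferInstance
    · infer_instance
  exact .comp (f := fun x : (TBox × List Fact) × Atom (Const × List Role) =>
      CanonSat x.1.1 x.1.2.toFinset x.2) (g := fun a => ((T a, A a), f a)) h inferInstance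

end Instances

/-! ## Bounding the matches of conjunctive queries -/

/-- The terms of an atom. -/
def Atom.termList {τ : Type} : Atom τ → List τ
  | .concept _ t => [t]
  | .role _ t t' => [t, t']

@[simp] theorem Atom.mem_termList {τ : Type} {a : Atom τ} {t : τ} :
    t ∈ a.termList ↔ t ∈ a.terms := by
  cases a <;> simp [termList, terms]

/-- The variables of a term. -/
def QTerm.vars : QTerm → List ℕ
  | .var x => [x]
  | .const _ => []

/-- The variables of a query. -/
def CQ.vars (q : CQ) : List ℕ := q.atoms.flatMap fun a => a.termList.flatMap QTerm.vars

theorem CQ.mem_vars {q : CQ} {x : ℕ} : x ∈ q.vars ↔ ∃ a ∈ q.atoms, QTerm.var x ∈ a.terms := by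
  simp only [vars, List.mem_flatMap, Atom.mem_termList]
  refine exists_congr fun a => and_congr_right fun _ => ?_
  constructor
  · rintro ⟨_ | _, h1, h2⟩
    · simp only [QTerm.vars, List.mem_singleton] at h2
      exact h2 ▸ h1
    · simp [QTerm.vars] at h2
  · exact fun h => ⟨_, h, by simp [QTerm.vars]⟩

theorem mem_adom_of_roleAtom {A : ABox} {R : Role} {c d : Const} (h : roleAtom R c d ∈ A) :
    c ∈ adom A ∧ d ∈ adom A := by
  constructor <;> exact ⟨_, h, by cases R <;> simp [roleAtom, Atom.terms]⟩

/-! ### Valid words: finitely many letters, shortening, and change of the initial segment -/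

section Words

variable {T : TBox} {A : ABox} {c : Const}

theorem BaseC.mem_adom {B : BasicConcept} (h : BaseC T A B c) : c ∈ adom A := by
  obtain ⟨C, -, d, h⟩ := h
  cases C with
  | atomic N => exact ⟨_, h, rfl⟩
  | exist R => exact (mem_adom_of_roleAtom h).1

theorem Valid.mem_adom : ∀ {w : List Role}, Valid T A c w → w ≠ [] → c ∈ adom A
  | [_], h, _ => h.1.1.mem_adom
  | _ :: S :: w, h, _ => Valid.mem_adom (w := S :: w) h.2 (by simp)

/-- The chain of inclusions that yields the letter cannot be trivial: at a constant this would mean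
an `R`-fact, elsewhere that `R` leads back to the parent. So `R` comes from the right side of an
inclusion. -/
theorem Gen.mem_genRoles {w : List Role} {R : Role} (h : Gen T A c w R) : R ∈ genRoles T := by
  cases w with
  | nil =>
    obtain ⟨⟨C, h1, d, h2⟩, h3⟩ := h
    refine h1.mem_genRoles fun hC => ?_
    subst hC
    exact h3 ⟨d, h2⟩
  | cons S w => exact h.1.mem_genRoles fun hS => h.2 (BasicConcept.exist.inj hS).symm

theorem Valid.mem_genRoles {w : List Role} (h : Valid T A c w) : ∀ R ∈ w, R ∈ genRoles T := by
  induction w with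
  | nil => simp
  | cons S w ih => exact List.forall_mem_cons.2 ⟨h.1.mem_genRoles, ih h.2⟩

/-- A word longer than the number of available letters repeats one of them. Cutting out the segment
between two occurrences leaves a valid word, since validity relates only neighbouring letters, and
it keeps the last letter `R`. -/
theorem Valid.shrink {R : Role} {w : List Role} (h : Valid T A c (R :: w))
    (hl : (genRoles T).length < (R :: w).length) :
    ∃ u, Valid T A c (R :: u) ∧ u.length < w.length := by
  have hn : ¬ (R :: w).Nodup := fun hn =>
    absurd (hn.subperm h.mem_genRoles).length_le (by omega)
  clear hl
  induction w generalizing R with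
  | nil => simp at hn
  | cons S w ih =>
    by_cases hR : R ∈ S :: w
    · obtain ⟨p, q, hpq⟩ := List.append_of_mem hR
      refine ⟨q, h.of_suffix ⟨R :: p, by rw [hpq]; rfl⟩, ?_⟩
      rw [hpq]
      simp
      omega
    · obtain ⟨u, h1, h2⟩ := ih h.2 fun h' => hn (List.nodup_cons.2 ⟨hR, h'⟩)
      exact ⟨S :: u, ⟨h.1, h1⟩, by simpa using h2⟩

/-- Only the last letter of a nonempty word decides how it may continue, so the path before the
common letter `R` may be exchanged. -/
theorem Gen.congr_append {t u u' : List Role} {R S : Role} (h : Gen T A c (t ++ R :: u) S) :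
    Gen T A c (t ++ R :: u') S := by
  cases t with
  | nil => exact h
  | cons U t => exact h

theorem El.congr_append {t u u' : List Role} {R : Role} {B : BasicConcept}
    (h : El T A c (t ++ R :: u) B) : El T A c (t ++ R :: u') B := by
  cases t with
  | nil => exact h
  | cons U t => exact h

theorem Valid.congr_append {t u u' : List Role} {R : Role} (h : Valid T A c (t ++ R :: u))
    (h' : Valid T A c (R :: u')) : Valid T A c (t ++ R :: u') := by
  induction t with
  | nil => exact h'
  | cons S t ih => exact ⟨h.1.congr_append, ih h.2⟩

open Classical in
/-- Replacement of the beginning `s` of the paths from `c₀` by `s'`. -/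
noncomputable def reroot (c₀ : Const) (s s' : List Role) (x : Const × List Role) :
    Const × List Role :=
  if x.1 = c₀ ∧ s <:+ x.2 then (x.1, x.2.take (x.2.length - s.length) ++ s') else x

theorem reroot_append (c₀ : Const) (s s' t : List Role) :
    reroot c₀ s s' (c₀, t ++ s) = (c₀, t ++ s') := by
  simp [reroot]

theorem reroot_cases (c₀ : Const) (s s' : List Role) (x : Const × List Role) :
    (∃ t, x = (c₀, t ++ s)) ∨ reroot c₀ s s' x = x ∧ ¬ (x.1 = c₀ ∧ s <:+ x.2) := by
  by_cases h : x.1 = c₀ ∧ s <:+ x.2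
  · obtain ⟨c, w⟩ := x
    obtain ⟨rfl, t, rfl⟩ := h
    exact .inl ⟨t, rfl⟩
  · exact .inr ⟨if_neg h, h⟩

theorem reroot_nil (c₀ : Const) (R : Role) (u s' : List Role) :
    reroot c₀ (R :: u) s' (c, []) = (c, []) := by
  simp [reroot]

theorem length_reroot_le (c₀ : Const) {s s' : List Role} (h : s'.length ≤ s.length)
    (x : Const × List Role) : (reroot c₀ s s' x).2.length ≤ x.2.length := by
  rcases reroot_cases c₀ s s' x with ⟨t, rfl⟩ | ⟨h, -⟩
  · simp [reroot_append, h]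
  · rw [h]

variable {c₀ : Const} {R : Role} {u u' : List Role} (hv : Valid T A c₀ (R :: u'))

include hv in
theorem CanonC.reroot {N : CName} {x : Const × List Role} (h : CanonC T A N x) :
    CanonC T A N (reroot c₀ (R :: u) (R :: u') x) := by
  have h0 : x.2 = [] → KABs.reroot c₀ (R :: u) (R :: u') x = x := by
    obtain ⟨c, w⟩ := x
    rintro rfl
    exact reroot_nil ..
  cases N with
  | name N =>
    rcases reroot_cases c₀ (R :: u) (R :: u') x with ⟨t, rfl⟩ | ⟨h', -⟩
    · rw [reroot_append]
      exact ⟨h.1.congr_append hv, h.2.congr_append⟩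
    · rwa [h']
  | state => rwa [h0 h.1]
  | viol => rwa [h0 h.1]

include hv in
-- Rerooting moves the whole subtree at the word `R :: u` and fixes everything else. Only the edge
-- joining that word to its parent `u` can be destroyed, and the hypotheses on the lengths exclude
-- it.
theorem Edge.reroot {S : Role} {x y : Const × List Role} (h : Edge T A S x y)
    (hx : x.2.length ≠ u.length) (hy : y.2.length ≠ u.length) :
    Edge T A S (reroot c₀ (R :: u) (R :: u') x) (reroot c₀ (R :: u) (R :: u') y) := by
  have key : ∀ {S : Role} {x y : Const × List Role}, x.2.length ≠ u.length → x.1 = y.1 →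
      (∃ U, y.2 = U :: x.2 ∧ Valid T A y.1 y.2 ∧ RSub T U S) →
      Edge T A S (KABs.reroot c₀ (R :: u) (R :: u') x) (KABs.reroot c₀ (R :: u) (R :: u') y) := by
    rintro S ⟨c, w⟩ ⟨d, z⟩ hx h1 ⟨U, h2, h3, h4⟩
    simp only at h1 h2 hx
    subst h1 h2
    rcases reroot_cases c₀ (R :: u) (R :: u') (c, w) with ⟨t, ht⟩ | ⟨h5, h6⟩
    · obtain ⟨rfl, rfl⟩ := Prod.mk.inj ht
      have h7 := reroot_append c (R :: u) (R :: u') (U :: t)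
      simp only [List.cons_append] at h7
      rw [reroot_append, h7]
      exact .inr (.inl ⟨rfl, U, rfl, Valid.congr_append (t := U :: t) h3 hv, h4⟩)
    · have h7 : ¬ (c = c₀ ∧ R :: u <:+ U :: w) := by
        rintro ⟨rfl, h7⟩
        rcases List.suffix_cons_iff.1 h7 with h7 | h7
        · cases h7
          exact hx rfl
        · exact h6 ⟨rfl, h7⟩
      rw [h5, KABs.reroot, if_neg h7]
      exact .inr (.inl ⟨rfl, U, rfl, h3, h4⟩)
  rcases h with ⟨h1, h2, h3⟩ | ⟨h1, h2⟩ | ⟨h1, h2⟩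
  · obtain ⟨c, w⟩ := x
    obtain ⟨d, z⟩ := y
    simp only at h1 h2
    subst h1 h2
    rw [reroot_nil, reroot_nil]
    exact .inl ⟨rfl, rfl, h3⟩
  · exact key hx h1 h2
  · exact edge_inverse.1 (key hy h1.symm h2)

theorem CanonSat.valid {a : Atom (Const × List Role)} (h : CanonSat T A a) :
    ∀ x ∈ a.terms, Valid T A x.1 x.2 := by
  have he : ∀ {R x y}, Edge T A R x y → Valid T A x.1 x.2 := by
    rintro R x y (⟨h1, h2, h3⟩ | ⟨h1, S, h2, h3, h4⟩ | ⟨h1, S, h2, h3, h4⟩)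
    · rw [h1]
      trivial
    · rw [h2, ← h1] at h3
      exact h3.2
    · exact h3
  intro x hx
  cases a with
  | concept N y =>
    obtain rfl : x = y := hx
    cases N with
    | name N => exact h.1
    | state =>
      rw [h.1]
      trivial
    | viol =>
      rw [h.1]
      trivial
  | role P y z =>
    rcases hx with rfl | rfl
    · exact he h
    · exact he (edge_inverse.2 h)

theorem CanonSat.mem_adom {a : Atom (Const × List Role)} (h : CanonSat T A a) :
    ∀ x ∈ a.terms, x.1 ∈ adom A := by
  intro x hx
  by_cases hw : x.2 = []
  · have he : ∀ {R x y}, Edge T A R x y → x.2 = [] → x.1 ∈ adom A := by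
      rintro R x y (⟨h1, h2, S, h3, h4⟩ | ⟨h1, S, h2, h3, h4⟩ | ⟨h1, S, h2, h3, h4⟩) hx
      · exact (mem_adom_of_roleAtom h4).1
      · rw [h1]
        exact h3.mem_adom (by simp [h2])
      · exact h3.mem_adom (by simp [h2])
    cases a with
    | concept N y =>
      obtain rfl : x = y := hx
      cases N with
      | name N =>
        have := h.2
        rw [hw] at this
        exact BaseC.mem_adom this
      | state => exact ⟨_, h.2, rfl⟩
      | viol => exact ⟨_, h.2, rfl⟩
    | role P y z =>
      rcases hx with rfl | rfl
      · exact he h hw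
      · exact he (edge_inverse.2 h) hw
  · exact (h.valid x hx).mem_adom hw

include hv in
theorem CanonSat.reroot {a : Atom (Const × List Role)} (h : CanonSat T A a)
    (ha : ∀ x ∈ a.terms, x.2.length ≠ u.length) :
    CanonSat T A (a.map (reroot c₀ (R :: u) (R :: u'))) := by
  cases a with
  | concept N x => exact CanonC.reroot hv h
  | role P x y => exact Edge.reroot hv h (ha x (by simp [Atom.terms])) (ha y (by simp [Atom.terms]))

end Words

theorem Atom.mem_terms_map {τ τ' : Type} {g : τ → τ'} {a : Atom τ} {t : τ'} :
    t ∈ (a.map g).terms ↔ ∃ s ∈ a.terms, g s = t := by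
  cases a <;> simp [Atom.map, Atom.terms, eq_comm]

/-- A bound on the depth of the matches that have to be considered. -/
def CQ.depth (T : TBox) (q : CQ) : ℕ := (genRoles T).length + q.vars.length + 1

/-- Induction on the total depth of the variables. If a variable lies too deep, some level below it
is used by no variable and is large enough for the path down to just past this level to be
shortened. Rerooting there destroys no atom, because no term sits at that level, and reduces the
total depth. -/
theorem CQ.Match.exists_bounded {T : TBox} {A : ABox} {q : CQ} {v : ℕ → Const}
    {η : ℕ → Const × List Role} (h : q.Match T A v η) :
    ∃ η, q.Match T A v η ∧ ∀ x ∈ q.vars, (η x).2.length ≤ q.depth T := by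
  induction hn : (q.vars.map fun x => (η x).2.length).sum using Nat.strong_induction_on
    generalizing η with
  | _ n ih =>
    by_cases hb : ∀ x ∈ q.vars, (η x).2.length ≤ q.depth T
    · exact ⟨η, h, hb⟩
    push Not at hb
    obtain ⟨x₀, hx₀, hlen⟩ := hb
    set K := (genRoles T).length with hK
    have hdepth : q.depth T = K + q.vars.length + 1 := rfl
    -- There is one more level in this range than there are entries in `q.vars`. The levels are
    -- positive, so constants, which sit at depth 0, are not at level `l`.
    obtain ⟨l, hl, hl'⟩ : ∃ l ∈ Finset.Icc (K + 1) (K + q.vars.length + 1),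
        l ∉ (q.vars.map fun x => (η x).2.length).toFinset := by
      refine Finset.exists_mem_notMem_of_card_lt_card ?_
      refine (List.toFinset_card_le _).trans_lt ?_
      simp only [List.length_map, Nat.card_Icc]
      omega
    rw [Finset.mem_Icc] at hl
    have hvars : ∀ x ∈ q.vars, (η x).2.length ≠ l := fun x hx h' =>
      hl' (by simpa using ⟨x, hx, h'⟩)
    have hval : Valid T A (η x₀).1 (η x₀).2 := by
      obtain ⟨a, ha, hx⟩ := CQ.mem_vars.1 hx₀
      exact (h.2 a ha).valid _ (Atom.mem_terms_map.2 ⟨_, hx, rfl⟩)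
    obtain ⟨⟨c₀, w⟩, hη⟩ : ∃ p, η x₀ = p := ⟨_, rfl⟩
    rw [hη] at hval hlen
    simp only at hval hlen
    -- Words are stored last letter first, so the initial part of the path, of length `l + 1`, is a
    -- suffix of the list. It is longer than the number of letters, as `Valid.shrink` requires.
    obtain ⟨t, s, rfl, hs⟩ : ∃ t s, w = t ++ s ∧ s.length = l + 1 :=
      ⟨w.take (w.length - (l + 1)), w.drop (w.length - (l + 1)), by simp, by
        rw [List.length_drop]; omega⟩
    obtain _ | ⟨R, u⟩ := s
    · simp at hs
    have hul : u.length = l := by simpa using hs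
    have hsv : Valid T A c₀ (R :: u) := hval.of_suffix (List.suffix_append _ _)
    obtain ⟨u', hu', hlt⟩ := hsv.shrink (by rw [← hK, hs]; omega)
    set φ := reroot c₀ (R :: u) (R :: u') with hφ
    have hle : ∀ x, (φ x).2.length ≤ x.2.length :=
      length_reroot_le c₀ (by simpa using hlt.le)
    refine ih _ ?_ (η := fun x => φ (η x)) ⟨fun x hx => ?_, fun a ha => ?_⟩ rfl
    · rw [← hn]
      refine List.sum_lt_sum _ _ (fun x _ => hle _) ⟨x₀, hx₀, ?_⟩
      rw [hη, hφ, reroot_append]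
      simpa using hlt
    · simp only [h.1 x hx]
      exact reroot_nil ..
    · have h1 : φ ∘ QTerm.val η = QTerm.val fun x => φ (η x) := by
        funext t
        cases t with
        | var x => rfl
        | const c => exact reroot_nil ..
      rw [← h1, ← Atom.map_map]
      refine (h.2 a ha).reroot hu' fun x hx => ?_
      obtain ⟨y | c, hy, rfl⟩ := Atom.mem_terms_map.1 hx
      · rw [hul]
        exact hvars y (CQ.mem_vars.2 ⟨a, ha, hy⟩)
      · simp only [QTerm.val, List.length_nil, hul]
        omega

/-! ## Decidability of query answering -/

/-- The value of a key in an association list. -/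
def assoc {κ β : Type} [DecidableEq κ] (d : β) (l : List (κ × β)) (k : κ) : β :=
  l.foldr (fun p acc => if p.1 = k then p.2 else acc) d

theorem assoc_map {κ β : Type} [DecidableEq κ] {d : β} (f : κ → β) {l : List κ} {k : κ}
    (h : k ∈ l) : assoc d (l.map fun k => (k, f k)) k = f k := by
  induction l with
  | nil => simp at h
  | cons x l ih =>
    by_cases hx : x = k
    · simp [assoc, hx]
    · have : k ∈ l := by simpa [Ne.symm hx] using h
      simpa [assoc, hx] using ih this

/-- The assignments of elements of `vals` to the entries of `keys`. -/
def asgs {κ β : Type} (keys : List κ) (vals : List β) : List (List (κ × β)) :=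
  keys.foldr (fun k acc => acc.flatMap fun l => vals.map fun v => (k, v) :: l) [[]]

theorem map_mem_asgs {κ β : Type} (f : κ → β) {keys : List κ} {vals : List β}
    (h : ∀ k ∈ keys, f k ∈ vals) : keys.map (fun k => (k, f k)) ∈ asgs keys vals := by
  induction keys with
  | nil => simp [asgs]
  | cons k keys ih =>
    refine List.mem_flatMap.2 ⟨_, ih fun k hk => h k (List.mem_cons_of_mem _ hk), ?_⟩
    exact List.mem_map.2 ⟨f k, h k (by simp), rfl⟩

/-- The words over `L` that are at most as long as `fuel`. -/
def words (L : List Role) (fuel : List ℕ) : List (List Role) :=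
  fuel.foldr (fun _ acc => [] :: acc.flatMap fun w => L.map fun R => R :: w) [[]]

theorem mem_words {L : List Role} {fuel : List ℕ} : ∀ {w : List Role}, w.length ≤ fuel.length →
    (∀ R ∈ w, R ∈ L) → w ∈ words L fuel := by
  induction fuel with
  | nil =>
    intro w h _
    have : w = [] := by simpa using h
    simp [words, this]
  | cons n fuel ih =>
    intro w h hL
    change w ∈ [] :: (words L fuel).flatMap fun w => L.map fun R => R :: w
    cases w with
    | nil => simp
    | cons R w =>
      refine List.mem_cons_of_mem _ (List.mem_flatMap.2 ⟨w, ih (by simpa using h)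
        fun R hR => hL R (List.mem_cons_of_mem _ hR), ?_⟩)
      exact List.mem_map.2 ⟨R, hL R (by simp), rfl⟩

/-- The constants of a list of facts. -/
def adomList (A : List Fact) : List Const := A.flatMap Atom.termList

@[simp] theorem mem_adomList {A : List Fact} {c : Const} :
    c ∈ adomList A ↔ c ∈ adom A.toFinset := by
  simp [adomList, adom]

/-- The valuation represented by an association list. -/
def val (g : List (ℕ × Const)) : ℕ → Const := assoc .temp g

/-- The elements of the canonical model to be considered as values in matches. -/
def cands (T : TBox) (A : List Fact) (q : CQ) : List (Const × List Role) :=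
  (adomList A).flatMap fun c =>
    (words (genRoles T) ((genRoles T).map (fun _ => 0) ++ q.vars ++ [0])).map fun w => (c, w)

/-- The valuation in the canonical model represented by an association list. -/
def matchVal (q : CQ) (g : List (ℕ × Const)) (l : List (ℕ × Const × List Role)) (x : ℕ) :
    Const × List Role :=
  if x ∈ q.exVars then assoc (Const.temp, []) l x else (val g x, [])

theorem Atom.map_congr {τ τ' : Type} {f g : τ → τ'} {a : Atom τ} (h : ∀ t ∈ a.terms, f t = g t) :
    a.map f = a.map g := by
  cases a with
  | concept N t => simp [map, h t (by simp [terms])]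
  | role P t t' => simp [map, h t (by simp [terms]), h t' (by simp [terms])]

/-- A match of bounded depth takes its values among words over `genRoles T` attached to constants of
the ABox. The list of fuel in `cands` has length `q.depth T`, so the finite search misses none of
them. -/
theorem exists_match_iff {T : TBox} {A : List Fact} {q : CQ} {g : List (ℕ × Const)} :
    (∃ η, q.Match T A.toFinset (val g) η) ↔ ∃ l, l ∈ asgs q.vars (cands T A q) ∧
      ∀ a, a ∈ q.atoms → CanonSat T A.toFinset (a.map (QTerm.val (matchVal q g l))) := by
  constructor
  · rintro ⟨η, h⟩
    obtain ⟨η, h, hb⟩ := h.exists_bounded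
    refine ⟨q.vars.map fun x => (x, η x), map_mem_asgs η fun x hx => ?_, fun a ha => ?_⟩
    · obtain ⟨a, ha, hxa⟩ := CQ.mem_vars.1 hx
      have hm := Atom.mem_terms_map (g := QTerm.val η) (t := η x) |>.2 ⟨_, hxa, rfl⟩
      refine List.mem_flatMap.2 ⟨(η x).1, mem_adomList.2 ((h.2 a ha).mem_adom _ hm),
        List.mem_map.2 ⟨(η x).2, mem_words ?_ ((h.2 a ha).valid _ hm).mem_genRoles, rfl⟩⟩
      simpa [CQ.depth, add_assoc] using hb x hx
    · rw [Atom.map_congr (g := QTerm.val η)]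
      · exact h.2 a ha
      · rintro (x | c) ht
        · simp only [QTerm.val, matchVal]
          split_ifs with hx
          · exact assoc_map η (CQ.mem_vars.2 ⟨a, ha, ht⟩)
          · exact (h.1 x hx).symm
        · rfl
  · rintro ⟨l, -, hl⟩
    exact ⟨matchVal q g l, fun x hx => if_neg hx, hl⟩

section Instances

variable {α β τ τ' : Type} [Coded α] [Coded β] [Coded τ] [Coded τ']

instance rFun_assoc {κ : Type} [Coded κ] [DecidableEq κ] {d : α → β} {l : α → List (κ × β)}
    {k : α → κ} [hd : RFun d] [hl : RFun l] [hk : RFun k] :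
    RFun fun a => assoc (d a) (l a) (k a) := by
  have h : RFun fun x : β × List (κ × β) × κ => assoc x.1 x.2.1 x.2.2 := by
    unfold assoc
    infer_instance
  exact .comp (f := fun x : β × List (κ × β) × κ => assoc x.1 x.2.1 x.2.2)
    (g := fun a => (d a, l a, k a)) h inferInstance

instance rFun_val {g : α → List (ℕ × Const)} {x : α → ℕ} [RFun g] [RFun x] :
    RFun fun a => val (g a) (x a) := by
  unfold val
  infer_instance

instance rFun_asgs {κ : Type} [Coded κ] {k : α → List κ} {v : α → List β} [hk : RFun k]
    [hv : RFun v] : RFun fun a => asgs (k a) (v a) := by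
  have h : RFun fun x : List κ × List β => asgs x.1 x.2 := by
    unfold asgs
    infer_instance
  exact .comp₂ (f := asgs) h hk hv

instance rFun_words {L : α → List Role} {v : α → List ℕ} [hk : RFun L]
    [hv : RFun v] : RFun fun a => words (L a) (v a) := by
  have h : RFun fun x : List Role × List ℕ => words x.1 x.2 := by
    unfold words
    infer_instance
  exact .comp₂ (f := words) h hk hv

instance rFun_termList {f : α → Atom τ} [hf : RFun f] : RFun fun a => (f a).termList := by
  have : RFun fun x : Unit × Atom τ => x.2.termList := by
    apply RFun.atom_cases (h := fun _ f => Atom.termList f) <;> unfold Atom.termList <;>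
      infer_instance
  exact .comp (f := fun x : Unit × Atom τ => x.2.termList) (g := fun a => ((), f a)) this
    inferInstance

instance rFun_adomList {A : α → List Fact} [hA : RFun A] : RFun fun a => adomList (A a) := by
  have : RFun fun A : List Fact => adomList A := by
    have : RFun (Atom.termList : Fact → _) := rFun_termList (f := fun x => x)
    have : RFun fun x : List Fact × Fact => Atom.termList x.2 := inferInstance
    exact RFun.flatMap (l := fun A => A) (f := fun _ f => Atom.termList f)
  exact .comp (f := adomList) this hA

instance rFun_qTermVars {f : α → QTerm} [hf : RFun f] : RFun fun a => (f a).vars := by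
  have : RFun fun x : Unit × QTerm => x.2.vars := by
    apply RFun.qTerm_cases (h := fun _ f => QTerm.vars f) <;> unfold QTerm.vars <;>
      infer_instance
  exact .comp (f := fun x : Unit × QTerm => x.2.vars) (g := fun a => ((), f a)) this
    inferInstance

instance rFun_cqVars {q : α → CQ} [hq : RFun q] : RFun fun a => (q a).vars := by
  have : RFun fun q : CQ => q.vars := by
    unfold CQ.vars
    have : RFun fun x : (CQ × Atom QTerm) × QTerm => QTerm.vars x.2 := inferInstance
    have : RFun fun x : CQ × Atom QTerm => x.2.termList.flatMap QTerm.vars :=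
      RFun.flatMap (l := fun x : CQ × Atom QTerm => x.2.termList) (f := fun _ t => t.vars)
    infer_instance
  exact .comp (f := CQ.vars) this hq

instance rFun_cands {T : α → TBox} {A : α → List Fact} {q : α → CQ} [hT : RFun T] [hA : RFun A]
    [hq : RFun q] : RFun fun a => cands (T a) (A a) (q a) := by
  have h : RFun fun x : TBox × List Fact × CQ => cands x.1 x.2.1 x.2.2 := by
    unfold cands
    infer_instance
  exact .comp (f := fun x : TBox × List Fact × CQ => cands x.1 x.2.1 x.2.2)
    (g := fun a => (T a, A a, q a)) h inferInstance

instance rFun_matchVal {q : α → CQ} {g : α → List (ℕ × Const)}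
    {l : α → List (ℕ × Const × List Role)} {x : α → ℕ} [RFun q] [RFun g] [RFun l] [RFun x] :
    RFun fun a => matchVal (q a) (g a) (l a) (x a) := by
  unfold matchVal
  infer_instance

instance rFun_atomMap {h : α → τ → τ'} {f : α → Atom τ} [hh : RFun fun x : α × τ => h x.1 x.2]
    [hf : RFun f] : RFun fun a => (f a).map (h a) := by
  have h1 : RFun fun x : α × CName × τ => h x.1 x.2.2 :=
    .comp (f := fun x : α × τ => h x.1 x.2) (g := fun x : α × CName × τ => (x.1, x.2.2)) hh
      inferInstance
  have h2 : RFun fun x : α × ℕ × τ × τ => h x.1 x.2.2.1 :=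
    .comp (f := fun x : α × τ => h x.1 x.2) (g := fun x : α × ℕ × τ × τ => (x.1, x.2.2.1)) hh
      inferInstance
  have h3 : RFun fun x : α × ℕ × τ × τ => h x.1 x.2.2.2 :=
    .comp (f := fun x : α × τ => h x.1 x.2) (g := fun x : α × ℕ × τ × τ => (x.1, x.2.2.2)) hh
      inferInstance
  have : RFun fun x : α × Atom τ => x.2.map (h x.1) := by
    apply RFun.atom_cases (h := fun a f => Atom.map (h a) f) <;> unfold Atom.map <;> infer_instance
  exact .comp (f := fun x : α × Atom τ => x.2.map (h x.1)) (g := fun a => (a, f a)) this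
    inferInstance

theorem rFun_qTermVal : RFun fun x : (CQ × List (ℕ × Const) × List (ℕ × Const × List Role)) × QTerm =>
    QTerm.val (matchVal x.1.1 x.1.2.1 x.1.2.2) x.2 := by
  apply RFun.qTerm_cases (h := fun (x : CQ × List (ℕ × Const) × List (ℕ × Const × List Role)) t =>
    QTerm.val (matchVal x.1 x.2.1 x.2.2) t) <;> unfold QTerm.val <;> infer_instance

instance rFun_exists_match {T : α → TBox} {A : α → List Fact} {q : α → CQ}
    {g : α → List (ℕ × Const)} [hT : RFun T] [hA : RFun A] [hq : RFun q] [hg : RFun g] :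
    RFun fun a => ∃ η, (q a).Match (T a) (A a).toFinset (val (g a)) η := by
  have h0 : RFun fun x : (((TBox × List Fact × CQ × List (ℕ × Const)) ×
      List (ℕ × Const × List Role)) × Atom QTerm) × QTerm =>
      QTerm.val (matchVal x.1.1.1.2.2.1 x.1.1.1.2.2.2 x.1.1.2) x.2 :=
    .comp (f := fun x : (CQ × List (ℕ × Const) × List (ℕ × Const × List Role)) × QTerm =>
      QTerm.val (matchVal x.1.1 x.1.2.1 x.1.2.2) x.2)
      (g := fun x : (((TBox × List Fact × CQ × List (ℕ × Const)) ×
      List (ℕ × Const × List Role)) × Atom QTerm) × QTerm =>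
        ((x.1.1.1.2.2.1, x.1.1.1.2.2.2, x.1.1.2), x.2)) rFun_qTermVal inferInstance
  have h : RFun fun x : TBox × List Fact × CQ × List (ℕ × Const) =>
      ∃ η, x.2.2.1.Match x.1 x.2.1.toFinset (val x.2.2.2) η :=
    RFun.congr_prop fun _ => exists_match_iff
  exact .comp (f := fun x : TBox × List Fact × CQ × List (ℕ × Const) =>
      ∃ η, x.2.2.1.Match x.1 x.2.1.toFinset (val x.2.2.2) η)
    (g := fun a => (T a, A a, q a, g a)) h inferInstance

end Instances

/-- TBoxes satisfying the restriction of DL-Lite_A. -/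
abbrev DLTBox := {T : TBox // T.IsDLLiteA}

theorem Interp.satAtom_conceptAtom (I : Interp) {B : BasicConcept} {x : I.Dom} :
    (∃ y, I.satAtom (conceptAtom B x y)) ↔ x ∈ I.conceptExt B := by
  cases B with
  | atomic N => exact ⟨fun ⟨_, h⟩ => h, fun h => ⟨x, h⟩⟩
  | exist R => exact exists_congr fun y => I.satAtom_roleAtom R x y

theorem conceptAtom_map {τ τ' : Type} (g : τ → τ') (B : BasicConcept) (x y : τ) :
    (conceptAtom B x y).map g = conceptAtom B (g x) (g y) := by
  cases B with
  | atomic N => rfl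
  | exist R => exact roleAtom_map g R x y

theorem trueIn_disjConceptQuery {I : Interp} {B C : BasicConcept} {v : ℕ → Const} :
    (disjConceptQuery B C).TrueIn I v ↔ ∃ x, x ∈ I.conceptExt B ∧ x ∈ I.conceptExt C := by
  simp only [UCQ.TrueIn, disjConceptQuery, exists_eq_left, CQ.TrueIn,
    List.mem_cons, List.not_mem_nil, or_false, forall_eq_or_imp, forall_eq, conceptAtom_map]
  constructor
  · rintro ⟨η, -, h1, h2⟩
    exact ⟨η 0, I.satAtom_conceptAtom.1 ⟨_, h1⟩, I.satAtom_conceptAtom.1 ⟨_, h2⟩⟩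
  · rintro ⟨x, h1, h2⟩
    obtain ⟨y, hy⟩ := I.satAtom_conceptAtom.2 h1
    obtain ⟨z, hz⟩ := I.satAtom_conceptAtom.2 h2
    refine ⟨fun n => if n = 0 then x else if n = 1 then y else if n = 2 then z else
      I.const (v n), fun n hn => ?_, hy, hz⟩
    simp only [not_or] at hn
    simp [hn]

theorem trueIn_disjRoleQuery {I : Interp} {R S : Role} {v : ℕ → Const} :
    (disjRoleQuery R S).TrueIn I v ↔ ∃ x y, I.roleExt R x y ∧ I.roleExt S x y := by
  simp only [UCQ.TrueIn, disjRoleQuery, exists_eq_left, CQ.TrueIn,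
    List.mem_cons, List.not_mem_nil, or_false, forall_eq_or_imp, forall_eq, roleAtom_map,
    I.satAtom_roleAtom]
  constructor
  · rintro ⟨η, -, h1, h2⟩
    exact ⟨η 0, η 1, h1, h2⟩
  · rintro ⟨x, y, h1, h2⟩
    refine ⟨fun n => if n = 0 then x else if n = 1 then y else I.const (v n), fun n hn => ?_,
      h1, h2⟩
    simp only [not_or] at hn
    simp [hn]

theorem violates_funct_iff {T : TBox} {A : List Fact} {R : Role} :
    Violates T A.toFinset (.funct R) ↔ ∃ f, f ∈ A ∧ ∃ p, p ∈ factRoles f ∧ ∃ f', f' ∈ A ∧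
      ∃ p', p' ∈ factRoles f' ∧ p.1 = R ∧ p'.1 = R ∧ p.2.1 = p'.2.1 ∧ p.2.2 ≠ p'.2.2 := by
  constructor
  · rintro ⟨c, d, e, h1, h2, h3⟩
    exact ⟨_, List.mem_toFinset.1 h1, (R, c, d), mem_factRoles.2 rfl, _, List.mem_toFinset.1 h2,
      (R, c, e), mem_factRoles.2 rfl, rfl, rfl, rfl, h3⟩
  · rintro ⟨f, hf, ⟨S, c, d⟩, hp, f', hf', ⟨S', c', e⟩, hp', rfl, h1, h2, h3⟩
    simp only at h1 h2 h3
    subst h1 h2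
    exact ⟨_, _, _, List.mem_toFinset.2 (mem_factRoles.1 hp ▸ hf),
      List.mem_toFinset.2 (mem_factRoles.1 hp' ▸ hf'), h3⟩

theorem TBox.isDLLiteA_positive (T : TBox) : T.positive.IsDLLiteA := by
  intro R R₁ R₂ h
  simp [TBox.positive, TAssertion.isPositive] at h

theorem TBox.positive_eq_sift (T : TBox) :
    T.positive = sift (fun t => t.isPositive = true) T := by
  simp [TBox.positive, sift]

/-! ### Decidability of consistency, certain answers and violation -/

section Instances

variable {α β τ : Type} [Coded α] [Coded β] [Coded τ]

instance rFun_roleAtom {R : α → Role} {x y : α → τ} [hR : RFun R] [hx : RFun x] [hy : RFun y] :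
    RFun fun a => roleAtom (R a) (x a) (y a) := by
  have : RFun fun x : (τ × τ) × Role => roleAtom x.2 x.1.1 x.1.2 := by
    apply RFun.role_cases (h := fun (x : τ × τ) R => roleAtom R x.1 x.2) <;> unfold roleAtom <;>
      infer_instance
  exact .comp (f := fun x : (τ × τ) × Role => roleAtom x.2 x.1.1 x.1.2)
    (g := fun a => ((x a, y a), R a)) this inferInstance

instance rFun_conceptAtom {B : α → BasicConcept} {x y : α → τ} [hB : RFun B] [hx : RFun x]
    [hy : RFun y] : RFun fun a => conceptAtom (B a) (x a) (y a) := by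
  have : RFun fun x : (τ × τ) × BasicConcept => conceptAtom x.2 x.1.1 x.1.2 := by
    apply RFun.basicConcept_cases (h := fun (x : τ × τ) R => conceptAtom R x.1 x.2) <;>
      unfold conceptAtom <;> infer_instance
  exact .comp (f := fun x : (τ × τ) × BasicConcept => conceptAtom x.2 x.1.1 x.1.2)
    (g := fun a => ((x a, y a), B a)) this inferInstance

instance rFun_disjConceptQuery {B C : α → BasicConcept} [hB : RFun B] [hC : RFun C] :
    RFun fun a => disjConceptQuery (B a) (C a) := by
  unfold disjConceptQuery
  infer_instance

instance rFun_disjRoleQuery {B C : α → Role} [hB : RFun B] [hC : RFun C] :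
    RFun fun a => disjRoleQuery (B a) (C a) := by
  unfold disjRoleQuery
  infer_instance

instance rFun_violates_funct {A : α → List Fact} {T : α → TBox} {R : α → Role} [hA : RFun A]
    [hR : RFun R] : RFun fun a => Violates (T a) (A a).toFinset (.funct (R a)) := by
  -- Violation of functionality is read off the ABox alone, so any TBox may stand here.
  have h : RFun fun x : List Fact × Role => Violates [] x.1.toFinset (.funct x.2) :=
    RFun.congr_prop fun _ => violates_funct_iff
  exact .comp₂ (f := fun A R => Violates [] A.toFinset (.funct R)) h hA hR

instance rFun_trueIn_canon {T : α → TBox} {A : α → List Fact} {q : α → UCQ}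
    {g : α → List (ℕ × Const)} [hT : RFun T] [hA : RFun A] [hq : RFun q] [hg : RFun g] :
    RFun fun a => ∃ d, d ∈ q a ∧ ∃ η, d.Match (T a) (A a).toFinset (val (g a)) η := by
  have h : RFun fun x : TBox × List Fact × UCQ × List (ℕ × Const) =>
      ∃ d, d ∈ x.2.2.1 ∧ ∃ η, d.Match x.1 x.2.1.toFinset (val x.2.2.2) η := inferInstance
  exact .comp (f := fun x : TBox × List Fact × UCQ × List (ℕ × Const) =>
      ∃ d, d ∈ x.2.2.1 ∧ ∃ η, d.Match x.1 x.2.1.toFinset (val x.2.2.2) η)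
    (g := fun a => (T a, A a, q a, g a)) h inferInstance

/-- A failure of disjointness in the canonical model is the truth of a closed conjunctive query
there, which the bounded search for matches decides. -/
theorem rFun_tOk : RFun fun x : (TBox × List Fact) × TAssertion =>
    TOk x.1.1 x.1.2.toFinset x.2 := by
  apply RFun.tAssertion_cases (h := fun (x : TBox × List Fact) t => TOk x.1 x.2.toFinset t) <;>
    unfold TOk
  · infer_instance
  · infer_instance
  · simp only [← trueIn_disjConceptQuery (v := val []), trueIn_canon_iff]
    infer_instance
  · simp only [← trueIn_disjRoleQuery (v := val []), trueIn_canon_iff]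
    infer_instance
  · infer_instance

instance rFun_consistent {T : α → DLTBox} {A : α → List Fact} [hT : RFun T] [hA : RFun A] :
    RFun fun a => Consistent (T a).1 (A a).toFinset := by
  have h0 : RFun fun x : (DLTBox × List Fact) × TAssertion => TOk x.1.1.1 x.1.2.toFinset x.2 :=
    .comp (f := fun x : (TBox × List Fact) × TAssertion => TOk x.1.1 x.1.2.toFinset x.2)
      (g := fun x : (DLTBox × List Fact) × TAssertion => ((x.1.1.1, x.1.2), x.2)) rFun_tOk
      inferInstance
  have h : RFun fun x : DLTBox × List Fact => Consistent x.1.1 x.2.toFinset :=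
    RFun.congr_prop fun x => consistent_iff x.1.2
  exact .comp₂ (f := fun (T : DLTBox) A => Consistent T.1 A.toFinset) h hT hA

instance rFun_certain {T : α → DLTBox} {A : α → List Fact} {q : α → UCQ}
    {g : α → List (ℕ × Const)} [hT : RFun T] [hA : RFun A] [hq : RFun q] [hg : RFun g] :
    RFun fun a => (q a).Certain (T a).1 (A a).toFinset (val (g a)) :=
  RFun.congr_prop fun a => certain_iff (T a).2

theorem rFun_isPositive : RFun fun t : TAssertion => t.isPositive = true := by
  have : RFun fun x : Unit × TAssertion => x.2.isPositive = true := by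
    apply RFun.tAssertion_cases (h := fun _ (t : TAssertion) => t.isPositive = true) <;>
      simp only [TAssertion.isPositive, Bool.false_eq_true] <;> infer_instance
  exact .comp (f := fun x : Unit × TAssertion => x.2.isPositive = true) (g := fun t => ((), t))
    this inferInstance

instance rFun_positive {T : α → TBox} [hT : RFun T] : RFun fun a => (T a).positive := by
  have h0 : RFun fun x : TBox × TAssertion => x.2.isPositive = true :=
    .comp (f := fun t : TAssertion => t.isPositive = true) (g := fun x : TBox × TAssertion => x.2)
      rFun_isPositive inferInstance
  have h : RFun fun T : TBox => T.positive :=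
    RFun.congr (fun T => T.positive_eq_sift)
      (hg := RFun.sift (p := fun (_ : TBox) t => t.isPositive = true) (l := fun T => T))
  exact .comp (f := TBox.positive) h hT

instance rFun_positive' {T : α → TBox} [hT : RFun T] :
    RFun fun a => (⟨(T a).positive, (T a).isDLLiteA_positive⟩ : DLTBox) :=
  RFun.subtypeMk inferInstance _

/-- The queries for negative inclusions are closed, so one valuation represents all of them. The
positive part of a TBox has no functionality assertions and satisfies the DL-Lite_A restriction for
free. -/
theorem rFun_violates : RFun fun x : (TBox × List Fact) × TAssertion =>
    Violates x.1.1 x.1.2.toFinset x.2 := by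
  have h : ∀ {α : Type} [Coded α] {T : α → TBox} {A : α → List Fact} {q : α → UCQ}
      [RFun T] [RFun A] [RFun q], RFun fun a =>
        UCQ.Certain (T a).positive (A a).toFinset (q a) (val []) := fun {α _ T A q _ _ _} =>
    rFun_certain (T := fun a => (⟨(T a).positive, (T a).isDLLiteA_positive⟩ : DLTBox))
      (g := fun _ => [])
  apply RFun.tAssertion_cases (h := fun (x : TBox × List Fact) t => Violates x.1 x.2.toFinset t)
  · unfold Violates
    infer_instance
  · unfold Violates
    infer_instance
  · refine RFun.congr_prop (q := fun x : (TBox × List Fact) × BasicConcept × BasicConcept =>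
      UCQ.Certain x.1.1.positive x.1.2.toFinset (disjConceptQuery x.2.1 x.2.2) (val [])) (hg := h)
      fun x => ?_
    simp only [Violates, UCQ.Certain, trueIn_disjConceptQuery]
    exact ⟨fun h => h (val []), fun h _ => h⟩
  · refine RFun.congr_prop (q := fun x : (TBox × List Fact) × Role × Role =>
      UCQ.Certain x.1.1.positive x.1.2.toFinset (disjRoleQuery x.2.1 x.2.2) (val [])) (hg := h)
      fun x => ?_
    simp only [Violates, UCQ.Certain, trueIn_disjRoleQuery]
    exact ⟨fun h => h (val []), fun h _ => h⟩
  · infer_instance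

end Instances

/-! ### Repairs -/

/-- The labels of the violated assertions. -/
noncomputable def violList (T : TBox) (A : List Fact) : List Const :=
  (sift (Violates T A.toFinset) T).map .label

theorem mem_violList {T : TBox} {A : List Fact} {d : Const} :
    d ∈ violList T A ↔ d ∈ viol T A.toFinset := by
  simp only [violList, List.mem_map, mem_sift, viol, Set.mem_ofPred_eq]
  exact exists_congr fun t => by rw [and_assoc, and_comm (b := _ = d), eq_comm (b := d)]

/-- The bold repairs. -/
noncomputable def boldList (T : TBox) (A : List Fact) : List (List Fact) :=
  sift (fun l => Consistent T l.toFinset ∧ ∀ m, m ∈ A.sublists' → Consistent T m.toFinset →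
    (∀ f, f ∈ l → f ∈ m) → ∀ f, f ∈ m → f ∈ l) A.sublists'

theorem subset_toFinset_iff {A : List Fact} {B : ABox} :
    B ⊆ A.toFinset ↔ ∃ l ∈ A.sublists', l.toFinset = B := by
  constructor
  · intro h
    refine ⟨A.filter (· ∈ B), List.mem_sublists'.2 List.filter_sublist, ?_⟩
    ext f
    simp only [List.mem_toFinset, List.mem_filter, decide_eq_true_eq, and_iff_right_iff_imp]
    exact fun hf => List.mem_toFinset.1 (h hf)
  · rintro ⟨l, hl, rfl⟩ f hf
    exact List.mem_toFinset.2 ((List.mem_sublists'.1 hl).subset (List.mem_toFinset.1 hf))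

theorem isBoldRepair_iff {T : TBox} {A : List Fact} {R : ABox} :
    IsBoldRepair T A.toFinset R ↔ ∃ l ∈ boldList T A, l.toFinset = R := by
  constructor
  · rintro ⟨⟨h1, h2⟩, h3⟩
    obtain ⟨l, hl, rfl⟩ := subset_toFinset_iff.1 h1
    refine ⟨l, mem_sift.2 ⟨hl, h2, fun m hm hc h f hf => ?_⟩, rfl⟩
    have := h3 ⟨subset_toFinset_iff.2 ⟨m, hm, rfl⟩, hc⟩ fun f hf => by
      simpa using h f (by simpa using hf)
    simpa using this (List.mem_toFinset.2 hf)
  · rintro ⟨l, hl, rfl⟩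
    obtain ⟨h1, h2, h3⟩ := mem_sift.1 hl
    refine ⟨⟨subset_toFinset_iff.2 ⟨l, h1, rfl⟩, h2⟩, ?_⟩
    rintro B ⟨h4, h5⟩ h6
    obtain ⟨m, hm, rfl⟩ := subset_toFinset_iff.1 h4
    intro f hf
    simpa using h3 m hm h5 (fun f hf => by simpa using h6 (List.mem_toFinset.2 hf)) f
      (by simpa using hf)

/-- The repairs. -/
noncomputable def repairList : RepairKind → TBox → List Fact → List (List Fact)
  | .bold, T, A => boldList T A
  | .certain, T, A =>
    sift (fun _ => boldList T A ≠ []) [sift (fun f => ∀ l, l ∈ boldList T A → f ∈ l) A]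

theorem isRepair_iff {k : RepairKind} {T : TBox} {A : List Fact} {R : ABox} :
    IsRepair k T A.toFinset R ↔ ∃ l ∈ repairList k T A, l.toFinset = R := by
  cases k with
  | bold => exact isBoldRepair_iff
  | certain =>
    have hmem : ∀ f, f ∈ (⋂ B ∈ {B : ABox | IsBoldRepair T A.toFinset B}, (B : Set Fact)) ↔
        ∀ l ∈ boldList T A, f ∈ l := by
      intro f
      simp only [Set.mem_iInter, Set.mem_ofPred_eq, isBoldRepair_iff]
      exact ⟨fun h l hl => by simpa using h _ ⟨l, hl, rfl⟩,
        fun h B ⟨l, hl, hB⟩ => by simpa [← hB] using h l hl⟩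
    change (R : Set Fact) = _ ↔ _
    rw [Set.ext_iff]
    simp only [hmem, repairList, mem_sift, List.mem_singleton, and_assoc, exists_eq_left]
    by_cases hb : boldList T A = []
    · simp only [hb, List.not_mem_nil, false_imp_iff, implies_true, iff_true, ne_eq,
        not_true_eq_false, false_and, iff_false]
      intro h
      -- Without bold repairs the intersection would be the set of all facts, which is no ABox; this
      -- is why `repairList` is empty in that case.
      have : Infinite Fact := Infinite.of_injective (fun n => Atom.concept .state (Const.val n))
        fun m n h => by simpa using h
      exact Set.infinite_univ (R.finite_toSet.subset fun f _ => h f)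
    · obtain ⟨l, hl⟩ := List.exists_mem_of_ne_nil _ hb
      have hlA : ∀ f ∈ l, f ∈ A := fun f hf =>
        (List.mem_sublists'.1 (mem_sift.1 hl).1).subset hf
      simp only [ne_eq, hb, not_false_eq_true, true_and]
      constructor
      · intro h
        ext f
        rw [List.mem_toFinset, mem_sift, ← h f]
        exact ⟨fun h => h.2, fun hf => ⟨hlA f ((h f).1 hf l hl), hf⟩⟩
      · rintro rfl f
        simp only [Finset.mem_coe, List.mem_toFinset, mem_sift]
        exact ⟨fun h => h.2, fun hf => ⟨hlA f (hf l hl), hf⟩⟩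

section Instances

variable {α : Type} [Coded α]

instance rFun_violList {T : α → TBox} {A : α → List Fact} [hT : RFun T] [hA : RFun A] :
    RFun fun a => violList (T a) (A a) := by
  have h0 : RFun fun x : (TBox × List Fact) × TAssertion => Violates x.1.1 x.1.2.toFinset x.2 :=
    rFun_violates
  have h : RFun fun x : TBox × List Fact => violList x.1 x.2 := by
    unfold violList
    have : RFun fun x : TBox × List Fact => sift (Violates x.1 x.2.toFinset) x.1 :=
      RFun.sift (p := fun (x : TBox × List Fact) t => Violates x.1 x.2.toFinset t)
    have : RFun fun x : (TBox × List Fact) × TAssertion => Const.label x.2 := inferInstance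
    exact RFun.map (f := fun _ t => Const.label t)
  exact .comp₂ (f := violList) h hT hA

instance rFun_boldList {T : α → DLTBox} {A : α → List Fact} [hT : RFun T] [hA : RFun A] :
    RFun fun a => boldList (T a).1 (A a) := by
  have h : RFun fun x : DLTBox × List Fact => boldList x.1.1 x.2 := by
    unfold boldList
    infer_instance
  exact .comp₂ (f := fun (T : DLTBox) A => boldList T.1 A) h hT hA

instance rFun_repairList {k : RepairKind} {T : α → DLTBox} {A : α → List Fact} [hT : RFun T]
    [hA : RFun A] : RFun fun a => repairList k (T a).1 (A a) := by
  have h : RFun fun x : DLTBox × List Fact => repairList k x.1.1 x.2 := by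
    cases k <;> unfold repairList <;> infer_instance
  exact .comp₂ (f := fun (T : DLTBox) A => repairList k T.1 A) h hT hA

end Instances

/-! ### Queries of the epistemic language -/

theorem val_cons (x : ℕ) (d : Const) (g : List (ℕ × Const)) :
    val ((x, d) :: g) = Function.update (val g) x d := by
  funext y
  by_cases h : y = x
  · subst h
    simp [val, assoc]
  · simp [val, assoc, h, Ne.symm h]

/-- The rules for the evaluation of queries. A judgment consists of a TBox, an ABox, a query, a
valuation and the truth value. -/
def holdsRule (j : DLTBox × List Fact × ECQ × List (ℕ × Const) × Prop)
    (l : List (DLTBox × List Fact × ECQ × List (ℕ × Const) × Prop)) : Prop :=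
  (∃ q : UCQ, j.2.2.1 = .ucq q ∧ l = [] ∧
    (j.2.2.2.2 ↔ q.Certain j.1.1 j.2.1.toFinset (val j.2.2.2.1))) ∨
  (∃ Q, j.2.2.1 = .neg Q ∧ l = [(j.1, j.2.1, Q, j.2.2.2.1, ¬ j.2.2.2.2)]) ∨
  (∃ Q Q' : ECQ, ∃ b b' : Prop, j.2.2.1 = .and Q Q' ∧ (j.2.2.2.2 ↔ b ∧ b') ∧
    l = [(j.1, j.2.1, Q, j.2.2.2.1, b), (j.1, j.2.1, Q', j.2.2.2.1, b')]) ∨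
  ∃ (x : ℕ) (Q : ECQ) (D : List Const), j.2.2.1 = .ex x Q ∧
    (j.2.2.2.2 ↔ ∃ d, d ∈ adomList j.2.1 ∧ d ∈ D) ∧
    l = (adomList j.2.1).map fun d => (j.1, j.2.1, Q, (x, d) :: j.2.2.2.1, d ∈ D)

theorem der_holdsRule_sound {j : DLTBox × List Fact × ECQ × List (ℕ × Const) × Prop}
    (h : Der holdsRule j) :
    j.2.2.2.2 ↔ j.2.2.1.Holds j.1.1 j.2.1.toFinset (val j.2.2.2.1) := by
  induction h with
  | intro j l h _ ih =>
    obtain ⟨T, A, Q, g, b⟩ := j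
    rcases h with ⟨q, h1, rfl, h2⟩ | ⟨Q', h1, rfl⟩ | ⟨Q₁, Q₂, b₁, b₂, h1, h2, rfl⟩ |
      ⟨x, Q', D, h1, h2, rfl⟩ <;> simp only at * <;> subst h1
    · exact h2
    · have := ih (T, A, Q', g, ¬ b) (by simp)
      simp only [ECQ.Holds] at this ⊢
      tauto
    · have h3 := ih (T, A, Q₁, g, b₁) (by simp)
      have h4 := ih (T, A, Q₂, g, b₂) (by simp)
      simp only [ECQ.Holds] at h3 h4 ⊢
      tauto
    · rw [h2]
      refine exists_congr fun d => and_congr_right_iff.2 ?_ |>.trans (by rw [mem_adomList])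
      intro hd
      have := ih (T, A, Q', (x, d) :: g, d ∈ D) (List.mem_map.2 ⟨d, hd, rfl⟩)
      rwa [val_cons] at this

theorem der_holdsRule_complete (T : DLTBox) (A : List Fact) (Q : ECQ) : ∀ (g : List (ℕ × Const)),
    Der holdsRule (T, A, Q, g, Q.Holds T.1 A.toFinset (val g)) := by
  induction Q with
  | ucq q => exact fun g => .intro _ [] (.inl ⟨q, rfl, rfl, Iff.rfl⟩) (by simp)
  | neg Q ih =>
    refine fun g => .intro _ _ (.inr (.inl ⟨Q, rfl, rfl⟩)) ?_
    simpa [ECQ.Holds] using ih g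
  | and Q Q' ih ih' =>
    refine fun g => .intro _ _ (.inr (.inr (.inl ⟨Q, Q', _, _, rfl, Iff.rfl, rfl⟩))) ?_
    simpa using ⟨ih g, ih' g⟩
  | ex x Q ih =>
    intro g
    -- The rule guesses the list of constants for which the body is true. With the correct list, the
    -- truth value in each premise is the right one.
    refine .intro _ _ (.inr (.inr (.inr ⟨x, Q, sift (fun d => Q.Holds T.1 A.toFinset
      (val ((x, d) :: g))) (adomList A), rfl, ?_, rfl⟩))) fun j hj => ?_
    · simp [ECQ.Holds, val_cons]
    · obtain ⟨d, hd, rfl⟩ := List.mem_map.1 hj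
      have : (d ∈ sift (fun d => Q.Holds T.1 A.toFinset (val ((x, d) :: g))) (adomList A)) =
          Q.Holds T.1 A.toFinset (val ((x, d) :: g)) := by
        rw [mem_sift]
        exact propext (and_iff_right hd)
      simp only [this]
      exact ih _

/-- Judgments carry a truth value and exactly the correct one is derivable, so truth and falsity are
both enumerable and the query is decidable. -/
theorem rFun_holds : RFun fun x : DLTBox × List Fact × ECQ × List (ℕ × Const) =>
    x.2.2.1.Holds x.1.1 x.2.1.toFinset (val x.2.2.2) := by
  have hR : RE (Der holdsRule) := RE.der (by unfold holdsRule; infer_instance)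
  have h : ∀ b : Prop, RE fun x : DLTBox × List Fact × ECQ × List (ℕ × Const) =>
      Der holdsRule (x.1, x.2.1, x.2.2.1, x.2.2.2, b) := fun b =>
    .comp (p := Der holdsRule) (f := fun x : DLTBox × List Fact × ECQ × List (ℕ × Const) =>
      (x.1, x.2.1, x.2.2.1, x.2.2.2, b)) hR inferInstance
  refine .of_re (RE.congr (fun x => ?_) (hq := h True)) (RE.congr (fun x => ?_) (hq := h False))
  · constructor
    · intro hx
      have := der_holdsRule_complete x.1 x.2.1 x.2.2.1 x.2.2.2
      rwa [eq_true hx] at this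
    · exact fun hx => (der_holdsRule_sound hx).1 trivial
  · constructor
    · intro hx
      have := der_holdsRule_complete x.1 x.2.1 x.2.2.1 x.2.2.2
      rwa [eq_false hx] at this
    · exact fun hx h => (der_holdsRule_sound hx).2 h

instance rFun_holds' {α : Type} [Coded α] {T : α → DLTBox} {A : α → List Fact} {Q : α → ECQ}
    {g : α → List (ℕ × Const)} [hT : RFun T] [hA : RFun A] [hQ : RFun Q] [hg : RFun g] :
    RFun fun a => (Q a).Holds (T a).1 (A a).toFinset (val (g a)) :=
  .comp (f := fun x : DLTBox × List Fact × ECQ × List (ℕ × Const) =>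
    x.2.2.1.Holds x.1.1 x.2.1.toFinset (val x.2.2.2)) (g := fun a => (T a, A a, Q a, g a))
    rFun_holds inferInstance

/-! ## Invariance under renamings of constants -/

/-- The constants of a term. -/
def QTerm.consts : QTerm → List Const
  | .var _ => []
  | .const c => [c]

/-- The constants of a query. -/
def UCQ.consts (q : UCQ) : List Const :=
  q.flatMap fun d => d.atoms.flatMap fun a => a.termList.flatMap QTerm.consts

theorem UCQ.mem_consts {q : UCQ} {c : Const} :
    c ∈ q.consts ↔ ∃ d ∈ q, ∃ a ∈ d.atoms, QTerm.const c ∈ a.terms := by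
  simp only [consts, List.mem_flatMap, Atom.mem_termList]
  refine exists_congr fun d => and_congr_right fun _ => exists_congr fun a =>
    and_congr_right fun _ => ?_
  constructor
  · rintro ⟨_ | _, h1, h2⟩
    · simp [QTerm.consts] at h2
    · simp only [QTerm.consts, List.mem_singleton] at h2
      exact h2 ▸ h1
  · exact fun h => ⟨_, h, by simp [QTerm.consts]⟩

/-- The constants of the query are among `C`. -/
def ECQ.ConstsIn (C : List Const) : ECQ → Prop
  | .ucq q => ∀ c, c ∈ q.consts → c ∈ C
  | .neg Q => Q.ConstsIn C
  | .and Q Q' => Q.ConstsIn C ∧ Q'.ConstsIn C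
  | .ex _ Q => Q.ConstsIn C

theorem ECQ.ConstsIn.mono {C C' : List Const} (h : C ⊆ C') {Q : ECQ} (hQ : Q.ConstsIn C) :
    Q.ConstsIn C' := by
  induction Q with
  | ucq q => exact fun c hc => h (hQ c hc)
  | neg Q ih => exact ih hQ
  | and Q Q' ih ih' => exact ⟨ih hQ.1, ih' hQ.2⟩
  | ex x Q ih => exact ih hQ

theorem ECQ.exists_constsIn (Q : ECQ) : ∃ C, Q.ConstsIn C := by
  induction Q with
  | ucq q => exact ⟨q.consts, fun _ h => h⟩
  | neg Q ih => exact ih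
  | and Q Q' ih ih' =>
    obtain ⟨C, hC⟩ := ih
    obtain ⟨C', hC'⟩ := ih'
    exact ⟨C ++ C', hC.mono (by simp), hC'.mono (by simp)⟩
  | ex x Q ih => exact ih

theorem Atom.map_id {τ : Type} (a : Atom τ) : a.map (fun x => x) = a := by cases a <;> rfl

theorem Atom.map_symm_map (π : Equiv.Perm Const) (f : Fact) : (f.map π.symm).map π = f := by
  rw [Atom.map_map]
  simpa [Function.comp_def] using f.map_id

theorem Atom.map_map_symm (π : Equiv.Perm Const) (f : Fact) : (f.map π).map π.symm = f := by
  rw [Atom.map_map]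
  simpa [Function.comp_def] using f.map_id

/-- The renaming of an ABox. -/
def permA (π : Equiv.Perm Const) (A : ABox) : ABox := A.image (Atom.map π)

theorem mem_permA {π : Equiv.Perm Const} {A : ABox} {f : Fact} :
    f ∈ permA π A ↔ f.map π.symm ∈ A := by
  rw [permA, Finset.mem_image]
  constructor
  · rintro ⟨g, hg, rfl⟩
    rwa [Atom.map_map_symm]
  · exact fun h => ⟨_, h, Atom.map_symm_map π f⟩

theorem map_mem_permA {π : Equiv.Perm Const} {A : ABox} {f : Fact} :
    f.map π ∈ permA π A ↔ f ∈ A := by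
  rw [mem_permA, Atom.map_map_symm]

@[simp] theorem permA_symm_permA (π : Equiv.Perm Const) (A : ABox) :
    permA π.symm (permA π A) = A := by
  ext f
  rw [mem_permA, mem_permA, Equiv.symm_symm, Atom.map_map_symm]

@[simp] theorem permA_permA_symm (π : Equiv.Perm Const) (A : ABox) :
    permA π (permA π.symm A) = A := permA_symm_permA π.symm A

theorem permA_subset_iff {π : Equiv.Perm Const} {A B : ABox} :
    permA π A ⊆ B ↔ A ⊆ permA π.symm B := by
  constructor
  · exact fun h f hf => mem_permA.2 (h (map_mem_permA.2 hf))
  · intro h f hf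
    have := mem_permA.1 (h (mem_permA.1 hf))
    rwa [Equiv.symm_symm, Atom.map_symm_map] at this

theorem permA_mono {π : Equiv.Perm Const} {A B : ABox} (h : A ⊆ B) : permA π A ⊆ permA π B :=
  Finset.image_subset_image h

theorem mem_adom_permA {π : Equiv.Perm Const} {A : ABox} {c : Const} :
    π c ∈ adom (permA π A) ↔ c ∈ adom A := by
  constructor
  · rintro ⟨f, hf, hc⟩
    exact ⟨_, mem_permA.1 hf, Atom.mem_terms_map.2 ⟨_, hc, π.symm_apply_apply c⟩⟩
  · rintro ⟨f, hf, hc⟩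
    exact ⟨_, map_mem_permA.2 hf, Atom.mem_terms_map.2 ⟨_, hc, rfl⟩⟩

/-- The interpretation with renamed constants. -/
def Interp.perm (I : Interp) (π : Equiv.Perm Const) : Interp where
  Dom := I.Dom
  const c := I.const (π.symm c)
  const_injective := I.const_injective.comp π.symm.injective
  concept := I.concept
  role := I.role

section Perm

variable {π : Equiv.Perm Const} {I : Interp} {T : TBox} {A : ABox}

theorem Interp.IsModel.perm (h : I.IsModel T A) : (I.perm π).IsModel T (permA π A) := by
  refine ⟨fun t ht => ?_, fun f hf => ?_⟩
  · have h1 : ∀ R, (I.perm π).roleExt R = I.roleExt R := fun R => by cases R <;> rfl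
    have h2 : ∀ B, (I.perm π).conceptExt B = I.conceptExt B := fun B => by
      cases B with
      | atomic N => rfl
      | exist R => cases R <;> rfl
    have := h.1 t ht
    cases t <;> simp only [Interp.satT, h1, h2] at this ⊢ <;> exact this
  · have := h.2 _ (mem_permA.1 hf)
    cases f <;> exact this

theorem Consistent.perm (h : Consistent T A) : Consistent T (permA π A) := by
  obtain ⟨I, hI⟩ := h
  exact ⟨_, hI.perm⟩

/-- Renaming the constants of an interpretation leaves its domain and extensions alone. Constants of
the query denote the same objects as before because `π` fixes them. -/
theorem UCQ.TrueIn.perm {C : List Const} {q : UCQ} {v v' : ℕ → Const} (hq : ∀ c ∈ q.consts, c ∈ C)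
    (hπ : ∀ c ∈ C, π c = c) (hv : ∀ x ∈ q.fv, v' x = π (v x)) (h : q.TrueIn (I.perm π) v') :
    q.TrueIn I v := by
  obtain ⟨d, hd, η, h1, h2⟩ := h
  classical
  -- Unquantified variables are reset to `v`: the two valuations correspond only on the free
  -- variables of `q`, while a match must agree with the valuation at every unquantified variable.
  let η' : ℕ → I.Dom := fun x => if x ∈ d.exVars then η x else I.const (v x)
  refine ⟨d, hd, η', fun x hx => if_neg hx, fun a ha => ?_⟩
  have h3 : a.map (QTerm.eval I η') = a.map (QTerm.eval (I.perm π) η) := by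
    refine Atom.map_congr fun t ht => ?_
    cases t with
    | var x =>
      by_cases hx : x ∈ d.exVars
      · exact if_pos hx
      · have := h1 x hx
        simp only [QTerm.eval, η', hx, if_false, this, Interp.perm]
        rw [hv x ⟨d, hd, ⟨a, ha, ht⟩, hx⟩, Equiv.symm_apply_apply]
    | const c =>
      have hc : c ∈ C := hq c (UCQ.mem_consts.2 ⟨d, hd, a, ha, ht⟩)
      simp only [QTerm.eval, Interp.perm]
      rw [π.symm_apply_eq.2 (hπ c hc).symm]
  rw [h3]
  have := h2 a ha
  cases a <;> exact this

theorem UCQ.Certain.perm {C : List Const} {q : UCQ} {v v' : ℕ → Const} (hq : ∀ c ∈ q.consts, c ∈ C)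
    (hπ : ∀ c ∈ C, π c = c) (hv : ∀ x ∈ q.fv, v' x = π (v x))
    (h : q.Certain T (permA π A) v') : q.Certain T A v :=
  fun _ hI => (h _ hI.perm).perm hq hπ hv

/-- Genericity of queries. Certain answers are transported along `π` and along its inverse, and
quantifiers cause no difficulty because the renaming maps one active domain onto the other. -/
theorem holds_perm {C : List Const} {Q : ECQ} : ∀ {v v' : ℕ → Const}, Q.ConstsIn C →
    (∀ c ∈ C, π c = c) → (∀ x ∈ Q.fv, v' x = π (v x)) →
    (Q.Holds T (permA π A) v' ↔ Q.Holds T A v) := by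
  induction Q with
  | ucq q =>
    intro v v' hq hπ hv
    refine ⟨fun h => UCQ.Certain.perm hq hπ hv h, fun h => ?_⟩
    refine UCQ.Certain.perm (π := π.symm) (v' := v) hq
      (fun c hc => π.symm_apply_eq.2 (hπ c hc).symm) (fun x hx => ?_) ?_
    · rw [hv x hx, Equiv.symm_apply_apply]
    · rw [permA_symm_permA]
      exact h
  | neg Q ih => exact fun hq hπ hv => not_congr (ih hq hπ hv)
  | and Q Q' ih ih' =>
    exact fun hq hπ hv => and_congr (ih hq.1 hπ fun x hx => hv x (.inl hx))
      (ih' hq.2 hπ fun x hx => hv x (.inr hx))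
  | ex x Q ih =>
    intro v v' hq hπ hv
    have key : ∀ d, Q.Holds T (permA π A) (Function.update v' x (π d)) ↔
        Q.Holds T A (Function.update v x d) := fun d => ih hq hπ fun y hy => by
      by_cases h : y = x
      · subst h
        simp
      · simp only [Function.update_of_ne h]
        exact hv y ⟨hy, h⟩
    constructor
    · rintro ⟨d, hd, h⟩
      obtain ⟨c, rfl⟩ := π.surjective d
      exact ⟨c, mem_adom_permA.1 hd, (key c).1 h⟩
    · rintro ⟨c, hc, h⟩
      exact ⟨π c, mem_adom_permA.2 hc, (key c).2 h⟩

theorem IsBoldRepair.perm {R : ABox} (h : IsBoldRepair T A R) :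
    IsBoldRepair T (permA π A) (permA π R) := by
  refine ⟨⟨permA_mono h.1.1, h.1.2.perm⟩, ?_⟩
  rintro B ⟨h1, h2⟩ h3
  have := h.2 (y := permA π.symm B) ⟨by simpa using permA_mono (π := π.symm) h1, h2.perm⟩
    (permA_subset_iff.1 h3)
  simpa using permA_mono (π := π) this

theorem IsRepair.perm {k : RepairKind} {R : ABox} (h : IsRepair k T A R) :
    IsRepair k T (permA π A) (permA π R) := by
  cases k with
  | bold => exact IsBoldRepair.perm h
  | certain =>
    have h1 : ∀ f, f ∈ R ↔ ∀ B, IsBoldRepair T A B → f ∈ B := fun f => by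
      rw [← Finset.mem_coe, show (R : Set Fact) = _ from h]
      simp
    change (permA π R : Set Fact) = _
    ext f
    simp only [Finset.mem_coe, mem_permA, h1, Set.mem_iInter, Set.mem_ofPred_eq]
    constructor
    · intro hf B hB
      have := hf (permA π.symm B) (by simpa using hB.perm (π := π.symm))
      rwa [mem_permA, Equiv.symm_symm, Atom.map_symm_map] at this
    · intro hf B hB
      exact mem_permA.1 (hf _ hB.perm)

theorem roleAtom_mem_permA {R : Role} {c d : Const} :
    roleAtom R c d ∈ permA π A ↔ roleAtom R (π.symm c) (π.symm d) ∈ A := by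
  rw [mem_permA, roleAtom_map]

theorem Violates.perm {t : TAssertion} (h : Violates T A t) : Violates T (permA π A) t := by
  have key : ∀ {q : UCQ}, q.consts = [] → q.fv = ∅ →
      (∀ v, q.Certain T.positive A v) → ∀ v, q.Certain T.positive (permA π A) v := by
    intro q hq hv h v
    refine UCQ.Certain.perm (π := π.symm) (C := []) (v' := v) (by simp [hq]) (by simp) (by simp [hv]) ?_
    simpa using h v
  cases t with
  | funct R =>
    obtain ⟨c, d, e, h1, h2, h3⟩ := h
    exact ⟨π c, π d, π e, by simpa [roleAtom_mem_permA] using h1,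
      by simpa [roleAtom_mem_permA] using h2, fun h => h3 (π.injective h)⟩
  | disjConcept B C =>
    refine key ?_ ?_ h
    · rcases B with _ | (_ | _) <;> rcases C with _ | (_ | _) <;>
        rfl
    · rcases B with _ | (_ | _) <;> rcases C with _ | (_ | _) <;> ext x <;>
        simp [UCQ.fv, CQ.fv, disjConceptQuery, conceptAtom, roleAtom, Atom.terms] <;> omega
  | disjRole R S =>
    refine key ?_ ?_ h
    · rcases R with _ | _ <;> rcases S with _ | _ <;>
        rfl
    · rcases R with _ | _ <;> rcases S with _ | _ <;> ext x <;>
        simp [UCQ.fv, CQ.fv, disjRoleQuery, roleAtom, Atom.terms] <;> omega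
  | _ => exact h

/-- The labels name assertions of the TBox and are not renamed; the violations themselves are
expressed without constants. -/
theorem viol_perm : viol T (permA π A) = viol T A := by
  have key : ∀ {π : Equiv.Perm Const} {A : ABox}, viol T A ⊆ viol T (permA π A) := by
    rintro π A d ⟨t, ht, rfl, h⟩
    exact ⟨t, ht, rfl, h.perm⟩
  refine Set.Subset.antisymm ?_ key
  simpa using key (π := π.symm) (A := permA π A)

end Perm

theorem holds_congr {T : TBox} {A : ABox} {Q : ECQ} {v v' : ℕ → Const}
    (h : ∀ x ∈ Q.fv, v' x = v x) : Q.Holds T A v' ↔ Q.Holds T A v := by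
  obtain ⟨C, hC⟩ : ∃ C, Q.ConstsIn C := Q.exists_constsIn
  have := holds_perm (π := 1) (T := T) (A := A) (v := v) (v' := v') hC (fun _ _ => rfl) h
  rwa [show permA 1 A = A from by
    ext f
    rw [mem_permA]
    exact iff_of_eq (congrArg (· ∈ A) f.map_id)] at this

/-! ### Execution steps -/

/-- The constants of a term. -/
def ETerm.consts : ETerm → List Const
  | .const c => [c]
  | _ => []

/-- The constants of the effect are among `C`. -/
def Effect.ConstsIn (C : List Const) (e : Effect) : Prop :=
  (∀ c, c ∈ e.qpos.consts → c ∈ C) ∧ e.qneg.ConstsIn C ∧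
    ∀ a, a ∈ e.facts → ∀ t, t ∈ a.termList → ∀ c, c ∈ t.consts → c ∈ C

/-- `C` contains the special constants and the constants of the knowledge and action base. -/
def KAB.ConstsIn (C : List Const) (K : KAB) : Prop :=
  .temp ∈ C ∧ (∀ t, t ∈ K.tbox → .label t ∈ C) ∧ (∀ c, c ∈ adomList K.init → c ∈ C) ∧
    (∀ α, α ∈ K.actions → ∀ e, e ∈ α.effects → e.ConstsIn C) ∧ ∀ r, r ∈ K.rules → r.cond.ConstsIn C

theorem Effect.cond_constsIn {C : List Const} {e : Effect} (h : e.ConstsIn C) :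
    e.cond.ConstsIn C := ⟨h.1, h.2.1⟩

/-- Quantifying over all larger lists lets the bounds for several effects and rules be combined by
concatenation. -/
theorem Effect.exists_constsIn (e : Effect) : ∃ C, ∀ C', C ⊆ C' → e.ConstsIn C' := by
  obtain ⟨C, hC⟩ := e.qneg.exists_constsIn
  refine ⟨e.qpos.consts ++ C ++ e.facts.flatMap fun a => a.termList.flatMap ETerm.consts,
    fun C' h => ⟨fun c hc => h (by simp [hc]), hC.mono fun c hc => h (by simp [hc]),
      fun a ha t ht c hc => h ?_⟩⟩
  exact List.mem_append_right _ (List.mem_flatMap.2 ⟨a, ha, List.mem_flatMap.2 ⟨t, ht, hc⟩⟩)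

theorem exists_forall_list {α : Type} {p : List Const → α → Prop} (l : List α)
    (h : ∀ a, ∃ C, ∀ C', C ⊆ C' → p C' a) : ∃ C, ∀ C', C ⊆ C' → ∀ a, a ∈ l → p C' a := by
  choose F hF using h
  exact ⟨l.flatMap F, fun C' hC a ha => hF a C' fun c hc => hC (List.mem_flatMap.2 ⟨a, ha, hc⟩)⟩

theorem KAB.exists_constsIn (K : KAB) : ∃ C, ∀ C', C ⊆ C' → K.ConstsIn C' := by
  obtain ⟨C₁, h₁⟩ := exists_forall_list (p := fun C (α : Action) => ∀ e, e ∈ α.effects →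
    e.ConstsIn C) K.actions fun α => exists_forall_list α.effects Effect.exists_constsIn
  obtain ⟨C₂, h₂⟩ := exists_forall_list (p := fun C (r : Rule) => r.cond.ConstsIn C) K.rules
    fun r => by
      obtain ⟨C, hC⟩ := r.cond.exists_constsIn
      exact ⟨C, fun _ h => hC.mono h⟩
  refine ⟨.temp :: (K.tbox.map .label ++ adomList K.init ++ C₁ ++ C₂), fun C' h => ⟨h (by simp),
    fun t ht => h ?_, fun c hc => h ?_, h₁ C' fun c hc => h ?_, h₂ C' fun c hc => h ?_⟩⟩
  · exact List.mem_cons_of_mem _ (by simp [ht])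
  · exact List.mem_cons_of_mem _ (by simp only [List.mem_append]; tauto)
  · exact List.mem_cons_of_mem _ (by simp only [List.mem_append]; tauto)
  · exact List.mem_cons_of_mem _ (by simp only [List.mem_append]; tauto)

/-- The renaming of a service call. -/
def permC (π : Equiv.Perm Const) (c : ServiceCall) : ServiceCall := (c.1, c.2.map π)

@[simp] theorem permC_symm_permC (π : Equiv.Perm Const) (c : ServiceCall) :
    permC π.symm (permC π c) = c := by simp [permC, Function.comp_def]

@[simp] theorem permC_permC_symm (π : Equiv.Perm Const) (c : ServiceCall) :
    permC π (permC π.symm c) = c := by simp [permC, Function.comp_def]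

/-- The renaming of a ground term. -/
def permG (π : Equiv.Perm Const) : GTerm → GTerm := Sum.map π (permC π)

/-- The renaming of a state. -/
def permS (π : Equiv.Perm Const) (s : KState) : KState :=
  ⟨permA π s.abox, fun c => (s.scmap (permC π.symm c)).map π⟩

theorem permS_symm_permS (π : Equiv.Perm Const) (s : KState) : permS π.symm (permS π s) = s := by
  obtain ⟨A, m⟩ := s
  simp [permS, Function.comp_def]

theorem permG_symm_permG (π : Equiv.Perm Const) : permG π ∘ permG π.symm = id := by
  funext t
  rcases t with c | c <;> simp [permG]

theorem Atom.map_id' {τ : Type} (a : Atom τ) : a.map id = a := by cases a <;> rfl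

section Step

variable {K : KAB} {k : RepairKind} {C : List Const} {π : Equiv.Perm Const}
  (hK : K.WellFormed) (hC : K.ConstsIn C) (hπ : ∀ c ∈ C, π c = c)

include hπ in
theorem symm_fixes : ∀ c ∈ C, π.symm c = c := fun c hc => π.symm_apply_eq.2 (hπ c hc).symm

include hπ in
theorem ground_perm {v : ℕ → Const} {t : ETerm} (ht : ∀ c ∈ t.consts, c ∈ C) :
    t.ground (π ∘ v) = permG π (t.ground v) := by
  cases t with
  | const c => simp [ETerm.ground, permG, hπ c (ht c (by simp [ETerm.consts]))]
  | var x => rfl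
  | call f args => simp [ETerm.ground, permG, permC]

include hC hπ in
theorem doFacts_perm {A : ABox} {α : Action} (hα : α ∈ K.actions) {σ : ℕ → Const} {g : Atom GTerm}
    (h : g ∈ doFacts K.tbox A α σ) :
    g.map (permG π) ∈ doFacts K.tbox (permA π A) α (π ∘ σ) := by
  obtain ⟨e, he, v, h1, h2, h3, a, ha, rfl⟩ := h
  have hCe := hC.2.2.2.1 α hα e he
  refine ⟨e, he, π ∘ v, fun p hp => congrArg π (h1 p hp),
    fun x hx hx' => mem_adom_permA.2 (h2 x hx hx'),
    (holds_perm (Effect.cond_constsIn hCe) hπ fun _ _ => rfl).2 h3, a, ha, ?_⟩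
  rw [Atom.map_map]
  refine (Atom.map_congr fun t ht => ?_).symm
  exact ground_perm hπ (hCe.2.2 a ha t (Atom.mem_termList.2 ht))

include hC hπ in
theorem doFacts_perm_eq {A : ABox} {α : Action} (hα : α ∈ K.actions) {σ : ℕ → Const} :
    doFacts K.tbox (permA π A) α (π ∘ σ) = Atom.map (permG π) '' doFacts K.tbox A α σ := by
  refine Set.Subset.antisymm (fun g hg => ?_) ?_
  · refine ⟨g.map (permG π.symm), ?_, ?_⟩
    · have := doFacts_perm hC (symm_fixes hπ) hα hg
      simpa [← Function.comp_assoc] using this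
    · rw [Atom.map_map, permG_symm_permG, Atom.map_id']
  · rintro _ ⟨g, hg, rfl⟩
    exact doFacts_perm hC hπ hα hg

theorem mem_callsOf_image {E : Set (Atom GTerm)} {c : ServiceCall} :
    c ∈ callsOf (Atom.map (permG π) '' E) ↔ permC π.symm c ∈ callsOf E := by
  constructor
  · rintro ⟨_, ⟨g, hg, rfl⟩, hc⟩
    obtain ⟨t | d, ht, h⟩ := Atom.mem_terms_map.1 hc
    · simp [permG] at h
    · simp only [permG, Sum.map_inr, Sum.inr.injEq] at h
      exact ⟨g, hg, by rwa [← h, permC_symm_permC]⟩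
  · rintro ⟨g, hg, hc⟩
    exact ⟨_, ⟨g, hg, rfl⟩, Atom.mem_terms_map.2 ⟨_, hc, by simp [permG]⟩⟩

include hC hπ in
-- The facts to be produced are renamed together with the arguments of their service calls, so the
-- map from calls to results has to be conjugated by `π`.
theorem KAB.Exec.perm {s s' : KState} {α : Action} {σ : ℕ → Const} (hα : α ∈ K.actions)
    (h : K.Exec s α σ s') : K.Exec (permS π s) α (π ∘ σ) (permS π s') := by
  obtain ⟨⟨r, hr, hrα, h1, h2⟩, θ, h3, h4, h5, h6⟩ := h
  refine ⟨⟨r, hr, hrα, fun x hx => mem_adom_permA.2 (h1 x hx),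
    (holds_perm (hC.2.2.2.2 r hr) hπ fun _ _ => rfl).2 h2⟩,
    fun c => π (θ (permC π.symm c)), ?_, ?_, ?_, ?_⟩ <;>
    simp only [permS, doFacts_perm_eq hC hπ hα, mem_callsOf_image]
  · intro c hc d hd
    obtain ⟨e, he, rfl⟩ := Option.map_eq_some_iff.1 hd
    exact congrArg π (h3 _ hc e he)
  · rw [permA, Finset.coe_image, h4, Set.image_image, Set.image_image]
    refine Set.image_congr fun g _ => ?_
    rw [Atom.map_map, Atom.map_map]
    refine Atom.map_congr fun t _ => ?_
    rcases t with c | c <;> simp [GTerm.subst, permG]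
  · intro c hc
    rw [h5 _ hc]
    rfl
  · intro c hc
    rw [h6 _ hc]

include hC hπ in
theorem map_stateTemp : (stateTemp).map π = stateTemp :=
  congrArg (Atom.concept .state) (hπ _ hC.1)

include hC hπ in
theorem stateTemp_mem_permA {A : ABox} : stateTemp ∈ permA π A ↔ stateTemp ∈ A := by
  rw [← map_mem_permA (π := π) (A := A), map_stateTemp hC hπ]

include hC hπ in
theorem KAB.Step.perm {s s' : KState} (h : K.Step k s s') : K.Step k (permS π s) (permS π s') := by
  cases h with
  | action α σ s' h1 h2 h3 =>
    have := KAB.Step.action (k := k) _ α _ _ (fun h => h1 ((stateTemp_mem_permA hC hπ).1 h)) h2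
      (h3.perm hC hπ h2)
    simpa [permS, permA, Finset.image_union, map_stateTemp hC hπ] using this
  | repair A R Rv h1 h2 h3 h4 =>
    refine KAB.Step.repair (permS π s) (permA π A) (permA π R) (permA π Rv)
      ((stateTemp_mem_permA hC hπ).2 h1) ?_ h3.perm ?_
    · subst h2
      ext f
      have : f.map π.symm = stateTemp ↔ f = stateTemp := by
        constructor
        · intro h
          rw [← Atom.map_symm_map π f, h, map_stateTemp hC hπ]
        · rintro rfl
          exact map_stateTemp hC (symm_fixes hπ)
      simp [permS, mem_permA, this]
    · ext f
      have h5 : f.map π.symm ∈ (Rv : Set Fact) ↔ _ := Set.ext_iff.1 h4 _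
      simp only [Finset.mem_coe, mem_permA, Set.mem_union, Set.mem_ofPred_eq, viol_perm] at h5 ⊢
      rw [h5]
      refine or_congr_right (exists_congr fun d => and_congr_right fun hd => ?_)
      obtain ⟨t, ht, rfl, -⟩ := hd
      have h6 : (violFact (.label t)).map π = violFact (.label t) :=
        congrArg (Atom.concept .viol) (hπ _ (hC.2.1 t ht))
      constructor
      · intro h
        rw [← Atom.map_symm_map π f, h, h6]
      · rintro rfl
        rw [← h6, Atom.map_map_symm, h6]

/-! ### Known constants -/

/-- The constants in `C` and those returned by service calls. -/
def known (C : List Const) (s : KState) : Set Const := {c | c ∈ C ∨ ∃ f, s.scmap f = some c}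

/-- The constants of the state are known. -/
structure Inv (C : List Const) (s : KState) : Prop where
  adom_subset : adom s.abox ⊆ known C s
  args : ∀ f d, s.scmap f = some d → ∀ c ∈ f.2, c ∈ known C s
  finite : (known C s).Finite

theorem finite_adom (A : ABox) : (adom A).Finite := by
  have : adom A = ⋃ f ∈ A, f.terms := by
    ext c
    simp [adom]
  rw [this]
  refine A.finite_toSet.biUnion fun f _ => ?_
  cases f <;> simp [Atom.terms]

theorem IsRepair.subset {T : TBox} {A R : ABox} (h : IsRepair k T A R) : R ⊆ A := by
  have hA : A.toList.toFinset = A := A.toList_toFinset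
  rw [← hA] at h ⊢
  obtain ⟨l, hl, rfl⟩ := isRepair_iff.1 h
  intro f hf
  rw [List.mem_toFinset] at hf ⊢
  cases k with
  | bold => exact (List.mem_sublists'.1 (mem_sift.1 hl).1).subset hf
  | certain =>
    have := (mem_sift.1 hl).1
    rw [List.mem_singleton] at this
    subst this
    exact (mem_sift.1 hf).1

include hK in
theorem KAB.Legal.mem_adom {A : ABox} {α : Action} {σ : ℕ → Const} (h : K.Legal A α σ) :
    ∀ x ∈ α.params, σ x ∈ adom A := by
  obtain ⟨r, hr, rfl, h1, h2⟩ := h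
  intro x hx
  have := hK.rules_fv r hr
  exact h1 x (by rw [this]; exact hx)

include hK hC in
theorem doFacts_terms {A : ABox} {α : Action} {σ : ℕ → Const} (hα : α ∈ K.actions)
    (hl : K.Legal A α σ) {g : Atom GTerm} (hg : g ∈ doFacts K.tbox A α σ) :
    (∀ c, Sum.inl c ∈ g.terms → c ∈ C ∨ c ∈ adom A) ∧
      ∀ f, Sum.inr f ∈ g.terms → ∀ c ∈ f.2, c ∈ adom A := by
  obtain ⟨e, he, v, h1, h2, h3, a, ha, rfl⟩ := hg
  have hv : ∀ t ∈ a.terms, ∀ x ∈ t.vars, v x ∈ adom A := by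
    intro t ht x hx
    by_cases hp : x ∈ α.params
    · rw [h1 x hp]
      exact hl.mem_adom hK x hp
    · exact h2 x (.inl ((hK.effects_wf α hα e he).fv_facts a ha t ht hx)) hp
  constructor
  · intro c hc
    obtain ⟨t, ht, h⟩ := Atom.mem_terms_map.1 hc
    cases t with
    | const d =>
      obtain rfl : d = c := Sum.inl.inj h
      exact .inl ((hC.2.2.2.1 α hα e he).2.2 a ha _ (Atom.mem_termList.2 ht) d
        (by simp [ETerm.consts]))
    | var x =>
      obtain rfl : v x = c := Sum.inl.inj h
      exact .inr (hv _ ht x rfl)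
    | call f args => cases h
  · intro f hf c hc
    obtain ⟨t, ht, h⟩ := Atom.mem_terms_map.1 hf
    cases t with
    | call f' args =>
      obtain rfl : (f', args.map v) = f := Sum.inr.inj h
      obtain ⟨x, hx, rfl⟩ := List.mem_map.1 hc
      exact hv _ ht x hx
    | _ => cases h

theorem adom_union {A B : ABox} : adom (A ∪ B) = adom A ∪ adom B := by
  ext c
  simp only [adom, Finset.mem_union, Set.mem_ofPred_eq, Set.mem_union]
  constructor
  · rintro ⟨f, h | h, hc⟩
    · exact .inl ⟨f, h, hc⟩
    · exact .inr ⟨f, h, hc⟩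
  · rintro (⟨f, h, hc⟩ | ⟨f, h, hc⟩)
    · exact ⟨f, .inl h, hc⟩
    · exact ⟨f, .inr h, hc⟩

theorem KAB.Step.scmap_mono {s s' : KState} (h : K.Step k s s') {f : ServiceCall} {d : Const}
    (hf : s.scmap f = some d) : s'.scmap f = some d := by
  cases h with
  | action α σ s' h1 h2 h3 =>
    obtain ⟨-, θ, h4, h5, h6, h7⟩ := h3
    by_cases hc : f ∈ callsOf (doFacts K.tbox s.abox α σ)
    · exact (h6 f hc).trans (congrArg some (h4 f hc d hf))
    · exact (h7 f hc).trans hf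
  | repair => exact hf

theorem KAB.Step.known_mono {s s' : KState} (h : K.Step k s s') : known C s ⊆ known C s' := by
  rintro c (hc | ⟨f, hf⟩)
  · exact .inl hc
  · exact .inr ⟨f, h.scmap_mono hf⟩

/-- A value newly returned by a service call occurs in the ABox. -/
theorem KAB.Step.mem_adom {s s' : KState} (h : K.Step k s s') {f : ServiceCall} {d : Const}
    (hf : s'.scmap f = some d) (hn : s.scmap f ≠ some d) : d ∈ adom s'.abox := by
  cases h with
  | action α σ s' h1 h2 h3 =>
    obtain ⟨-, θ, h4, h5, h6, h7⟩ := h3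
    by_cases hc : f ∈ callsOf (doFacts K.tbox s.abox α σ)
    · obtain rfl : θ f = d := Option.some.inj ((h6 f hc).symm.trans hf)
      obtain ⟨g, hg, hfg⟩ := hc
      rw [adom_union]
      refine .inl ⟨g.map (GTerm.subst θ), ?_, Atom.mem_terms_map.2 ⟨_, hfg, rfl⟩⟩
      have : g.map (GTerm.subst θ) ∈ (s'.abox : Set Fact) := h5 ▸ ⟨g, hg, rfl⟩
      exact this
    · exact absurd ((h7 f hc).symm.trans hf) hn
  | repair => exact absurd hf hn

include hC in
theorem KAB.Step.repair_facts {A R Rv : ABox} (h3 : IsRepair k K.tbox A R)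
    (h4 : (Rv : Set Fact) = ↑R ∪ {f | ∃ d ∈ viol K.tbox A, f = violFact d}) {c : Const}
    (hc : c ∈ adom Rv) : c ∈ C ∨ c ∈ adom A := by
  obtain ⟨f, hf, hc⟩ := hc
  have : f ∈ (Rv : Set Fact) := hf
  rw [h4] at this
  rcases this with h | ⟨d, ⟨t, ht, rfl, -⟩, rfl⟩
  · exact .inr ⟨f, h3.subset h, hc⟩
  · obtain rfl : c = .label t := hc
    exact .inl (hC.2.1 t ht)

include hK hC in
-- Apart from results of calls, a step writes only constants in `C` and constants of the old ABox.
-- New results appear in the new ABox, which is finite, so the known constants remain finite in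
-- number.
theorem KAB.Step.inv {s s' : KState} (h : K.Step k s s') (hs : Inv C s) : Inv C s' := by
  have hfin : (known C s').Finite := by
    refine (hs.finite.union (finite_adom s'.abox)).subset ?_
    rintro c (hc | ⟨f, hf⟩)
    · exact .inl (.inl hc)
    · by_cases hn : s.scmap f = some c
      · exact .inl (.inr ⟨f, hn⟩)
      · exact .inr (h.mem_adom hf hn)
  have hmono := h.known_mono (C := C)
  have h' := h
  cases h' with
  | action α σ s' h1 h2 h3 =>
    obtain ⟨hl, θ, h4, h5, h6, h7⟩ := h3
    refine ⟨?_, fun f d hf c hc => ?_, hfin⟩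
    · rw [adom_union]
      rintro c (⟨f, hf, hc⟩ | ⟨f, hf, hc⟩)
      · have : f ∈ (s'.abox : Set Fact) := hf
        rw [h5] at this
        obtain ⟨g, hg, rfl⟩ := this
        have hgt := doFacts_terms hK hC h2 hl hg
        obtain ⟨d | d, hd, rfl⟩ := Atom.mem_terms_map.1 hc
        · rcases hgt.1 d hd with h | h
          · exact .inl h
          · exact hmono (hs.adom_subset h)
        · exact .inr ⟨d, h6 d ⟨g, hg, hd⟩⟩
      · rw [Finset.mem_singleton] at hf
        subst hf
        obtain rfl : c = .temp := hc
        exact .inl hC.1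
    · by_cases hcall : f ∈ callsOf (doFacts K.tbox s.abox α σ)
      · obtain ⟨g, hg, hfg⟩ := hcall
        exact hmono (hs.adom_subset ((doFacts_terms hK hC h2 hl hg).2 f hfg c hc))
      · exact hmono (hs.args f d ((h7 f hcall).symm.trans hf) c hc)
  | repair A R Rv h1 h2 h3 h4 =>
    refine ⟨fun c hc => ?_, hs.args, hfin⟩
    rcases KAB.Step.repair_facts hC h3 h4 hc with h | ⟨f, hf, hc⟩
    · exact .inl h
    · subst h2
      exact hs.adom_subset ⟨f, (Finset.mem_sdiff.1 hf).1, hc⟩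

include hC in
theorem inv_start : Inv C K.startState := by
  refine ⟨fun c hc => .inl (hC.2.2.1 c (mem_adomList.2 hc)), fun f d h => by simp [KAB.startState] at h, ?_⟩
  refine C.finite_toSet.subset ?_
  rintro c (hc | ⟨f, hf⟩)
  · exact hc
  · simp [KAB.startState] at hf

/-- The replacement of the constants of the ABox and of the values of service calls. -/
def postS (G : Const → Const) (s : KState) : KState :=
  ⟨s.abox.image (Atom.map G), fun f => (s.scmap f).map G⟩

include hK hC in
-- Results of new service calls are arbitrary: any map that fixes the known constants may be applied
-- to them afterwards, even if it identifies results. A repair step introduces no unknown constants,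
-- so the map leaves its target unchanged.
theorem KAB.Step.post {s s' : KState} (h : K.Step k s s') (hs : Inv C s) {G : Const → Const}
    (hG : ∀ c ∈ known C s, G c = c) : K.Step k s (postS G s') := by
  cases h with
  | action α σ s' h1 h2 h3 =>
    obtain ⟨hl, θ, h4, h5, h6, h7⟩ := h3
    have htemp : (stateTemp).map G = stateTemp :=
      congrArg (Atom.concept .state) (hG _ (.inl hC.1))
    have hex : K.Exec s α σ (postS G s') := by
      refine ⟨hl, fun f => G (θ f), fun f hf d hd => ?_, ?_, fun f hf => ?_, fun f hf => ?_⟩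
      · simp only [h4 f hf d hd]
        exact hG _ (.inr ⟨f, hd⟩)
      · simp only [postS, Finset.coe_image, h5, Set.image_image]
        refine Set.image_congr fun g hg => ?_
        rw [Atom.map_map]
        refine Atom.map_congr fun t ht => ?_
        rcases t with c | f
        · refine hG c ?_
          rcases (doFacts_terms hK hC h2 hl hg).1 c ht with h | h
          · exact .inl h
          · exact hs.adom_subset h
        · rfl
      · simp [postS, h6 f hf]
      · simp only [postS, h7 f hf]
        cases hf' : s.scmap f with
        | none => rfl
        | some d => exact congrArg some (hG d (.inr ⟨f, hf'⟩))
    have := KAB.Step.action (k := k) s α σ _ h1 h2 hex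
    simpa [postS, Finset.image_union, htemp] using this
  | repair A R Rv h1 h2 h3 h4 =>
    have h5 : postS G ⟨Rv, s.scmap⟩ = ⟨Rv, s.scmap⟩ := by
      simp only [postS, KState.mk.injEq]
      constructor
      · have h6 : ∀ f ∈ Rv, f.map G = f := fun f hf => by
          conv_rhs => rw [← f.map_id']
          refine Atom.map_congr fun c hc => hG c ?_
          rcases KAB.Step.repair_facts hC h3 h4 ⟨f, hf, hc⟩ with h | ⟨f, hf, hc⟩
          · exact .inl h
          · subst h2
            exact hs.adom_subset ⟨f, (Finset.mem_sdiff.1 hf).1, hc⟩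
        rw [Finset.image_congr (g := id) h6, Finset.image_id]
      · funext f
        cases hf : s.scmap f with
        | none => rfl
        | some d => exact congrArg some (hG d (.inr ⟨f, hf⟩))
    rw [h5]
    exact KAB.Step.repair s A R Rv h1 h2 h3 h4

include hπ in
theorem known_permS {s : KState} : known C (permS π s) = π '' known C s := by
  ext c
  constructor
  · rintro (hc | ⟨f, hf⟩)
    · exact ⟨c, .inl hc, hπ c hc⟩
    · obtain ⟨d, hd, rfl⟩ := Option.map_eq_some_iff.1 hf
      exact ⟨d, .inr ⟨_, hd⟩, rfl⟩
  · rintro ⟨d, hd | ⟨f, hf⟩, rfl⟩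
    · exact .inl (by rwa [hπ d hd])
    · exact .inr ⟨permC π f, by simp [permS, hf]⟩

end Step

/-! ### Service calls with results in a finite set -/

/-- A step in which the new results of service calls are in `F`. -/
def KAB.StepIn (K : KAB) (k : RepairKind) (F : List Const) (s s' : KState) : Prop :=
  K.Step k s s' ∧ ∀ c d, s'.scmap c = some d → s.scmap c = some d ∨ d ∈ F

/-- The transition system in which the results of service calls are in `F`. -/
def KAB.boundedTS (K : KAB) (k : RepairKind) (F : List Const) : TransitionSystem where
  tbox := K.tbox
  State := KState
  states := {s | ReflTransGen (K.StepIn k F) K.startState s}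
  start := K.startState
  abox := KState.abox
  trans := fun s s' => ReflTransGen (K.StepIn k F) K.startState s ∧ K.StepIn k F s s'

/-- In each state some element of `F` is not known. -/
def KAB.Adequate (K : KAB) (k : RepairKind) (C F : List Const) : Prop :=
  ∀ s, ReflTransGen (K.StepIn k F) K.startState s → ∃ c ∈ F, c ∉ known C s

/-- An injection of a finite set extends to a permutation. -/
theorem exists_perm_eq_on {α : Type} [DecidableEq α] {S : Set α} (hS : S.Finite) (f : α → α)
    (hf : Set.InjOn f S) : ∃ τ : Equiv.Perm α, ∀ x ∈ S, τ x = f x := by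
  induction S, hS using Set.Finite.induction_on with
  | empty => exact ⟨1, by simp⟩
  | @insert a S ha hS ih =>
    obtain ⟨τ, hτ⟩ := ih (hf.mono (Set.subset_insert a S))
    refine ⟨Equiv.swap (τ a) (f a) * τ, ?_⟩
    rintro x (rfl | hx)
    · simp
    · have h1 : x ≠ a := fun h => ha (h ▸ hx)
      rw [Equiv.Perm.mul_apply, Equiv.swap_apply_of_ne_of_ne, hτ x hx]
      · exact fun h => h1 (τ.injective h)
      · rw [hτ x hx]
        exact fun h => h1 (hf (.inr hx) (.inl rfl) h)

/-- Between a finite set and a nonempty set there is a map that is injective or surjective. -/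
theorem exists_injOn_or_subset_image {α : Type} (X Y : Set α) (hY : Y.Nonempty) :
    ∃ f : α → α, (∀ x ∈ X, f x ∈ Y) ∧ (Set.InjOn f X ∨ Y ⊆ f '' X) := by
  classical
  have : Nonempty Y := hY.to_subtype
  rcases Function.Embedding.total X Y with ⟨⟨e, he⟩⟩ | ⟨⟨e, he⟩⟩
  · refine ⟨fun x => if h : x ∈ X then e ⟨x, h⟩ else x, fun x hx => ?_, .inl fun x hx y hy h => ?_⟩
    · simp only [hx, dif_pos]
      exact (e _).2
    · simp only [hx, hy, dif_pos] at h
      exact congrArg Subtype.val (he (Subtype.ext h))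
  · refine ⟨fun x => if h : x ∈ X then (Function.invFun e ⟨x, h⟩ : Y) else x, fun x hx => ?_,
      .inr fun y hy => ?_⟩
    · simp only [hx, dif_pos]
      exact (Function.invFun e (⟨x, hx⟩ : X) : Y).2
    · refine ⟨e ⟨y, hy⟩, (e _).2, ?_⟩
      simp [Function.leftInverse_invFun he _]

/-! ### Moving steps into the finite set -/

section Bounded

variable {K : KAB} {k : RepairKind} {C F : List Const} {π : Equiv.Perm Const}
  (hK : K.WellFormed) (hC : K.ConstsIn C) (hCF : C ⊆ F) (hπ : ∀ c ∈ C, π c = c)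

theorem reach_of_reachIn {s s' : KState} (h : ReflTransGen (K.StepIn k F) s s') :
    ReflTransGen (K.Step k) s s' := by
  induction h with
  | refl => exact .refl
  | tail _ h ih => exact ih.tail h.1

include hK hC in
theorem KAB.inv_of_reach {s : KState} (h : ReflTransGen (K.Step k) K.startState s) : Inv C s := by
  induction h with
  | refl => exact inv_start hC
  | tail _ h ih => exact h.inv hK hC ih

include hCF in
theorem known_subset_of_reachIn {s : KState} (h : ReflTransGen (K.StepIn k F) K.startState s) :
    ∀ c ∈ known C s, c ∈ F := by
  induction h with
  | refl =>
    rintro c (hc | ⟨f, hf⟩)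
    · exact hCF hc
    · simp [KAB.startState] at hf
  | tail _ h ih =>
    rintro c (hc | ⟨f, hf⟩)
    · exact hCF hc
    · rcases h.2 f c hf with h1 | h1
      · exact ih c (.inr ⟨f, h1⟩)
      · exact h1

include hK hC in
-- Arguments of calls are taken from the ABox before the step. Renaming the new constants therefore
-- touches results but no arguments, which is what lets `permS` be replaced by `postS`.
theorem KAB.Step.args {s s' : KState} (h : K.Step k s s') (hs : Inv C s) {f : ServiceCall}
    {d : Const} (hf : s'.scmap f = some d) : ∀ c ∈ f.2, c ∈ known C s := by
  intro c hc
  cases h with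
  | action α σ s' h1 h2 h3 =>
    obtain ⟨hl, θ, h4, h5, h6, h7⟩ := h3
    by_cases hcall : f ∈ callsOf (doFacts K.tbox s.abox α σ)
    · obtain ⟨g, hg, hfg⟩ := hcall
      exact hs.adom_subset ((doFacts_terms hK hC h2 hl hg).2 f hfg c hc)
    · exact hs.args f d ((h7 f hcall).symm.trans hf) c hc
  | repair A R Rv h1 h2 h3 h4 => exact hs.args f d hf c hc

theorem permS_eq_postS {s : KState} (h : ∀ f d, s.scmap f = some d → ∀ c ∈ f.2, π c = c) :
    permS π s = postS π s := by
  simp only [permS, postS, permA, KState.mk.injEq, true_and]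
  funext f
  have key : ∀ f : ServiceCall, (∀ c ∈ f.2, π c = c) → permC π f = f := fun f hf =>
    Prod.ext rfl ((List.map_congr_left hf).trans f.2.map_id)
  by_cases hf : ∀ c ∈ f.2, π c = c
  · rw [show permC π.symm f = f from by
      conv_lhs => rw [← key f hf]
      exact permC_symm_permC π f]
  · have h1 : s.scmap f = none := Option.eq_none_iff_forall_ne_some.2 fun d hd => hf (h f d hd)
    have h2 : s.scmap (permC π.symm f) = none := Option.eq_none_iff_forall_ne_some.2 fun d hd =>
      hf (by
        have := h _ d hd
        have h3 := key _ this
        rw [permC_permC_symm] at h3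
        rwa [← h3] at this)
    rw [h1, h2]

theorem permS_mul (τ π : Equiv.Perm Const) (s : KState) :
    permS τ (permS π s) = permS (τ * π) s := by
  simp only [permS, permA, KState.mk.injEq, Finset.image_image]
  refine ⟨congrArg (Finset.image · _) (funext fun f => Atom.map_map _ _ _), funext fun f => ?_⟩
  rw [Option.map_map]
  rw [show permC (τ * π).symm f = permC π.symm (permC τ.symm f) from ?_]
  · rfl
  · simp only [permC, List.map_map]
    rfl

include hK hC hCF in
/-- Up to a renaming of the new constants, each step has its results in `F`. -/
theorem KAB.Adequate.exists_stepIn (hF : K.Adequate k C F) {t u : KState}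
    (ht : ReflTransGen (K.StepIn k F) K.startState t) (h : K.Step k t u) :
    ∃ τ : Equiv.Perm Const, (∀ c ∈ known C t, τ c = c) ∧ K.StepIn k F t (permS τ u) := by
  have hit := KAB.inv_of_reach hK hC (reach_of_reachIn ht)
  have hiu := h.inv hK hC hit
  have htF := known_subset_of_reachIn hCF ht
  -- The constants introduced by the step are compared with the unused elements of `F`, of which
  -- there is at least one by adequacy.
  obtain ⟨g, hg, hg'⟩ := exists_injOn_or_subset_image (known C u \ known C t)
    ({c | c ∈ F} \ known C t) (hF t ht)
  classical
  let G : Const → Const := fun c => if c ∈ known C t then c else g c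
  have hG1 : ∀ c ∈ known C t, G c = c := fun c hc => if_pos hc
  have hG2 : ∀ c ∉ known C t, G c = g c := fun c hc => if_neg hc
  have hGF : ∀ c ∈ known C u, G c ∈ F := fun c hc => by
    by_cases hct : c ∈ known C t
    · rw [hG1 c hct]
      exact htF c hct
    · rw [hG2 c hct]
      exact (hg c ⟨hc, hct⟩).1
  have hstep : K.StepIn k F t (postS G u) := by
    refine ⟨h.post hK hC hit hG1, fun f d hd => .inr ?_⟩
    obtain ⟨e, he, rfl⟩ := Option.map_eq_some_iff.1 hd
    exact hGF e (.inr ⟨f, he⟩)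
  rcases hg' with hg' | hg'
  · have hinj : Set.InjOn G (known C u) := by
      intro x hx y hy hxy
      by_cases hxt : x ∈ known C t <;> by_cases hyt : y ∈ known C t
      · rwa [hG1 x hxt, hG1 y hyt] at hxy
      · rw [hG1 x hxt, hG2 y hyt] at hxy
        exact absurd (hxy ▸ hxt) (hg y ⟨hy, hyt⟩).2
      · rw [hG2 x hxt, hG1 y hyt] at hxy
        exact absurd (hxy ▸ hyt) (hg x ⟨hx, hxt⟩).2
      · rw [hG2 x hxt, hG2 y hyt] at hxy
        exact hg' ⟨hx, hxt⟩ ⟨hy, hyt⟩ hxy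
    obtain ⟨τ, hτ⟩ := exists_perm_eq_on hiu.finite G hinj
    have hτt : ∀ c ∈ known C t, τ c = c := fun c hc =>
      (hτ c (h.known_mono hc)).trans (hG1 c hc)
    refine ⟨τ, hτt, ?_⟩
    rw [permS_eq_postS fun f d hd c hc => hτt c (h.args hK hC hit hd c hc)]
    have : postS τ u = postS G u := by
      simp only [postS, KState.mk.injEq]
      constructor
      · refine Finset.image_congr fun f hf => Atom.map_congr fun c hc => ?_
        exact hτ c (hiu.adom_subset ⟨f, hf, hc⟩)
      · funext f
        cases hf : u.scmap f with
        | none => rfl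
        | some d => exact congrArg some (hτ d (.inr ⟨f, hf⟩))
    rwa [this]
  -- If `g` is onto, the modified step is legal and its target knows every element of `F`, against
  -- adequacy.
  · obtain ⟨c, hc, hc'⟩ := hF _ (ht.tail hstep)
    by_cases hct : c ∈ known C t
    · exact absurd (hstep.1.known_mono hct) hc'
    · obtain ⟨e, ⟨he1, he2⟩, rfl⟩ := hg' ⟨hc, hct⟩
      rcases he1 with he1 | ⟨f, hf⟩
      · exact absurd (.inl he1) he2
      · refine absurd (.inr ⟨f, ?_⟩) hc'
        simp only [postS, hf]
        exact congrArg some (hG2 e he2)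

/-- The values of service calls occur in the ABoxes of a run. -/
theorem exists_run {s : KState} (h : ReflTransGen (K.Step k) K.startState s) :
    ∃ (n : ℕ) (τ : ℕ → KState), (K.extendedTS k).IsRun n τ ∧ τ n = s ∧
      ∀ f d, s.scmap f = some d → ∃ i ≤ n, d ∈ adom (τ i).abox := by
  induction h with
  | refl =>
    refine ⟨0, fun _ => K.startState, ⟨rfl, fun i hi => absurd hi (by simp)⟩, rfl, fun f d h => ?_⟩
    simp [KAB.startState] at h
  | @tail s s' hs h ih =>
    obtain ⟨n, τ, ⟨h0, hr⟩, hn, hv⟩ := ih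
    refine ⟨n + 1, fun i => if i ≤ n then τ i else s', ⟨?_, fun i hi => ?_⟩, ?_, fun f d hd => ?_⟩
    · simpa using h0
    · have hi' : i < n + 1 := by exact_mod_cast hi
      rcases Nat.lt_succ_iff_lt_or_eq.1 hi' with h1 | rfl
      · have := hr i (by exact_mod_cast h1)
        simp only [h1.le, if_true, Nat.succ_le_of_lt h1]
        exact this
      · simp only [le_refl, if_true, Nat.not_succ_le_self, if_false, hn]
        exact ⟨hs, h⟩
    · simp
    · by_cases hf : s.scmap f = some d
      · obtain ⟨i, hi, h1⟩ := hv f d hf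
        exact ⟨i, hi.trans n.le_succ, by simpa [hi] using h1⟩
      · exact ⟨n + 1, le_rfl, by simpa using h.mem_adom hd hf⟩

/-- Known constants are in `C` or occur in an ABox of the run leading to the state. In total they
are fewer than `C.length + b`, independently of `F`, so a set with that many elements is never
exhausted. -/
theorem exists_adequate (hb : (K.extendedTS k).RunBounded) (C : List Const) :
    ∃ F, C ⊆ F ∧ K.Adequate k C F := by
  obtain ⟨b, hb⟩ := hb
  -- The added constants may overlap `C`; hence `C.length + b` of them rather than `b`.
  refine ⟨C ++ (List.range (C.length + b)).map .val, by simp, fun s hs => ?_⟩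
  by_contra! hcon
  obtain ⟨n, τ, hr, -, hv⟩ := exists_run (reach_of_reachIn hs)
  have h1 := hb n τ hr
  have h2 : (((Finset.range (C.length + b)).image Const.val : Finset Const) : Set Const) ⊆
      (C.toFinset : Set Const) ∪
        {c | ∃ i : ℕ, (i : ℕ∞) ≤ n ∧ c ∈ adom ((K.extendedTS k).abox (τ i))} := by
    intro c hc
    have hcF : c ∈ C ++ (List.range (C.length + b)).map .val := by
      simp only [Finset.coe_image, Finset.coe_range, Set.mem_image, Set.mem_Iio] at hc
      simp only [List.mem_append, List.mem_map, List.mem_range]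
      exact .inr hc
    rcases hcon c hcF with h | ⟨f, hf⟩
    · exact .inl (by simpa using h)
    · obtain ⟨i, hi, h⟩ := hv f c hf
      exact .inr ⟨i, by exact_mod_cast hi, h⟩
  have h3 := (Set.encard_le_encard h2).trans (Set.encard_union_le _ _)
  rw [Set.encard_coe_eq_coe_finsetCard, Set.encard_coe_eq_coe_finsetCard,
    Finset.card_image_of_injective _ (fun a b h => Const.val.inj h), Finset.card_range] at h3
  have h4 : ((C.toFinset.card : ℕ) : ℕ∞) ≤ C.length := by exact_mod_cast C.toFinset_card_le
  have h5 : ((C.length + b : ℕ) : ℕ∞) < ((C.length + b : ℕ) : ℕ∞) := by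
    refine h3.trans_lt ?_
    push_cast
    exact ENat.add_lt_add_of_le_of_lt (ENat.natCast_ne_top _) h4 h1
  exact lt_irrefl _ h5

/-! ### Finiteness of the system with results in a finite set -/

theorem finite_lists {S : Set Const} (hS : S.Finite) (n : ℕ) :
    {l : List Const | l.length = n ∧ ∀ x ∈ l, x ∈ S}.Finite := by
  induction n with
  | zero =>
    refine (Set.finite_singleton []).subset ?_
    rintro l ⟨h, -⟩
    exact List.length_eq_zero_iff.1 h
  | succ n ih =>
    refine (Set.Finite.image2 List.cons hS ih).subset ?_
    rintro (_ | ⟨a, l⟩) ⟨h1, h2⟩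
    · simp at h1
    · exact ⟨a, h2 a (by simp), l, ⟨by simpa using h1, fun x hx => h2 x (by simp [hx])⟩, rfl⟩

/-- The predicate of an atom. -/
def Atom.shape {τ : Type} (a : Atom τ) : Atom Unit := a.map fun _ => ()

theorem Atom.shape_map {τ τ' : Type} (g : τ → τ') (a : Atom τ) : (a.map g).shape = a.shape := by
  rw [shape, Atom.map_map]
  rfl

theorem finite_facts {S : Set Const} {P : Set (Atom Unit)} (hS : S.Finite) (hP : P.Finite) :
    {f : Fact | f.shape ∈ P ∧ f.terms ⊆ S}.Finite := by
  refine (hP.biUnion (t := fun p => {f : Fact | f.shape = p ∧ f.terms ⊆ S}) fun p _ => ?_).subset ?_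
  · cases p with
    | concept N t =>
      refine (hS.image (Atom.concept N)).subset ?_
      rintro f ⟨h1, h2⟩
      cases f with
      | concept M c =>
        obtain ⟨rfl, -⟩ := Atom.concept.inj h1
        exact ⟨c, h2 rfl, rfl⟩
      | role P c d => cases h1
    | role N t t' =>
      refine (Set.Finite.image2 (Atom.role N) hS hS).subset ?_
      rintro f ⟨h1, h2⟩
      cases f with
      | concept M c => cases h1
      | role P c d =>
        obtain ⟨rfl, -⟩ := Atom.role.inj h1
        exact ⟨c, h2 (by simp [Atom.terms]), d, h2 (by simp [Atom.terms]), rfl⟩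
  · rintro f ⟨h1, h2⟩
    exact Set.mem_biUnion h1 ⟨rfl, h2⟩

theorem finite_states {S : Set Const} {U : Set Fact} {P : Set ServiceCall} (hS : S.Finite)
    (hU : U.Finite) (hP : P.Finite) :
    {s : KState | (s.abox : Set Fact) ⊆ U ∧ ∀ f d, s.scmap f = some d → f ∈ P ∧ d ∈ S}.Finite := by
  classical
  have h1 : {A : ABox | (A : Set Fact) ⊆ U}.Finite := by
    refine (hU.toFinset.powerset.finite_toSet).subset fun A hA => ?_
    simp only [Finset.coe_powerset, Set.mem_preimage, Set.mem_powerset_iff]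
    simpa using hA
  have := hP.to_subtype
  have h2 : {g : P → Option Const | ∀ f, g f ∈ insert none (some '' S)}.Finite :=
    Set.Finite.pi' fun _ => (hS.image some).insert none
  refine ((h1.prod h2).image fun p => (⟨p.1, fun f => if h : f ∈ P then p.2 ⟨f, h⟩ else none⟩ :
    KState)).subset ?_
  rintro ⟨A, m⟩ ⟨hA, hm⟩
  refine ⟨(A, fun f => m f), ⟨hA, fun f => ?_⟩, ?_⟩
  · cases h : m f with
    | none => exact .inl h
    | some d => exact .inr ⟨d, (hm f d h).2, h.symm⟩
  · simp only [KState.mk.injEq, true_and]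
    funext f
    by_cases hf : f ∈ P
    · simp [hf]
    · simp only [hf, dif_neg, not_false_eq_true]
      exact (Option.eq_none_iff_forall_ne_some.2 fun d hd => hf (hm f d hd).1).symm

/-- The predicates of the knowledge and action base. -/
def KAB.shapes (K : KAB) : Set (Atom Unit) :=
  {p | p = (stateTemp).shape ∨ p = (violFact .temp).shape ∨ (∃ f ∈ K.init, p = f.shape) ∨
    ∃ α ∈ K.actions, ∃ e ∈ α.effects, ∃ a ∈ e.facts, p = a.shape}

/-- The names and arities of the service calls. -/
def KAB.callShapes (K : KAB) : Set (ℕ × ℕ) :=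
  {p | ∃ α ∈ K.actions, ∃ e ∈ α.effects, ∃ a ∈ e.facts, ∃ t ∈ a.termList, ∃ f args,
    t = .call f args ∧ p = (f, args.length)}

theorem finite_exists_mem {α β : Type} (l : List α) {p : α → β → Prop}
    (h : ∀ a, {b | p a b}.Finite) : {b | ∃ a ∈ l, p a b}.Finite := by
  refine ((l.finite_toSet).biUnion fun a _ => h a).subset ?_
  rintro b ⟨a, ha, hb⟩
  exact Set.mem_biUnion ha hb

theorem KAB.finite_shapes (K : KAB) : K.shapes.Finite := by
  refine Set.Finite.union (Set.finite_singleton _) (Set.Finite.union (Set.finite_singleton _)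
    (Set.Finite.union ?_ ?_))
  · exact finite_exists_mem _ fun _ => Set.finite_singleton _
  · exact finite_exists_mem _ fun _ => finite_exists_mem _ fun _ => finite_exists_mem _ fun _ =>
      Set.finite_singleton _

theorem KAB.finite_callShapes (K : KAB) : K.callShapes.Finite := by
  refine finite_exists_mem _ fun _ => finite_exists_mem _ fun _ => finite_exists_mem _ fun _ =>
    finite_exists_mem _ fun t => ?_
  cases t with
  | call f args =>
    refine (Set.finite_singleton (f, args.length)).subset ?_
    rintro p ⟨f', args', h, rfl⟩
    obtain ⟨rfl, rfl⟩ := ETerm.call.inj h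
    rfl
  | _ =>
    refine Set.finite_empty.subset ?_
    rintro p ⟨f', args', h, -⟩
    cases h

theorem doFacts_shapes {A : ABox} {α : Action} {σ : ℕ → Const} (hα : α ∈ K.actions)
    {g : Atom GTerm} (hg : g ∈ doFacts K.tbox A α σ) :
    g.shape ∈ K.shapes ∧ ∀ f, Sum.inr f ∈ g.terms → (f.1, f.2.length) ∈ K.callShapes := by
  obtain ⟨e, he, v, h1, h2, h3, a, ha, rfl⟩ := hg
  refine ⟨.inr (.inr (.inr ⟨α, hα, e, he, a, ha, Atom.shape_map _ _⟩)), fun f hf => ?_⟩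
  obtain ⟨t, ht, h⟩ := Atom.mem_terms_map.1 hf
  cases t with
  | call f' args =>
    obtain rfl : (f', args.map v) = f := Sum.inr.inj h
    exact ⟨α, hα, e, he, a, ha, _, Atom.mem_termList.2 ht, f', args, rfl, by simp⟩
  | _ => cases h

theorem reach_shapes {s : KState} (h : ReflTransGen (K.Step k) K.startState s) :
    (∀ f ∈ s.abox, f.shape ∈ K.shapes) ∧
      ∀ f d, s.scmap f = some d → (f.1, f.2.length) ∈ K.callShapes := by
  induction h with
  | refl =>
    refine ⟨fun f hf => .inr (.inr (.inl ⟨f, List.mem_toFinset.1 hf, rfl⟩)), fun f d h => ?_⟩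
    simp [KAB.startState] at h
  | @tail s s' hs h ih =>
    cases h with
    | action α σ s' h1 h2 h3 =>
      obtain ⟨hl, θ, h4, h5, h6, h7⟩ := h3
      refine ⟨fun f hf => ?_, fun f d hf => ?_⟩
      · rcases Finset.mem_union.1 hf with h | h
        · have : f ∈ (s'.abox : Set Fact) := h
          rw [h5] at this
          obtain ⟨g, hg, rfl⟩ := this
          rw [Atom.shape_map]
          exact (doFacts_shapes h2 hg).1
        · rw [Finset.mem_singleton] at h
          exact .inl (h ▸ rfl)
      · by_cases hcall : f ∈ callsOf (doFacts K.tbox s.abox α σ)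
        · obtain ⟨g, hg, hfg⟩ := hcall
          exact (doFacts_shapes h2 hg).2 f hfg
        · exact ih.2 f d ((h7 f hcall).symm.trans hf)
    | repair A R Rv h1 h2 h3 h4 =>
      refine ⟨fun f hf => ?_, ih.2⟩
      have : f ∈ (Rv : Set Fact) := hf
      rw [h4] at this
      rcases this with h | ⟨d, -, rfl⟩
      · subst h2
        exact ih.1 f (Finset.mem_sdiff.1 (h3.subset h)).1
      · exact .inr (.inl rfl)

include hK hC hCF in
-- All constants, including arguments of recorded calls, lie in `F`. The facts use finitely many
-- predicates and the calls finitely many names and arities, read off the knowledge and action base.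
theorem finite_reachIn : {s | ReflTransGen (K.StepIn k F) K.startState s}.Finite := by
  have hF := F.finite_toSet
  refine (finite_states hF (finite_facts hF K.finite_shapes)
    (P := {f | (f.1, f.2.length) ∈ K.callShapes ∧ ∀ c ∈ f.2, c ∈ {c | c ∈ F}}) ?_).subset ?_
  · refine (K.finite_callShapes.biUnion (t := fun p => (Prod.mk p.1) ''
      {l : List Const | l.length = p.2 ∧ ∀ x ∈ l, x ∈ {c | c ∈ F}}) fun p _ =>
      (finite_lists hF p.2).image _).subset ?_
    rintro ⟨f, l⟩ ⟨h1, h2⟩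
    exact Set.mem_biUnion h1 ⟨l, ⟨rfl, h2⟩, rfl⟩
  · intro s hs
    have h1 := reach_shapes (reach_of_reachIn hs)
    have h2 := KAB.inv_of_reach hK hC (reach_of_reachIn hs)
    have h3 := known_subset_of_reachIn hCF hs
    exact ⟨fun f hf => ⟨h1.1 f hf, fun c hc => h3 c (h2.adom_subset ⟨f, hf, hc⟩)⟩,
      fun f d hd => ⟨⟨h1.2 f d hd, fun c hc => h3 c (h2.args f d hd c hc)⟩, h3 d (.inr ⟨f, hd⟩)⟩⟩

end Bounded

/-! ### Invariance of the mu-calculus -/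

/-- The constants of the formula are among `C`. -/
def MuEQL.ConstsIn (C : List Const) : MuEQL → Prop
  | .query Q => Q.ConstsIn C
  | .neg Φ => Φ.ConstsIn C
  | .and Φ Ψ => Φ.ConstsIn C ∧ Ψ.ConstsIn C
  | .ex _ Φ => Φ.ConstsIn C
  | .dia Φ => Φ.ConstsIn C
  | .pvar _ => True
  | .mu _ Φ => Φ.ConstsIn C

theorem MuEQL.ConstsIn.mono {C C' : List Const} (h : C ⊆ C') {Φ : MuEQL} (hΦ : Φ.ConstsIn C) :
    Φ.ConstsIn C' := by
  induction Φ with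
  | query Q => exact ECQ.ConstsIn.mono h hΦ
  | and Φ Ψ ih ih' => exact ⟨ih hΦ.1, ih' hΦ.2⟩
  | pvar Z => trivial
  | neg Φ ih => exact ih hΦ
  | ex x Φ ih => exact ih hΦ
  | dia Φ ih => exact ih hΦ
  | mu Z Φ ih => exact ih hΦ

theorem MuEQL.exists_constsIn (Φ : MuEQL) : ∃ C, Φ.ConstsIn C := by
  induction Φ with
  | query Q => exact Q.exists_constsIn
  | and Φ Ψ ih ih' =>
    obtain ⟨C, hC⟩ := ih
    obtain ⟨C', hC'⟩ := ih'
    exact ⟨C ++ C', hC.mono (by simp), hC'.mono (by simp)⟩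
  | pvar Z => exact ⟨[], trivial⟩
  | neg Φ ih => exact ih
  | ex x Φ ih => exact ih
  | dia Φ ih => exact ih
  | mu Z Φ ih => exact ih

theorem MuEQL.ext_subset {Υ : TransitionSystem} {Φ : MuEQL} :
    ∀ {v : ℕ → Const} {V : ℕ → Set Υ.State}, (∀ Z, V Z ⊆ Υ.states) → Φ.ext Υ v V ⊆ Υ.states := by
  induction Φ with
  | neg Φ => exact fun _ => Set.sdiff_subset
  | and Φ Ψ ih => exact fun hV => Set.inter_subset_left.trans (ih hV)
  | pvar Z => exact fun hV => hV Z
  | _ => exact fun _ => Set.sep_subset _ _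

theorem MuEQL.ext_mono {Υ : TransitionSystem} {Z : ℕ} {E E' : Set Υ.State} (hE : E ⊆ E')
    {Φ : MuEQL} : ∀ {v : ℕ → Const} {V : ℕ → Set Υ.State},
    (OccursWith Z true Φ → Φ.ext Υ v (Function.update V Z E) ⊆
      Φ.ext Υ v (Function.update V Z E')) ∧
    (OccursWith Z false Φ → Φ.ext Υ v (Function.update V Z E') ⊆
      Φ.ext Υ v (Function.update V Z E)) := by
  induction Φ with
  | query Q => exact ⟨fun _ => subset_rfl, fun _ => subset_rfl⟩
  | neg Φ ih =>
    exact ⟨fun h => Set.sdiff_subset_sdiff_right (ih.2 h),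
      fun h => Set.sdiff_subset_sdiff_right (ih.1 h)⟩
  | and Φ Ψ ih ih' =>
    exact ⟨fun h => Set.inter_subset_inter (ih.1 h.1) (ih'.1 h.2),
      fun h => Set.inter_subset_inter (ih.2 h.1) (ih'.2 h.2)⟩
  | ex x Φ ih =>
    exact ⟨fun h s hs => ⟨hs.1, hs.2.imp fun d hd => ⟨hd.1, ih.1 h hd.2⟩⟩,
      fun h s hs => ⟨hs.1, hs.2.imp fun d hd => ⟨hd.1, ih.2 h hd.2⟩⟩⟩
  | dia Φ ih =>
    exact ⟨fun h s hs => ⟨hs.1, hs.2.imp fun d hd => ⟨hd.1, ih.1 h hd.2⟩⟩,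
      fun h s hs => ⟨hs.1, hs.2.imp fun d hd => ⟨hd.1, ih.2 h hd.2⟩⟩⟩
  | pvar Y =>
    intro v V
    simp only [OccursWith, ext]
    by_cases h : Y = Z
    · subst h
      simpa using hE
    · simp [h]
  | mu Y Φ ih =>
    intro v V
    by_cases h : Z = Y
    · subst h
      simp [ext]
    · have key : ∀ D D' : Set Υ.State, Function.update (Function.update V Z D) Y D' =
          Function.update (Function.update V Y D') Z D := fun D D' => Function.update_comm h _ _ _
      simp only [ext, key]
      constructor <;> rintro (rfl | h') s hs
      · exact absurd rfl h
      · exact ⟨hs.1, fun D hD hD' => hs.2 D hD ((ih.1 h').trans hD')⟩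
      · exact absurd rfl h
      · exact ⟨hs.1, fun D hD hD' => hs.2 D hD ((ih.2 h').trans hD')⟩

/-- A bisimulation between transition systems, which respects queries with constants in `C`. It
is indexed by relations between constants, the pairs of values of individual variables. -/
structure Bisim (C : List Const) (Υ Υ' : TransitionSystem)
    (W : Set (Const × Const) → Υ.State → Υ'.State → Prop) : Prop where
  left : ∀ {ρ s t}, W ρ s t → s ∈ Υ.states
  right : ∀ {ρ s t}, W ρ s t → t ∈ Υ'.states
  anti : ∀ {ρ ρ' s t}, ρ ⊆ ρ' → W ρ' s t → W ρ s t
  forth : ∀ {ρ s t s'}, W ρ s t → Υ.trans s s' → ∃ t', Υ'.trans t t' ∧ W ρ s' t'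
  back : ∀ {ρ s t t'}, W ρ s t → Υ'.trans t t' → ∃ s', Υ.trans s s' ∧ W ρ s' t'
  dom_forth : ∀ {ρ s t d}, W ρ s t → d ∈ adom (Υ.abox s) →
    ∃ d' ∈ adom (Υ'.abox t), W (insert (d, d') ρ) s t
  dom_back : ∀ {ρ s t d'}, W ρ s t → d' ∈ adom (Υ'.abox t) →
    ∃ d ∈ adom (Υ.abox s), W (insert (d, d') ρ) s t
  query : ∀ {ρ s t v v'} {Q : ECQ}, W ρ s t → Q.ConstsIn C → (∀ x ∈ Q.fv, (v x, v' x) ∈ ρ) →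
    (Q.Holds Υ.tbox (Υ.abox s) v ↔ Q.Holds Υ'.tbox (Υ'.abox t) v')

section Bisim

variable {C : List Const} {Υ Υ' : TransitionSystem}
  {W : Set (Const × Const) → Υ.State → Υ'.State → Prop}

/-- Within sets of states that are closed under the operators of both systems there are related
sets with this property. -/
theorem exists_related {R : Υ.State → Υ'.State → Prop} {f : Set Υ.State → Set Υ.State}
    {f' : Set Υ'.State → Set Υ'.State} (hf : _root_.Monotone f) (hf' : _root_.Monotone f')
    (hR : ∀ D D', D ⊆ Υ.states → D' ⊆ Υ'.states → (∀ s t, R s t → (s ∈ D ↔ t ∈ D')) →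
      ∀ s t, R s t → (s ∈ f D ↔ t ∈ f' D'))
    {E : Set Υ.State} {E' : Set Υ'.State} (hEs : E ⊆ Υ.states) (hEs' : E' ⊆ Υ'.states)
    (hE : f E ⊆ E) (hE' : f' E' ⊆ E') :
    ∃ D D', D ⊆ E ∧ D' ⊆ E' ∧ f D ⊆ D ∧ f' D' ⊆ D' ∧ ∀ s t, R s t → (s ∈ D ↔ t ∈ D') := by
  -- `D` and `D'` form the largest related pair inside `E` and `E'`. Applying the operators gives
  -- another related pair inside `E` and `E'`, hence one inside `D` and `D'`.
  let D : Set Υ.State := {s | ∃ P P', P ⊆ E ∧ P' ⊆ E' ∧ (∀ s t, R s t → (s ∈ P ↔ t ∈ P')) ∧ s ∈ P}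
  let D' : Set Υ'.State :=
    {t | ∃ P P', P ⊆ E ∧ P' ⊆ E' ∧ (∀ s t, R s t → (s ∈ P ↔ t ∈ P')) ∧ t ∈ P'}
  have hD : D ⊆ E := fun s ⟨P, P', h1, _, _, h⟩ => h1 h
  have hD' : D' ⊆ E' := fun s ⟨P, P', _, h1, _, h⟩ => h1 h
  have hDD : ∀ s t, R s t → (s ∈ D ↔ t ∈ D') := fun s t hst =>
    exists_congr fun P => exists_congr fun P' => and_congr_right fun _ => and_congr_right fun _ =>
      and_congr_right fun h => h s t hst
  have hfD := hR D D' (hD.trans hEs) (hD'.trans hEs') hDD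
  exact ⟨D, D', hD, hD', fun s hs => ⟨f D, f' D', (hf hD).trans hE, (hf' hD').trans hE', hfD, hs⟩,
    fun s hs => ⟨f D, f' D', (hf hD).trans hE, (hf' hD').trans hE', hfD, hs⟩, hDD⟩

/-- Induction on the formula. A quantifier enlarges `ρ` by the chosen pair, and the hypothesis on
predicate variables survives because `W` is antitone in `ρ`. For a fixpoint, a closed set on one
side need not correspond to a set on the other; `exists_related` shrinks it to a closed set that
does. -/
theorem Bisim.ext (hW : Bisim C Υ Υ' W) {Φ : MuEQL} : ∀ {ρ : Set (Const × Const)}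
    {v v' : ℕ → Const} {V : ℕ → Set Υ.State} {V' : ℕ → Set Υ'.State}, Φ.Monotone → Φ.ConstsIn C →
    (∀ x ∈ Φ.fv, (v x, v' x) ∈ ρ) → (∀ Z, V Z ⊆ Υ.states) → (∀ Z, V' Z ⊆ Υ'.states) →
    (∀ Z ∈ Φ.fpv, ∀ s t, W ρ s t → (s ∈ V Z ↔ t ∈ V' Z)) → ∀ s t, W ρ s t →
    (s ∈ Φ.ext Υ v V ↔ t ∈ Φ.ext Υ' v' V') := by
  induction Φ with
  | query Q =>
    intro ρ v v' V V' hm hc hv hV hV' hVV s t h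
    exact and_congr (iff_of_true (hW.left h) (hW.right h)) (hW.query h hc hv)
  | neg Φ ih =>
    intro ρ v v' V V' hm hc hv hV hV' hVV s t h
    exact and_congr (iff_of_true (hW.left h) (hW.right h))
      (not_congr (ih hm hc hv hV hV' hVV s t h))
  | and Φ Ψ ih ih' =>
    intro ρ v v' V V' hm hc hv hV hV' hVV s t h
    exact and_congr (ih hm.1 hc.1 (fun x hx => hv x (.inl hx)) hV hV'
      (fun Z hZ => hVV Z (.inl hZ)) s t h) (ih' hm.2 hc.2 (fun x hx => hv x (.inr hx)) hV hV'
      (fun Z hZ => hVV Z (.inr hZ)) s t h)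
  | ex x Φ ih =>
    intro ρ v v' V V' hm hc hv hV hV' hVV s t h
    have key : ∀ d d', W (insert (d, d') ρ) s t → (s ∈ Φ.ext Υ (Function.update v x d) V ↔
        t ∈ Φ.ext Υ' (Function.update v' x d') V') := fun d d' h =>
      ih hm hc (fun y hy => by
        by_cases hyx : y = x
        · subst hyx
          simp
        · simp only [Function.update_of_ne hyx]
          exact .inr (hv y ⟨hy, hyx⟩)) hV hV'
        (fun Z hZ s t h => hVV Z hZ s t (hW.anti (Set.subset_insert _ _) h)) s t h
    refine and_congr (iff_of_true (hW.left h) (hW.right h)) ⟨?_, ?_⟩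
    · rintro ⟨d, hd, hs⟩
      obtain ⟨d', hd', h'⟩ := hW.dom_forth h hd
      exact ⟨d', hd', (key d d' h').1 hs⟩
    · rintro ⟨d', hd', ht⟩
      obtain ⟨d, hd, h'⟩ := hW.dom_back h hd'
      exact ⟨d, hd, (key d d' h').2 ht⟩
  | dia Φ ih =>
    intro ρ v v' V V' hm hc hv hV hV' hVV s t h
    refine and_congr (iff_of_true (hW.left h) (hW.right h)) ⟨?_, ?_⟩
    · rintro ⟨s', h1, hs⟩
      obtain ⟨t', h2, h'⟩ := hW.forth h h1
      exact ⟨t', h2, (ih hm hc hv hV hV' hVV s' t' h').1 hs⟩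
    · rintro ⟨t', h1, ht⟩
      obtain ⟨s', h2, h'⟩ := hW.back h h1
      exact ⟨s', h2, (ih hm hc hv hV hV' hVV s' t' h').2 ht⟩
  | pvar Z =>
    intro ρ v v' V V' hm hc hv hV hV' hVV s t h
    exact hVV Z rfl s t h
  | mu Z Φ ih =>
    intro ρ v v' V V' hm hc hv hV hV' hVV s t h
    have hup : ∀ D : Set Υ.State, D ⊆ Υ.states → ∀ Y, Function.update V Z D Y ⊆ Υ.states :=
      fun D hD Y => by
        by_cases hY : Y = Z
        · subst hY
          simpa using hD
        · simpa [hY] using hV Y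
    have hup' : ∀ D : Set Υ'.State, D ⊆ Υ'.states → ∀ Y, Function.update V' Z D Y ⊆ Υ'.states :=
      fun D hD Y => by
        by_cases hY : Y = Z
        · subst hY
          simpa using hD
        · simpa [hY] using hV' Y
    have key := fun (E : Set Υ.State) (E' : Set Υ'.State) => exists_related (R := W ρ)
      (f := fun D => Φ.ext Υ v (Function.update V Z D))
      (f' := fun D => Φ.ext Υ' v' (Function.update V' Z D))
      (fun _ _ h => (MuEQL.ext_mono h).1 hm.1) (fun _ _ h => (MuEQL.ext_mono h).1 hm.1)
      (fun D D' hD hD' hDD => ih hm.2 hc hv (hup D hD) (hup' D' hD') fun Y hY s t h => by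
        by_cases hYZ : Y = Z
        · subst hYZ
          simpa using hDD s t h
        · simp only [Function.update_of_ne hYZ]
          exact hVV Y ⟨hY, hYZ⟩ s t h) (E := E) (E' := E')
    refine and_congr (iff_of_true (hW.left h) (hW.right h)) ⟨fun hs E' h1 h2 => ?_,
      fun ht E h1 h2 => ?_⟩
    -- Only `E'` is given; the set of all states is a closed set to start with on the other side.
    · obtain ⟨D, D', hD, hD', hfD, hfD', hDD⟩ := key Υ.states E' subset_rfl h1
        (MuEQL.ext_subset (hup _ subset_rfl)) h2
      exact hD' ((hDD s t h).1 (hs D hD hfD))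
    · obtain ⟨D, D', hD, hD', hfD, hfD', hDD⟩ := key E Υ'.states h1 subset_rfl h2
        (MuEQL.ext_subset (hup' _ subset_rfl))
      exact hD ((hDD s t h).2 (ht D' hD' hfD'))

end Bisim

/-! ### Bisimilarity of the extended and the restricted system -/

section

variable {K : KAB} {k : RepairKind} {C F : List Const}

/-- The states are equal up to a renaming that fixes `C` and contains the given pairs. -/
def Related (K : KAB) (k : RepairKind) (C F : List Const) (ρ : Set (Const × Const))
    (s t : KState) : Prop :=
  ReflTransGen (K.Step k) K.startState s ∧ ReflTransGen (K.StepIn k F) K.startState t ∧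
    ∃ π : Equiv.Perm Const, (∀ c ∈ C, π c = c) ∧ t = permS π s ∧
      ∀ p ∈ ρ, p.1 ∈ known C s ∧ π p.1 = p.2

/-- A step of the full system is renamed by `π` and then by some `τ` that brings its results into
`F`. Since `τ` fixes the constants known before the step and the values of variables are among
these, `τ * π` still matches the recorded pairs. A step of the restricted system is pulled back by
`π.symm`. -/
theorem bisim_boundedTS (hK : K.WellFormed) (hC : K.ConstsIn C) (hCF : C ⊆ F)
    (hF : K.Adequate k C F) :
    Bisim C (K.extendedTS k) (K.boundedTS k F) (Related K k C F) where
  left h := h.1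
  right h := h.2.1
  anti := fun hρ ⟨h1, h2, π, h3, h4, h5⟩ => ⟨h1, h2, π, h3, h4, fun p hp => h5 p (hρ hp)⟩
  forth := by
    rintro ρ s t s' ⟨h1, h2, π, h3, rfl, h4⟩ ⟨-, h⟩
    obtain ⟨τ, hτ, hs⟩ := hF.exists_stepIn hK hC hCF h2 (h.perm hC h3)
    refine ⟨_, ⟨h2, hs⟩, h1.tail h, h2.tail hs, τ * π, fun c hc => ?_, permS_mul τ π s',
      fun p hp => ⟨h.known_mono (h4 p hp).1, ?_⟩⟩
    · rw [Equiv.Perm.mul_apply, h3 c hc, hτ c (.inl hc)]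
    · rw [Equiv.Perm.mul_apply, hτ _ ?_, (h4 p hp).2]
      exact (Set.ext_iff.1 (known_permS h3) _).2 ⟨_, (h4 p hp).1, rfl⟩
  back := by
    rintro ρ s t t' ⟨h1, h2, π, h3, rfl, h4⟩ ⟨-, h⟩
    have hs : K.Step k s (permS π.symm t') := by
      have := h.1.perm hC (symm_fixes h3)
      rwa [show permS π.symm (permS π s) = s from permS_symm_permS π s] at this
    refine ⟨permS π.symm t', ⟨h1, hs⟩, h1.tail hs, h2.tail h, π, h3, ?_, fun p hp =>
      ⟨hs.known_mono (h4 p hp).1, (h4 p hp).2⟩⟩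
    simpa using (permS_symm_permS π.symm t').symm
  dom_forth := by
    rintro ρ s t d ⟨h1, h2, π, h3, rfl, h4⟩ hd
    refine ⟨π d, mem_adom_permA.2 hd, h1, h2, π, h3, rfl, ?_⟩
    rintro p (rfl | hp)
    · exact ⟨(KAB.inv_of_reach hK hC h1).adom_subset hd, rfl⟩
    · exact h4 p hp
  dom_back := by
    rintro ρ s t d' ⟨h1, h2, π, h3, rfl, h4⟩ hd
    obtain ⟨d, rfl⟩ := π.surjective d'
    have hd : d ∈ adom s.abox := mem_adom_permA.1 hd
    refine ⟨d, hd, h1, h2, π, h3, rfl, ?_⟩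
    rintro p (rfl | hp)
    · exact ⟨(KAB.inv_of_reach hK hC h1).adom_subset hd, rfl⟩
    · exact h4 p hp
  query := by
    rintro ρ s t v v' Q ⟨h1, h2, π, h3, rfl, h4⟩ hQ hv
    exact (holds_perm hQ h3 fun x hx => ((h4 _ (hv x hx)).2).symm).symm

/-- The start states are related by the identity. With no free variables the valuations on the two
sides need not correspond, which removes the quantification over valuations. -/
theorem models_iff (hK : K.WellFormed) (hC : K.ConstsIn C) (hCF : C ⊆ F) (hF : K.Adequate k C F)
    {Φ : MuEQL} (hΦ : Φ.Closed) (hm : Φ.Monotone) (hΦC : Φ.ConstsIn C) (v : ℕ → Const) :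
    (K.extendedTS k).Models Φ ↔ K.startState ∈ Φ.ext (K.boundedTS k F) v fun _ => ∅ := by
  have h1 : permS 1 K.startState = K.startState := by
    have := permS_symm_permS 1 K.startState
    rwa [permS_mul] at this
  have hrel : Related K k C F ∅ K.startState K.startState :=
    ⟨.refl, .refl, 1, fun _ _ => rfl, h1.symm, by simp⟩
  have key : ∀ (v' : ℕ → Const) (V : ℕ → Set KState), (∀ Z, V Z ⊆ (K.extendedTS k).states) →
      (K.startState ∈ Φ.ext (K.extendedTS k) v' V ↔
        K.startState ∈ Φ.ext (K.boundedTS k F) v fun _ => ∅) := fun v' V hV =>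
    (bisim_boundedTS hK hC hCF hF).ext hm hΦC (fun x hx => (Set.ext_iff.1 hΦ.1 x).1 hx |>.elim) hV
      (fun _ => Set.empty_subset _) (fun Z hZ => (Set.ext_iff.1 hΦ.2 Z).1 hZ |>.elim) _ _ hrel
  constructor
  · exact fun h => (key v (fun _ => ∅) fun _ => Set.empty_subset _).1
      (h _ _ fun _ => Set.empty_subset _)
  · exact fun h v' V hV => (key v' V hV).2 h

end

/-! ### Computation of the steps -/

section Assoc

variable {κ β : Type} [DecidableEq κ] {d : β}

theorem assoc_mem {l : List (κ × β)} {k : κ} (h : k ∈ l.map Prod.fst) : (k, assoc d l k) ∈ l := by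
  induction l with
  | nil => simp at h
  | cons x l ih =>
    by_cases hx : x.1 = k
    · simp [assoc, ← hx]
    · have : k ∈ l.map Prod.fst := by
        rcases List.mem_cons.1 h with h | h
        · exact absurd h.symm hx
        · exact h
      simpa [assoc, hx] using .inr (ih this)

theorem assoc_append_left {l m : List (κ × β)} {k : κ} (h : k ∈ l.map Prod.fst) :
    assoc d (l ++ m) k = assoc d l k := by
  induction l with
  | nil => simp at h
  | cons x l ih =>
    by_cases hx : x.1 = k
    · simp [assoc, hx]
    · have : k ∈ l.map Prod.fst := by
        rcases List.mem_cons.1 h with h | h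
        · exact absurd h.symm hx
        · exact h
      simpa [assoc, hx] using ih this

theorem assoc_append_right {l m : List (κ × β)} {k : κ} (h : k ∉ l.map Prod.fst) :
    assoc d (l ++ m) k = assoc d m k := by
  induction l with
  | nil => rfl
  | cons x l ih =>
    rw [List.map_cons, List.mem_cons, not_or] at h
    simpa [assoc, Ne.symm h.1] using ih h.2

omit [DecidableEq κ] in
theorem mem_asgs {l : List (κ × β)} {keys : List κ} {vals : List β} (h : l ∈ asgs keys vals) :
    l.map Prod.fst = keys ∧ ∀ p ∈ l, p.2 ∈ vals := by
  induction keys generalizing l with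
  | nil =>
    have : l = [] := by simpa [asgs] using h
    simp [this]
  | cons k keys ih =>
    obtain ⟨l, hl, h⟩ := List.mem_flatMap.1 h
    obtain ⟨v, hv, rfl⟩ := List.mem_map.1 h
    obtain ⟨h1, h2⟩ := ih hl
    refine ⟨by simp [h1], ?_⟩
    rintro p hp
    rcases List.mem_cons.1 hp with rfl | hp
    · exact hv
    · exact h2 p hp

end Assoc

/-- The partial function given by an association list. -/
def lookup (m : List (ServiceCall × Const)) (c : ServiceCall) : Option Const :=
  if c ∈ m.map Prod.fst then some (assoc .temp m c) else none

theorem lookup_append_of_mem {μ m : List (ServiceCall × Const)} {c : ServiceCall}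
    (h : c ∈ μ.map Prod.fst) : lookup (μ ++ m) c = some (assoc .temp μ c) := by
  rw [lookup, if_pos (by rw [List.map_append]; exact List.mem_append_left _ h),
    assoc_append_left h]

theorem lookup_append_of_notMem {μ m : List (ServiceCall × Const)} {c : ServiceCall}
    (h : c ∉ μ.map Prod.fst) : lookup (μ ++ m) c = lookup m c := by
  simp only [lookup, List.map_append, List.mem_append, h, false_or, assoc_append_right h]

/-- The presentation of states by lists. -/
abbrev CState := List Fact × List (ServiceCall × Const)

/-- The state presented by a pair of lists. -/
def decode (cs : CState) : KState := ⟨cs.1.toFinset, lookup cs.2⟩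

/-- The free variables of a query. -/
noncomputable def UCQ.fvList (q : UCQ) : List ℕ :=
  q.flatMap fun d => sift (fun x => x ∉ d.exVars) d.vars

theorem UCQ.mem_fvList {q : UCQ} {x : ℕ} : x ∈ q.fvList ↔ x ∈ q.fv := by
  simp [fvList, fv, CQ.fv, CQ.mem_vars]

/-- The answers of the condition of an effect. -/
noncomputable def effectVals (T : TBox) (A : List Fact) (ps : List ℕ) (g : List (ℕ × Const))
    (e : Effect) : List (List (ℕ × Const)) :=
  sift (fun h => e.cond.Holds T A.toFinset (val h))
    ((asgs (sift (fun x => x ∉ ps) e.qpos.fvList) (adomList A)).map fun h => h ++ g)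

/-- The facts produced by an action. -/
noncomputable def doList (T : TBox) (A : List Fact) (α : Action) (g : List (ℕ × Const)) :
    List (Atom GTerm) :=
  α.effects.flatMap fun e => (effectVals T A α.params g e).flatMap fun h =>
    e.facts.map (Atom.map (ETerm.ground (val h)))

theorem ground_congr {v v' : ℕ → Const} {t : ETerm} (h : ∀ x ∈ t.vars, v x = v' x) :
    t.ground v = t.ground v' := by
  cases t with
  | const c => rfl
  | var x => exact congrArg Sum.inl (h x rfl)
  | call f args =>
    simp only [ETerm.ground, List.map_congr_left h]

/-- Well-formed effects mention only free variables of the positive query. It suffices to assign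
values from the active domain to those that are not parameters and to append the assignment `g` of
the parameters. -/
theorem mem_doList {T : TBox} {A : List Fact} {α : Action} {g : List (ℕ × Const)}
    (hα : ∀ e ∈ α.effects, e.WellFormed) {a : Atom GTerm} :
    a ∈ doList T A α g ↔ a ∈ doFacts T A.toFinset α (val g) := by
  simp only [doList, List.mem_flatMap, List.mem_map, effectVals, mem_sift]
  constructor
  · rintro ⟨e, he, _, ⟨⟨h, hh, rfl⟩, hH⟩, b, hb, rfl⟩
    obtain ⟨h1, h2⟩ := mem_asgs hh
    refine ⟨e, he, val (h ++ g), fun p hp => ?_, fun x hx hxp => ?_, hH, b, hb, rfl⟩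
    · refine assoc_append_right ?_
      simp [h1, hp]
    · have hx' : x ∈ h.map Prod.fst := by
        rw [h1, mem_sift, UCQ.mem_fvList]
        exact ⟨hx.elim id fun hx => (hα e he).fv_neg hx, hxp⟩
      rw [val, assoc_append_left hx']
      exact mem_adomList.1 (h2 _ (assoc_mem hx'))
  · rintro ⟨e, he, v, h1, h2, h3, b, hb, rfl⟩
    set keys := sift (fun x => x ∉ α.params) e.qpos.fvList with hkeys
    have hv : ∀ x ∈ e.qpos.fv, val (keys.map (fun x => (x, v x)) ++ g) x = v x := by
      intro x hx
      have hk : (keys.map fun x => (x, v x)).map Prod.fst = keys := by simp [Function.comp_def]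
      by_cases hp : x ∈ α.params
      · rw [val, assoc_append_right (by simp [hkeys, hp])]
        exact (h1 x hp).symm
      · have hx' : x ∈ keys := by
          rw [hkeys, mem_sift, UCQ.mem_fvList]
          exact ⟨hx, hp⟩
        rw [val, assoc_append_left (by rw [hk]; exact hx')]
        exact assoc_map v hx'
    refine ⟨e, he, _, ⟨⟨_, map_mem_asgs v fun x hx => ?_, rfl⟩, ?_⟩, b, hb, ?_⟩
    · rw [mem_sift, UCQ.mem_fvList] at hx
      exact mem_adomList.2 (h2 x (.inl hx.1) hx.2)
    · refine (holds_congr fun x hx => hv x ?_).2 h3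
      exact Or.elim hx id fun hx => (hα e he).fv_neg hx
    · refine Atom.map_congr fun t ht => ground_congr fun x hx => ?_
      exact hv x ((hα e he).fv_facts b hb t ht hx)

/-- The service calls in a term. -/
def GTerm.calls : GTerm → List ServiceCall
  | .inl _ => []
  | .inr c => [c]

/-- The service calls in a list of facts. -/
def callList (E : List (Atom GTerm)) : List ServiceCall :=
  E.flatMap fun a => a.termList.flatMap GTerm.calls

theorem mem_callList {E : List (Atom GTerm)} {c : ServiceCall} :
    c ∈ callList E ↔ c ∈ callsOf {a | a ∈ E} := by
  simp only [callList, List.mem_flatMap, Atom.mem_termList, callsOf, Set.mem_ofPred_eq]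
  refine exists_congr fun a => and_congr_right fun _ => ⟨?_, fun h => ⟨_, h, by simp [GTerm.calls]⟩⟩
  rintro ⟨t | d, h1, h2⟩
  · simp [GTerm.calls] at h2
  · simp only [GTerm.calls, List.mem_singleton] at h2
    exact h2 ▸ h1

/-- The states obtained from the facts produced by an action. -/
noncomputable def execList (F : List Const) (m : List (ServiceCall × Const))
    (E : List (Atom GTerm)) : List CState :=
  (asgs (sift (fun c => c ∉ m.map Prod.fst) (callList E)) F).map fun μ =>
    (E.map (Atom.map (GTerm.subst (assoc .temp (μ ++ m)))), μ ++ m)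

/-- The relation between states given by the results of the service calls in `D`. -/
def ExecFrom (D : Set (Atom GTerm)) (s s' : KState) : Prop :=
  ∃ θ : ServiceCall → Const,
    (∀ c ∈ callsOf D, ∀ d, s.scmap c = some d → θ c = d) ∧
    (s'.abox : Set Fact) = Atom.map (GTerm.subst θ) '' D ∧
    (∀ c ∈ callsOf D, s'.scmap c = some (θ c)) ∧
    (∀ c ∉ callsOf D, s'.scmap c = s.scmap c)

/-- Calls already recorded in `m` keep their results; the others range independently over `F`. Their
assignments are put in front of `m`, with disjoint keys. -/
theorem execFrom_iff {F : List Const} {A : List Fact} {m : List (ServiceCall × Const)}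
    {E : List (Atom GTerm)} {s' : KState} :
    (ExecFrom {a | a ∈ E} (decode (A, m)) s' ∧
      ∀ c d, s'.scmap c = some d → (decode (A, m)).scmap c = some d ∨ d ∈ F) ↔
    ∃ p ∈ execList F m E, decode p = s' := by
  set U := sift (fun c => c ∉ m.map Prod.fst) (callList E) with hU
  have hUmem : ∀ c, c ∈ U ↔ c ∈ callsOf {a | a ∈ E} ∧ c ∉ m.map Prod.fst := fun c => by
    rw [hU, mem_sift, mem_callList]
  constructor
  · rintro ⟨⟨θ, h1, h2, h3, h4⟩, h5⟩
    have hk : (U.map fun c => (c, θ c)).map Prod.fst = U := by simp [Function.comp_def]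
    have hUF : ∀ c ∈ U, θ c ∈ F := fun c hc => by
      have := (hUmem c).1 hc
      rcases h5 c _ (h3 c this.1) with h | h
      · simp [decode, lookup, this.2] at h
      · exact h
    have hθ : ∀ c ∈ callsOf {a | a ∈ E},
        assoc .temp (U.map (fun c => (c, θ c)) ++ m) c = θ c := fun c hc => by
      by_cases hcU : c ∈ U
      · rw [assoc_append_left (by rw [hk]; exact hcU)]
        exact assoc_map θ hcU
      · have hcm : c ∈ m.map Prod.fst := by
          by_contra h
          exact hcU ((hUmem c).2 ⟨hc, h⟩)
        rw [assoc_append_right (by rw [hk]; exact hcU)]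
        exact (h1 c hc _ (if_pos hcm)).symm
    refine ⟨_, List.mem_map.2 ⟨U.map fun c => (c, θ c), map_mem_asgs θ hUF, rfl⟩, ?_⟩
    obtain ⟨A', m'⟩ := s'
    simp only [decode, KState.mk.injEq]
    constructor
    · rw [← Finset.coe_inj, h2]
      ext f
      simp only [List.coe_toFinset, List.mem_map, Set.mem_ofPred_eq, Set.mem_image]
      refine exists_congr fun a => and_congr_right fun ha => ?_
      rw [Atom.map_congr (g := GTerm.subst θ)]
      rintro (t | c) ht
      · rfl
      · exact hθ c ⟨a, ha, ht⟩
    · funext c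
      by_cases hc : c ∈ callsOf {a | a ∈ E}
      · rw [show m' c = _ from h3 c hc, lookup, if_pos, hθ c hc]
        rw [List.map_append, List.mem_append, hk, hUmem]
        tauto
      · rw [show m' c = _ from h4 c hc, lookup_append_of_notMem]
        · rfl
        · rw [hk, hUmem]
          tauto
  · rintro ⟨p, hp, rfl⟩
    obtain ⟨μ, hμ, rfl⟩ := List.mem_map.1 hp
    obtain ⟨hk, hv⟩ := mem_asgs hμ
    rw [← hU] at hk
    refine ⟨⟨assoc .temp (μ ++ m), fun c hc d hd => ?_, ?_, fun c hc => ?_, fun c hc => ?_⟩,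
      fun c d hd => ?_⟩
    · have hcm : c ∈ m.map Prod.fst := by
        by_contra h
        simp [decode, lookup, h] at hd
      simp only [decode, lookup, hcm, if_true, Option.some.injEq] at hd
      rw [assoc_append_right, hd]
      rw [hk, hUmem]
      tauto
    · ext f
      simp [decode]
    · simp only [decode, lookup]
      rw [if_pos]
      rw [List.map_append, List.mem_append, hk, hUmem]
      tauto
    · simp only [decode]
      rw [lookup_append_of_notMem]
      rw [hk, hUmem]
      tauto
    · simp only [decode] at hd ⊢
      by_cases hc : c ∈ μ.map Prod.fst
      · rw [lookup_append_of_mem hc, Option.some.injEq] at hd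
        exact .inr (hd ▸ hv _ (assoc_mem hc))
      · rw [lookup_append_of_notMem hc] at hd
        exact .inl hd

/-- The legal parameters of an action. -/
noncomputable def legalList (K : KAB) (A : List Fact) (α : Action) : List (List (ℕ × Const)) :=
  sift (fun g => ∃ r, r ∈ K.rules ∧ r.act = α ∧ r.cond.Holds K.tbox A.toFinset (val g))
    (asgs α.params (adomList A))

/-- The successors of a state. -/
noncomputable def succList (K : KAB) (k : RepairKind) (F : List Const) (cs : CState) :
    List CState :=
  if stateTemp ∈ cs.1 then
    (repairList k K.tbox (sift (fun f => f ≠ stateTemp) cs.1)).map fun R =>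
      (R ++ (violList K.tbox (sift (fun f => f ≠ stateTemp) cs.1)).map violFact, cs.2)
  else
    K.actions.flatMap fun α => (legalList K cs.1 α).flatMap fun g =>
      (execList F cs.2 (doList K.tbox cs.1 α g)).map fun p => (p.1 ++ [stateTemp], p.2)

/-- Only the values at the parameters matter, and the parameters are exactly the free variables of
the rule's condition, so answers put them in the active domain. -/
theorem exists_mem_legalList_iff {K : KAB} (hK : K.WellFormed) {A : List Fact} {α : Action}
    {p : Set (Atom GTerm) → Prop} :
    (∃ σ, K.Legal A.toFinset α σ ∧ p (doFacts K.tbox A.toFinset α σ)) ↔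
      ∃ g ∈ legalList K A α, p (doFacts K.tbox A.toFinset α (val g)) := by
  constructor
  · rintro ⟨σ, ⟨r, hr, hrα, h1, h2⟩, hp⟩
    have hfv : ∀ x, x ∈ r.cond.fv ↔ x ∈ α.params := fun x => by
      rw [hK.rules_fv r hr, hrα]
      rfl
    have hv : ∀ x ∈ α.params, val (α.params.map fun x => (x, σ x)) x = σ x :=
      fun x hx => assoc_map σ hx
    refine ⟨α.params.map fun x => (x, σ x), mem_sift.2 ⟨map_mem_asgs σ fun x hx => ?_,
      r, hr, hrα, ?_⟩, ?_⟩
    · exact mem_adomList.2 (h1 x ((hfv x).2 hx))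
    · exact (holds_congr fun x hx => hv x ((hfv x).1 hx)).2 h2
    · convert hp using 1
      ext a
      refine exists_congr fun e => and_congr_right fun _ => exists_congr fun v => and_congr_left
        fun _ => forall₂_congr fun x hx => ?_
      rw [hv x hx]
  · rintro ⟨g, hg, hp⟩
    obtain ⟨h1, r, hr, hrα, h2⟩ := mem_sift.1 hg
    refine ⟨val g, ⟨r, hr, hrα, fun x hx => ?_, h2⟩, hp⟩
    obtain ⟨h3, h4⟩ := mem_asgs h1
    rw [hK.rules_fv r hr, hrα] at hx
    exact mem_adomList.1 (h4 _ (assoc_mem (h3 ▸ hx)))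

theorem stepIn_decode_iff {K : KAB} (hK : K.WellFormed) {k : RepairKind} {F : List Const}
    {cs : CState} {s' : KState} :
    K.StepIn k F (decode cs) s' ↔ ∃ p ∈ succList K k F cs, decode p = s' := by
  obtain ⟨A, m⟩ := cs
  by_cases hA : stateTemp ∈ A
  · simp only [succList, hA, if_true, List.mem_map, exists_exists_and_eq_and]
    have hA' : stateTemp ∈ (decode (A, m)).abox := List.mem_toFinset.2 hA
    have hminus : (decode (A, m)).abox \ {stateTemp} =
        (sift (fun f => f ≠ stateTemp) A).toFinset := by
      ext f
      simp [decode]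
    constructor
    · rintro ⟨h, -⟩
      cases h with
      | action α σ s' h1 h2 h3 => exact absurd hA' h1
      | repair A' R Rv h1 h2 h3 h4 =>
        rw [hminus] at h2
        subst h2
        obtain ⟨l, hl, rfl⟩ := isRepair_iff.1 h3
        refine ⟨l, hl, ?_⟩
        simp only [decode, KState.mk.injEq, and_true]
        rw [← Finset.coe_inj, h4]
        ext f
        simp [mem_violList, eq_comm]
    · rintro ⟨l, hl, rfl⟩
      refine ⟨.repair _ _ l.toFinset _ hA' rfl ?_ ?_, fun c d hd => .inl hd⟩
      · rw [hminus]
        exact isRepair_iff.2 ⟨l, hl, rfl⟩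
      · rw [hminus]
        ext f
        simp [mem_violList, eq_comm]
  · simp only [succList, hA, if_false, List.mem_flatMap, List.mem_map]
    have hA' : stateTemp ∉ (decode (A, m)).abox := fun h => hA (List.mem_toFinset.1 h)
    have hdec : ∀ p : CState, decode (p.1 ++ [stateTemp], p.2) =
        ⟨(decode p).abox ∪ {stateTemp}, (decode p).scmap⟩ := fun p => by
      simp only [decode, KState.mk.injEq, and_true]
      ext f
      simp
    have key : ∀ α ∈ K.actions, ∀ s'' : KState,
        ((∃ σ, K.Exec (decode (A, m)) α σ s'') ∧
          ∀ c d, s''.scmap c = some d → (decode (A, m)).scmap c = some d ∨ d ∈ F) ↔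
        ∃ g ∈ legalList K A α, ∃ p ∈ execList F m (doList K.tbox A α g), decode p = s'' := by
      intro α hα s''
      have h1 := exists_mem_legalList_iff hK (A := A) (α := α)
        (p := fun D => ExecFrom D (decode (A, m)) s'')
      have h2 : ∀ g, doFacts K.tbox A.toFinset α (val g) = {a | a ∈ doList K.tbox A α g} :=
        fun g => Set.ext fun a => (mem_doList (hK.effects_wf α hα)).symm
      simp only [h2] at h1
      simp only [← execFrom_iff (A := A)]
      constructor
      · rintro ⟨h, hF⟩
        obtain ⟨g, hg, h⟩ := h1.1 h
        exact ⟨g, hg, h, hF⟩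
      · rintro ⟨g, hg, h, hF⟩
        exact ⟨h1.2 ⟨g, hg, h⟩, hF⟩
    constructor
    · rintro ⟨h, hF⟩
      cases h with
      | action α σ s'' h1 h2 h3 =>
        obtain ⟨g, hg, p, hp, rfl⟩ := (key α h2 s'').1 ⟨⟨σ, h3⟩, hF⟩
        exact ⟨_, ⟨α, h2, g, hg, p, hp, rfl⟩, hdec p⟩
      | repair A' R Rv h1 h2 h3 h4 => exact absurd h1 hA'
    · rintro ⟨_, ⟨α, h2, g, hg, p, hp, rfl⟩, rfl⟩
      obtain ⟨⟨σ, h3⟩, hF⟩ := (key α h2 (decode p)).2 ⟨g, hg, p, hp, rfl⟩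
      rw [hdec]
      exact ⟨.action _ α σ _ hA' h2 h3, hF⟩

instance : RE fun K : KAB => K.tbox.IsDLLiteA := by
  have : RFun fun K : KAB => K.tbox.IsDLLiteA :=
    .comp (f := TBox.IsDLLiteA) (g := fun K : KAB => K.tbox) RFun.isDLLiteA inferInstance
  infer_instance

/-- Knowledge and action bases whose TBoxes satisfy the restriction of DL-Lite_A. -/
abbrev DLKAB := {K : KAB // K.tbox.IsDLLiteA}

/-- The TBox. -/
def DLKAB.dlTBox (K : DLKAB) : DLTBox := ⟨K.1.tbox, K.2⟩

/-- The states are equal. -/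
def CState.Equiv (cs cs' : CState) : Prop := decode cs = decode cs'

/-- A state has many presentations by lists. Equality of the states presented is decidable since the
partial functions are undefined outside the finitely many keys. -/
theorem CState.equiv_iff {cs cs' : CState} : cs.Equiv cs' ↔
    ((∀ f, f ∈ cs.1 → f ∈ cs'.1) ∧ ∀ f, f ∈ cs'.1 → f ∈ cs.1) ∧
      ∀ c, c ∈ cs.2.map Prod.fst ++ cs'.2.map Prod.fst → lookup cs.2 c = lookup cs'.2 c := by
  simp only [Equiv, decode, KState.mk.injEq]
  refine and_congr ?_ ⟨fun h c _ => congrFun h c, fun h => funext fun c => ?_⟩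
  · rw [Finset.ext_iff]
    simp only [List.mem_toFinset]
    exact ⟨fun h => ⟨fun f => (h f).1, fun f => (h f).2⟩, fun h f => ⟨h.1 f, h.2 f⟩⟩
  · by_cases hc : c ∈ cs.2.map Prod.fst ++ cs'.2.map Prod.fst
    · exact h c hc
    · rw [List.mem_append, not_or] at hc
      rw [lookup, lookup, if_neg hc.1, if_neg hc.2]

/-- The state occurs in the list. -/
def CState.In (cs : CState) (E : List CState) : Prop := ∃ cs', cs' ∈ E ∧ cs'.Equiv cs

/-! ### Computability of the successor function -/

section Instances

variable {α : Type} [Coded α]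

instance rFun_dlTBox {K : α → DLKAB} [hK : RFun K] : RFun fun a => (K a).dlTBox :=
  .subtypeMk (p := TBox.IsDLLiteA) (f := fun a => (K a).1.tbox) inferInstance _

instance rFun_lookup {m : α → List (ServiceCall × Const)} {c : α → ServiceCall} [hm : RFun m]
    [hc : RFun c] : RFun fun a => lookup (m a) (c a) := by
  have : RFun fun x : List (ServiceCall × Const) × ServiceCall => lookup x.1 x.2 := by
    unfold lookup
    infer_instance
  exact .comp₂ (f := lookup) this hm hc

instance rFun_fvList {q : α → UCQ} [hq : RFun q] : RFun fun a => (q a).fvList := by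
  have : RFun fun q : UCQ => q.fvList := by
    exact RFun.flatMap (l := fun q : UCQ => q) (f := fun _ d => sift (fun x => x ∉ d.exVars) d.vars)
  exact .comp (f := UCQ.fvList) this hq

instance rFun_effectCond {e : α → Effect} [he : RFun e] : RFun fun a => (e a).cond := by
  unfold Effect.cond
  infer_instance

instance rFun_effectVals {T : α → DLTBox} {A : α → List Fact} {ps : α → List ℕ}
    {g : α → List (ℕ × Const)} {e : α → Effect} [hT : RFun T] [hA : RFun A] [hps : RFun ps]
    [hg : RFun g] [he : RFun e] : RFun fun a => effectVals (T a).1 (A a) (ps a) (g a) (e a) := by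
  have h : RFun fun x : DLTBox × List Fact × List ℕ × List (ℕ × Const) × Effect =>
      effectVals x.1.1 x.2.1 x.2.2.1 x.2.2.2.1 x.2.2.2.2 := by
    unfold effectVals
    infer_instance
  exact .comp (f := fun x : DLTBox × List Fact × List ℕ × List (ℕ × Const) × Effect =>
      effectVals x.1.1 x.2.1 x.2.2.1 x.2.2.2.1 x.2.2.2.2)
    (g := fun a => (T a, A a, ps a, g a, e a)) h inferInstance

instance rFun_ground {g : α → List (ℕ × Const)} {t : α → ETerm} [hg : RFun g] [ht : RFun t] :
    RFun fun a => (t a).ground (val (g a)) := by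
  have : RFun fun x : List (ℕ × Const) × ETerm => x.2.ground (val x.1) := by
    apply RFun.eTerm_cases (h := fun g t => ETerm.ground (val g) t) <;> unfold ETerm.ground <;>
      infer_instance
  exact .comp₂ (f := fun g (t : ETerm) => t.ground (val g)) this hg ht

instance rFun_groundAtom {g : α → List (ℕ × Const)} {f : α → Atom ETerm} [hg : RFun g]
    [ht : RFun f] : RFun fun a => (f a).map (ETerm.ground (val (g a))) := by
  have : RFun fun x : α × ETerm => g x.1 := .comp (f := g) hg inferInstance
  have : RFun fun x : α × ETerm => ETerm.ground (val (g x.1)) x.2 :=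
    rFun_ground (g := fun x : α × ETerm => g x.1) (t := fun x => x.2)
  exact rFun_atomMap (h := fun a t => ETerm.ground (val (g a)) t)

instance rFun_doList {T : α → DLTBox} {A : α → List Fact} {b : α → Action}
    {g : α → List (ℕ × Const)} [hT : RFun T] [hA : RFun A] [hb : RFun b] [hg : RFun g] :
    RFun fun a => doList (T a).1 (A a) (b a) (g a) := by
  have h : RFun fun x : DLTBox × List Fact × Action × List (ℕ × Const) =>
      doList x.1.1 x.2.1 x.2.2.1 x.2.2.2 := by
    unfold doList
    infer_instance
  exact .comp (f := fun x : DLTBox × List Fact × Action × List (ℕ × Const) =>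
      doList x.1.1 x.2.1 x.2.2.1 x.2.2.2) (g := fun a => (T a, A a, b a, g a)) h inferInstance

instance rFun_calls {t : α → GTerm} [ht : RFun t] : RFun fun a => (t a).calls := by
  have : RFun fun x : Unit × GTerm => x.2.calls := by
    apply RFun.sum_cases (h := fun _ t => GTerm.calls t) <;> unfold GTerm.calls <;> infer_instance
  exact .comp (f := fun x : Unit × GTerm => x.2.calls) (g := fun a => ((), t a)) this inferInstance

instance rFun_callList {E : α → List (Atom GTerm)} [hE : RFun E] :
    RFun fun a => callList (E a) := by
  have : RFun fun E : List (Atom GTerm) => callList E := by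
    have : RFun fun x : (List (Atom GTerm) × Atom GTerm) × GTerm => GTerm.calls x.2 := inferInstance
    have : RFun fun x : List (Atom GTerm) × Atom GTerm => x.2.termList.flatMap GTerm.calls :=
      RFun.flatMap (l := fun x : List (Atom GTerm) × Atom GTerm => x.2.termList)
        (f := fun _ t => t.calls)
    exact RFun.flatMap (l := fun E : List (Atom GTerm) => E)
      (f := fun _ a => a.termList.flatMap GTerm.calls)
  exact .comp (f := callList) this hE

instance rFun_subst {m : α → List (ServiceCall × Const)} {t : α → GTerm} [hm : RFun m]
    [ht : RFun t] : RFun fun a => GTerm.subst (assoc .temp (m a)) (t a) := by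
  have : RFun fun x : List (ServiceCall × Const) × GTerm =>
      GTerm.subst (assoc .temp x.1) x.2 := by
    apply RFun.sum_cases (h := fun m t => GTerm.subst (assoc .temp m) t) <;> unfold GTerm.subst <;>
      simp only [Sum.elim_inl, Sum.elim_inr, id] <;> infer_instance
  exact .comp₂ (f := fun m t => GTerm.subst (assoc .temp m) t) this hm ht

instance rFun_substAtom {m : α → List (ServiceCall × Const)} {f : α → Atom GTerm} [hm : RFun m]
    [hf : RFun f] : RFun fun a => (f a).map (GTerm.subst (assoc .temp (m a))) := by
  have : RFun fun x : α × GTerm => m x.1 := .comp (f := m) hm inferInstance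
  have : RFun fun x : α × GTerm => GTerm.subst (assoc .temp (m x.1)) x.2 :=
    rFun_subst (m := fun x : α × GTerm => m x.1) (t := fun x => x.2)
  exact rFun_atomMap (h := fun a t => GTerm.subst (assoc .temp (m a)) t)

instance rFun_execList {F : α → List Const} {m : α → List (ServiceCall × Const)}
    {E : α → List (Atom GTerm)} [hF : RFun F] [hm : RFun m] [hE : RFun E] :
    RFun fun a => execList (F a) (m a) (E a) := by
  have h : RFun fun x : List Const × List (ServiceCall × Const) × List (Atom GTerm) =>
      execList x.1 x.2.1 x.2.2 := by
    unfold execList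
    infer_instance
  exact .comp (f := fun x : List Const × List (ServiceCall × Const) × List (Atom GTerm) =>
      execList x.1 x.2.1 x.2.2) (g := fun a => (F a, m a, E a)) h inferInstance

instance rFun_holds_kab {K : α → DLKAB} {A : α → List Fact} {Q : α → ECQ}
    {g : α → List (ℕ × Const)} [hK : RFun K] [hA : RFun A] [hQ : RFun Q] [hg : RFun g] :
    RFun fun a => (Q a).Holds (K a).1.tbox (A a).toFinset (val (g a)) :=
  rFun_holds' (T := fun a => (K a).dlTBox)

instance rFun_legalList {K : α → DLKAB} {A : α → List Fact} {b : α → Action} [hK : RFun K]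
    [hA : RFun A] [hb : RFun b] : RFun fun a => legalList (K a).1 (A a) (b a) := by
  have h : RFun fun x : DLKAB × List Fact × Action => legalList x.1.1 x.2.1 x.2.2 := by
    unfold legalList
    infer_instance
  exact .comp (f := fun x : DLKAB × List Fact × Action => legalList x.1.1 x.2.1 x.2.2)
    (g := fun a => (K a, A a, b a)) h inferInstance

instance rFun_violFact {d : α → Const} [hd : RFun d] : RFun fun a => violFact (d a) := by
  unfold violFact
  infer_instance

instance rFun_doList_kab {K : α → DLKAB} {A : α → List Fact} {b : α → Action}
    {g : α → List (ℕ × Const)} [hK : RFun K] [hA : RFun A] [hb : RFun b] [hg : RFun g] :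
    RFun fun a => doList (K a).1.tbox (A a) (b a) (g a) :=
  rFun_doList (T := fun a => (K a).dlTBox)

instance rFun_repairList_kab {k : RepairKind} {K : α → DLKAB} {A : α → List Fact} [hK : RFun K]
    [hA : RFun A] : RFun fun a => repairList k (K a).1.tbox (A a) :=
  rFun_repairList (T := fun a => (K a).dlTBox)

instance rFun_succList {k : RepairKind} {K : α → DLKAB} {F : α → List Const} {cs : α → CState}
    [hK : RFun K] [hF : RFun F] [hcs : RFun cs] :
    RFun fun a => succList (K a).1 k (F a) (cs a) := by
  have h : RFun fun x : DLKAB × List Const × CState => succList x.1.1 k x.2.1 x.2.2 := by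
    unfold succList
    have : RFun fun x : (DLKAB × List Const × CState) × List Fact =>
        (violList x.1.1.1.tbox (sift (fun f => f ≠ stateTemp) x.1.2.2.1)).map violFact :=
      RFun.map (f := fun _ d => violFact d)
    infer_instance
  exact .comp (f := fun x : DLKAB × List Const × CState => succList x.1.1 k x.2.1 x.2.2)
    (g := fun a => (K a, F a, cs a)) h inferInstance

instance rFun_equiv {cs cs' : α → CState} [hc : RFun cs] [hc' : RFun cs'] :
    RFun fun a => (cs a).Equiv (cs' a) := by
  have : RFun fun x : CState × CState => x.1.Equiv x.2 :=
    RFun.congr_prop fun x => CState.equiv_iff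
  exact .comp₂ (f := CState.Equiv) this hc hc'

instance rFun_in {cs : α → CState} {E : α → List CState} [hc : RFun cs] [hE : RFun E] :
    RFun fun a => (cs a).In (E a) := by
  have : RFun fun x : CState × List CState => x.1.In x.2 := by
    unfold CState.In
    infer_instance
  exact .comp₂ (f := CState.In) this hc hE

end Instances

/-! ### Evaluation of formulae -/

/-- A knowledge and action base, the possible results of service calls, and a list of states. -/
abbrev EvalParam := DLKAB × List Const × List CState

/-- A judgment consists of the parameters, the information whether the list of states is the
extension of the formula or only contained in it, the formula, the valuations, and the list. -/
abbrev EvalJudgment :=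
  EvalParam × Prop × MuIT × List (ℕ × Const) × List (ℕ × List CState) × List CState

/-- The rules for the evaluation of formulae. -/
def evalRule (k : RepairKind) (j : EvalJudgment) (l : List EvalJudgment) : Prop :=
  (∃ Q, j.2.2.1 = .query Q ∧ l = [] ∧ j.2.2.2.2.2 =
    sift (fun cs => Q.Holds j.1.1.1.tbox cs.1.toFinset (val j.2.2.2.1)) j.1.2.2) ∨
  (∃ Φ E, j.2.2.1 = .neg Φ ∧ l = [(j.1, True, Φ, j.2.2.2.1, j.2.2.2.2.1, E)] ∧ j.2.2.2.2.2 =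
    sift (fun cs => ¬ cs.In E) j.1.2.2) ∨
  (∃ Φ E Ψ E', j.2.2.1 = .and Φ Ψ ∧ l = [(j.1, True, Φ, j.2.2.2.1, j.2.2.2.2.1, E),
    (j.1, True, Ψ, j.2.2.2.1, j.2.2.2.2.1, E')] ∧ j.2.2.2.2.2 =
    sift (fun cs => cs.In E ∧ cs.In E') j.1.2.2) ∨
  (∃ x Φ, ∃ D : List (Const × List CState), j.2.2.1 = .ex x Φ ∧
    D.map Prod.fst = j.1.2.2.flatMap (fun cs => adomList cs.1) ∧
    l = D.map (fun p => (j.1, True, Φ, (x, p.1) :: j.2.2.2.1, j.2.2.2.2.1, p.2)) ∧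
    j.2.2.2.2.2 = sift (fun cs => ∃ p, p ∈ D ∧ p.1 ∈ adomList cs.1 ∧ cs.In p.2) j.1.2.2) ∨
  (∃ Φ E, j.2.2.1 = .diaBox Φ ∧ l = [(j.1, True, Φ, j.2.2.2.1, j.2.2.2.2.1, E)] ∧ j.2.2.2.2.2 =
    sift (fun cs => ∃ cs', cs' ∈ succList j.1.1.1 k j.1.2.1 cs ∧
      ∀ cs'', cs'' ∈ succList j.1.1.1 k j.1.2.1 cs' → cs''.In E) j.1.2.2) ∨
  (∃ Φ E, j.2.2.1 = .boxBox Φ ∧ l = [(j.1, True, Φ, j.2.2.2.1, j.2.2.2.2.1, E)] ∧ j.2.2.2.2.2 =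
    sift (fun cs => ∀ cs', cs' ∈ succList j.1.1.1 k j.1.2.1 cs →
      ∀ cs'', cs'' ∈ succList j.1.1.1 k j.1.2.1 cs' → cs''.In E) j.1.2.2) ∨
  (∃ Z, j.2.2.1 = .pvar Z ∧ l = [] ∧ j.2.2.2.2.2 = assoc [] j.2.2.2.2.1 Z) ∨
  (∃ Z Φ, j.2.2.1 = .mu Z Φ ∧ ¬ j.2.1 ∧ l = [] ∧ j.2.2.2.2.2 = []) ∨
  (∃ Z Φ E, j.2.2.1 = .mu Z Φ ∧ ¬ j.2.1 ∧
    l = [(j.1, False, j.2.2.1, j.2.2.2.1, j.2.2.2.2.1, E),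
      (j.1, True, Φ, j.2.2.2.1, (Z, E) :: j.2.2.2.2.1, j.2.2.2.2.2)]) ∨
  ∃ Z Φ E, j.2.2.1 = .mu Z Φ ∧
    l = [(j.1, False, j.2.2.1, j.2.2.2.1, j.2.2.2.2.1, j.2.2.2.2.2),
      (j.1, True, Φ, j.2.2.2.1, (Z, j.2.2.2.2.2) :: j.2.2.2.2.1, E)] ∧
    ∀ cs, cs ∈ E → cs.In j.2.2.2.2.2

theorem rE_der_evalRule (k : RepairKind) : RE (Der (evalRule k)) :=
  RE.der (by unfold evalRule; infer_instance)

/-- The set of states presented by a list. -/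
def stateSet (E : List CState) : Set KState := {s | ∃ cs ∈ E, decode cs = s}

/-- The valuation of predicate variables given by an association list. -/
def pval (V : List (ℕ × List CState)) (Z : ℕ) : Set KState := stateSet (assoc [] V Z)

theorem CState.in_iff {cs : CState} {E : List CState} : cs.In E ↔ decode cs ∈ stateSet E := by
  simp only [CState.In, CState.Equiv, stateSet, Set.mem_ofPred_eq]

theorem CState.in_iff_of_eq {cs : CState} {E : List CState} {X : Set KState} (h : stateSet E = X) :
    cs.In E ↔ decode cs ∈ X := h ▸ CState.in_iff

theorem pval_cons (Z : ℕ) (E : List CState) (V : List (ℕ × List CState)) :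
    pval ((Z, E) :: V) = Function.update (pval V) Z (stateSet E) := by
  funext Y
  by_cases h : Y = Z
  · subst h
    simp [pval, assoc]
  · simp [pval, assoc, h, Ne.symm h]

theorem mem_stateSet_sift {p : CState → Prop} {q : KState → Prop} {L : List CState}
    (h : ∀ cs ∈ L, p cs ↔ q (decode cs)) {s : KState} :
    s ∈ stateSet (sift p L) ↔ s ∈ stateSet L ∧ q s := by
  constructor
  · rintro ⟨cs, hcs, rfl⟩
    obtain ⟨h1, h2⟩ := mem_sift.1 hcs
    exact ⟨⟨cs, h1, rfl⟩, (h cs h1).1 h2⟩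
  · rintro ⟨⟨cs, hcs, rfl⟩, h2⟩
    exact ⟨cs, mem_sift.2 ⟨hcs, (h cs hcs).2 h2⟩, rfl⟩

section Eval

variable {K : DLKAB} {k : RepairKind} {F : List Const} {L : List CState}
  (hK : K.1.WellFormed) (hL : stateSet L = (K.1.boundedTS k F).states)

include hL in
theorem ext_eq_stateSet {E : List CState} {Φ : MuEQL} {v : ℕ → Const} {V : ℕ → Set KState}
    {p : CState → Prop} {q : KState → Prop} (hE : E = sift p L)
    (h : ∀ cs ∈ L, p cs ↔ q (decode cs))
    (hΦ : ∀ s, s ∈ Φ.ext (K.1.boundedTS k F) v V ↔ s ∈ (K.1.boundedTS k F).states ∧ q s) :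
    stateSet E = Φ.ext (K.1.boundedTS k F) v V := by
  subst hE
  ext s
  rw [mem_stateSet_sift h, hL]
  exact (hΦ s).symm

theorem pval_cons_subset {V : List (ℕ × List CState)} {Z : ℕ} {E : List CState}
    (hE : stateSet E ⊆ (K.1.boundedTS k F).states)
    (hV : ∀ Z, pval V Z ⊆ (K.1.boundedTS k F).states) (Y : ℕ) :
    pval ((Z, E) :: V) Y ⊆ (K.1.boundedTS k F).states := by
  rw [pval_cons]
  by_cases h : Y = Z
  · subst h
    simpa using hE
  · simpa [h] using hV Y

include hK in
theorem exists_trans_iff {cs : CState} (hcs : decode cs ∈ (K.1.boundedTS k F).states)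
    {p : KState → Prop} : (∃ s', (K.1.boundedTS k F).trans (decode cs) s' ∧ p s') ↔
      ∃ cs', cs' ∈ succList K.1 k F cs ∧ p (decode cs') := by
  constructor
  · rintro ⟨s', ⟨-, h⟩, hp⟩
    obtain ⟨cs', h', rfl⟩ := (stepIn_decode_iff hK).1 h
    exact ⟨cs', h', hp⟩
  · rintro ⟨cs', h, hp⟩
    exact ⟨_, ⟨hcs, (stepIn_decode_iff hK).2 ⟨cs', h, rfl⟩⟩, hp⟩

theorem mem_ext_box {Υ : TransitionSystem} {Φ : MuEQL} {v : ℕ → Const} {V : ℕ → Set Υ.State}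
    (hΥ : ∀ s s', Υ.trans s s' → s' ∈ Υ.states) {s : Υ.State} :
    s ∈ Φ.box.ext Υ v V ↔ s ∈ Υ.states ∧ ∀ s', Υ.trans s s' → s' ∈ Φ.ext Υ v V := by
  simp only [MuEQL.box, MuEQL.ext, Set.mem_sdiff, Set.mem_ofPred_eq, not_and, not_exists, not_not]
  exact and_congr_right fun hs => ⟨fun h s' h' => h hs s' h' (hΥ s s' h'),
    fun h _ s' h' _ => h s' h'⟩

theorem trans_mem_states {s s' : KState} (h : (K.1.boundedTS k F).trans s s') :
    s' ∈ (K.1.boundedTS k F).states := h.1.tail h.2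

include hK in
theorem forall_trans_iff {cs : CState} (hcs : decode cs ∈ (K.1.boundedTS k F).states)
    {p : KState → Prop} : (∀ s', (K.1.boundedTS k F).trans (decode cs) s' → p s') ↔
      ∀ cs', cs' ∈ succList K.1 k F cs → p (decode cs') := by
  have := exists_trans_iff hK hcs (p := fun s => ¬ p s)
  rw [← not_iff_not] at this
  push Not at this
  exact this

include hK in
theorem mem_states_of_mem_succList {cs cs' : CState}
    (hcs : decode cs ∈ (K.1.boundedTS k F).states) (h : cs' ∈ succList K.1 k F cs) :
    decode cs' ∈ (K.1.boundedTS k F).states :=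
  ReflTransGen.tail hcs ((stepIn_decode_iff hK).2 ⟨cs', h, rfl⟩)

include hK in
theorem decode_mem_ext_box_iff {Φ : MuEQL} {v : ℕ → Const} {V : ℕ → Set KState} {cs : CState}
    (hcs : decode cs ∈ (K.1.boundedTS k F).states) :
    decode cs ∈ Φ.box.ext (K.1.boundedTS k F) v V ↔
      ∀ cs', cs' ∈ succList K.1 k F cs → decode cs' ∈ Φ.ext (K.1.boundedTS k F) v V :=
  ((mem_ext_box fun _ _ => trans_mem_states).trans (and_iff_right hcs)).trans
    (forall_trans_iff hK hcs (p := fun s => s ∈ Φ.ext (K.1.boundedTS k F) v V))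

include hK hL in
-- The three rules for a least fixpoint say: the empty set is contained in it; applying the body to
-- a set contained in it gives a set contained in it; a set contained in it that is closed under the
-- body equals it. Each holds by monotonicity or by the definition as an intersection of closed
-- sets.
theorem der_evalRule_sound {j : EvalJudgment} (h : Der (evalRule k) j) (hj : j.1 = (K, F, L))
    (hm : j.2.2.1.toEQL.Monotone)
    (hV : ∀ Z, pval j.2.2.2.2.1 Z ⊆ (K.1.boundedTS k F).states) :
    stateSet j.2.2.2.2.2 ⊆
      j.2.2.1.toEQL.ext (K.1.boundedTS k F) (val j.2.2.2.1) (pval j.2.2.2.2.1) ∧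
    (j.2.1 → stateSet j.2.2.2.2.2 =
      j.2.2.1.toEQL.ext (K.1.boundedTS k F) (val j.2.2.2.1) (pval j.2.2.2.2.1)) := by
  have hLs : ∀ cs ∈ L, decode cs ∈ (K.1.boundedTS k F).states := fun cs hcs =>
    hL ▸ ⟨cs, hcs, rfl⟩
  induction h with
  | intro j l h _ ih =>
    obtain ⟨P, b, Φ₀, g, V, E₀⟩ := j
    obtain rfl : P = (K, F, L) := hj
    have full : ∀ {E : List CState} {X : Set KState}, stateSet E = X →
        stateSet E ⊆ X ∧ (b → stateSet E = X) := fun h => ⟨h.subset, fun _ => h⟩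
    rcases h with ⟨Q, h1, -, h2⟩ | ⟨Φ, E, h1, rfl, h2⟩ | ⟨Φ, E, Ψ, E', h1, rfl, h2⟩ |
      ⟨x, Φ, D, h1, hD, rfl, h2⟩ | ⟨Φ, E, h1, rfl, h2⟩ | ⟨Φ, E, h1, rfl, h2⟩ | ⟨Z, h1, -, h2⟩ |
      ⟨Z, Φ, h1, hb, -, h2⟩ | ⟨Z, Φ, E, h1, hb, rfl⟩ | ⟨Z, Φ, E, h1, rfl, h2⟩ <;>
      simp only at h1 <;> subst h1 <;> (try simp only at h2 hm hV)
    · exact full (ext_eq_stateSet hL (q := fun s => Q.Holds K.1.tbox s.abox (val g)) h2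
        (fun cs _ => Iff.rfl) fun s => Iff.rfl)
    · have h3 := (ih _ (.head _) rfl hm hV).2 trivial
      simp only at h3
      exact full (ext_eq_stateSet hL (q := fun s => s ∉ Φ.toEQL.ext (K.1.boundedTS k F) (val g)
        (pval V)) h2 (fun _ _ => not_congr (CState.in_iff_of_eq h3)) fun s => Iff.rfl)
    · have h3 := (ih _ (.head _) rfl hm.1 hV).2 trivial
      have h4 := (ih _ (.tail _ (.head _)) rfl hm.2 hV).2 trivial
      simp only at h3 h4
      refine full (ext_eq_stateSet hL (q := fun s => s ∈ Φ.toEQL.ext (K.1.boundedTS k F) (val g)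
        (pval V) ∧ s ∈ Ψ.toEQL.ext (K.1.boundedTS k F) (val g) (pval V)) h2
        (fun _ _ => and_congr (CState.in_iff_of_eq h3) (CState.in_iff_of_eq h4)) fun s => ?_)
      exact ⟨fun h => ⟨MuEQL.ext_subset hV h.1, h⟩, fun h => h.2⟩
    · have h3 : ∀ p ∈ D, stateSet p.2 = Φ.toEQL.ext (K.1.boundedTS k F)
          (Function.update (val g) x p.1) (pval V) := fun p hp => by
        have := (ih _ (List.mem_map.2 ⟨p, hp, rfl⟩) rfl hm hV).2 trivial
        rwa [val_cons] at this
      refine full (ext_eq_stateSet hL (q := fun s => ∃ d ∈ adom s.abox, s ∈ Φ.toEQL.ext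
        (K.1.boundedTS k F) (Function.update (val g) x d) (pval V)) h2 (fun cs hcs => ?_)
        fun s => Iff.rfl)
      constructor
      · rintro ⟨p, hp, h4, h5⟩
        exact ⟨p.1, mem_adomList.1 h4, (CState.in_iff_of_eq (h3 p hp)).1 h5⟩
      · rintro ⟨d, hd, h4⟩
        have hd' : d ∈ adomList cs.1 := mem_adomList.2 hd
        have : d ∈ D.map Prod.fst := by
          rw [hD]
          exact List.mem_flatMap.2 ⟨cs, hcs, hd'⟩
        obtain ⟨p, hp, rfl⟩ := List.mem_map.1 this
        exact ⟨p, hp, hd', (CState.in_iff_of_eq (h3 p hp)).2 h4⟩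
    · have h3 := (ih _ (.head _) rfl hm hV).2 trivial
      simp only at h3
      refine full (ext_eq_stateSet hL (q := fun s => ∃ s', (K.1.boundedTS k F).trans s s' ∧
        s' ∈ Φ.toEQL.box.ext (K.1.boundedTS k F) (val g) (pval V)) h2 (fun cs hcs => ?_)
        fun s => Iff.rfl)
      refine Iff.trans (exists_congr fun cs' => and_congr_right fun h => ?_)
        (exists_trans_iff hK (hLs cs hcs)).symm
      exact Iff.trans (forall₂_congr fun _ _ => CState.in_iff_of_eq h3)
        (decode_mem_ext_box_iff hK (mem_states_of_mem_succList hK (hLs cs hcs) h)).symm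
    · have h3 := (ih _ (.head _) rfl hm hV).2 trivial
      simp only at h3
      refine full (ext_eq_stateSet hL (q := fun s => ∀ s', (K.1.boundedTS k F).trans s s' →
        s' ∈ Φ.toEQL.box.ext (K.1.boundedTS k F) (val g) (pval V)) h2 (fun cs hcs => ?_)
        fun s => mem_ext_box (fun _ _ => trans_mem_states))
      refine Iff.trans (forall₂_congr fun cs' h => ?_) (forall_trans_iff hK (hLs cs hcs)).symm
      exact Iff.trans (forall₂_congr fun _ _ => CState.in_iff_of_eq h3)
        (decode_mem_ext_box_iff hK (mem_states_of_mem_succList hK (hLs cs hcs) h)).symm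
    · subst h2
      exact full rfl
    · subst h2
      refine ⟨?_, fun h => absurd h hb⟩
      rintro s ⟨cs, hcs, -⟩
      simp at hcs
    · have h3 := (ih _ (.head _) rfl hm hV).1
      have hE := h3.trans (MuEQL.ext_subset hV)
      have h4 := (ih _ (.tail _ (.head _)) rfl hm.2 (pval_cons_subset hE hV)).1
      simp only [pval_cons] at h3 h4
      refine ⟨fun s hs => ⟨MuEQL.ext_subset
        (fun Y => pval_cons Z E V ▸ pval_cons_subset hE hV Y) (h4 hs),
        fun X hX hX' => hX' ?_⟩, fun h => absurd h hb⟩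
      exact (MuEQL.ext_mono fun t ht => (h3 ht).2 X hX hX').1 hm.1 (h4 hs)
    · have h3 := (ih _ (.head _) rfl hm hV).1
      have hE := h3.trans (MuEQL.ext_subset hV)
      have h4 := (ih _ (.tail _ (.head _)) rfl hm.2 (pval_cons_subset hE hV)).2 trivial
      simp only [pval_cons] at h3 h4
      refine full (Set.Subset.antisymm h3 fun s hs => hs.2 _ hE ?_)
      refine h4.symm.subset.trans ?_
      rintro s ⟨cs, hcs, rfl⟩
      exact CState.in_iff.1 (h2 cs hcs)

include hK hL in
-- For a fixpoint, iterate the body from the empty list. The approximants increase, so in a finite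
-- system they become closed, and the last rule then yields the exact extension.
theorem der_evalRule_complete (hfin : (K.1.boundedTS k F).states.Finite) (Φ : MuIT) :
    ∀ (g : List (ℕ × Const)) (V : List (ℕ × List CState)), Φ.toEQL.Monotone →
      (∀ Z, pval V Z ⊆ (K.1.boundedTS k F).states) →
      ∃ E, Der (evalRule k) ((K, F, L), True, Φ, g, V, E) := by
  induction Φ with
  | query Q =>
    exact fun g V _ _ => ⟨sift (fun cs => Q.Holds K.1.tbox cs.1.toFinset (val g)) L,
      .intro _ [] (.inl ⟨Q, rfl, rfl, rfl⟩) (by simp)⟩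
  | neg Φ ih =>
    intro g V hm hV
    obtain ⟨E, hE⟩ := ih g V hm hV
    exact ⟨sift (fun cs => ¬ cs.In E) L, .intro _ _ (.inr (.inl ⟨Φ, E, rfl, rfl, rfl⟩)) (by simpa using hE)⟩
  | and Φ Ψ ih ih' =>
    intro g V hm hV
    obtain ⟨E, hE⟩ := ih g V hm.1 hV
    obtain ⟨E', hE'⟩ := ih' g V hm.2 hV
    exact ⟨sift (fun cs => cs.In E ∧ cs.In E') L,
      .intro _ _ (.inr (.inr (.inl ⟨Φ, E, Ψ, E', rfl, rfl, rfl⟩)))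
      (by simpa using ⟨hE, hE'⟩)⟩
  | ex x Φ ih =>
    intro g V hm hV
    choose f hf using fun d => ih ((x, d) :: g) V hm hV
    let D := (L.flatMap fun cs => adomList cs.1).map fun d => (d, f d)
    refine ⟨sift (fun cs => ∃ p, p ∈ D ∧ p.1 ∈ adomList cs.1 ∧ cs.In p.2) L,
      .intro _ _ (.inr (.inr (.inr (.inl ⟨x, Φ, D, rfl, ?_, rfl, rfl⟩)))) fun j hj => ?_⟩
    · simp [D, Function.comp_def]
    · simp only [D, List.map_map, List.mem_map] at hj
      obtain ⟨d, -, rfl⟩ := hj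
      exact hf d
  | diaBox Φ ih =>
    intro g V hm hV
    obtain ⟨E, hE⟩ := ih g V hm hV
    exact ⟨sift (fun cs => ∃ cs', cs' ∈ succList K.1 k F cs ∧
      ∀ cs'', cs'' ∈ succList K.1 k F cs' → cs''.In E) L,
      .intro _ _ (.inr (.inr (.inr (.inr (.inl ⟨Φ, E, rfl, rfl, rfl⟩)))))
      (by simpa using hE)⟩
  | boxBox Φ ih =>
    intro g V hm hV
    obtain ⟨E, hE⟩ := ih g V hm hV
    exact ⟨sift (fun cs => ∀ cs', cs' ∈ succList K.1 k F cs →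
      ∀ cs'', cs'' ∈ succList K.1 k F cs' → cs''.In E) L,
      .intro _ _ (.inr (.inr (.inr (.inr (.inr (.inl ⟨Φ, E, rfl, rfl, rfl⟩))))))
      (by simpa using hE)⟩
  | pvar Z =>
    exact fun g V _ _ => ⟨assoc [] V Z, .intro _ []
      (.inr (.inr (.inr (.inr (.inr (.inr (.inl ⟨Z, rfl, rfl, rfl⟩))))))) (by simp)⟩
  | mu Z Φ ih =>
    intro g V hm hV
    let Part : List CState → Prop := fun E => Der (evalRule k) ((K, F, L), False, .mu Z Φ, g, V, E)
    let Full : List CState → List CState → Prop := fun E E' =>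
      Der (evalRule k) ((K, F, L), True, Φ, g, (Z, E) :: V, E')
    have hsub : ∀ {E}, Part E → stateSet E ⊆ (K.1.boundedTS k F).states := fun h =>
      (der_evalRule_sound hK hL h rfl hm hV).1.trans (MuEQL.ext_subset hV)
    have hfull : ∀ {E}, Part E → ∃ E', Full E E' := fun h =>
      ih g _ hm.2 (pval_cons_subset (hsub h) hV)
    have hext : ∀ {E E'}, Part E → Full E E' → stateSet E' = Φ.toEQL.ext (K.1.boundedTS k F)
        (val g) (Function.update (pval V) Z (stateSet E)) := fun h h' => by
      have := (der_evalRule_sound hK hL h' rfl hm.2 (pval_cons_subset (hsub h) hV)).2 trivial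
      simp only [pval_cons] at this
      exact this
    have hnext : ∀ {E E'}, Part E → Full E E' → Part E' := fun {E E'} h h' =>
      .intro _ _ (.inr (.inr (.inr (.inr (.inr (.inr (.inr (.inr (.inl
        ⟨Z, Φ, E, rfl, not_false, rfl⟩))))))))) (by simpa using ⟨h, h'⟩)
    -- After `n` rounds either a closed approximant has been found or there is one with at least `n`
    -- states that the body does not decrease; the latter property is what makes the next inclusion
    -- strict.
    have key : ∀ n : ℕ, ∃ E, Part E ∧ ((∃ E', Full E E' ∧ stateSet E' ⊆ stateSet E) ∨
        (n ≤ (stateSet E).ncard ∧ ∀ E', Full E E' → stateSet E ⊆ stateSet E')) := by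
      intro n
      induction n with
      | zero =>
        refine ⟨[], .intro _ [] (.inr (.inr (.inr (.inr (.inr (.inr (.inr (.inl
          ⟨Z, Φ, rfl, not_false, rfl, rfl⟩)))))))) (by simp), .inr ⟨Nat.zero_le _, fun E' _ => ?_⟩⟩
        rintro s ⟨cs, hcs, -⟩
        simp at hcs
      | succ n ihn =>
        obtain ⟨E, hE, h | ⟨h1, h2⟩⟩ := ihn
        · exact ⟨E, hE, .inl h⟩
        · obtain ⟨E', hE'⟩ := hfull hE
          by_cases h3 : stateSet E' ⊆ stateSet E
          · exact ⟨E, hE, .inl ⟨E', hE', h3⟩⟩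
          · refine ⟨E', hnext hE hE', .inr ⟨?_, fun E'' h => ?_⟩⟩
            · have hfin' : (stateSet E').Finite := hfin.subset (hsub (hnext hE hE'))
              exact Nat.succ_le_of_lt (h1.trans_lt (Set.ncard_lt_ncard ⟨h2 E' hE', h3⟩ hfin'))
            · rw [hext hE hE', hext (hnext hE hE') h]
              exact (MuEQL.ext_mono (h2 E' hE')).1 hm.1
    -- An approximant cannot have more elements than there are states.
    obtain ⟨E, hE, ⟨E', hE', h⟩ | ⟨h, -⟩⟩ := key ((K.1.boundedTS k F).states.ncard + 1)
    · exact ⟨E, .intro _ _ (.inr (.inr (.inr (.inr (.inr (.inr (.inr (.inr (.inr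
        ⟨Z, Φ, E', rfl, rfl, fun cs hcs => CState.in_iff.2 (h ⟨cs, hcs, rfl⟩)⟩)))))))))
        (by simpa using ⟨hE, hE'⟩)⟩
    · exact absurd (h.trans (Set.ncard_le_ncard (hsub hE) hfin)) (Nat.not_succ_le_self _)

end Eval

/-! ### The decision procedure -/

/-! ### Enumerability of the condition that a list contains all relevant constants -/

section Consts

variable {α : Type} [Coded α]

instance rFun_qTermConsts {t : α → QTerm} [ht : RFun t] : RFun fun a => (t a).consts := by
  have : RFun fun x : Unit × QTerm => x.2.consts := by
    apply RFun.qTerm_cases (h := fun _ t => QTerm.consts t) <;> unfold QTerm.consts <;>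
      infer_instance
  exact .comp (f := fun x : Unit × QTerm => x.2.consts) (g := fun a => ((), t a)) this
    inferInstance

instance rFun_eTermConsts {t : α → ETerm} [ht : RFun t] : RFun fun a => (t a).consts := by
  have : RFun fun x : Unit × ETerm => x.2.consts := by
    apply RFun.eTerm_cases (h := fun _ t => ETerm.consts t) <;> simp only [ETerm.consts] <;>
      infer_instance
  exact .comp (f := fun x : Unit × ETerm => x.2.consts) (g := fun a => ((), t a)) this
    inferInstance

instance rFun_ucqConsts {q : α → UCQ} [hq : RFun q] : RFun fun a => (q a).consts := by
  have : RFun fun q : UCQ => q.consts := by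
    have : RFun fun x : ((UCQ × CQ) × Atom QTerm) × QTerm => QTerm.consts x.2 := inferInstance
    have : RFun fun x : (UCQ × CQ) × Atom QTerm => x.2.termList.flatMap QTerm.consts :=
      RFun.flatMap (l := fun x : (UCQ × CQ) × Atom QTerm => x.2.termList)
        (f := fun _ t => t.consts)
    have : RFun fun x : UCQ × CQ => x.2.atoms.flatMap fun a => a.termList.flatMap QTerm.consts :=
      RFun.flatMap (l := fun x : UCQ × CQ => x.2.atoms)
        (f := fun _ a => a.termList.flatMap QTerm.consts)
    exact RFun.flatMap (l := fun q : UCQ => q)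
      (f := fun _ d => d.atoms.flatMap fun a => a.termList.flatMap QTerm.consts)
  exact .comp (f := UCQ.consts) this hq

/-- The rules for `ECQ.ConstsIn`. -/
def ecqConstsRule (j : List Const × ECQ) (l : List (List Const × ECQ)) : Prop :=
  (∃ q : UCQ, j.2 = .ucq q ∧ l = [] ∧ ∀ c, c ∈ q.consts → c ∈ j.1) ∨
  (∃ Q, j.2 = .neg Q ∧ l = [(j.1, Q)]) ∨
  (∃ Q Q', j.2 = .and Q Q' ∧ l = [(j.1, Q), (j.1, Q')]) ∨
  ∃ x Q, j.2 = .ex x Q ∧ l = [(j.1, Q)]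

theorem der_ecqConstsRule_iff {j : List Const × ECQ} :
    Der ecqConstsRule j ↔ j.2.ConstsIn j.1 := by
  constructor
  · intro h
    induction h with
    | intro j l h _ ih =>
      obtain ⟨C, Q⟩ := j
      rcases h with ⟨q, h, rfl, h'⟩ | ⟨Q, h, rfl⟩ | ⟨Q, Q', h, rfl⟩ | ⟨x, Q, h, rfl⟩ <;>
        simp only at h <;> subst h
      · exact h'
      · exact ih (C, Q) (.head _)
      · exact ⟨ih _ (.head _), ih _ (.tail _ (.head _))⟩
      · exact ih (C, Q) (.head _)
  · obtain ⟨C, Q⟩ := j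
    intro h
    induction Q with
    | ucq q => exact .intro _ [] (.inl ⟨q, rfl, rfl, h⟩) (by simp)
    | neg Q ih => exact .intro _ _ (.inr (.inl ⟨Q, rfl, rfl⟩)) (by simpa using ih h)
    | and Q Q' ih ih' =>
      exact .intro _ _ (.inr (.inr (.inl ⟨Q, Q', rfl, rfl⟩))) (by simpa using ⟨ih h.1, ih' h.2⟩)
    | ex x Q ih => exact .intro _ _ (.inr (.inr (.inr ⟨x, Q, rfl, rfl⟩))) (by simpa using ih h)

instance rE_ecqConstsIn {C : α → List Const} {Q : α → ECQ} [hC : RFun C] [hQ : RFun Q] :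
    RE fun a => (Q a).ConstsIn (C a) := by
  have h : RE (Der ecqConstsRule) := RE.der (by unfold ecqConstsRule; infer_instance)
  have h' : RE fun a => Der ecqConstsRule (C a, Q a) := .comp (p := Der ecqConstsRule) h inferInstance
  exact RE.congr (q := fun a => Der ecqConstsRule (C a, Q a)) fun a =>
    (der_ecqConstsRule_iff (j := (C a, Q a))).symm

/-- The rules for the analogue of `ECQ.ConstsIn` for formulae. -/
def muConstsRule (j : List Const × MuIT) (l : List (List Const × MuIT)) : Prop :=
  (∃ Q : ECQ, j.2 = .query Q ∧ l = [] ∧ Q.ConstsIn j.1) ∨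
  (∃ Φ, j.2 = .neg Φ ∧ l = [(j.1, Φ)]) ∨
  (∃ Φ Ψ, j.2 = .and Φ Ψ ∧ l = [(j.1, Φ), (j.1, Ψ)]) ∨
  (∃ x Φ, j.2 = .ex x Φ ∧ l = [(j.1, Φ)]) ∨
  (∃ Φ, j.2 = .diaBox Φ ∧ l = [(j.1, Φ)]) ∨
  (∃ Φ, j.2 = .boxBox Φ ∧ l = [(j.1, Φ)]) ∨
  (∃ Z, j.2 = .pvar Z ∧ l = []) ∨
  ∃ Z Φ, j.2 = .mu Z Φ ∧ l = [(j.1, Φ)]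

theorem der_muConstsRule_iff {j : List Const × MuIT} :
    Der muConstsRule j ↔ j.2.toEQL.ConstsIn j.1 := by
  constructor
  · intro h
    induction h with
    | intro j l h _ ih =>
      obtain ⟨C, Φ⟩ := j
      rcases h with ⟨Q, h, rfl, h'⟩ | ⟨Φ, h, rfl⟩ | ⟨Φ, Ψ, h, rfl⟩ | ⟨x, Φ, h, rfl⟩ | ⟨Φ, h, rfl⟩ |
        ⟨Φ, h, rfl⟩ | ⟨Z, h, rfl⟩ | ⟨Z, Φ, h, rfl⟩ <;> simp only at h <;> subst h
      · exact h'
      · exact ih (C, Φ) (.head _)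
      · exact ⟨ih _ (.head _), ih _ (.tail _ (.head _))⟩
      · exact ih (C, Φ) (.head _)
      · exact ih (C, Φ) (.head _)
      · exact ih (C, Φ) (.head _)
      · trivial
      · exact ih (C, Φ) (.head _)
  · obtain ⟨C, Φ⟩ := j
    intro h
    induction Φ with
    | query Q => exact .intro _ [] (.inl ⟨Q, rfl, rfl, h⟩) (by simp)
    | neg Φ ih => exact .intro _ _ (.inr (.inl ⟨Φ, rfl, rfl⟩)) (by simpa using ih h)
    | and Φ Ψ ih ih' =>
      exact .intro _ _ (.inr (.inr (.inl ⟨Φ, Ψ, rfl, rfl⟩))) (by simpa using ⟨ih h.1, ih' h.2⟩)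
    | ex x Φ ih =>
      exact .intro _ _ (.inr (.inr (.inr (.inl ⟨x, Φ, rfl, rfl⟩)))) (by simpa using ih h)
    | diaBox Φ ih =>
      exact .intro _ _ (.inr (.inr (.inr (.inr (.inl ⟨Φ, rfl, rfl⟩))))) (by simpa using ih h)
    | boxBox Φ ih =>
      exact .intro _ _ (.inr (.inr (.inr (.inr (.inr (.inl ⟨Φ, rfl, rfl⟩))))))
        (by simpa using ih h)
    | pvar Z =>
      exact .intro _ [] (.inr (.inr (.inr (.inr (.inr (.inr (.inl ⟨Z, rfl, rfl⟩))))))) (by simp)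
    | mu Z Φ ih =>
      exact .intro _ _ (.inr (.inr (.inr (.inr (.inr (.inr (.inr ⟨Z, Φ, rfl, rfl⟩)))))))
        (by simpa using ih h)

instance rE_muConstsIn {C : α → List Const} {Φ : α → MuIT} [hC : RFun C] [hΦ : RFun Φ] :
    RE fun a => (Φ a).toEQL.ConstsIn (C a) := by
  have h : RE (Der muConstsRule) := RE.der (by unfold muConstsRule; infer_instance)
  have h' : RE fun a => Der muConstsRule (C a, Φ a) := .comp (p := Der muConstsRule) h inferInstance
  exact RE.congr (q := fun a => Der muConstsRule (C a, Φ a)) fun a =>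
    (der_muConstsRule_iff (j := (C a, Φ a))).symm

instance rE_effectConstsIn {C : α → List Const} {e : α → Effect} [hC : RFun C] [he : RFun e] :
    RE fun a => (e a).ConstsIn (C a) := by
  have h : RE fun x : List Const × Effect => x.2.ConstsIn x.1 := by
    unfold Effect.ConstsIn
    infer_instance
  exact .comp (p := fun x : List Const × Effect => x.2.ConstsIn x.1) (f := fun a => (C a, e a)) h
    inferInstance

instance rE_kabConstsIn {C : α → List Const} {K : α → DLKAB} [hC : RFun C] [hK : RFun K] :
    RE fun a => (K a).1.ConstsIn (C a) := by
  have h : RE fun x : List Const × DLKAB => x.2.1.ConstsIn x.1 := by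
    unfold KAB.ConstsIn
    infer_instance
  exact .comp (p := fun x : List Const × DLKAB => x.2.1.ConstsIn x.1) (f := fun a => (C a, K a)) h
    inferInstance

end Consts

/-- The rules for reachability. -/
def reachRule (k : RepairKind) (j : DLKAB × List Const × CState)
    (l : List (DLKAB × List Const × CState)) : Prop :=
  (l = [] ∧ j.2.2 = (j.1.1.init, [])) ∨
    ∃ cs, l = [(j.1, j.2.1, cs)] ∧ j.2.2 ∈ succList j.1.1 k j.2.1 cs

/-- The data from which the truth of the formula can be read off. -/
def Certified (k : RepairKind) (x : DLKAB × MuIT) : Prop :=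
  ∃ (C F : List Const) (L E : List CState), x.1.1.ConstsIn C ∧ x.2.toEQL.ConstsIn C ∧
    (∀ c, c ∈ C → c ∈ F) ∧
    (∀ cs, cs ∈ L → Der (reachRule k) (x.1, F, cs)) ∧
    CState.In (x.1.1.init, []) L ∧
    (∀ cs, cs ∈ L → ∀ cs', cs' ∈ succList x.1.1 k F cs → cs'.In L) ∧
    (∀ cs, cs ∈ L → ∃ c, c ∈ F ∧ c ∉ C ∧
      ∀ f, f ∈ cs.2.map Prod.fst → lookup cs.2 f ≠ some c) ∧
    Der (evalRule k) ((x.1, F, L), True, x.2, [], [], E) ∧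
    CState.In (x.1.1.init, []) E

theorem rE_certified (k : RepairKind) : RE (Certified k) := by
  have h1 : RE (Der (reachRule k)) := RE.der (by unfold reachRule; infer_instance)
  have h2 : ∀ {α : Type} [Coded α] {f : α → DLKAB × List Const × CState} [RFun f],
      RE fun a => Der (reachRule k) (f a) := fun {α _ f _} => .comp (p := Der (reachRule k)) h1 ‹_›
  have h3 : ∀ {α : Type} [Coded α] {f : α → EvalJudgment} [RFun f],
      RE fun a => Der (evalRule k) (f a) := fun {α _ f _} =>
    .comp (p := Der (evalRule k)) (rE_der_evalRule k) ‹_›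
  unfold Certified
  infer_instance

/-! ### Certificates and truth -/

section Decide

variable {K : DLKAB} {k : RepairKind} {F : List Const} {L : List CState}

theorem decode_start : decode (K.1.init, []) = K.1.startState := by
  simp only [decode, KAB.startState, KState.mk.injEq, true_and]
  funext c
  simp [lookup]

theorem der_reachRule_sound (hK : K.1.WellFormed) {j : DLKAB × List Const × CState}
    (h : Der (reachRule k) j) : j.1 = K → j.2.1 = F →
    decode j.2.2 ∈ (K.1.boundedTS k F).states := by
  induction h with
  | intro j l h _ ih =>
    rintro rfl rfl
    rcases h with ⟨rfl, h⟩ | ⟨cs, rfl, h⟩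
    · rw [h, decode_start]
      exact .refl
    · exact mem_states_of_mem_succList hK (ih _ (.head _) rfl rfl) h

theorem exists_der_reachRule (hK : K.1.WellFormed) {s : KState}
    (hs : s ∈ (K.1.boundedTS k F).states) : ∃ cs, Der (reachRule k) (K, F, cs) ∧ decode cs = s := by
  have hs' : ReflTransGen (K.1.StepIn k F) K.1.startState s := hs
  induction hs' with
  | refl => exact ⟨_, .intro _ [] (.inl ⟨rfl, rfl⟩) (by simp), decode_start⟩
  | tail h h' ih =>
    obtain ⟨cs, hcs, rfl⟩ := ih h
    obtain ⟨cs', h1, rfl⟩ := (stepIn_decode_iff hK).1 h'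
    exact ⟨cs', .intro _ _ (.inr ⟨cs, rfl, h1⟩) (by simpa using hcs), rfl⟩

theorem stateSet_eq_states (hK : K.1.WellFormed)
    (h1 : ∀ cs, cs ∈ L → Der (reachRule k) (K, F, cs)) (h2 : CState.In (K.1.init, []) L)
    (h3 : ∀ cs, cs ∈ L → ∀ cs', cs' ∈ succList K.1 k F cs → cs'.In L) :
    stateSet L = (K.1.boundedTS k F).states := by
  refine Set.Subset.antisymm ?_ fun s hs => ?_
  · rintro s ⟨cs, hcs, rfl⟩
    exact der_reachRule_sound hK (h1 cs hcs) rfl rfl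
  · have hs' : ReflTransGen (K.1.StepIn k F) K.1.startState s := hs
    induction hs' with
    | refl => exact decode_start (K := K) ▸ CState.in_iff.1 h2
    | tail h h' ih =>
      obtain ⟨cs, hcs, rfl⟩ := ih h
      obtain ⟨cs', h4, rfl⟩ := (stepIn_decode_iff hK).1 h'
      exact CState.in_iff.1 (h3 cs hcs cs' h4)

theorem notMem_known_decode {C : List Const} {cs : CState} {c : Const} :
    c ∉ known C (decode cs) ↔ c ∉ C ∧ ∀ f, f ∈ cs.2.map Prod.fst → lookup cs.2 f ≠ some c := by
  simp only [known, Set.mem_ofPred_eq, not_or, not_exists]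
  refine and_congr_right fun _ => ⟨fun h f _ => h f, fun h f hf => ?_⟩
  by_cases hm : f ∈ cs.2.map Prod.fst
  · exact h f hm hf
  · simp [decode, lookup, hm] at hf

theorem pval_nil : pval [] = fun _ => ∅ := by
  funext Z
  simp [pval, assoc, stateSet]

theorem models_iff_pval {C : List Const} (hK : K.1.WellFormed) (hC : K.1.ConstsIn C) (hCF : C ⊆ F)
    (hF : K.1.Adequate k C F) {Φ : MuEQL} (hΦ : Φ.Closed) (hm : Φ.Monotone) (hΦC : Φ.ConstsIn C) :
    (K.1.extendedTS k).Models Φ ↔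
      decode (K.1.init, []) ∈ Φ.ext (K.1.boundedTS k F) (val []) (pval []) := by
  rw [pval_nil, decode_start]
  exact models_iff hK hC hCF hF hΦ hm hΦC (val [])

/-- A certificate proves its own adequacy: `L` contains the start, consists of reachable states and
is closed under successors, so it presents the whole restricted system, and for each of its entries
an unused element of `F` is exhibited. Run-boundedness provides an adequate `F`, hence a certificate
for every true property. -/
theorem certified_iff (hK : K.1.WellFormed) (hb : (K.1.extendedTS k).RunBounded) {Φ : MuIT}
    (hΦ : Φ.IsProperty) : Certified k (K, Φ) ↔ (K.1.extendedTS k).Models Φ.toEQL := by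
  have hV : ∀ F Z, pval [] Z ⊆ (K.1.boundedTS k F).states := fun F Z => by
    rw [pval_nil]
    exact Set.empty_subset _
  constructor
  · rintro ⟨C, F, L, E, hC, hΦC, hCF, h1, h2, h3, h4, h5, h6⟩
    have hL := stateSet_eq_states hK h1 h2 h3
    have hF : K.1.Adequate k C F := by
      intro s hs
      have : s ∈ stateSet L := hL ▸ hs
      obtain ⟨cs, hcs, rfl⟩ := this
      obtain ⟨c, hc, h⟩ := h4 cs hcs
      exact ⟨c, hc, notMem_known_decode.2 h⟩
    rw [models_iff_pval hK hC hCF hF hΦ.1 hΦ.2 hΦC]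
    have h7 := (der_evalRule_sound hK hL h5 rfl hΦ.2 (hV F)).2 trivial
    exact (CState.in_iff_of_eq h7).1 h6
  · intro h
    obtain ⟨C₁, hC₁⟩ := K.1.exists_constsIn
    obtain ⟨C₂, hC₂⟩ := Φ.toEQL.exists_constsIn
    have hC := hC₁ (C₁ ++ C₂) (by simp)
    have hΦC : Φ.toEQL.ConstsIn (C₁ ++ C₂) := hC₂.mono (by simp)
    obtain ⟨F, hCF, hF⟩ := exists_adequate hb (C₁ ++ C₂)
    have hfin : (K.1.boundedTS k F).states.Finite := finite_reachIn hK hC hCF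
    have hex : ∀ s, ∃ cs, s ∈ (K.1.boundedTS k F).states →
        Der (reachRule k) (K, F, cs) ∧ decode cs = s := fun s => by
      by_cases hs : s ∈ (K.1.boundedTS k F).states
      · obtain ⟨cs, hcs⟩ := exists_der_reachRule hK hs
        exact ⟨cs, fun _ => hcs⟩
      · exact ⟨([], []), fun h => absurd h hs⟩
    choose f hf using hex
    let L : List CState := hfin.toFinset.toList.map f
    have hmem : ∀ cs ∈ L, ∃ s ∈ (K.1.boundedTS k F).states, f s = cs := fun cs hcs => by
      obtain ⟨s, hs, rfl⟩ := List.mem_map.1 hcs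
      exact ⟨s, by simpa using hs, rfl⟩
    have hL : stateSet L = (K.1.boundedTS k F).states := by
      ext s
      constructor
      · rintro ⟨cs, hcs, rfl⟩
        obtain ⟨s, hs, rfl⟩ := hmem cs hcs
        rwa [(hf s hs).2]
      · intro hs
        exact ⟨f s, List.mem_map.2 ⟨s, Finset.mem_toList.2 (hfin.mem_toFinset.2 hs), rfl⟩,
          (hf s hs).2⟩
    have hst : decode (K.1.init, []) ∈ (K.1.boundedTS k F).states := by
      rw [decode_start]
      exact .refl
    have hLs : ∀ cs ∈ L, decode cs ∈ (K.1.boundedTS k F).states := fun cs hcs => hL ▸ ⟨cs, hcs, rfl⟩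
    obtain ⟨E, hE⟩ := der_evalRule_complete hK hL hfin Φ [] [] hΦ.2 (hV F)
    refine ⟨C₁ ++ C₂, F, L, E, hC, hΦC, fun c hc => hCF hc, fun cs hcs => ?_,
      (CState.in_iff_of_eq hL).2 hst, fun cs hcs cs' h' => (CState.in_iff_of_eq hL).2
        (mem_states_of_mem_succList hK (hLs cs hcs) h'), fun cs hcs => ?_, hE, ?_⟩
    · obtain ⟨s, hs, rfl⟩ := hmem cs hcs
      exact (hf s hs).1
    · obtain ⟨c, hc, h'⟩ := hF _ (hLs cs hcs)
      exact ⟨c, hc, notMem_known_decode.1 h'⟩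
    · have h7 := (der_evalRule_sound hK hL hE rfl hΦ.2 (hV F)).2 trivial
      exact (CState.in_iff_of_eq h7).2 ((models_iff_pval hK hC hCF hF hΦ.1 hΦ.2 hΦC).1 h)

/-- `Models` quantifies over all valuations, so it does not commute with negation by definition.
Passing to a restricted system with fixed valuations reduces the claim to complementation there. -/
theorem models_neg_iff {K : KAB} (hK : K.WellFormed) (hb : (K.extendedTS k).RunBounded)
    {Φ : MuEQL} (hΦ : Φ.Closed) (hm : Φ.Monotone) :
    (K.extendedTS k).Models (.neg Φ) ↔ ¬ (K.extendedTS k).Models Φ := by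
  obtain ⟨C₁, hC₁⟩ := K.exists_constsIn
  obtain ⟨C₂, hC₂⟩ := Φ.exists_constsIn
  have hC := hC₁ (C₁ ++ C₂) (by simp)
  have hΦC : Φ.ConstsIn (C₁ ++ C₂) := hC₂.mono (by simp)
  obtain ⟨F, hCF, hF⟩ := exists_adequate hb (C₁ ++ C₂)
  rw [models_iff hK hC hCF hF hΦ hm hΦC (val []),
    models_iff hK hC hCF hF (Φ := .neg Φ) hΦ hm hΦC (val [])]
  exact and_iff_right ReflTransGen.refl

end Decide

end KABs

theorem theorem3 (k : KABs.RepairKind) :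
    ∃ f : ℕ →. Bool, Partrec f ∧
      ∀ (K : KABs.KAB) (Φ : KABs.MuIT),
        K.WellFormed → (K.extendedTS k).RunBounded → Φ.IsProperty →
          ∃ b ∈ f (Nat.pair K.code Φ.code),
            (b = true ↔ (K.extendedTS k).Models Φ.toEQL) := by
  have h1 : KABs.RE (KABs.Certified k) := KABs.rE_certified k
  have h2 : KABs.RE fun x : KABs.DLKAB × KABs.MuIT => KABs.Certified k (x.1, x.2.neg) :=
    .comp (p := KABs.Certified k) h1 inferInstance
  obtain ⟨f, hf, h⟩ := KABs.exists_partrec_decide (p := KABs.Certified k)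
    (q := fun x : KABs.DLKAB × KABs.MuIT => KABs.Certified k (x.1, x.2.neg))
  refine ⟨f, hf, fun K Φ hK hb hΦ => ?_⟩
  have hpos := KABs.certified_iff (K := ⟨K, hK.dlLiteA⟩) hK hb hΦ
  have hneg := (KABs.certified_iff (K := ⟨K, hK.dlLiteA⟩) (Φ := Φ.neg) hK hb hΦ).trans
    (KABs.models_neg_iff hK hb hΦ.1 hΦ.2)
  -- Subtypes keep codes, so the code of this pair is the prescribed input. Exactly one of `Φ` and
  -- its negation is true in the initial state, so one of the two searches ends.
  obtain ⟨b, hb', ht, hf'⟩ := h (⟨K, hK.dlLiteA⟩, Φ)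
    ((Classical.em _).imp hpos.2 hneg.2)
  refine ⟨b, hb', fun h => hpos.1 (ht h), fun h => ?_⟩
  cases b with
  | true => rfl
  | false => exact absurd h (hneg.1 (hf' rfl))
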